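/- Let $(r,\vartheta,z)$ be cylindrical coordinates on $\mathbb R^3$, let $\alpha_{OT}=\cos r\,dz+r\sin r\,d\vartheta$, and for $0<\delta<\pi/2$ and $h>0$ let $B(h)=B_\delta(h)=\{r<\pi+\delta,\ |z|<h\}\subset\mathbb R^3$. For a smooth Riemannian manifold $(L,g)$ (second countable, Hausdorff, without boundary, of any dimension $n\ge 0$, not necessarily compact, connected or complete), let $\mathbb D_{<c}(T^*L)$ be the set of covectors of $g$-norm less than $c$, and let $\lambda_{can}$ be the canonical $1$-form on $T^*L$ (with the sign convention $\lambda_{can}=-\sum_j p_j\,dq_j$ in canonical coordinates). There is a universal constant $\mu_0$ with $0<\mu_0<7/6$ such that the following holds. Let $(L,g)$ be as above, let $(M,\xi)$ be a $(2n+3)$-dimensional contact manifold ($M$ second countable, Hausdorff, without boundary, $\xi$ not necessarily coorientable), let $c_0\in\mathbb R$, and let $$\iota\colon \Sigma:=\mathbb D^2_{\le\pi}\times\mathbb D_{<c_0}(T^*L)\hookrightarrow M$$ be a smooth embedding (smooth up to the boundary, that is, extending smoothly to an open neighborhood of $\Sigma$ in $\mathbb R^2\times T^*L$) such that the induced singular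 distribution $(D\iota)^{-1}(\xi)$ on $\Sigma$ is the kernel of $\beta=r\sin r\,d\vartheta+\lambda_{can}$, where $(r,\vartheta)$ are polar coordinates on $\mathbb D^2_{\le\pi}$. Let $c>0$ be such that $\mu_0c<c_0$. Then for every $0<\delta<\pi/2$, every height $h>0$ and every open neighborhood $U\subset M$ of $\iota(\Sigma)$ there is a smooth embedding $$\Phi\colon B_\delta(h)\times\mathbb D_{<c}(T^*L)\hookrightarrow U$$ which is a contactomorphism onto its image, i.e. $(D\Phi)^{-1}(\xi)=\ker(\alpha_{OT}+\lambda_{can})$. -/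

import Mathlib

open scoped Manifold ContDiff

noncomputable section

namespace OvertwistedBox

/-- The plane `ℝ²` with its Euclidean norm; `‖x‖` is the polar radius `r` of `x`. -/
abbrev Plane := EuclideanSpace ℝ (Fin 2)

section Forms

/-- The one-form `r sin r dϑ` on the plane. Since `r² dϑ = x₀ dx₁ - x₁ dx₀`, it equals
`(sin r / r) (x₀ dx₁ - x₁ dx₀)`, which is smooth at the origin as well. -/
def rSinForm (x : Plane) : Plane →L[ℝ] ℝ :=
  Real.sinc ‖x‖ • (x 0 • EuclideanSpace.proj (𝕜 := ℝ) (1 : Fin 2)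
    - x 1 • EuclideanSpace.proj (𝕜 := ℝ) (0 : Fin 2))

/-- The one-form `α_OT = cos r dz + r sin r dϑ` on `ℝ³ = ℝ² × ℝ`. -/
def alphaOT (x : Plane × ℝ) : Plane × ℝ →L[ℝ] ℝ :=
  Real.cos ‖x.1‖ • ContinuousLinearMap.snd ℝ Plane ℝ
    + (rSinForm x.1).comp (ContinuousLinearMap.fst ℝ Plane ℝ)

end Forms

/-- The open box `B(h) = 𝔻²_{<π+δ} × (-h, h)`. -/
def box (δ h : ℝ) : Set (Plane × ℝ) :=
  {x | ‖x.1‖ < Real.pi + δ ∧ |x.2| < h}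

section Cotangent

variable (n : ℕ) (L : Type*) [TopologicalSpace L] [ChartedSpace (EuclideanSpace ℝ (Fin n)) L]
  [IsManifold (𝓡 n) ∞ L]

/-- The total space of `T*L`, the bundle of continuous linear functionals on the tangent spaces. -/
abbrev Cotangent :=
  Bundle.TotalSpace (EuclideanSpace ℝ (Fin n) →L[ℝ] ℝ)
    (fun q : L => TangentSpace (𝓡 n) q →L[ℝ] Bundle.Trivial L ℝ q)

/-- The model of the smooth manifold `T*L`. -/
abbrev cotangentModel :=
  (𝓡 n).prod 𝓘(ℝ, EuclideanSpace ℝ (Fin n) →L[ℝ] ℝ)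

/-- The model of the smooth manifold `ℝ² × T*L`. -/
abbrev discModel := 𝓘(ℝ, Plane).prod (cotangentModel n)

/-- The model of the smooth manifold `ℝ³ × T*L`. -/
abbrev boxModel := 𝓘(ℝ, Plane × ℝ).prod (cotangentModel n)

variable {n L}

/-- The value of the covector `ν` on a tangent vector at its base point. -/
def pairing (ν : Cotangent n L) (v : TangentSpace (𝓡 n) ν.proj) : ℝ := ν.snd v

/-- The canonical one-form `λ_can` on `T*L`, with the sign for which `λ_can = - ∑ pⱼ dqⱼ` in
canonical coordinates: it maps `w ∈ T_ν (T*L)` to `-ν (dπ w)`, where `π : T*L → L`. -/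
def lambdaCan (ν : Cotangent n L) (w : TangentSpace (cotangentModel n) ν) : ℝ :=
  -pairing ν (mfderiv (cotangentModel n) (𝓡 n) (fun η : Cotangent n L => η.proj) ν w)

/-- The norm of a covector that is dual to the Riemannian metric `g`. -/
def covectorNorm
    (g : Bundle.ContMDiffRiemannianMetric (𝓡 n) ∞ (EuclideanSpace ℝ (Fin n))
      (fun q : L => TangentSpace (𝓡 n) q)) (ν : Cotangent n L) : ℝ :=
  sSup {a | ∃ v : TangentSpace (𝓡 n) ν.proj, g.inner ν.proj v v ≤ 1 ∧ a = pairing ν v}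

/-- The open disk bundle `𝔻_{<c}(T*L)`. -/
def diskBundle
    (g : Bundle.ContMDiffRiemannianMetric (𝓡 n) ∞ (EuclideanSpace ℝ (Fin n))
      (fun q : L => TangentSpace (𝓡 n) q)) (c : ℝ) : Set (Cotangent n L) :=
  {ν | covectorNorm g ν < c}

/-- The one-form `β = r sin r dϑ + λ_can` on `ℝ² × T*L`. -/
def betaForm (x : Plane × Cotangent n L) (v : TangentSpace (discModel n) x) : ℝ :=
  rSinForm x.1 (mfderiv (discModel n) 𝓘(ℝ, Plane) Prod.fst x v)
    + lambdaCan x.2 (mfderiv (discModel n) (cotangentModel n) Prod.snd x v)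

/-- The one-form `α_OT + λ_can` on `ℝ³ × T*L`. -/
def boxForm (x : (Plane × ℝ) × Cotangent n L) (v : TangentSpace (boxModel n) x) : ℝ :=
  alphaOT x.1 (mfderiv (boxModel n) 𝓘(ℝ, Plane × ℝ) Prod.fst x v)
    + lambdaCan x.2 (mfderiv (boxModel n) (cotangentModel n) Prod.snd x v)

/-- The model hypersurface `Σ = 𝔻²_{≤π} × 𝔻_{<c}(T*L)`, a subset of `ℝ² × T*L`. -/
def modelHypersurface
    (g : Bundle.ContMDiffRiemannianMetric (𝓡 n) ∞ (EuclideanSpace ℝ (Fin n))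
      (fun q : L => TangentSpace (𝓡 n) q)) (c : ℝ) : Set (Plane × Cotangent n L) :=
  Metric.closedBall 0 Real.pi ×ˢ diskBundle g c

/-- The domain `B(h) × 𝔻_{<c}(T*L)`, a subset of `ℝ³ × T*L`. -/
def boxDomain
    (g : Bundle.ContMDiffRiemannianMetric (𝓡 n) ∞ (EuclideanSpace ℝ (Fin n))
      (fun q : L => TangentSpace (𝓡 n) q)) (δ h c : ℝ) : Set ((Plane × ℝ) × Cotangent n L) :=
  box δ h ×ˢ diskBundle g c

end Cotangent

section Contact

/-- `ξ` is a contact structure on the `m`-dimensional manifold `M`: around every point, in a chart,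
`ξ` is the kernel of a smooth nowhere vanishing one-form `a` such that
`da (u, v) = (D a · u) v - (D a · v) u` is non-degenerate on `ker a`, that is, of a contact form. -/
def IsContactStructure {m : ℕ} {M : Type*} [TopologicalSpace M]
    [ChartedSpace (EuclideanSpace ℝ (Fin m)) M]
    (ξ : ∀ x : M, Submodule ℝ (TangentSpace (𝓡 m) x)) : Prop :=
  ∀ x₀ : M, ∃ (V : Set (EuclideanSpace ℝ (Fin m)))
    (a : EuclideanSpace ℝ (Fin m) → EuclideanSpace ℝ (Fin m) →L[ℝ] ℝ),
    IsOpen V ∧ extChartAt (𝓡 m) x₀ x₀ ∈ V ∧ V ⊆ (extChartAt (𝓡 m) x₀).target ∧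
    ContDiffOn ℝ ∞ a V ∧
    ∀ y ∈ V,
      (∀ v : EuclideanSpace ℝ (Fin m),
        mfderiv 𝓘(ℝ, EuclideanSpace ℝ (Fin m)) (𝓡 m) (extChartAt (𝓡 m) x₀).symm y v
          ∈ ξ ((extChartAt (𝓡 m) x₀).symm y) ↔ a y v = 0) ∧
      a y ≠ 0 ∧
      ∀ u, a y u = 0 → u ≠ 0 → ∃ v, a y v = 0 ∧ fderiv ℝ a y u v - fderiv ℝ a y v u ≠ 0

variable {E H N E' H' M : Type*} [NormedAddCommGroup E] [NormedSpace ℝ E] [TopologicalSpace H]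
  [TopologicalSpace N] [ChartedSpace H N] [NormedAddCommGroup E'] [NormedSpace ℝ E']
  [TopologicalSpace H'] [TopologicalSpace M] [ChartedSpace H' M]

/-- `f` restricts to a smooth embedding of the subset `A ⊆ N` into `M`: it is smooth on an open
neighbourhood of `A` (for a subset with boundary, this is smoothness up to the boundary), its
differential is injective at every point of `A`, and `f|_A` is a homeomorphism onto its image. -/
structure IsSmoothEmbeddingOn (I : ModelWithCorners ℝ E H) (J : ModelWithCorners ℝ E' H')
    (f : N → M) (A : Set N) : Prop where
  smooth : ∃ W : Set N, IsOpen W ∧ A ⊆ W ∧ ContMDiffOn I J ∞ f W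
  immersive : ∀ x ∈ A, Function.Injective (mfderiv I J f x)
  embedding : Topology.IsEmbedding (A.domRestrict f)

/-- The (singular) distribution `(Df)⁻¹ ξ` induced along `A` by `f` agrees with the kernel of the
one-form `β`. -/
def InducesKernelOn (I : ModelWithCorners ℝ E H) (J : ModelWithCorners ℝ E' H')
    (f : N → M) (A : Set N) (ξ : ∀ y : M, Submodule ℝ (TangentSpace J y))
    (β : ∀ x : N, TangentSpace I x → ℝ) : Prop :=
  ∀ x ∈ A, ∀ v : TangentSpace I x, mfderiv I J f x v ∈ ξ (f x) ↔ β x v = 0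

end Contact

end OvertwistedBox

end

/-! The argument has two halves which meet along the slice z = 0, r ≤ π, |p| < c₀ of ℝ³ × T*L: a
neighbourhood theorem, which identifies the germ of ξ along ι(Σ) with the germ of ker(α_OT + λ_can)
along the slice, and a squeezing map, which sends the large box into an arbitrarily thin
neighbourhood of the slice while preserving the model contact structure.

Neighbourhood theorem (`exists_box_germ`). A local contact form A for ξ pulls back to a form with
the kernel of β. Hadamard division, needed where β vanishes (p = 0 and r = 0 or r = π), gives ι*A =
fβ with f smooth (`exists_smooth_factor`), and the contact condition forces f ≠ 0. After division by
f the local forms pull back to β itself. Normalised in this way they are unique along ι(Σ), so a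
partition of unity glues them to a form α near ι(Σ) although ξ need not be coorientable; cos r is
extended to a function h in the same manner (`exists_global_data`). Flowing ι(Σ) along the contact
vector field with Hamiltonian h gives a map in (z, x) which pulls α back to β + cos r dz = α_OT +
λ_can along z = 0, with the right exterior derivative on the contact hyperplanes
(`exists_contact_germ`). A relative Gray argument (`exists_gray_map`) removes the remaining
discrepancy nearby. All flows in the proof are needed only near stationary points; their existence
on [0, 1] and their smoothness come from the inverse function theorem in the Banach space of curves
(`exists_local_flow`). The resulting germ is a local diffeomorphism which restricts to the embedding
ι, hence it is injective near the slice (`exists_injOn_nhds`).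

Squeezing (`exists_squeeze`). For 0 < s ≤ 1 let R tan R = s r tan r, with R and r on the same branch
of the tangent. Then f (cos r, r sin r) = (s cos R, R sin R) for some f > 0, and for a positive
function s on L the map (r, ϑ, z, q, p) ↦ (R, ϑ, s(q) z, q, f p + z cos R ds) pulls α_OT + λ_can
back to f (α_OT + λ_can). As s becomes small, discs of radius π + δ land in discs of radius barely
above π, and heights shrink. Covectors grow by the factor f and by the term h |ds|, which can be
made small. Since L need not be compact, the bounds on s vary over L (`exists_small_function`).

The constant: f ≤ 1 if R ≤ r. Otherwise π/2 < r ≤ R ≤ π and f = R sin R / (r sin r). Concavity of t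
sin t bounds this by max(1, 2 max(t sin t) / π), and t sin t ≤ 1.83 on [π/2, π] gives f ≤ 1.166 <
7/6 (`factor_le`). -/

noncomputable section
namespace OvertwistedBox

set_option linter.unusedSectionVars false

open Set Topology Filter unitInterval

/-! ### Superposition operators on spaces of curves. -/

section Nemytskii

variable {E F : Type} [NormedAddCommGroup E] [NormedSpace ℝ E]
  [NormedAddCommGroup F] [NormedSpace ℝ F]

/-- The superposition operator `γ ↦ (t ↦ v (t, γ t))`. -/
def superpose (v : C(ℝ × E, F)) (γ : C(I, E)) : C(I, F) :=
  v.comp (ContinuousMap.prodMk ⟨fun t : I => (t : ℝ), continuous_subtype_val⟩ γ)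

@[simp] lemma superpose_apply (v : C(ℝ × E, F)) (γ : C(I, E)) (t : I) :
    superpose v γ t = v (t, γ t) := rfl

lemma continuous_superpose (v : C(ℝ × E, F)) : Continuous (superpose v) := by
  refine ContinuousMap.continuous_of_continuous_uncurry _ ?_
  change Continuous fun p : C(I, E) × I => v ((p.2 : ℝ), p.1 p.2)
  fun_prop

/-- Pointwise application of a curve of operators to a curve of vectors. -/
def pointwiseApply : C(I, E →L[ℝ] F) →L[ℝ] C(I, E) →L[ℝ] C(I, F) :=
  LinearMap.mkContinuous₂
    (LinearMap.mk₂ ℝ (fun (A : C(I, E →L[ℝ] F)) (η : C(I, E)) =>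
        (⟨fun t => A t (η t), by fun_prop⟩ : C(I, F)))
      (by intros; ext; simp) (by intros; ext; simp) (by intros; ext; simp)
      (by intros; ext; simp)) 1 (by
      intro A η
      rw [one_mul]
      refine (ContinuousMap.norm_le _ (by positivity)).2 fun t => ?_
      refine ((A t).le_opNorm _).trans ?_
      gcongr
      · exact A.norm_coe_le_norm t
      · exact η.norm_coe_le_norm t)

@[simp] lemma pointwiseApply_apply (A : C(I, E →L[ℝ] F)) (η : C(I, E)) (t : I) :
    pointwiseApply A η t = A t (η t) := rfl

lemma contDiff_pointwiseApply {k : WithTop ℕ∞} : ContDiff ℝ k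
    (fun A : C(I, E →L[ℝ] F) => (pointwiseApply A : C(I, E) →L[ℝ] C(I, F))) := by
  refine IsBoundedLinearMap.contDiff (𝕜 := ℝ) ⟨⟨fun A B => map_add _ A B, fun c A => map_smul _ c A⟩,
    1, one_pos, fun A => ?_⟩
  refine ContinuousLinearMap.opNorm_le_bound _ (by positivity) fun η => ?_
  rw [one_mul]
  refine (ContinuousMap.norm_le _ (by positivity)).2 fun t => ?_
  refine ((A t).le_opNorm _).trans ?_
  gcongr
  · exact A.norm_coe_le_norm t
  · exact η.norm_coe_le_norm t

/-- The partial differential of `v (t, x)` in `x`. -/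
def partialSnd (v : ℝ × E → F) (p : ℝ × E) : E →L[ℝ] F :=
  (fderiv ℝ v p).comp (ContinuousLinearMap.inr ℝ ℝ E)

lemma contDiff_partialSnd {v : ℝ × E → F} (hv : ContDiff ℝ ∞ v) :
    ContDiff ℝ ∞ (partialSnd v) :=
  (hv.fderiv_right (m := ∞) (by simp)).clm_comp contDiff_const

lemma hasCompactSupport_partialSnd {v : ℝ × E → F} (hv : HasCompactSupport v) :
    HasCompactSupport (partialSnd v) := by
  refine (hv.fderiv (𝕜 := ℝ)).comp_left (g := fun A : ℝ × E →L[ℝ] F =>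
    A.comp (ContinuousLinearMap.inr ℝ ℝ E)) (by simp)

lemma hasFDerivAt_partialSnd {v : ℝ × E → F} {t : ℝ} {x : E}
    (hv : DifferentiableAt ℝ v (t, x)) :
    HasFDerivAt (fun y => v (t, y)) (partialSnd v (t, x)) x :=
  hv.hasFDerivAt.comp x (hasFDerivAt_prodMk_right t x)

/-- The partial differential of `v` is smooth with compact support, hence globally Lipschitz with
some constant C. The mean value inequality on the segment from x to x + h then bounds the remainder
by C‖h‖² uniformly in t, which is what the sup norm on curves requires. -/
lemma hasFDerivAt_superpose (v : C(ℝ × E, F)) (hv : ContDiff ℝ ∞ v)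
    (hc : HasCompactSupport v) (w : C(ℝ × E, E →L[ℝ] F)) (hw : ⇑w = partialSnd v)
    (γ : C(I, E)) :
    HasFDerivAt (superpose v) (pointwiseApply (superpose w γ)) γ := by
  obtain ⟨C, hC⟩ := ContDiff.lipschitzWith_of_hasCompactSupport
    (hasCompactSupport_partialSnd hc) (contDiff_partialSnd hv) (by simp)
  have key : ∀ (t : ℝ) (x h : E),
      ‖v (t, x + h) - v (t, x) - partialSnd v (t, x) h‖ ≤ C * ‖h‖ * ‖h‖ := by
    intro t x h
    have := (convex_segment x (x + h)).norm_image_sub_le_of_norm_hasFDerivWithin_le'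
      (f := fun y => v (t, y)) (f' := fun y => partialSnd v (t, y)) (φ := partialSnd v (t, x))
      (C := C * ‖h‖) (fun y _ => (hasFDerivAt_partialSnd
        (hv.differentiable (by simp) _)).hasFDerivWithinAt) (fun y hy => ?_)
      (left_mem_segment ℝ x (x + h)) (right_mem_segment ℝ x (x + h))
    · simpa using this
    · have h1 := hC.norm_sub_le (t, y) (t, x)
      have h2 : ‖y - x‖ ≤ ‖h‖ := by
        have := norm_sub_le_of_mem_segment hy
        simpa using this
      refine h1.trans ?_
      gcongr
      simpa [Prod.norm_def] using h2
  rw [hasFDerivAt_iff_isLittleO_nhds_zero]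
  refine Asymptotics.IsBigO.trans_isLittleO (g := fun h : C(I, E) => ‖h‖ * ‖h‖) ?_ ?_
  · refine Asymptotics.IsBigO.of_bound C (Eventually.of_forall fun h => ?_)
    refine (ContinuousMap.norm_le _ (by positivity)).2 fun t => ?_
    have := key t (γ t) (h t)
    simp only [ContinuousMap.sub_apply, superpose_apply, ContinuousMap.add_apply,
      pointwiseApply_apply, hw]
    refine this.trans ?_
    rw [mul_assoc, norm_mul, norm_norm]
    gcongr <;> exact h.norm_coe_le_norm t
  · have : (fun h : C(I, E) => ‖h‖ * ‖h‖) =o[𝓝 0] fun h : C(I, E) => ‖h‖ * (1 : ℝ) :=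
      (Asymptotics.isBigO_refl _ _).mul_isLittleO
        ((Asymptotics.isLittleO_one_iff ℝ).2 (by simpa using (continuous_norm.tendsto (0 : C(I, E)))))
    simpa only [mul_one] using this.trans_isBigO (by simpa using
      (Asymptotics.isBigO_refl (fun h : C(I, E) => h) (𝓝 0)).norm_left)

/-- Induction on the order of differentiability: the derivative is again a superposition operator,
of the partial differential, followed by a bounded linear map. The target space changes from F to E
→L F, so the induction runs over all targets at once. -/
theorem contDiff_superpose (v : C(ℝ × E, F)) (hv : ContDiff ℝ ∞ v) (hc : HasCompactSupport v) :
    ContDiff ℝ ∞ (superpose v) := by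
  rw [contDiff_infty]
  intro k
  induction k generalizing F with
  | zero => exact contDiff_zero.2 (continuous_superpose v)
  | succ k ih =>
    have hw := contDiff_partialSnd hv
    let w : C(ℝ × E, E →L[ℝ] F) := ⟨partialSnd v, hw.continuous⟩
    refine contDiff_succ_iff_hasFDerivAt.2 ⟨fun γ => pointwiseApply (superpose w γ), ?_,
      fun γ => hasFDerivAt_superpose v hv hc w rfl γ⟩
    exact contDiff_pointwiseApply.comp (ih w hw (hasCompactSupport_partialSnd hc))

end Nemytskii

/-! ### Integration of curves and Volterra operators. -/

section Integration

variable {E : Type} [NormedAddCommGroup E] [NormedSpace ℝ E] [CompleteSpace E]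

/-- The extension of a curve on the unit interval to the real line by constants. -/
abbrev extendCurve (η : C(I, E)) : ℝ → E := IccExtend (zero_le_one' ℝ) η

lemma continuous_extendCurve (η : C(I, E)) : Continuous (extendCurve η) :=
  η.continuous.Icc_extend'

lemma norm_extendCurve_le (η : C(I, E)) (t : ℝ) : ‖extendCurve η t‖ ≤ ‖η‖ :=
  η.norm_coe_le_norm _

/-- Integration `η ↦ (t ↦ ∫₀ᵗ η)` on curves. -/
def primitive : C(I, E) →L[ℝ] C(I, E) :=
  LinearMap.mkContinuous
    { toFun := fun η => ⟨fun t => ∫ s in (0 : ℝ)..t, extendCurve η s,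
        (intervalIntegral.continuous_primitive
          (fun a b => (continuous_extendCurve η).intervalIntegrable a b) 0).comp
          continuous_subtype_val⟩
      map_add' := fun η ζ => by
        ext t
        exact intervalIntegral.integral_add ((continuous_extendCurve η).intervalIntegrable _ _)
          ((continuous_extendCurve ζ).intervalIntegrable _ _)
      map_smul' := fun c η => by
        ext t
        exact intervalIntegral.integral_smul c _ } 1 (by
    intro η
    rw [one_mul]
    refine (ContinuousMap.norm_le _ (norm_nonneg _)).2 fun t => ?_
    refine (intervalIntegral.norm_integral_le_of_norm_le_const
      (fun s _ => norm_extendCurve_le η s)).trans ?_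
    have h0 : |(t : ℝ) - 0| ≤ 1 := by
      rw [sub_zero, abs_of_nonneg t.2.1]; exact t.2.2
    exact mul_le_of_le_one_right (norm_nonneg _) h0)

lemma primitive_apply (η : C(I, E)) (t : I) :
    primitive η t = ∫ s in (0 : ℝ)..t, extendCurve η s := rfl

/-- An integral equation on the unit interval turns into a differential equation. -/
lemma hasDerivWithinAt_of_eq_primitive {γ η : C(I, E)} {x : E}
    (h : γ = ContinuousMap.const I x + primitive η) {t : ℝ} (ht : t ∈ Icc (0 : ℝ) 1) :
    HasDerivWithinAt (extendCurve γ) (extendCurve η t) (Icc 0 1) t := by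
  have h1 : HasDerivAt (fun u => x + ∫ s in (0 : ℝ)..u, extendCurve η s) (extendCurve η t) t :=
    ((continuous_extendCurve η).integral_hasStrictDerivAt 0 t).hasDerivAt.const_add x
  refine h1.hasDerivWithinAt.congr_of_mem (fun u hu => ?_) ht
  rw [extendCurve, IccExtend_of_mem _ _ hu, h]
  rfl

/-- Volterra operators have invertible perturbations of the identity. -/
lemma isUnit_one_sub_volterra (A : C(I, E →L[ℝ] E)) :
    IsUnit (1 - primitive.comp (pointwiseApply A) : C(I, E) →L[ℝ] C(I, E)) := by
  set T : C(I, E) →L[ℝ] C(I, E) := primitive.comp (pointwiseApply A) with hT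
  -- Every iteration integrates a power of t, which produces the factorial; hence some power of T is
  -- a contraction even if T is not.
  have key : ∀ (n : ℕ) (η : C(I, E)) (t : I),
      ‖(T ^ n) η t‖ ≤ ‖A‖ ^ n * (t : ℝ) ^ n / n.factorial * ‖η‖ := by
    intro n
    induction n with
    | zero => intro η t; simpa using η.norm_coe_le_norm t
    | succ n ih =>
      intro η t
      rw [pow_succ', mul_apply_eq_comp, hT, ContinuousLinearMap.comp_apply,
        ← hT, primitive_apply]
      have hb : ∀ s ∈ Icc (0 : ℝ) t, ‖extendCurve (pointwiseApply A ((T ^ n) η)) s‖ ≤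
          ‖A‖ ^ (n + 1) / n.factorial * ‖η‖ * s ^ n := by
        intro s hs
        have hs' : s ∈ Icc (0 : ℝ) 1 := ⟨hs.1, hs.2.trans t.2.2⟩
        rw [extendCurve, IccExtend_of_mem _ _ hs', pointwiseApply_apply]
        refine ((A _).le_opNorm _).trans ?_
        refine (mul_le_mul (A.norm_coe_le_norm _) (ih η ⟨s, hs'⟩) (norm_nonneg _)
          (norm_nonneg _)).trans (le_of_eq ?_)
        simp only [pow_succ]
        ring
      refine (intervalIntegral.norm_integral_le_of_norm_le t.2.1
        (g := fun s => ‖A‖ ^ (n + 1) / n.factorial * ‖η‖ * s ^ n)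
        (Eventually.of_forall fun s hs => hb s ⟨hs.1.le, hs.2⟩)
        (Continuous.intervalIntegrable (by fun_prop) _ _)).trans (le_of_eq ?_)
      rw [intervalIntegral.integral_const_mul, integral_pow, Nat.factorial_succ]
      push_cast
      field_simp
      ring
  obtain ⟨n, hn⟩ : ∃ n : ℕ, ‖A‖ ^ n / n.factorial < 1 :=
    ((FloorSemiring.tendsto_pow_div_factorial_atTop ‖A‖).eventually
      (gt_mem_nhds one_pos)).exists
  have hnorm : ‖T ^ n‖ < 1 := by
    refine lt_of_le_of_lt (ContinuousLinearMap.opNorm_le_bound _ (by positivity) fun η => ?_) hn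
    refine (ContinuousMap.norm_le _ (by positivity)).2 fun t => (key n η t).trans ?_
    gcongr
    exact mul_le_of_le_one_right (by positivity) (pow_le_one₀ t.2.1 t.2.2)
  have hu : IsUnit (1 - T ^ n) := (Units.oneSub (T ^ n) hnorm).isUnit
  -- 1 - T is a factor of the invertible operator 1 - T ^ n, and it commutes with the geometric sum,
  -- so it is invertible itself.
  rw [← mul_neg_geom_sum T n] at hu
  refine ((Commute.isUnit_mul_iff ?_).1 hu).1
  exact (Commute.sub_left (Commute.one_left _)
    (Commute.sum_right _ _ _ fun i _ => Commute.pow_right (Commute.refl T) i))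

end Integration

end OvertwistedBox

end

noncomputable section
namespace OvertwistedBox

set_option linter.unusedSectionVars false

open Set Topology Filter unitInterval

/-! ### Local flows near stationary points, smooth integrals and smooth division. -/

section LocalFlow

variable {E F : Type} [NormedAddCommGroup E] [NormedSpace ℝ E] [FiniteDimensional ℝ E]
  [NormedAddCommGroup F] [NormedSpace ℝ F]

/-- A function which is smooth near `[0, 1] × {a}` agrees near this set with a smooth function of
compact support. -/
lemma exists_compactSupport_extension {v : ℝ × E → F} {D : Set (ℝ × E)} (hD : IsOpen D)
    (hv : ∀ p ∈ D, ContDiffAt ℝ ∞ v p) {a : E} (ha : ∀ t ∈ Icc (0 : ℝ) 1, (t, a) ∈ D) :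
    ∃ u : ℝ × E → F, ContDiff ℝ ∞ u ∧ HasCompactSupport u ∧
      ∃ W : Set E, IsOpen W ∧ a ∈ W ∧ ∀ t ∈ Icc (0 : ℝ) 1, ∀ x ∈ W, (t, x) ∈ D ∧
        u =ᶠ[𝓝 (t, x)] v := by
  obtain ⟨U, W, hU, hW, hIU, haW, hUW⟩ := generalized_tube_lemma (isCompact_Icc (a := (0 : ℝ))
    (b := 1)) (isCompact_singleton (x := a)) hD (by
      rintro ⟨t, x⟩ ⟨ht, hx⟩
      obtain rfl : x = a := hx
      exact ha t ht)
  obtain ⟨ε, hε, hεU⟩ := isCompact_Icc.exists_cthickening_subset_open hU hIU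
  obtain ⟨ρ, hρ, hρW⟩ := Metric.nhds_basis_closedBall.mem_iff.1 (hW.mem_nhds (haW rfl))
  -- Centred at the midpoint of [0, 1]: the inner radius 1/2 + ε/2 covers a neighbourhood of the
  -- interval, and the outer radius 1/2 + ε keeps the support in its ε-thickening.
  let f : ContDiffBump (1 / 2 : ℝ) := ⟨1 / 2 + ε / 2, 1 / 2 + ε, by positivity, by linarith⟩
  let g : ContDiffBump a := ⟨ρ / 2, ρ, by positivity, by linarith⟩
  have hfU : tsupport f ⊆ U := by
    rw [f.tsupport_eq]
    intro t ht
    apply hεU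
    rw [Metric.mem_closedBall, Real.dist_eq, abs_le] at ht
    change -(1 / 2 + ε) ≤ t - 1 / 2 ∧ t - 1 / 2 ≤ 1 / 2 + ε at ht
    obtain ⟨h1, h2⟩ := ht
    rcases lt_or_ge t 0 with h | h
    · refine Metric.mem_cthickening_of_dist_le t 0 ε _ (by simp) ?_
      rw [Real.dist_eq, abs_le]; constructor <;> linarith
    · rcases le_or_gt t 1 with h' | h'
      · exact Metric.self_subset_cthickening _ ⟨h, h'⟩
      · refine Metric.mem_cthickening_of_dist_le t 1 ε _ (by simp) ?_
        rw [Real.dist_eq, abs_le]; constructor <;> linarith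
  let χ : ℝ × E → ℝ := fun p => f p.1 * g p.2
  have hχ : ContDiff ℝ ∞ χ :=
    (f.contDiff.comp contDiff_fst).mul (g.contDiff.comp contDiff_snd)
  have hsub : tsupport χ ⊆ tsupport f ×ˢ tsupport g := by
    refine closure_minimal ?_ ((isClosed_tsupport _).prod (isClosed_tsupport _))
    intro p hp
    have := mul_ne_zero_iff.1 hp
    exact ⟨subset_tsupport _ this.1, subset_tsupport _ this.2⟩
  have hsD : tsupport χ ⊆ D := by
    refine hsub.trans (Subset.trans (prod_mono hfU ?_) hUW)
    rw [g.tsupport_eq]; exact hρW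
  have hχc : HasCompactSupport χ :=
    (f.hasCompactSupport.isCompact.prod g.hasCompactSupport.isCompact).of_isClosed_subset
      (isClosed_tsupport _) hsub
  refine ⟨fun p => χ p • v p, ?_, hχc.smul_right, Metric.ball a (ρ / 2), Metric.isOpen_ball,
    Metric.mem_ball_self (by positivity), fun t ht x hx => ⟨?_, ?_⟩⟩
  · rw [contDiff_iff_contDiffAt]
    intro p
    by_cases hp : p ∈ tsupport χ
    · exact hχ.contDiffAt.smul (hv p (hsD hp))
    · have : (fun p => χ p • v p) =ᶠ[𝓝 p] fun _ => 0 := by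
        filter_upwards [(isClosed_tsupport χ).isOpen_compl.mem_nhds hp] with q hq
        rw [image_eq_zero_of_notMem_tsupport hq, zero_smul]
      exact contDiffAt_const.congr_of_eventuallyEq this
  · exact hUW ⟨hIU ht, hρW (Metric.ball_subset_closedBall
      (Metric.ball_subset_ball (by linarith) hx))⟩
  · have h1 : ∀ᶠ s in 𝓝 t, f s = 1 := by
      have : t ∈ Metric.ball (1 / 2 : ℝ) f.rIn := by
        rw [Metric.mem_ball, Real.dist_eq, abs_lt]
        change -(1 / 2 + ε / 2) < t - 1 / 2 ∧ t - 1 / 2 < 1 / 2 + ε / 2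
        constructor <;> linarith [ht.1, ht.2]
      exact f.eventuallyEq_one_of_mem_ball this
    have h2 : ∀ᶠ y in 𝓝 x, g y = 1 := g.eventuallyEq_one_of_mem_ball hx
    filter_upwards [h1.prod_nhds h2] with p hp
    simp only [χ, hp.1, hp.2, one_mul, one_smul]

/-- Solutions of an integral equation with smooth compactly supported right hand side, near a
stationary point, depend smoothly on the initial value. -/
lemma exists_smooth_solutions (v : C(ℝ × E, E)) (hv : ContDiff ℝ ∞ v)
    (hc : HasCompactSupport v) {a : E} (ha : ∀ t ∈ Icc (0 : ℝ) 1, v (t, a) = 0) :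
    ∃ Y : E → C(I, E), Y a = ContinuousMap.const I a ∧ ∃ W : Set E, IsOpen W ∧ a ∈ W ∧
      ∀ x ∈ W, ContDiffAt ℝ ∞ Y x ∧
        Y x = ContinuousMap.const I x + primitive (superpose v (Y x)) := by
  have : CompleteSpace E := FiniteDimensional.complete ℝ E
  let w : C(ℝ × E, E →L[ℝ] E) := ⟨partialSnd v, (contDiff_partialSnd hv).continuous⟩
  -- The solution with initial value x is the preimage under Θ of the constant curve x. The
  -- differential of Θ is the identity minus a Volterra operator, so the inverse function theorem
  -- turns smooth dependence on x into smoothness of a local inverse.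
  let Θ : C(I, E) → C(I, E) := fun γ => γ - primitive (superpose v γ)
  have hΘ : ContDiff ℝ ∞ Θ :=
    contDiff_id.sub (ContDiff.comp (primitive (E := E)).contDiff (contDiff_superpose v hv hc))
  have hder : ∀ γ, ∃ e : C(I, E) ≃L[ℝ] C(I, E), HasFDerivAt Θ (e : C(I, E) →L[ℝ] C(I, E)) γ := by
    intro γ
    obtain ⟨e, he⟩ := isUnit_one_sub_volterra (superpose w γ)
    refine ⟨ContinuousLinearEquiv.unitsEquiv ℝ _ e, ?_⟩
    have h1 : ((ContinuousLinearEquiv.unitsEquiv ℝ _ e : C(I, E) ≃L[ℝ] C(I, E)) :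
        C(I, E) →L[ℝ] C(I, E)) = 1 - primitive.comp (pointwiseApply (superpose w γ)) := by
      rw [← he]; rfl
    rw [h1]
    exact (hasFDerivAt_id γ).sub
      ((primitive (E := E)).hasFDerivAt.comp γ (hasFDerivAt_superpose v hv hc w rfl γ))
  obtain ⟨e₀, he₀⟩ := hder (ContinuousMap.const I a)
  let e := hΘ.contDiffAt.toOpenPartialHomeomorph Θ he₀ (by simp)
  have hea : ContinuousMap.const I a ∈ e.source :=
    hΘ.contDiffAt.mem_toOpenPartialHomeomorph_source he₀ (by simp)
  have hΘa : e (ContinuousMap.const I a) = ContinuousMap.const I a := by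
    change Θ _ = _
    have : superpose v (ContinuousMap.const I a) = 0 := by
      ext t; exact ha t t.2
    simp [Θ, this]
  have hcc : Continuous (fun x : E => ContinuousMap.const I x) := ContinuousMap.continuous_const'
  refine ⟨fun x => e.symm (ContinuousMap.const I x), ?_,
    (fun x : E => ContinuousMap.const I x) ⁻¹' e.target, e.open_target.preimage hcc, ?_,
    fun x hx => ⟨?_, ?_⟩⟩
  · have := e.left_inv hea
    rwa [hΘa] at this
  · have := e.map_source hea
    rwa [hΘa] at this
  · obtain ⟨e₁, he₁⟩ := hder (e.symm (ContinuousMap.const I x))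
    have h1 : ContDiffAt ℝ ∞ e.symm (ContinuousMap.const I x) :=
      e.contDiffAt_symm hx he₁ hΘ.contDiffAt
    refine h1.comp x ?_
    exact (ContinuousLinearMap.contDiff
      (ContinuousLinearMap.const ℝ I : E →L[ℝ] C(I, E))).contDiffAt
  · have : Θ (e.symm (ContinuousMap.const I x)) = ContinuousMap.const I x := e.right_inv hx
    exact (sub_eq_iff_eq_add.1 this)

/-- Near a stationary point the flow of a time-dependent vector field exists on `[0, 1]`, is smooth,
and its differential solves the linearized equation. -/
theorem exists_local_flow {v : ℝ × E → E} {D : Set (ℝ × E)} (hD : IsOpen D)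
    (hv : ∀ p ∈ D, ContDiffAt ℝ ∞ v p) {a : E} (ha : ∀ t ∈ Icc (0 : ℝ) 1, (t, a) ∈ D)
    (ha0 : ∀ t ∈ Icc (0 : ℝ) 1, v (t, a) = 0) {V : Set E} (hV : IsOpen V) (haV : a ∈ V) :
    ∃ y : ℝ → E → E, (∀ t, y t a = a) ∧ ∃ W : Set E, IsOpen W ∧ a ∈ W ∧ ∀ x ∈ W, y 0 x = x ∧
      ∀ t ∈ Icc (0 : ℝ) 1, (t, y t x) ∈ D ∧ y t x ∈ V ∧ ContDiffAt ℝ ∞ (y t) x ∧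
        HasDerivWithinAt (fun s => y s x) (v (t, y t x)) (Icc 0 1) t ∧
        ∀ w, HasDerivWithinAt (fun s => fderiv ℝ (y s) x w)
          (partialSnd v (t, y t x) (fderiv ℝ (y t) x w)) (Icc 0 1) t := by
  have : CompleteSpace E := FiniteDimensional.complete ℝ E
  obtain ⟨u, hu, huc, W₁, hW₁, haW₁, hW₁D⟩ := exists_compactSupport_extension hD hv ha
  let u' : C(ℝ × E, E) := ⟨u, hu.continuous⟩
  let w' : C(ℝ × E, E →L[ℝ] E) := ⟨partialSnd u, (contDiff_partialSnd hu).continuous⟩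
  obtain ⟨Y, hYa, W₂, hW₂, haW₂, hY⟩ := exists_smooth_solutions u' hu huc (a := a)
    (fun t ht => by
      rw [← ha0 t ht]; exact (hW₁D t ht a haW₁).2.eq_of_nhds)
  have hYc : ContinuousOn Y W₂ := fun x hx => (hY x hx).1.continuousAt.continuousWithinAt
  -- Closeness in the sup norm keeps the solutions that start near `a` in the region where the
  -- cut-off field agrees with `v`.
  have hopen : IsOpen {γ : C(I, E) | MapsTo γ univ (W₁ ∩ V)} :=
    ContinuousMap.isOpen_setOfPred_mapsTo isCompact_univ (hW₁.inter hV)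
  let ev : ℝ → C(I, E) →L[ℝ] E := fun t => ContinuousMap.evalCLM ℝ (projIcc 0 1 zero_le_one t)
  have hcd : ∀ t, ∀ x ∈ W₂, HasFDerivAt (fun x => extendCurve (Y x) t)
      ((ev t).comp (fderiv ℝ Y x)) x := fun t x hx =>
    (ev t).hasFDerivAt.comp x ((hY x hx).1.differentiableAt (by simp)).hasFDerivAt
  refine ⟨fun t x => extendCurve (Y x) t, fun t => ?_, W₂ ∩ Y ⁻¹' {γ | MapsTo γ univ (W₁ ∩ V)},
    hYc.isOpen_inter_preimage hW₂ hopen, ⟨haW₂, ?_⟩, ?_⟩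
  · simp [hYa, extendCurve, IccExtend]
  · intro t _
    rw [hYa]; exact ⟨haW₁, haV⟩
  rintro x ⟨hx2, hx1⟩
  have hxt : ∀ t, extendCurve (Y x) t ∈ W₁ ∩ V := fun t => hx1 (mem_univ _)
  have hYx := (hY x hx2).2
  have he : ∀ {t : ℝ} {ht : t ∈ Icc (0 : ℝ) 1} (η : C(I, E)), extendCurve η t = η ⟨t, ht⟩ :=
    fun {_ ht} η => IccExtend_of_mem _ _ ht
  refine ⟨?_, fun t ht => ⟨(hW₁D t ht _ (hxt t).1).1, (hxt t).2, ?_, ?_, fun w => ?_⟩⟩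
  · have h0 : (0 : ℝ) ∈ Icc (0 : ℝ) 1 := by simp
    beta_reduce
    rw [extendCurve, IccExtend_of_mem _ _ h0, hYx]
    simp [primitive_apply]
  · exact (ev t).contDiff.contDiffAt.comp x (hY x hx2).1
  · have := hasDerivWithinAt_of_eq_primitive hYx ht
    convert this using 1
    rw [he (ht := ht) (superpose _ _), superpose_apply, ← he]
    exact (hW₁D t ht _ (hxt t).1).2.eq_of_nhds.symm
  -- Differentiating the integral equation with respect to the initial value yields the linearized
  -- equation in integral form.
  · have hlin : fderiv ℝ Y x w = ContinuousMap.const I w +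
        primitive (pointwiseApply (superpose w' (Y x)) (fderiv ℝ Y x w)) := by
      have h1 : HasFDerivAt Y ((ContinuousLinearMap.const ℝ I : E →L[ℝ] C(I, E)) +
          (primitive (E := E)).comp ((pointwiseApply (superpose w' (Y x))).comp (fderiv ℝ Y x)))
          x := by
        have h2 : HasFDerivAt (fun x => ContinuousMap.const I x + primitive (superpose u' (Y x)))
            ((ContinuousLinearMap.const ℝ I : E →L[ℝ] C(I, E)) +
              (primitive (E := E)).comp ((pointwiseApply (superpose w' (Y x))).comp
                (fderiv ℝ Y x))) x :=
          ((ContinuousLinearMap.const ℝ I : E →L[ℝ] C(I, E)).hasFDerivAt).add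
            ((primitive (E := E)).hasFDerivAt.comp x
              ((hasFDerivAt_superpose u' hu huc w' rfl (Y x)).comp x
                ((hY x hx2).1.differentiableAt (by simp)).hasFDerivAt))
        refine h2.congr_of_eventuallyEq ?_
        filter_upwards [hW₂.mem_nhds hx2] with z hz using (hY z hz).2
      exact congrArg (fun A : E →L[ℝ] C(I, E) => A w) h1.fderiv
    have hf : ∀ s, fderiv ℝ (fun x => extendCurve (Y x) s) x w =
        extendCurve (fderiv ℝ Y x w) s := fun s => by
      rw [(hcd s x hx2).fderiv]; rfl
    simp only [hf]
    have h3 := hasDerivWithinAt_of_eq_primitive hlin ht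
    convert h3 using 1
    rw [he (ht := ht) (pointwiseApply _ _), pointwiseApply_apply, superpose_apply, ← he, ← he]
    have h4 := (hW₁D t ht _ (hxt t).1).2
    change _ = partialSnd u _ _
    rw [partialSnd, partialSnd, h4.fderiv_eq]

/-- Integrals over `[0, 1]` of smooth functions depend smoothly on parameters. -/
lemma exists_smooth_integral {F : Type} [NormedAddCommGroup F] [NormedSpace ℝ F] [CompleteSpace F]
    {v : ℝ × E → F} {D : Set (ℝ × E)} (hD : IsOpen D)
    (hv : ∀ p ∈ D, ContDiffAt ℝ ∞ v p) {a : E} (ha : ∀ t ∈ Icc (0 : ℝ) 1, (t, a) ∈ D) :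
    ∃ W : Set E, IsOpen W ∧ a ∈ W ∧ ∀ x ∈ W,
      (∀ t ∈ Icc (0 : ℝ) 1, (t, x) ∈ D) ∧
      ContDiffAt ℝ ∞ (fun x => ∫ t in (0 : ℝ)..1, v (t, x)) x := by
  obtain ⟨u, hu, huc, W₁, hW₁, haW₁, hW₁D⟩ := exists_compactSupport_extension hD hv ha
  let u' : C(ℝ × E, F) := ⟨u, hu.continuous⟩
  refine ⟨W₁, hW₁, haW₁, fun x hx => ⟨fun t ht => (hW₁D t ht x hx).1, ?_⟩⟩
  have h1 : ContDiff ℝ ∞ fun x : E => ContinuousMap.evalCLM ℝ (1 : I)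
      (primitive (superpose u' (ContinuousMap.const I x))) :=
    (ContinuousLinearMap.contDiff _).comp ((primitive (E := F)).contDiff.comp
      ((contDiff_superpose u' hu huc).comp
        (ContinuousLinearMap.contDiff (ContinuousLinearMap.const ℝ I : E →L[ℝ] C(I, E)))))
  refine h1.contDiffAt.congr_of_eventuallyEq ?_
  filter_upwards [hW₁.mem_nhds hx] with z hz
  change _ = primitive (superpose u' (ContinuousMap.const I z)) 1
  rw [primitive_apply]
  refine intervalIntegral.integral_congr fun t ht => ?_
  rw [uIcc_of_le zero_le_one] at ht
  change t ∈ Icc (0 : ℝ) 1 at ht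
  rw [extendCurve, IccExtend_of_mem _ _ ht]
  exact (hW₁D t ht z hz).2.eq_of_nhds.symm

/-- Smooth division by a function `w` for which the points split as `x = ρ x + w x • e x`, of a
smooth function vanishing along `ρ`. -/
lemma exists_smooth_quotient {B w : E → ℝ} {ρ e : E → E} {D : Set E} (hD : IsOpen D) {a : E}
    (haD : a ∈ D) (hB : ∀ x ∈ D, ContDiffAt ℝ ∞ B x) (hw : ∀ x ∈ D, ContDiffAt ℝ ∞ w x)
    (hρ : ∀ x ∈ D, ContDiffAt ℝ ∞ ρ x) (he : ∀ x ∈ D, ContDiffAt ℝ ∞ e x)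
    (hx : ∀ x ∈ D, x = ρ x + w x • e x) (hB0 : ∀ x ∈ D, B (ρ x) = 0) (hwa : w a = 0) :
    ∃ f : E → ℝ, ∃ W : Set E, IsOpen W ∧ a ∈ W ∧ W ⊆ D ∧ ∀ x ∈ W, ContDiffAt ℝ ∞ f x ∧
      B x = w x * f x := by
  -- Hadamard's lemma: κ (t, x) runs from ρ x to x with velocity w x • e x, so B x is w x times the
  -- integral over t of DB (κ (t, x)) (e x). That integral is the quotient.
  let κ : ℝ × E → E := fun p => ρ p.2 + (p.1 * w p.2) • e p.2
  have hρa : ρ a = a := by have := hx a haD; rw [hwa, zero_smul, add_zero] at this; exact this.symm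
  have hκs : ∀ p : ℝ × E, p.2 ∈ D → ContDiffAt ℝ ∞ κ p := fun p hp =>
    ((hρ _ hp).comp p contDiffAt_snd).add
      ((contDiffAt_fst.mul ((hw _ hp).comp p contDiffAt_snd)).smul
        ((he _ hp).comp p contDiffAt_snd))
  have hκc : ContinuousOn κ (Prod.snd ⁻¹' D) := fun p hp =>
    (hκs p hp).continuousAt.continuousWithinAt
  have hD' : IsOpen (Prod.snd ⁻¹' D ∩ κ ⁻¹' D) :=
    hκc.isOpen_inter_preimage (hD.preimage continuous_snd) hD
  let v : ℝ × E → ℝ := fun p => fderiv ℝ B (κ p) (e p.2)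
  have hv : ∀ p ∈ Prod.snd ⁻¹' D ∩ κ ⁻¹' D, ContDiffAt ℝ ∞ v p := fun p hp =>
    (((hB _ hp.2).fderiv_right (m := ∞) (by simp)).comp p (hκs p hp.1)).clm_apply
      ((he _ hp.1).comp p contDiffAt_snd)
  obtain ⟨W, hW, haW, hWs⟩ := exists_smooth_integral hD' hv (a := a) (fun t _ => by
    refine ⟨haD, ?_⟩
    simpa [κ, hwa, hρa] using haD)
  refine ⟨_, W, hW, haW, fun x hxW => ((hWs x hxW).1 0 (by simp)).1,
    fun x hxW => ⟨(hWs x hxW).2, ?_⟩⟩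
  have hxD := (hWs x hxW).1
  have h0 : x ∈ D := (hxD 0 (by simp)).1
  have hderiv : ∀ t ∈ uIcc (0 : ℝ) 1, HasDerivAt (fun t => B (κ (t, x))) (w x * v (t, x)) t := by
    intro t ht
    rw [uIcc_of_le zero_le_one] at ht
    have h1 : HasDerivAt (fun t : ℝ => κ (t, x)) ((1 * w x) • e x) t :=
      (((hasDerivAt_id t).mul_const (w x)).smul_const (e x)).const_add (ρ x)
    have h2 := ((hB _ (hxD t ht).2).differentiableAt (by simp)).hasFDerivAt.comp_hasDerivAt t h1
    have h3 : fderiv ℝ B (κ (t, x)) ((1 * w x) • e x) = w x * v (t, x) := by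
      simp only [one_mul, map_smul, smul_eq_mul, v]
    rw [h3] at h2
    exact h2
  have hcont : ContinuousOn (fun t => w x * v (t, x)) (uIcc 0 1) := by
    rw [uIcc_of_le zero_le_one]
    intro t ht
    have h1 : ContinuousAt (fun t : ℝ => v (t, x)) t :=
      ContinuousAt.comp (f := fun t : ℝ => (t, x)) (hv _ (hxD t ht)).continuousAt (by fun_prop)
    exact (h1.const_mul _).continuousWithinAt
  have hint := intervalIntegral.integral_eq_sub_of_hasDerivAt hderiv hcont.intervalIntegrable
  rw [intervalIntegral.integral_const_mul] at hint
  rw [hint]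
  have h1 : κ (1, x) = x := by simp only [κ, one_mul]; exact (hx x h0).symm
  have h2 : κ (0, x) = ρ x := by simp [κ]
  rw [h1, h2, hB0 x h0, sub_zero]

end LocalFlow

end OvertwistedBox

end

noncomputable section
namespace OvertwistedBox

set_option linter.unusedSectionVars false

open Set Topology Filter

/-! ### The exterior derivative of a one-form on a normed space. -/

section ExteriorDerivative

variable {E E' : Type*} [NormedAddCommGroup E] [NormedSpace ℝ E]
  [NormedAddCommGroup E'] [NormedSpace ℝ E']

/-- The exterior derivative of a one-form on a normed space, `da (u, v) = (Da u) v - (Da v) u`. -/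
def dOne (a : E → E →L[ℝ] ℝ) (y : E) : E →L[ℝ] E →L[ℝ] ℝ :=
  fderiv ℝ a y - (fderiv ℝ a y).flip

lemma dOne_apply (a : E → E →L[ℝ] ℝ) (y u v : E) :
    dOne a y u v = fderiv ℝ a y u v - fderiv ℝ a y v u := rfl

lemma dOne_congr {a b : E → E →L[ℝ] ℝ} {y : E} (h : a =ᶠ[𝓝 y] b) : dOne a y = dOne b y := by
  rw [dOne, dOne, h.fderiv_eq]

/-- The only term that is not natural contains the second derivative of `g`. It is symmetric and
cancels in the antisymmetrization. -/
lemma dOne_pull {a : E → E →L[ℝ] ℝ} {g : E' → E} {e : E'} (ha : DifferentiableAt ℝ a (g e))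
    (hg : ContDiffAt ℝ 2 g e) (u v : E') :
    dOne (fun x => (a (g x)).comp (fderiv ℝ g x)) e u v =
      dOne a (g e) (fderiv ℝ g e u) (fderiv ℝ g e v) := by
  have hg1 : DifferentiableAt ℝ g e := hg.differentiableAt (by simp)
  have hg2 : DifferentiableAt ℝ (fderiv ℝ g) e :=
    (hg.fderiv_right (m := 1) (by norm_num)).differentiableAt (by simp)
  have hsymm : fderiv ℝ (fderiv ℝ g) e u v = fderiv ℝ (fderiv ℝ g) e v u :=
    (hg.isSymmSndFDerivAt (by simp)).eq u v
  have hD : HasFDerivAt (fun x => (a (g x)).comp (fderiv ℝ g x)) _ e :=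
    (ha.hasFDerivAt.comp e hg1.hasFDerivAt).clm_comp hg2.hasFDerivAt
  rw [dOne_apply, dOne_apply, hD.fderiv]
  simp [hsymm]

lemma contDiff_flip : ContDiff ℝ ∞ fun A : E →L[ℝ] E →L[ℝ] ℝ => A.flip :=
  IsBoundedLinearMap.contDiff (𝕜 := ℝ) ⟨⟨fun A B => A.flip_add B, fun c A => A.flip_smul c⟩,
    1, one_pos, fun A => by rw [A.opNorm_flip, one_mul]⟩

lemma contDiffAt_dOne {a : E → E →L[ℝ] ℝ} {y : E} (h : ContDiffAt ℝ ∞ a y) :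
    ContDiffAt ℝ ∞ (dOne a) y :=
  (h.fderiv_right (m := ∞) (by simp)).sub
    (contDiff_flip.contDiffAt.comp y (h.fderiv_right (m := ∞) (by simp)))

end ExteriorDerivative

/-! ### One-forms on manifolds and naturality of their exterior derivative. -/

section Forms

variable {E H X E' H' X' E'' H'' X'' : Type*}
  [NormedAddCommGroup E] [NormedSpace ℝ E] [TopologicalSpace H]
  {I : ModelWithCorners ℝ E H} [TopologicalSpace X] [ChartedSpace H X]
  [NormedAddCommGroup E'] [NormedSpace ℝ E'] [TopologicalSpace H']
  {I' : ModelWithCorners ℝ E' H'} [TopologicalSpace X'] [ChartedSpace H' X']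
  [NormedAddCommGroup E''] [NormedSpace ℝ E''] [TopologicalSpace H'']
  {I'' : ModelWithCorners ℝ E'' H''} [TopologicalSpace X''] [ChartedSpace H'' X'']

/-- The differential of a map between manifolds, as an operator between the model spaces. -/
def md (I' : ModelWithCorners ℝ E' H') (I : ModelWithCorners ℝ E H) (f : X' → X) (x : X') :
    E' →L[ℝ] E :=
  mfderiv I' I f x

lemma md_congr {f g : X' → X} {x : X'} (h : f =ᶠ[𝓝 x] g) : md I' I f x = md I' I g x := by
  unfold md
  exact h.mfderiv_eq

lemma md_comp {f : X' → X} {g : X'' → X'} {x : X''} (hf : MDifferentiableAt I' I f (g x))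
    (hg : MDifferentiableAt I'' I' g x) :
    md I'' I (fun y => f (g y)) x = (md I' I f (g x)).comp (md I'' I' g x) :=
  mfderiv_comp x hf hg

lemma md_eq_fderiv {f : E' → E} {x : E'} : md 𝓘(ℝ, E') 𝓘(ℝ, E) f x = fderiv ℝ f x :=
  mfderiv_eq_fderiv

/-- One-forms on a manifold. -/
abbrev OneForm (E X : Type*) [NormedAddCommGroup E] [NormedSpace ℝ E] := X → E →L[ℝ] ℝ

/-- The pullback of a one-form. -/
def pullForm (I' : ModelWithCorners ℝ E' H') (I : ModelWithCorners ℝ E H) (α : OneForm E X)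
    (f : X' → X) : OneForm E' X' :=
  fun x => (α (f x)).comp (md I' I f x)

lemma pullForm_apply (α : OneForm E X) (f : X' → X) (x : X') (v : E') :
    pullForm I' I α f x v = α (f x) (md I' I f x v) := rfl

lemma pullForm_congr {α : OneForm E X} {f g : X' → X} {e : X'} (h : f =ᶠ[𝓝 e] g) :
    pullForm I' I α f =ᶠ[𝓝 e] pullForm I' I α g := by
  filter_upwards [h.eventuallyEq_nhds] with y hy
  rw [pullForm, pullForm, md_congr hy, hy.eq_of_nhds]

/-- A one-form is smooth at `x` if its expression in the preferred chart at `x` is. -/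
def SmoothFormAt (I : ModelWithCorners ℝ E H) (α : OneForm E X) (x : X) : Prop :=
  ContDiffAt ℝ ∞ (pullForm 𝓘(ℝ, E) I α (extChartAt I x).symm) (extChartAt I x x)

/-- The exterior derivative of a one-form, computed at `x` in the preferred chart at `x`. -/
def dForm (I : ModelWithCorners ℝ E H) (α : OneForm E X) (x : X) : E →L[ℝ] E →L[ℝ] ℝ :=
  dOne (pullForm 𝓘(ℝ, E) I α (extChartAt I x).symm) (extChartAt I x x)

variable [I.Boundaryless] [IsManifold I ∞ X] [I'.Boundaryless] [IsManifold I' ∞ X']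

lemma contMDiffAt_extChartAt_symm' {x₀ : X} {y : E} (hy : y ∈ (extChartAt I x₀).target) :
    ContMDiffAt 𝓘(ℝ, E) I ∞ (extChartAt I x₀).symm y :=
  (contMDiffOn_extChartAt_symm x₀).contMDiffAt ((isOpen_extChartAt_target x₀).mem_nhds hy)

lemma eventually_mdifferentiableAt {f : X' → X} {x : X'} (hf : ContMDiffAt I' I ∞ f x) :
    ∀ᶠ y in 𝓝 x, MDifferentiableAt I' I f y := by
  have : IsManifold I 1 X := .of_le (n := ∞) (by simp)
  have : IsManifold I' 1 X' := .of_le (n := ∞) (by simp)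
  have h1 : ContMDiffAt I' I 1 f x := hf.of_le (by simp)
  filter_upwards [(contMDiffAt_iff_contMDiffAt_nhds (by simp)).1 h1] with y hy
  exact hy.mdifferentiableAt (by simp)

lemma md_extChartAt_self (x : X) : md I 𝓘(ℝ, E) (extChartAt I x) x = ContinuousLinearMap.id ℝ E := by
  have : IsManifold I 1 X := .of_le (n := ∞) (by simp)
  exact mfderiv_extChartAt_self

lemma md_extChartAt_comp_symm {x₀ : X} {y : E} (hy : y ∈ (extChartAt I x₀).target) :
    (md I 𝓘(ℝ, E) (extChartAt I x₀) ((extChartAt I x₀).symm y)).comp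
      (md 𝓘(ℝ, E) I (extChartAt I x₀).symm y) = ContinuousLinearMap.id ℝ E := by
  have : IsManifold I 1 X := .of_le (n := ∞) (by simp)
  have := mfderiv_extChartAt_comp_mfderivWithin_extChartAt_symm (I := I) hy
  rw [I.range_eq_univ, mfderivWithin_univ] at this
  exact this

lemma md_extChartAt_symm_comp {x₀ : X} {y : E} (hy : y ∈ (extChartAt I x₀).target) :
    (md 𝓘(ℝ, E) I (extChartAt I x₀).symm y).comp
      (md I 𝓘(ℝ, E) (extChartAt I x₀) ((extChartAt I x₀).symm y)) = ContinuousLinearMap.id ℝ E := by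
  have : IsManifold I 1 X := .of_le (n := ∞) (by simp)
  have := mfderivWithin_extChartAt_symm_comp_mfderiv_extChartAt (I := I) hy
  rw [I.range_eq_univ, mfderivWithin_univ] at this
  exact this

/-- The pullback under a composition. -/
lemma pullForm_comp (α : OneForm E X) {f : X' → X} {g : X'' → X'} {x : X''}
    (hf : MDifferentiableAt I' I f (g x)) (hg : MDifferentiableAt I'' I' g x) :
    pullForm I'' I α (fun y => f (g y)) x = pullForm I'' I' (pullForm I' I α f) g x := by
  rw [pullForm, pullForm, pullForm, md_comp hf hg]
  rfl

lemma pullForm_comp_eventuallyEq (α : OneForm E X) {f : X' → X} {g : E'' → X'} {x : E''}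
    (hf : ContMDiffAt I' I ∞ f (g x)) (hg : ContMDiffAt 𝓘(ℝ, E'') I' ∞ g x) :
    pullForm 𝓘(ℝ, E'') I α (fun y => f (g y)) =ᶠ[𝓝 x]
      pullForm 𝓘(ℝ, E'') I' (pullForm I' I α f) g := by
  filter_upwards [hg.continuousAt.eventually (eventually_mdifferentiableAt hf),
    eventually_mdifferentiableAt hg] with y h1 h2 using pullForm_comp α h1 h2

/-- The expression of a plot in a chart around its value. -/
lemma plot_eventuallyEq (α : OneForm E X) {f : E' → X} {e : E'} {x₀ : X}
    (hf : ContMDiffAt 𝓘(ℝ, E') I ∞ f e) (hx : f e ∈ (extChartAt I x₀).source) :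
    pullForm 𝓘(ℝ, E') I α f =ᶠ[𝓝 e] fun y =>
      (pullForm 𝓘(ℝ, E) I α (extChartAt I x₀).symm (extChartAt I x₀ (f y))).comp
        (fderiv ℝ (fun z => extChartAt I x₀ (f z)) y) := by
  have h2 : ∀ᶠ y in 𝓝 e, f y ∈ (extChartAt I x₀).source :=
    hf.continuousAt.eventually ((isOpen_extChartAt_source x₀).mem_nhds hx)
  have h3 : f =ᶠ[𝓝 e] fun y => (extChartAt I x₀).symm (extChartAt I x₀ (f y)) := by
    filter_upwards [h2] with y hy using ((extChartAt I x₀).left_inv hy).symm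
  have h4 : ContMDiffAt 𝓘(ℝ, E') 𝓘(ℝ, E) ∞ (fun z => extChartAt I x₀ (f z)) e :=
    (contMDiffAt_extChartAt' (by simpa using hx)).comp e hf
  refine (pullForm_congr h3).trans ?_
  refine (pullForm_comp_eventuallyEq (I' := 𝓘(ℝ, E)) (f := (extChartAt I x₀).symm)
    (g := fun y => extChartAt I x₀ (f y)) α
    (contMDiffAt_extChartAt_symm' ((extChartAt I x₀).map_source hx)) h4).trans ?_
  refine Eventually.of_forall fun y => ?_
  rw [pullForm, md_eq_fderiv]

lemma contDiffAt_extChartAt_comp {f : E' → X} {e : E'} {x₀ : X}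
    (hf : ContMDiffAt 𝓘(ℝ, E') I ∞ f e) (hx : f e ∈ (extChartAt I x₀).source) :
    ContDiffAt ℝ ∞ (fun z => extChartAt I x₀ (f z)) e :=
  ((contMDiffAt_extChartAt' (by simpa using hx)).comp e hf).contDiffAt

/-- Pullbacks of smooth one-forms to normed spaces are smooth. -/
lemma SmoothFormAt.contDiffAt_plot {α : OneForm E X} {f : E' → X} {e : E'}
    (hα : SmoothFormAt I α (f e)) (hf : ContMDiffAt 𝓘(ℝ, E') I ∞ f e) :
    ContDiffAt ℝ ∞ (pullForm 𝓘(ℝ, E') I α f) e := by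
  have hs := mem_extChartAt_source (I := I) (f e)
  have hg := contDiffAt_extChartAt_comp hf hs
  refine ContDiffAt.congr_of_eventuallyEq ?_ (plot_eventuallyEq α hf hs)
  have hα' : ContDiffAt ℝ ∞ (pullForm 𝓘(ℝ, E) I α (extChartAt I (f e)).symm)
    ((fun z => extChartAt I (f e) (f z)) e) := hα
  exact (hα'.comp e hg).clm_comp (hg.fderiv_right (m := ∞) (by simp))

/-- The exterior derivative is natural with respect to plots. -/
lemma dOne_plot {α : OneForm E X} {f : E' → X} {e : E'}
    (hα : SmoothFormAt I α (f e)) (hf : ContMDiffAt 𝓘(ℝ, E') I ∞ f e) (u v : E') :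
    dOne (pullForm 𝓘(ℝ, E') I α f) e u v =
      dForm I α (f e) (md 𝓘(ℝ, E') I f e u) (md 𝓘(ℝ, E') I f e v) := by
  have hs := mem_extChartAt_source (I := I) (f e)
  have hg := contDiffAt_extChartAt_comp hf hs
  have h1 : fderiv ℝ (fun z => extChartAt I (f e) (f z)) e = md 𝓘(ℝ, E') I f e := by
    have : IsManifold I 1 X := .of_le (n := ∞) (by simp)
    rw [← md_eq_fderiv, md_comp (I' := I) (mdifferentiableAt_extChartAt (by simp))
      (hf.mdifferentiableAt (by simp)), md_extChartAt_self, ContinuousLinearMap.id_comp]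
  rw [dOne_congr (plot_eventuallyEq α hf hs), dOne_pull (g := fun z => extChartAt I (f e) (f z))
    (a := pullForm 𝓘(ℝ, E) I α (extChartAt I (f e)).symm) (ContDiffAt.differentiableAt hα (by simp))
    (hg.of_le (by norm_cast)), h1]
  rfl

lemma SmoothFormAt.pullForm {α : OneForm E X} {f : X' → X} {x : X'}
    (hα : SmoothFormAt I α (f x)) (hf : ContMDiffAt I' I ∞ f x) :
    SmoothFormAt I' (pullForm I' I α f) x := by
  have hs := extChartAt_to_inv (I := I') x
  have h1 : ContMDiffAt 𝓘(ℝ, E') I' ∞ (extChartAt I' x).symm (extChartAt I' x x) :=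
    contMDiffAt_extChartAt_symm' (mem_extChartAt_target x)
  have hf' : ContMDiffAt I' I ∞ f ((extChartAt I' x).symm (extChartAt I' x x)) := by rwa [hs]
  refine ContDiffAt.congr_of_eventuallyEq ?_ (pullForm_comp_eventuallyEq α hf' h1).symm
  exact SmoothFormAt.contDiffAt_plot (by rwa [hs]) (hf'.comp _ h1)

/-- Composing `f` with the inverse of the preferred chart at x reduces this to `dOne_plot`; the
differential of that chart is the identity at its centre, so no factor is left over. -/
lemma dForm_pullForm {α : OneForm E X} {f : X' → X} {x : X'}
    (hα : SmoothFormAt I α (f x)) (hf : ContMDiffAt I' I ∞ f x) (u v : E') :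
    dForm I' (OvertwistedBox.pullForm I' I α f) x u v =
      dForm I α (f x) (md I' I f x u) (md I' I f x v) := by
  have : IsManifold I' 1 X' := .of_le (n := ∞) (by simp)
  have hs := extChartAt_to_inv (I := I') x
  have h1 : ContMDiffAt 𝓘(ℝ, E') I' ∞ (extChartAt I' x).symm (extChartAt I' x x) :=
    contMDiffAt_extChartAt_symm' (mem_extChartAt_target x)
  have hf' : ContMDiffAt I' I ∞ f ((extChartAt I' x).symm (extChartAt I' x x)) := by rwa [hs]
  have hid : md 𝓘(ℝ, E') I' (extChartAt I' x).symm (extChartAt I' x x) =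
      ContinuousLinearMap.id ℝ E' := by
    have := md_extChartAt_comp_symm (I := I') (mem_extChartAt_target x)
    rwa [hs, md_extChartAt_self, ContinuousLinearMap.id_comp] at this
  rw [dForm, ← dOne_congr (pullForm_comp_eventuallyEq α hf' h1),
    dOne_plot (f := fun y => f ((extChartAt I' x).symm y)) (by rwa [hs]) (hf'.comp _ h1),
    md_comp (I' := I') (hf'.mdifferentiableAt (by simp)) (h1.mdifferentiableAt (by simp)), hid, hs]
  rfl

end Forms

end OvertwistedBox

end

noncomputable section
namespace OvertwistedBox

set_option linter.unusedSectionVars false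

open Set Topology Filter

/-! ### Linear algebra of the contact condition. -/

section LinearContact

variable {E E' P : Type*} [NormedAddCommGroup E] [NormedSpace ℝ E]
  [NormedAddCommGroup E'] [NormedSpace ℝ E'] [NormedAddCommGroup P] [NormedSpace ℝ P]

/-- The contact condition on a covector `a` and a bilinear form `b`, which plays the role of the
exterior derivative of `a`. -/
def IsContactPair (a : E →L[ℝ] ℝ) (b : E →L[ℝ] E →L[ℝ] ℝ) : Prop :=
  a ≠ 0 ∧ ∀ u, a u = 0 → u ≠ 0 → ∃ v, a v = 0 ∧ b u v ≠ 0

/-- The operator `u ↦ b (u, ·) + a u • a`, which is invertible for contact pairs. -/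
def contactOp (a : E →L[ℝ] ℝ) (b : E →L[ℝ] E →L[ℝ] ℝ) : E →L[ℝ] E →L[ℝ] ℝ :=
  b + a.smulRight a

lemma contactOp_apply (a : E →L[ℝ] ℝ) (b : E →L[ℝ] E →L[ℝ] ℝ) (u v : E) :
    contactOp a b u v = b u v + a u * a v := by
  simp [contactOp]

/-- The vector `X` with `a X = h` and `b (X, ·) = η` on the kernel of `a`. -/
def contactSolve (a : E →L[ℝ] ℝ) (b : E →L[ℝ] E →L[ℝ] ℝ) (η : E →L[ℝ] ℝ) (h : ℝ) : E :=
  (contactOp a b).inverse η +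
    (h - a ((contactOp a b).inverse η)) • (contactOp a b).inverse a

variable {a : E →L[ℝ] ℝ} {b : E →L[ℝ] E →L[ℝ] ℝ}

/-- Uniqueness of the solution X of a X = h, b (X, ·) = η on ker a: the difference of two solutions
lies in ker a and pairs to zero with ker a. -/
lemma IsContactPair.eq_of_forall (hc : IsContactPair a b) {X Y : E} (h : a X = a Y)
    (h' : ∀ v, a v = 0 → b X v = b Y v) : X = Y := by
  by_contra hne
  obtain ⟨v, hv, hv'⟩ := hc.2 (X - Y) (by simp [h]) (sub_ne_zero.2 hne)
  exact hv' (by simp [h' v hv])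

/-- The contact condition only depends on the restriction of the bilinear form to the kernel. -/
lemma IsContactPair.congr (hc : IsContactPair a b) {b' : E →L[ℝ] E →L[ℝ] ℝ}
    (h : ∀ u v, a u = 0 → a v = 0 → b' u v = b u v) : IsContactPair a b' :=
  ⟨hc.1, fun u hu hu0 => let ⟨v, hv, hv'⟩ := hc.2 u hu hu0; ⟨v, hv, by rwa [h u v hu hv]⟩⟩

/-- A covector that vanishes on the kernel of `a` is a multiple of `a`. -/
lemma eq_mul_of_forall_ker (η : E →L[ℝ] ℝ) (h : ∀ v, a v = 0 → η v = 0) {R : E}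
    (hR : a R = 1) (v : E) : η v = η R * a v := by
  have := h (v - a v • R) (by simp [hR])
  simp only [map_sub, map_smul, smul_eq_mul] at this
  linarith

variable [FiniteDimensional ℝ E] [FiniteDimensional ℝ E']

lemma isInvertible_of_injective {B : E →L[ℝ] E →L[ℝ] ℝ} (h : Function.Injective B) :
    B.IsInvertible := by
  have h1 : Module.finrank ℝ E = Module.finrank ℝ (E →L[ℝ] ℝ) := by
    rw [← (LinearMap.toContinuousLinearMap : (E →ₗ[ℝ] ℝ) ≃ₗ[ℝ] E →L[ℝ] ℝ).finrank_eq]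
    exact (Subspace.dual_finrank_eq (K := ℝ) (V := E)).symm
  have : FiniteDimensional ℝ (E →L[ℝ] ℝ) :=
    LinearEquiv.finiteDimensional (LinearMap.toContinuousLinearMap : (E →ₗ[ℝ] ℝ) ≃ₗ[ℝ] E →L[ℝ] ℝ)
  let e := LinearEquiv.ofInjectiveOfFinrankEq B.toLinearMap h h1
  exact ⟨e.toContinuousLinearEquiv, by ext; rfl⟩

/-- If b (u, ·) + a u • a = 0, evaluation at u gives (a u)² = 0, because b is alternating. Then b
(u, ·) = 0, and non-degeneracy forces u = 0. -/
lemma IsContactPair.isInvertible (hc : IsContactPair a b) (hb : ∀ u, b u u = 0) :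
    (contactOp a b).IsInvertible := by
  refine isInvertible_of_injective ((injective_iff_map_eq_zero _).2 fun u hu => ?_)
  have h0 : ∀ v, b u v + a u * a v = 0 := fun v => by rw [← contactOp_apply, hu]; rfl
  have hau : a u = 0 := by
    have := h0 u
    rw [hb, zero_add] at this
    exact mul_self_eq_zero.1 this
  by_contra hne
  obtain ⟨v, _, hv⟩ := hc.2 u hau hne
  exact hv (by simpa [hau] using h0 v)

/-- The preimage R of `a` is the Reeb vector. Its equation tested on R reads (a R)² = a R; the case
a R = 0 would give R = 0 and then a = 0. -/
lemma IsContactPair.apply_inverse (hc : IsContactPair a b) (hb : ∀ u, b u u = 0) :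
    a ((contactOp a b).inverse a) = 1 := by
  have hinv := hc.isInvertible hb
  set R := (contactOp a b).inverse a with hR
  have h0 : ∀ v, b R v + a R * a v = a v := fun v => by
    rw [← contactOp_apply, hR, hinv.self_apply_inverse]
  have h1 := h0 R
  rw [hb, zero_add] at h1
  by_contra hne
  have h2 : a R = 0 := by
    by_contra h2
    exact hne (mul_left_cancel₀ h2 (by rw [h1, mul_one]))
  have h3 : R = 0 := by
    by_contra h3
    obtain ⟨v, hv, hv'⟩ := hc.2 R h2 h3
    exact hv' (by simpa [h2, hv] using h0 v)
  exact hc.1 (by ext v; simpa [h3] using (h0 v).symm)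

lemma IsContactPair.contactSolve_apply (hc : IsContactPair a b) (hb : ∀ u, b u u = 0)
    (η : E →L[ℝ] ℝ) (h : ℝ) : a (contactSolve a b η h) = h := by
  simp [contactSolve, hc.apply_inverse hb]

lemma IsContactPair.contactSolve_ker (hc : IsContactPair a b) (hb : ∀ u, b u u = 0)
    (η : E →L[ℝ] ℝ) (h : ℝ) {v : E} (hv : a v = 0) : b (contactSolve a b η h) v = η v := by
  have hinv := hc.isInvertible hb
  have h1 : ∀ ζ : E →L[ℝ] ℝ, b ((contactOp a b).inverse ζ) v = ζ v := fun ζ => by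
    have := contactOp_apply a b ((contactOp a b).inverse ζ) v
    rw [hinv.self_apply_inverse, hv, mul_zero, add_zero] at this
    exact this.symm
  simp [contactSolve, h1, hv]

lemma IsContactPair.eq_contactSolve (hc : IsContactPair a b) (hb : ∀ u, b u u = 0)
    {η : E →L[ℝ] ℝ} {h : ℝ} {X : E} (h1 : a X = h) (h2 : ∀ v, a v = 0 → b X v = η v) :
    X = contactSolve a b η h :=
  hc.eq_of_forall (by rw [h1, hc.contactSolve_apply hb])
    fun v hv => by rw [h2 v hv, hc.contactSolve_ker hb η h hv]

lemma IsContactPair.comp (hc : IsContactPair a b) {P : E' →L[ℝ] E} (hP : Function.Bijective P)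
    {b' : E' →L[ℝ] E' →L[ℝ] ℝ} (hb' : ∀ u v, b' u v = b (P u) (P v)) :
    IsContactPair (a.comp P) b' := by
  refine ⟨fun h => hc.1 ?_, fun u hu hu0 => ?_⟩
  · ext v
    obtain ⟨v, rfl⟩ := hP.2 v
    exact congrArg (fun f : E' →L[ℝ] ℝ => f v) h
  · obtain ⟨v, hv, hv'⟩ := hc.2 (P u) hu (fun h => hu0 (hP.1 (by rw [h, map_zero])))
    obtain ⟨v, rfl⟩ := hP.2 v
    exact ⟨v, hv, by rwa [hb']⟩

/-- The solution is characterized by equations that are natural under linear isomorphisms, so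
uniqueness makes it natural as well. -/
lemma IsContactPair.map_contactSolve (hc : IsContactPair a b) (hb : ∀ u, b u u = 0)
    {P : E' →L[ℝ] E} (hP : Function.Bijective P)
    {b' : E' →L[ℝ] E' →L[ℝ] ℝ} (hb' : ∀ u v, b' u v = b (P u) (P v)) (η : E →L[ℝ] ℝ) (h : ℝ) :
    P (contactSolve (a.comp P) b' (η.comp P) h) = contactSolve a b η h := by
  have hc' := hc.comp hP hb'
  have hb0 : ∀ u, b' u u = 0 := fun u => by rw [hb', hb]
  refine hc.eq_contactSolve hb (hc'.contactSolve_apply hb0 _ _) fun v hv => ?_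
  obtain ⟨v, rfl⟩ := hP.2 v
  rw [← hb']
  exact hc'.contactSolve_ker hb0 _ _ hv

/-- A vector u of ker a that pairs to zero with ker a is sent by the operator to a multiple of `a`,
so u is a multiple of R; but `a` does not vanish on R. This converse expresses the contact condition
by an invertible operator and one nonzero number, from which its openness is read off. -/
lemma isContactPair_of_isInvertible (hinv : (contactOp a b).IsInvertible)
    (h : a ((contactOp a b).inverse a) ≠ 0) : IsContactPair a b := by
  refine ⟨fun h0 => h (by simp [h0]), fun u hu hu0 => ?_⟩
  by_contra! hcon
  set R := (contactOp a b).inverse a with hR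
  have h1 : ∀ v, b u v = b u ((a R)⁻¹ • R) * a v :=
    eq_mul_of_forall_ker (b u) hcon (by simp [inv_mul_cancel₀ h])
  set c := b u ((a R)⁻¹ • R)
  have h2 : u = c • R := by
    rw [hR, ← map_smul, eq_comm, hinv.inverse_apply_eq]
    ext v
    simp [contactOp_apply, h1 v, hu]
  have hc0 : c ≠ 0 := fun h => hu0 (by rw [h2, h, zero_smul])
  rw [h2, map_smul, smul_eq_mul] at hu
  exact (mul_ne_zero hc0 h) hu

section Smooth

lemma contDiff_contactOp {f : P → E →L[ℝ] ℝ} {g : P → E →L[ℝ] E →L[ℝ] ℝ} {p : P}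
    {n : WithTop ℕ∞} (hf : ContDiffAt ℝ n f p) (hg : ContDiffAt ℝ n g p) :
    ContDiffAt ℝ n (fun q => contactOp (f q) (g q)) p :=
  hg.add (hf.smulRight hf)

lemma contDiffAt_contactInverse {f : P → E →L[ℝ] ℝ} {g : P → E →L[ℝ] E →L[ℝ] ℝ} {p : P}
    {n : WithTop ℕ∞} (hf : ContDiffAt ℝ n f p) (hg : ContDiffAt ℝ n g p)
    (hc : (contactOp (f p) (g p)).IsInvertible) :
    ContDiffAt ℝ n (fun q => (contactOp (f q) (g q)).inverse) p := by
  have : CompleteSpace E := FiniteDimensional.complete ℝ E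
  obtain ⟨e, he⟩ := hc
  have h := contDiffAt_map_inverse (𝕜 := ℝ) (n := n) e
  rw [he] at h
  exact h.comp p (contDiff_contactOp hf hg)

lemma contDiffAt_contactSolve {f : P → E →L[ℝ] ℝ} {g : P → E →L[ℝ] E →L[ℝ] ℝ}
    {η : P → E →L[ℝ] ℝ} {h : P → ℝ} {p : P} (hf : ContDiffAt ℝ ∞ f p) (hg : ContDiffAt ℝ ∞ g p)
    (hη : ContDiffAt ℝ ∞ η p) (hh : ContDiffAt ℝ ∞ h p) (hc : IsContactPair (f p) (g p))
    (h0 : ∀ u, g p u u = 0) :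
    ContDiffAt ℝ ∞ (fun q => contactSolve (f q) (g q) (η q) (h q)) p := by
  have hinv := contDiffAt_contactInverse hf hg (hc.isInvertible h0)
  have h1 := hinv.clm_apply hη
  exact h1.add ((hh.sub (hf.clm_apply h1)).smul (hinv.clm_apply hf))

end Smooth

/-- The contact condition is open. -/
lemma eventually_isContactPair {T : Type*} [TopologicalSpace T] {f : T → E →L[ℝ] ℝ}
    {g : T → E →L[ℝ] E →L[ℝ] ℝ} {p : T} (hf : ContinuousAt f p) (hg : ContinuousAt g p)
    (hc : IsContactPair (f p) (g p)) (h0 : ∀ u, g p u u = 0) :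
    ∀ᶠ q in 𝓝 p, IsContactPair (f q) (g q) := by
  have : CompleteSpace E := FiniteDimensional.complete ℝ E
  have hinv : ContDiffAt ℝ 0 (fun q : (E →L[ℝ] ℝ) × (E →L[ℝ] E →L[ℝ] ℝ) =>
      (contactOp q.1 q.2).inverse) (f p, g p) :=
    contDiffAt_contactInverse contDiffAt_fst contDiffAt_snd (hc.isInvertible h0)
  have hcont : ContinuousAt (fun q : (E →L[ℝ] ℝ) × (E →L[ℝ] E →L[ℝ] ℝ) =>
      q.1 ((contactOp q.1 q.2).inverse q.1)) (f p, g p) :=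
    continuousAt_fst.clm_apply (hinv.continuousAt.clm_apply continuousAt_fst)
  have h1 : ∀ᶠ q in 𝓝 (f p, g p), q.1 ((contactOp q.1 q.2).inverse q.1) ≠ 0 :=
    hcont.eventually_ne (by
      change (f p) ((contactOp (f p) (g p)).inverse (f p)) ≠ 0
      rw [hc.apply_inverse h0]; exact one_ne_zero)
  filter_upwards [(hf.prodMk hg).eventually h1] with q hq
  by_cases hi : (contactOp (f q) (g q)).IsInvertible
  · exact isContactPair_of_isInvertible hi hq
  -- The inverse of a non-invertible operator is 0 by convention, so `hq` also rules this case out.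
  · rw [ContinuousLinearMap.inverse_of_not_isInvertible hi] at hq
    simp at hq

end LinearContact

/-! ### Zeros of solutions of linear scalar equations. -/

section ScalarODE

/-- Solutions of a linear scalar equation vanish at the start if and only if they vanish at the
end. -/
lemma eq_zero_iff_of_linear {m g : ℝ → ℝ} (hg : ContinuousOn g (Icc 0 1))
    (hm : ∀ t ∈ Icc (0 : ℝ) 1, HasDerivWithinAt m (g t * m t) (Icc 0 1) t) :
    m 0 = 0 ↔ m 1 = 0 := by
  obtain ⟨C, hC⟩ := isCompact_Icc.exists_bound_of_continuousOn hg
  have hlip : ∀ t ∈ Icc (0 : ℝ) 1, LipschitzOnWith (Real.toNNReal C) (fun x => g t * x) univ := by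
    intro t ht
    refine LipschitzOnWith.of_dist_le_mul fun x _ y _ => ?_
    rw [Real.dist_eq, ← mul_sub, abs_mul, Real.dist_eq]
    gcongr
    exact (hC t ht).trans (Real.le_coe_toNNReal C)
  have hcont : ContinuousOn m (Icc 0 1) := fun t ht => (hm t ht).continuousWithinAt
  have hz : ∀ (t : ℝ) (s : Set ℝ), HasDerivWithinAt (fun _ : ℝ => (0 : ℝ)) (g t * 0) s t :=
    fun t s => by rw [mul_zero]; exact hasDerivWithinAt_const t s 0
  constructor
  · intro h
    exact ODE_solution_unique_of_mem_Icc_right (v := fun t x => g t * x) (s := fun _ => univ)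
      (fun t ht => hlip t (Ico_subset_Icc_self ht)) hcont
      (fun t ht => (hm t (Ico_subset_Icc_self ht)).mono_of_mem_nhdsWithin
        (Icc_mem_nhdsGE_of_mem ht)) (fun _ _ => mem_univ _) continuousOn_const
      (fun t _ => hz t _) (fun _ _ => mem_univ _) h (right_mem_Icc.2 zero_le_one)
  · intro h
    exact ODE_solution_unique_of_mem_Icc_left (v := fun t x => g t * x) (s := fun _ => univ)
      (fun t ht => hlip t (Ioc_subset_Icc_self ht)) hcont
      (fun t ht => (hm t (Ioc_subset_Icc_self ht)).mono_of_mem_nhdsWithin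
        (Icc_mem_nhdsLE_of_mem ht)) (fun _ _ => mem_univ _) continuousOn_const
      (fun t _ => hz t _) (fun _ _ => mem_univ _) h (left_mem_Icc.2 zero_le_one)

end ScalarODE

end OvertwistedBox

end

noncomputable section
namespace OvertwistedBox

set_option linter.unusedSectionVars false

open Set Topology Filter

/-! ### Time-dependent flows on manifolds near stationary points. -/

section Flow

variable {E : Type} {H X : Type*} [NormedAddCommGroup E] [NormedSpace ℝ E] [FiniteDimensional ℝ E]
  [TopologicalSpace H] {I : ModelWithCorners ℝ E H} [TopologicalSpace X] [ChartedSpace H X]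
  [I.Boundaryless] [IsManifold I ∞ X]

/-- The expression in the chart at `a` of a vector field on `X` that depends on the time `t` and on
a parameter `z`. -/
def chartField (I : ModelWithCorners ℝ E H) (v : ℝ → ℝ → X → E) (a : X) (q : ℝ × ℝ × E) : E :=
  md I 𝓘(ℝ, E) (extChartAt I a) ((extChartAt I a).symm q.2.2)
    (v q.1 q.2.1 ((extChartAt I a).symm q.2.2))

/-- Smoothness of a vector field depending on time and a parameter. -/
def SmoothFieldOn (I : ModelWithCorners ℝ E H) (v : ℝ → ℝ → X → E) (D : Set (ℝ × ℝ × X)) : Prop :=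
  ∀ (a : X) (t z : ℝ) (e : E), e ∈ (extChartAt I a).target →
    (t, z, (extChartAt I a).symm e) ∈ D → ContDiffAt ℝ ∞ (chartField I v a) (t, z, e)

/-- Integral curves on `[0, 1]` inside `D`. -/
def IsTrajectory (I : ModelWithCorners ℝ E H) (v : ℝ → ℝ → X → E) (D : Set (ℝ × ℝ × X)) (z : ℝ)
    (γ : ℝ → X) : Prop :=
  ∀ t ∈ Icc (0 : ℝ) 1, (t, z, γ t) ∈ D ∧ HasMFDerivWithinAt 𝓘(ℝ, ℝ) I γ (Icc 0 1) t
    ((ContinuousLinearMap.toSpanSingleton ℝ (v t z (γ t)) : ℝ →L[ℝ] E))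

variable {v : ℝ → ℝ → X → E} {D : Set (ℝ × ℝ × X)}

lemma IsTrajectory.hasDerivWithinAt {z : ℝ} {γ : ℝ → X} (h : IsTrajectory I v D z γ) {t : ℝ}
    (ht : t ∈ Icc (0 : ℝ) 1) {a : X} (ha : γ t ∈ (extChartAt I a).source) :
    HasDerivWithinAt (fun s => extChartAt I a (γ s))
      (chartField I v a (t, z, extChartAt I a (γ t))) (Icc 0 1) t := by
  have : IsManifold I 1 X := .of_le (n := ∞) (by simp)
  have h1 : HasMFDerivAt I 𝓘(ℝ, E) (extChartAt I a) (γ t) (mfderiv I 𝓘(ℝ, E) (extChartAt I a) (γ t)) :=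
    (mdifferentiableAt_extChartAt (by simpa using ha)).hasMFDerivAt
  have h2 := h1.comp_hasMFDerivWithinAt t (h t ht).2
  have h3 : HasFDerivWithinAt (fun s => extChartAt I a (γ s))
      ((md I 𝓘(ℝ, E) (extChartAt I a) (γ t)).comp
        (ContinuousLinearMap.toSpanSingleton ℝ (v t z (γ t)))) (Icc 0 1) t := h2.hasFDerivWithinAt
  refine h3.hasDerivWithinAt.congr_deriv ?_
  simp only [chartField]
  rw [(extChartAt I a).left_inv ha]
  simp

/-- The set of times at which the curves agree is closed, as X is Hausdorff. It extends to the right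
of each of its points, since in the chart at the common value the field is locally Lipschitz and the
curves solve the same equation. -/
lemma IsTrajectory.eqOn [T2Space X] (hv : SmoothFieldOn I v D) {z : ℝ} {γ₁ γ₂ : ℝ → X}
    (h₁ : IsTrajectory I v D z γ₁) (h₂ : IsTrajectory I v D z γ₂) (h0 : γ₁ 0 = γ₂ 0) :
    EqOn γ₁ γ₂ (Icc 0 1) := by
  have hc₁ : ContinuousOn γ₁ (Icc 0 1) := fun t ht => (h₁ t ht).2.continuousWithinAt
  have hc₂ : ContinuousOn γ₂ (Icc 0 1) := fun t ht => (h₂ t ht).2.continuousWithinAt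
  have hcl : IsClosed ({t | γ₁ t = γ₂ t} ∩ Icc (0 : ℝ) 1) := by
    rw [inter_comm]
    exact (hc₁.prodMk hc₂).preimage_isClosed_of_isClosed isClosed_Icc isClosed_diagonal
  refine hcl.Icc_subset_of_forall_exists_gt h0 ?_
  rintro t ⟨heq, ht⟩ y hy
  change γ₁ t = γ₂ t at heq
  have ht' := Ico_subset_Icc_self ht
  set a := γ₁ t with ha
  set φ := extChartAt I a with hφ
  have hsrc : a ∈ φ.source := mem_extChartAt_source a
  have hsm : ContDiffAt ℝ ∞ (chartField I v a) (t, z, φ a) :=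
    hv a t z (φ a) (φ.map_source hsrc) (by rw [φ.left_inv hsrc]; exact (h₁ t ht').1)
  obtain ⟨K, S, hS, hlip⟩ := (hsm.of_le (m := 1) (by simp)).exists_lipschitzOnWith
  have hev : ∀ γ : ℝ → X, IsTrajectory I v D z γ → γ t = a →
      ∀ᶠ s in 𝓝[≥] t, γ s ∈ φ.source ∧ (s, z, φ (γ s)) ∈ S := by
    intro γ hγ hγt
    have hcw : ContinuousWithinAt γ (Ici t) t :=
      ((hγ t ht').2.continuousWithinAt).mono_of_mem_nhdsWithin (Icc_mem_nhdsGE_of_mem ht)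
    have h1 : ∀ᶠ s in 𝓝[≥] t, γ s ∈ φ.source :=
      hcw.eventually ((isOpen_extChartAt_source a).mem_nhds (by rw [hγt]; exact hsrc))
    have h2 : ContinuousWithinAt (fun s => (s, z, φ (γ s))) (Ici t) t := by
      refine continuousWithinAt_id.prodMk (continuousWithinAt_const.prodMk ?_)
      exact ContinuousAt.comp_continuousWithinAt (by rw [hγt]; exact continuousAt_extChartAt a) hcw
    exact h1.and (h2.eventually (by
      change S ∈ 𝓝 (t, z, φ (γ t))
      rw [hγt]; exact hS))
  have hall := ((hev γ₁ h₁ rfl).and (hev γ₂ h₂ heq.symm)).and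
    (show ∀ᶠ s in 𝓝[≥] t, s < 1 ∧ s < y from
      nhdsWithin_le_nhds ((gt_mem_nhds ht.2).and (gt_mem_nhds hy)))
  obtain ⟨r, hr, hrs⟩ := mem_nhdsGE_iff_exists_Icc_subset.1 hall
  have hrt : Icc t r ⊆ Icc 0 1 := fun s hs => ⟨ht.1.trans hs.1, (hrs hs).2.1.le⟩
  have huniq : EqOn (fun s => φ (γ₁ s)) (fun s => φ (γ₂ s)) (Icc t r) := by
    refine ODE_solution_unique_of_mem_Icc_right (v := fun s e => chartField I v a (s, z, e))
      (s := fun s => {e | (s, z, e) ∈ S}) (K := K) ?_ ?_ ?_ ?_ ?_ ?_ ?_ ?_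
    · intro s hs
      refine LipschitzOnWith.of_dist_le_mul fun e he e' he' => ?_
      refine (hlip.dist_le_mul _ he _ he').trans_eq ?_
      simp [Prod.dist_eq]
    · intro s hs
      exact ((h₁.hasDerivWithinAt (hrt hs) (hrs hs).1.1.1).mono hrt).continuousWithinAt
    · intro s hs
      have hs' := Ico_subset_Icc_self hs
      exact (h₁.hasDerivWithinAt (hrt hs') (hrs hs').1.1.1).mono_of_mem_nhdsWithin
        (Icc_mem_nhdsGE_of_mem ⟨(hrt hs').1, (hrs hs').2.1⟩)
    · exact fun s hs => (hrs (Ico_subset_Icc_self hs)).1.1.2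
    · intro s hs
      exact ((h₂.hasDerivWithinAt (hrt hs) (hrs hs).1.2.1).mono hrt).continuousWithinAt
    · intro s hs
      have hs' := Ico_subset_Icc_self hs
      exact (h₂.hasDerivWithinAt (hrt hs') (hrs hs').1.2.1).mono_of_mem_nhdsWithin
        (Icc_mem_nhdsGE_of_mem ⟨(hrt hs').1, (hrs hs').2.1⟩)
    · exact fun s hs => (hrs (Ico_subset_Icc_self hs)).1.2.2
    · rw [heq.symm]
  have hrr : r ∈ Icc t r := right_mem_Icc.2 (le_of_lt hr)
  refine ⟨r, ?_, hr, (hrs hrr).2.2.le⟩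
  exact φ.injOn (hrs hrr).1.1.1 (hrs hrr).1.2.1 (huniq hrr)

/-- Near the zeros of a vector field, its flow exists on `[0, 1]` and is smooth. In charts, the
differential of the flow solves the linearized equation. -/
theorem exists_flow [T2Space X] (hD : IsOpen D) (hv : SmoothFieldOn I v D) :
    ∃ Φ : ℝ → ℝ × X → X, ∀ (z₀ : ℝ) (a : X),
      (∀ t ∈ Icc (0 : ℝ) 1, (t, z₀, a) ∈ D ∧ v t z₀ a = 0) →
      (∀ t ∈ Icc (0 : ℝ) 1, Φ t (z₀, a) = a) ∧
      ∃ (y : ℝ → ℝ × E → E) (W : Set (ℝ × E)), IsOpen W ∧ (z₀, extChartAt I a a) ∈ W ∧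
        (∀ t, y t (z₀, extChartAt I a a) = extChartAt I a a) ∧
        ∀ q ∈ W, q.2 ∈ (extChartAt I a).target ∧ y 0 q = q.2 ∧ ∀ t ∈ Icc (0 : ℝ) 1,
          y t q ∈ (extChartAt I a).target ∧ (t, q.1, (extChartAt I a).symm (y t q)) ∈ D ∧
          ContDiffAt ℝ ∞ (y t) q ∧
          Φ t (q.1, (extChartAt I a).symm q.2) = (extChartAt I a).symm (y t q) ∧
          HasDerivWithinAt (fun s => y s q) (chartField I v a (t, q.1, y t q)) (Icc 0 1) t ∧
          ∀ w, HasDerivWithinAt (fun s => fderiv ℝ (y s) q w)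
            (fderiv ℝ (chartField I v a) (t, q.1, y t q) (0, w.1, fderiv ℝ (y t) q w))
            (Icc 0 1) t := by
  classical
  have : IsManifold I 1 X := .of_le (n := ∞) (by simp)
  -- By uniqueness the choice of a trajectory does not matter, so one globally defined Φ agrees with
  -- the local flows around all stationary points. Where no trajectory exists on [0, 1], the value
  -- is a dummy.
  let Φ : ℝ → ℝ × X → X := fun t p =>
    if h : ∃ γ, IsTrajectory I v D p.1 γ ∧ γ 0 = p.2 then h.choose t else p.2
  have hΦ : ∀ {z : ℝ} {γ : ℝ → X}, IsTrajectory I v D z γ → ∀ t ∈ Icc (0 : ℝ) 1,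
      Φ t (z, γ 0) = γ t := by
    intro z γ hγ t ht
    have hex : ∃ γ', IsTrajectory I v D z γ' ∧ γ' 0 = γ 0 := ⟨γ, hγ, rfl⟩
    change (if h : ∃ γ', IsTrajectory I v D z γ' ∧ γ' 0 = γ 0 then h.choose t else γ 0) = γ t
    rw [dif_pos hex]
    exact hex.choose_spec.1.eqOn hv hγ hex.choose_spec.2 ht
  refine ⟨Φ, fun z₀ a ha => ?_⟩
  set φ := extChartAt I a with hφ
  have hsrc : a ∈ φ.source := mem_extChartAt_source a
  let u : ℝ × ℝ × E → E := chartField I v a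
  -- The parameter is carried along as a coordinate with zero velocity; smooth dependence on it then
  -- becomes dependence on the initial value.
  let v' : ℝ × ℝ × E → ℝ × E := fun p => (0, u p)
  let D' : Set (ℝ × ℝ × E) := {p | p.2.2 ∈ φ.target} ∩
    (fun p => (p.1, p.2.1, φ.symm p.2.2)) ⁻¹' D
  have hto : IsOpen {p : ℝ × ℝ × E | p.2.2 ∈ φ.target} :=
    (isOpen_extChartAt_target a).preimage (by fun_prop)
  have hD' : IsOpen D' := by
    refine ContinuousOn.isOpen_inter_preimage ?_ hto hD
    refine continuousOn_fst.prodMk ((by fun_prop : ContinuousOn _ _).prodMk ?_)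
    exact (continuousOn_extChartAt_symm a).comp (by fun_prop) fun p hp => hp
  have hu : ∀ p ∈ D', ContDiffAt ℝ ∞ u p := fun p hp => hv a p.1 p.2.1 p.2.2 hp.1 hp.2
  have hv' : ∀ p ∈ D', ContDiffAt ℝ ∞ v' p := fun p hp => contDiffAt_const.prodMk (hu p hp)
  have haD : ∀ t ∈ Icc (0 : ℝ) 1, (t, z₀, φ a) ∈ D' := fun t ht =>
    ⟨φ.map_source hsrc, by
      change (t, z₀, φ.symm (φ a)) ∈ D
      rw [φ.left_inv hsrc]; exact (ha t ht).1⟩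
  have ha0 : ∀ t ∈ Icc (0 : ℝ) 1, v' (t, z₀, φ a) = 0 := fun t ht => by
    have : u (t, z₀, φ a) = 0 := by
      change md I 𝓘(ℝ, E) φ (φ.symm (φ a)) (v t z₀ (φ.symm (φ a))) = 0
      rw [φ.left_inv hsrc, (ha t ht).2, map_zero]
    simp [v', this]
  obtain ⟨y, hya, W, hW, haW, hy⟩ := exists_local_flow hD' hv' haD ha0
    (V := {q : ℝ × E | q.2 ∈ φ.target}) ((isOpen_extChartAt_target a).preimage continuous_snd)
    (φ.map_source hsrc)
  have hfst : ∀ q ∈ W, ∀ t ∈ Icc (0 : ℝ) 1, (y t q).1 = q.1 := by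
    intro q hq t ht
    have hd : ∀ s ∈ Icc (0 : ℝ) 1, HasDerivWithinAt (fun s => (y s q).1) 0 (Icc 0 1) s :=
      fun s hs => ((hy q hq).2 s hs).2.2.2.1.fst
    have := constant_of_has_deriv_right_zero (fun s hs => (hd s hs).continuousWithinAt)
      (fun s hs => (hd s (Ico_subset_Icc_self hs)).mono_of_mem_nhdsWithin
        (Icc_mem_nhdsGE_of_mem hs)) t ht
    rw [this, (hy q hq).1]
  have hpair : ∀ q ∈ W, ∀ t ∈ Icc (0 : ℝ) 1, y t q = (q.1, (y t q).2) := fun q hq t ht =>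
    Prod.ext (hfst q hq t ht) rfl
  have htraj : ∀ q ∈ W, IsTrajectory I v D q.1 (fun t => φ.symm (y t q).2) := by
    intro q hq t ht
    obtain ⟨h1, h2, -, h4, -⟩ := (hy q hq).2 t ht
    rw [hpair q hq t ht] at h1 h4
    refine ⟨h1.2, ?_⟩
    have h5 : HasDerivWithinAt (fun s => (y s q).2) (u (t, q.1, (y t q).2)) (Icc 0 1) t := h4.snd
    have h6 : HasMFDerivWithinAt 𝓘(ℝ, ℝ) 𝓘(ℝ, E) (fun s => (y s q).2) (Icc 0 1) t
        (ContinuousLinearMap.toSpanSingleton ℝ (u (t, q.1, (y t q).2))) :=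
      h5.hasFDerivWithinAt.hasMFDerivWithinAt
    have h7 : HasMFDerivAt 𝓘(ℝ, E) I φ.symm (y t q).2
        (mfderiv 𝓘(ℝ, E) I φ.symm (y t q).2) :=
      ((contMDiffAt_extChartAt_symm' h2).mdifferentiableAt (by simp)).hasMFDerivAt
    have h8 := h7.comp_hasMFDerivWithinAt t h6
    have hkey : (md 𝓘(ℝ, E) I φ.symm (y t q).2).comp
        (ContinuousLinearMap.toSpanSingleton ℝ (u (t, q.1, (y t q).2))) =
        ContinuousLinearMap.toSpanSingleton ℝ (v t q.1 (φ.symm (y t q).2)) := by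
      ext
      change md 𝓘(ℝ, E) I φ.symm (y t q).2 ((1 : ℝ) • (u (t, q.1, (y t q).2))) =
        (1 : ℝ) • v t q.1 (φ.symm (y t q).2)
      rw [one_smul, one_smul]
      have := md_extChartAt_symm_comp (I := I) h2
      exact congrArg (fun A : E →L[ℝ] E => A (v t q.1 (φ.symm (y t q).2))) this
    exact h8.congr_mfderiv hkey
  refine ⟨fun t ht => ?_, fun t q => (y t q).2, W, hW, haW, fun t => by
    change (y t (z₀, φ a)).2 = φ a
    rw [hya], fun q hq => ?_⟩
  · have h1 := hΦ (htraj _ haW) t ht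
    have h2 : φ.symm (φ a) = a := φ.left_inv hsrc
    simp only [hya] at h1
    rwa [h2] at h1
  · have hy0 : (y 0 q).2 = q.2 := by rw [(hy q hq).1]
    refine ⟨?_, hy0, fun t ht => ?_⟩
    · have := ((hy q hq).2 0 (by simp)).2.1
      rw [(hy q hq).1] at this
      exact this
    obtain ⟨h1, h2, h3, h4, h5⟩ := (hy q hq).2 t ht
    have hD1 := h1
    rw [hpair q hq t ht] at h1 h4
    refine ⟨h2, h1.2, h3.snd, ?_, h4.snd, fun w => ?_⟩
    · have := hΦ (htraj q hq) t ht
      simp only [hy0] at this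
      exact this
    · have hlin : ∀ s ∈ Icc (0 : ℝ) 1, ∀ w, (fderiv ℝ (y s) q w).2 = fderiv ℝ (fun q => (y s q).2) q w := by
        intro s hs w
        have := ((hy q hq).2 s hs).2.2.1.differentiableAt (by simp)
        rw [fderiv.snd this]
        rfl
      have hpar : ∀ s ∈ Icc (0 : ℝ) 1, ∀ w, partialSnd v' (s, y s q) w =
          (0, fderiv ℝ u (s, y s q) (0, w)) := by
        intro s hs w
        have hus := hu _ ((hy q hq).2 s hs).1
        have : HasFDerivAt v' ((0 : ℝ × ℝ × E →L[ℝ] ℝ).prod (fderiv ℝ u (s, y s q))) (s, y s q) :=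
          (hasFDerivAt_const _ _).prodMk (hus.differentiableAt (by simp)).hasFDerivAt
        rw [partialSnd, this.fderiv]
        rfl
      have hfst' : ∀ s ∈ Icc (0 : ℝ) 1, (fderiv ℝ (y s) q w).1 = w.1 := by
        intro s hs
        have hc : (fun q => (y s q).1) =ᶠ[𝓝 q] fun q => q.1 := by
          filter_upwards [hW.mem_nhds hq] with q' hq' using hfst q' hq' s hs
        have h6 := ((hy q hq).2 s hs).2.2.1.differentiableAt (by simp)
        have h7 : fderiv ℝ (fun q => (y s q).1) q w = (fderiv ℝ (y s) q w).1 := by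
          rw [fderiv.fst h6]; rfl
        rw [← h7, hc.fderiv_eq, fderiv_fst]
        rfl
      have h8 : HasDerivWithinAt (fun s => (fderiv ℝ (y s) q w).2)
          (partialSnd v' (t, y t q) (fderiv ℝ (y t) q w)).2 (Icc 0 1) t := (h5 w).snd
      rw [hpar t ht] at h8
      refine (h8.congr_of_mem (fun s hs => (hlin s hs w).symm) ht).congr_deriv ?_
      change fderiv ℝ u (t, y t q) (0, fderiv ℝ (y t) q w) = _
      rw [show fderiv ℝ (y t) q w = (w.1, fderiv ℝ (fun q => (y t q).2) q w) from
        Prod.ext (hfst' t ht) (hlin t ht w), hpair q hq t ht]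

end Flow

end OvertwistedBox

end

noncomputable section
namespace OvertwistedBox

set_option linter.unusedSectionVars false

open Set Topology Filter

/-! ### Contact vector fields and linear paths of contact forms. -/

section ContactField

variable {E : Type} {H X : Type*} [NormedAddCommGroup E] [NormedSpace ℝ E] [FiniteDimensional ℝ E]
  [TopologicalSpace H] {I : ModelWithCorners ℝ E H} [TopologicalSpace X] [ChartedSpace H X]
  [I.Boundaryless] [IsManifold I ∞ X]

lemma dOne_self (a : E → E →L[ℝ] ℝ) (y u : E) : dOne a y u u = 0 := by
  rw [dOne_apply, sub_self]

lemma dForm_self (α : OneForm E X) (x : X) (u : E) : dForm I α x u u = 0 := dOne_self _ _ _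

lemma dForm_swap (α : OneForm E X) (x : X) (u v : E) : dForm I α x u v = -dForm I α x v u := by
  rw [dForm, dOne_apply, dOne_apply]; ring

lemma bijective_md_extChartAt_symm {a : X} {e : E} (he : e ∈ (extChartAt I a).target) :
    Function.Bijective (md 𝓘(ℝ, E) I (extChartAt I a).symm e) := by
  have h1 := md_extChartAt_comp_symm (I := I) he
  have h2 := md_extChartAt_symm_comp (I := I) he
  exact Function.bijective_iff_has_inverse.2 ⟨md I 𝓘(ℝ, E) (extChartAt I a) _,
    fun v => congrArg (fun A : E →L[ℝ] E => A v) h1, fun v => congrArg (fun A : E →L[ℝ] E => A v) h2⟩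

lemma bijective_md_extChartAt {a : X} {e : E} (he : e ∈ (extChartAt I a).target) :
    Function.Bijective (md I 𝓘(ℝ, E) (extChartAt I a) ((extChartAt I a).symm e)) := by
  have h1 := md_extChartAt_comp_symm (I := I) he
  have h2 := md_extChartAt_symm_comp (I := I) he
  exact Function.bijective_iff_has_inverse.2 ⟨md 𝓘(ℝ, E) I (extChartAt I a).symm e,
    fun v => congrArg (fun A : E →L[ℝ] E => A v) h2, fun v => congrArg (fun A : E →L[ℝ] E => A v) h1⟩

/-- The vector field `X` with `α X = h` and `dα (X, ·) = η` on the kernel of `α`. -/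
def contactField (I : ModelWithCorners ℝ E H) (α η : OneForm E X) (h : X → ℝ) (x : X) : E :=
  contactSolve (α x) (dForm I α x) (η x) (h x)

section Chart

variable {α : OneForm E X} {a : X} {e : E}

lemma dOne_chart (he : e ∈ (extChartAt I a).target)
    (hα : SmoothFormAt I α ((extChartAt I a).symm e)) (u v : E) :
    dOne (pullForm 𝓘(ℝ, E) I α (extChartAt I a).symm) e u v =
      dForm I α ((extChartAt I a).symm e) (md 𝓘(ℝ, E) I (extChartAt I a).symm e u)
        (md 𝓘(ℝ, E) I (extChartAt I a).symm e v) :=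
  dOne_plot hα (contMDiffAt_extChartAt_symm' he) u v

lemma isContactPair_chart_iff (he : e ∈ (extChartAt I a).target)
    (hα : SmoothFormAt I α ((extChartAt I a).symm e)) :
    IsContactPair (pullForm 𝓘(ℝ, E) I α (extChartAt I a).symm e)
      (dOne (pullForm 𝓘(ℝ, E) I α (extChartAt I a).symm) e) ↔
    IsContactPair (α ((extChartAt I a).symm e)) (dForm I α ((extChartAt I a).symm e)) := by
  constructor
  · intro h
    have h2 := md_extChartAt_symm_comp (I := I) he
    have h3 : ∀ v, md 𝓘(ℝ, E) I (extChartAt I a).symm e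
        (md I 𝓘(ℝ, E) (extChartAt I a) ((extChartAt I a).symm e) v) = v :=
      fun v => congrArg (fun A : E →L[ℝ] E => A v) h2
    have := h.comp (bijective_md_extChartAt he)
      (b' := dForm I α ((extChartAt I a).symm e)) (fun u v => by
        rw [dOne_chart he hα, h3, h3])
    convert this using 1
    ext v
    exact (congrArg (α _) (h3 v)).symm
  · intro h
    exact h.comp (bijective_md_extChartAt_symm he) (dOne_chart he hα)

lemma md_contactField (he : e ∈ (extChartAt I a).target)
    (hα : SmoothFormAt I α ((extChartAt I a).symm e)) (η : OneForm E X) (h : X → ℝ)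
    (hc : IsContactPair (α ((extChartAt I a).symm e)) (dForm I α ((extChartAt I a).symm e))) :
    md I 𝓘(ℝ, E) (extChartAt I a) ((extChartAt I a).symm e)
      (contactField I α η h ((extChartAt I a).symm e)) =
    contactSolve (pullForm 𝓘(ℝ, E) I α (extChartAt I a).symm e)
      (dOne (pullForm 𝓘(ℝ, E) I α (extChartAt I a).symm) e)
      (pullForm 𝓘(ℝ, E) I η (extChartAt I a).symm e) (h ((extChartAt I a).symm e)) := by
  have h1 := md_extChartAt_comp_symm (I := I) he
  rw [contactField, ← hc.map_contactSolve (dForm_self α _) (bijective_md_extChartAt_symm he)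
    (dOne_chart he hα)]
  exact congrArg (fun A : E →L[ℝ] E => A _) h1

end Chart

section LinearPath

/-- The linear path of one-forms with initial point `α` and direction `η`. -/
def pathForm (α η : OneForm E X) (t : ℝ) : OneForm E X := fun x => α x + t • η x

lemma pullForm_pathForm (α η : OneForm E X) (t : ℝ) (f : E → X) :
    pullForm 𝓘(ℝ, E) I (pathForm α η t) f =
      pathForm (pullForm 𝓘(ℝ, E) I α f) (pullForm 𝓘(ℝ, E) I η f) t := rfl

lemma SmoothFormAt.pathForm {α η : OneForm E X} {x : X} (hα : SmoothFormAt I α x)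
    (hη : SmoothFormAt I η x) (t : ℝ) : SmoothFormAt I (pathForm α η t) x :=
  ContDiffAt.add (f := OvertwistedBox.pullForm 𝓘(ℝ, E) I α (extChartAt I x).symm)
    (g := fun e => t • OvertwistedBox.pullForm 𝓘(ℝ, E) I η (extChartAt I x).symm e) hα
    (ContDiffAt.const_smul t hη)

lemma dOne_pathForm {A B : E → E →L[ℝ] ℝ} {e : E} (hA : DifferentiableAt ℝ A e)
    (hB : DifferentiableAt ℝ B e) (t : ℝ) :
    dOne (OvertwistedBox.pathForm A B t) e = dOne A e + t • dOne B e := by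
  have : HasFDerivAt (OvertwistedBox.pathForm A B t) (fderiv ℝ A e + t • fderiv ℝ B e) e :=
    hA.hasFDerivAt.add (hB.hasFDerivAt.const_smul t)
  ext u v
  simp only [dOne_apply, this.fderiv, add_apply,
    smul_apply, smul_eq_mul]
  ring

lemma dForm_pathForm {α η : OneForm E X} {x : X} (hα : SmoothFormAt I α x)
    (hη : SmoothFormAt I η x) (t : ℝ) :
    dForm I (pathForm α η t) x = dForm I α x + t • dForm I η x :=
  dOne_pathForm (ContDiffAt.differentiableAt hα (by simp))
    (ContDiffAt.differentiableAt hη (by simp)) t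

lemma SmoothFormAt.sub {α η : OneForm E X} {x : X} (hα : SmoothFormAt I α x)
    (hη : SmoothFormAt I η x) : SmoothFormAt I (α - η) x := by
  have := hα.pathForm hη (-1)
  have h : α - η = OvertwistedBox.pathForm α η (-1) := by
    funext x
    refine ContinuousLinearMap.ext fun v => ?_
    change α x v - η x v = α x v + -1 * η x v
    ring
  rwa [h]

lemma contDiffAt_pathForm {A B : E → E →L[ℝ] ℝ} {p : ℝ × ℝ × E} (hA : ContDiffAt ℝ ∞ A p.2.2)
    (hB : ContDiffAt ℝ ∞ B p.2.2) :
    ContDiffAt ℝ ∞ (fun q : ℝ × ℝ × E => OvertwistedBox.pathForm A B q.1 q.2.2) p :=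
  (hA.comp p (contDiffAt_snd.snd)).add (contDiffAt_fst.smul (hB.comp p (contDiffAt_snd.snd)))

lemma contDiffAt_smul' {P V : Type*} [NormedAddCommGroup P] [NormedSpace ℝ P]
    [NormedAddCommGroup V] [NormedSpace ℝ V] {f : P → ℝ} {g : P → V} {p : P}
    (hf : ContDiffAt ℝ ∞ f p) (hg : ContDiffAt ℝ ∞ g p) : ContDiffAt ℝ ∞ (fun q => f q • g q) p :=
  hf.smul hg

/-- Chart expression of the exterior derivative of a linear path. -/
def pathTwoForm (A B : E → E →L[ℝ] ℝ) (q : ℝ × ℝ × E) : E →L[ℝ] E →L[ℝ] ℝ :=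
  dOne A q.2.2 + q.1 • dOne B q.2.2

lemma contDiffAt_pathTwoForm {A B : E → E →L[ℝ] ℝ} {p : ℝ × ℝ × E}
    (hA : ContDiffAt ℝ ∞ A p.2.2) (hB : ContDiffAt ℝ ∞ B p.2.2) :
    ContDiffAt ℝ ∞ (pathTwoForm A B) p :=
  ((contDiffAt_dOne hA).comp p (contDiffAt_snd.snd)).add
    (contDiffAt_smul' contDiffAt_fst ((contDiffAt_dOne hB).comp p (contDiffAt_snd.snd)))

lemma pathTwoForm_self (A B : E → E →L[ℝ] ℝ) (q : ℝ × ℝ × E) (u : E) :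
    pathTwoForm A B q u u = 0 := by
  simp [pathTwoForm, dOne_self]

end LinearPath

section Gray

variable {α η : OneForm E X} {O : Set X}

/-- The times and points at which a linear path of one-forms is contact. -/
def contactDomain (I : ModelWithCorners ℝ E H) (α η : OneForm E X) (O : Set X) :
    Set (ℝ × ℝ × X) :=
  {p | p.2.2 ∈ O ∧ IsContactPair (pathForm α η p.1 p.2.2) (dForm I (pathForm α η p.1) p.2.2)}

/-- The vector field whose flow realizes the linear path of contact forms. -/
def grayField (I : ModelWithCorners ℝ E H) (α η : OneForm E X) (t _z : ℝ) (x : X) : E :=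
  contactField I (pathForm α η t) (-η) 0 x

/-- Moves the contact condition to forms on the model space which are jointly smooth in time and
point. Openness of the domain and smoothness of the Gray field are both deduced there. -/
lemma contactDomain_chart_iff (hα : ∀ x ∈ O, SmoothFormAt I α x)
    (hη : ∀ x ∈ O, SmoothFormAt I η x) {a : X} {e : E} (he : e ∈ (extChartAt I a).target)
    (hO' : (extChartAt I a).symm e ∈ O) (t z : ℝ) :
    (t, z, (extChartAt I a).symm e) ∈ contactDomain I α η O ↔
      IsContactPair (pathForm (pullForm 𝓘(ℝ, E) I α (extChartAt I a).symm)
        (pullForm 𝓘(ℝ, E) I η (extChartAt I a).symm) t e)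
        (pathTwoForm (pullForm 𝓘(ℝ, E) I α (extChartAt I a).symm)
        (pullForm 𝓘(ℝ, E) I η (extChartAt I a).symm) (t, z, e)) := by
  have h1 := isContactPair_chart_iff he ((hα _ hO').pathForm (hη _ hO') t)
  have hA := (hα _ hO').contDiffAt_plot (contMDiffAt_extChartAt_symm' he)
  have hB := (hη _ hO').contDiffAt_plot (contMDiffAt_extChartAt_symm' he)
  rw [pullForm_pathForm, dOne_pathForm (hA.differentiableAt (by simp))
    (hB.differentiableAt (by simp))] at h1
  exact ⟨fun h => h1.2 h.2, fun h => ⟨hO', h1.1 h⟩⟩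

lemma isOpen_contactDomain (hO : IsOpen O) (hα : ∀ x ∈ O, SmoothFormAt I α x)
    (hη : ∀ x ∈ O, SmoothFormAt I η x) : IsOpen (contactDomain I α η O) := by
  rw [isOpen_iff_mem_nhds]
  rintro ⟨t, z, x⟩ hp
  set φ := extChartAt I x with hφ
  have hsrc : x ∈ φ.source := mem_extChartAt_source x
  have hO' : φ.symm (φ x) ∈ O := by rw [φ.left_inv hsrc]; exact hp.1
  have htar : φ x ∈ φ.target := φ.map_source hsrc
  have hA := (hα _ hO').contDiffAt_plot (contMDiffAt_extChartAt_symm' htar)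
  have hB := (hη _ hO').contDiffAt_plot (contMDiffAt_extChartAt_symm' htar)
  have hp' : (t, z, φ.symm (φ x)) ∈ contactDomain I α η O := by rwa [φ.left_inv hsrc]
  have hc := (contactDomain_chart_iff hα hη htar hO' t z).1 hp'
  have hev := eventually_isContactPair (p := (t, z, φ x))
    (contDiffAt_pathForm (p := (t, z, φ x)) hA hB).continuousAt
    (contDiffAt_pathTwoForm (p := (t, z, φ x)) hA hB).continuousAt hc (pathTwoForm_self _ _ _)
  have hcont : ContinuousAt (fun p : ℝ × ℝ × X => (p.1, p.2.1, φ p.2.2)) (t, z, x) := by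
    refine continuousAt_fst.prodMk ((by fun_prop : ContinuousAt _ _).prodMk ?_)
    exact ContinuousAt.comp (f := fun p : ℝ × ℝ × X => p.2.2) (continuousAt_extChartAt x)
      (by fun_prop)
  have hc2 : ContinuousAt (fun p : ℝ × ℝ × X => p.2.2) (t, z, x) := by fun_prop
  filter_upwards [hcont.eventually hev,
    hc2.eventually ((isOpen_extChartAt_source (I := I) x).mem_nhds hsrc),
    hc2.eventually (hO.mem_nhds hp.1)] with p h1 h2 h3
  have h4 : φ.symm (φ p.2.2) = p.2.2 := φ.left_inv h2
  have h5 := (contactDomain_chart_iff (I := I) hα hη (φ.map_source h2) (by rwa [h4]) p.1 p.2.1).2 h1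
  rw [h4] at h5
  exact h5

lemma chartField_grayField (hα : ∀ x ∈ O, SmoothFormAt I α x)
    (hη : ∀ x ∈ O, SmoothFormAt I η x) {a : X} {e : E} {t z : ℝ} (he : e ∈ (extChartAt I a).target)
    (hD : (t, z, (extChartAt I a).symm e) ∈ contactDomain I α η O) :
    chartField I (grayField I α η) a (t, z, e) =
      contactSolve (pathForm (pullForm 𝓘(ℝ, E) I α (extChartAt I a).symm)
        (pullForm 𝓘(ℝ, E) I η (extChartAt I a).symm) t e)
        (pathTwoForm (pullForm 𝓘(ℝ, E) I α (extChartAt I a).symm)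
        (pullForm 𝓘(ℝ, E) I η (extChartAt I a).symm) (t, z, e))
        (-pullForm 𝓘(ℝ, E) I η (extChartAt I a).symm e) 0 := by
  have hDO : (extChartAt I a).symm e ∈ O := hD.1
  have hA := (hα _ hDO).contDiffAt_plot (contMDiffAt_extChartAt_symm' he)
  have hB := (hη _ hDO).contDiffAt_plot (contMDiffAt_extChartAt_symm' he)
  have h1 := md_contactField he ((hα _ hDO).pathForm (hη _ hDO) t) (-η) 0 hD.2
  rw [pullForm_pathForm, dOne_pathForm (hA.differentiableAt (by simp))
    (hB.differentiableAt (by simp))] at h1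
  refine h1.trans ?_
  congr 1

lemma smoothFieldOn_grayField (hO : IsOpen O) (hα : ∀ x ∈ O, SmoothFormAt I α x)
    (hη : ∀ x ∈ O, SmoothFormAt I η x) : SmoothFieldOn I (grayField I α η) (contactDomain I α η O) := by
  intro a t z e he hD
  have hDO : (extChartAt I a).symm e ∈ O := hD.1
  have hA := (hα _ hDO).contDiffAt_plot (contMDiffAt_extChartAt_symm' he)
  have hB := (hη _ hDO).contDiffAt_plot (contMDiffAt_extChartAt_symm' he)
  have hc := (contactDomain_chart_iff hα hη he hDO t z).1 hD
  refine ContDiffAt.congr_of_eventuallyEq (contDiffAt_contactSolve (p := (t, z, e))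
    (contDiffAt_pathForm (p := (t, z, e)) hA hB)
    (contDiffAt_pathTwoForm (p := (t, z, e)) hA hB)
    (η := fun q => -pullForm 𝓘(ℝ, E) I η (extChartAt I a).symm q.2.2)
    (ContDiffAt.neg (hB.comp (t, z, e) (contDiffAt_snd.snd)))
    (contDiffAt_const (c := (0 : ℝ))) hc (pathTwoForm_self _ _ _)) ?_
  have hcont : ContinuousAt (fun q : ℝ × ℝ × E => (q.1, q.2.1, (extChartAt I a).symm q.2.2))
      (t, z, e) := by
    refine continuousAt_fst.prodMk ((by fun_prop : ContinuousAt _ _).prodMk ?_)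
    exact ContinuousAt.comp (f := fun p : ℝ × ℝ × E => p.2.2)
      ((continuousOn_extChartAt_symm a).continuousAt ((isOpen_extChartAt_target a).mem_nhds he))
      (by fun_prop)
  have hc2 : ContinuousAt (fun p : ℝ × ℝ × E => p.2.2) (t, z, e) := by fun_prop
  filter_upwards [hcont.eventually ((isOpen_contactDomain hO hα hη).mem_nhds hD),
    hc2.eventually ((isOpen_extChartAt_target (I := I) a).mem_nhds he)] with q h1 h2
  exact chartField_grayField hα hη h2 h1

end Gray

end ContactField

end OvertwistedBox

end

noncomputable section
namespace OvertwistedBox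

set_option linter.unusedSectionVars false

open Set Topology Filter

/-! ### Gray stability relative to a set. -/

section GrayStability

variable {E : Type} {H X : Type*} [NormedAddCommGroup E] [NormedSpace ℝ E] [FiniteDimensional ℝ E]
  [TopologicalSpace H] {I : ModelWithCorners ℝ E H} [TopologicalSpace X] [ChartedSpace H X]
  [I.Boundaryless] [IsManifold I ∞ X]

lemma fderiv_pathForm {A B : E → E →L[ℝ] ℝ} {p : ℝ × ℝ × E} (hA : DifferentiableAt ℝ A p.2.2)
    (hB : DifferentiableAt ℝ B p.2.2) (v : ℝ × ℝ × E) (w : E) :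
    fderiv ℝ (fun q : ℝ × ℝ × E => pathForm A B q.1 q.2.2) p v w =
      v.1 * B p.2.2 w + (fderiv ℝ A p.2.2 v.2.2 w + p.1 * fderiv ℝ B p.2.2 v.2.2 w) := by
  have h2 : HasFDerivAt (fun q : ℝ × ℝ × E => q.2.2)
      ((ContinuousLinearMap.snd ℝ ℝ E).comp (ContinuousLinearMap.snd ℝ ℝ (ℝ × E))) p :=
    ((ContinuousLinearMap.snd ℝ ℝ E).comp (ContinuousLinearMap.snd ℝ ℝ (ℝ × E))).hasFDerivAt
  have hA' := hA.hasFDerivAt.comp p h2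
  have hB' := hB.hasFDerivAt.comp p h2
  have h := hA'.add ((hasFDerivAt_fst (𝕜 := ℝ) (p := p)).smul hB')
  have h' : HasFDerivAt (fun q : ℝ × ℝ × E => pathForm A B q.1 q.2.2) _ p := h
  rw [h'.fderiv]
  simp
  ring

set_option maxHeartbeats 1000000 in
/-- Along the flow of the field of a linear path of contact forms, the kernels are preserved. -/
lemma gray_kernel_iff {A B : E → E →L[ℝ] ℝ} {u : ℝ × ℝ × E → E} {z : ℝ} {y w : ℝ → E}
    (hA : ∀ t ∈ Icc (0 : ℝ) 1, ContDiffAt ℝ ∞ A (y t))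
    (hB : ∀ t ∈ Icc (0 : ℝ) 1, ContDiffAt ℝ ∞ B (y t))
    (hc : ∀ t ∈ Icc (0 : ℝ) 1, IsContactPair (pathForm A B t (y t)) (pathTwoForm A B (t, z, y t)))
    (hus : ∀ t ∈ Icc (0 : ℝ) 1, ContDiffAt ℝ ∞ u (t, z, y t))
    (hu : ∀ t ∈ Icc (0 : ℝ) 1, ∀ᶠ q in 𝓝 (t, z, y t), pathForm A B q.1 q.2.2 (u q) = 0)
    (hu' : ∀ t ∈ Icc (0 : ℝ) 1, ∀ v, pathForm A B t (y t) v = 0 →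
      pathTwoForm A B (t, z, y t) (u (t, z, y t)) v = -B (y t) v)
    (hy : ∀ t ∈ Icc (0 : ℝ) 1, HasDerivWithinAt y (u (t, z, y t)) (Icc 0 1) t)
    (hw : ∀ t ∈ Icc (0 : ℝ) 1,
      HasDerivWithinAt w (fderiv ℝ u (t, z, y t) (0, 0, w t)) (Icc 0 1) t) :
    A (y 0) (w 0) = 0 ↔ A (y 1) (w 1) + B (y 1) (w 1) = 0 := by
  set P : ℝ × ℝ × E → E →L[ℝ] ℝ := fun q => pathForm A B q.1 q.2.2 with hP
  -- The Reeb vector of the path form. A covector that vanishes on the kernel of the form is its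
  -- value on R times the form, which identifies the conformal rate G below.
  set R : ℝ × ℝ × E → E := fun q => (contactOp (P q) (pathTwoForm A B q)).inverse (P q) with hR
  have hPs : ∀ t ∈ Icc (0 : ℝ) 1, ContDiffAt ℝ ∞ P (t, z, y t) := fun t ht =>
    contDiffAt_pathForm (hA t ht) (hB t ht)
  have hQs : ∀ t ∈ Icc (0 : ℝ) 1, ContDiffAt ℝ ∞ (pathTwoForm A B) (t, z, y t) := fun t ht =>
    contDiffAt_pathTwoForm (hA t ht) (hB t ht)
  have hRs : ∀ t ∈ Icc (0 : ℝ) 1, ContDiffAt ℝ ∞ R (t, z, y t) := fun t ht =>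
    (contDiffAt_contactInverse (hPs t ht) (hQs t ht)
      ((hc t ht).isInvertible (pathTwoForm_self _ _ _))).clm_apply (hPs t ht)
  have hcy : ContinuousOn (fun t => (t, z, y t)) (Icc (0 : ℝ) 1) :=
    continuousOn_id.prodMk (continuousOn_const.prodMk fun t ht => (hy t ht).continuousWithinAt)
  set G : ℝ × ℝ × E → ℝ := fun q => B q.2.2 (R q) + pathTwoForm A B q (u q) (R q) with hG
  have hGs : ContinuousOn (fun t => G (t, z, y t)) (Icc (0 : ℝ) 1) := fun t ht => by
    have h1 : ContinuousAt G (t, z, y t) :=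
      ((ContinuousAt.comp (f := fun q : ℝ × ℝ × E => q.2.2) (hB t ht).continuousAt
        (by fun_prop)).clm_apply (hRs t ht).continuousAt).add
        (((hQs t ht).continuousAt.clm_apply (hus t ht).continuousAt).clm_apply
          (hRs t ht).continuousAt)
    exact ContinuousAt.comp_continuousWithinAt (f := fun t => (t, z, y t)) (g := G) h1 (hcy t ht)
  -- Along the flow, the derivative of P(w) is (B + dP(u, ·))(w) plus a term from the differential
  -- of P(u), which is zero because P(u) vanishes identically near the curve. The remaining covector
  -- vanishes on ker P, so it equals G P, and P(w) solves m' = G m.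
  have key := eq_zero_iff_of_linear (m := fun t => P (t, z, y t) (w t)) hGs (by
    intro t ht
    have hAd := (hA t ht).differentiableAt (by simp)
    have hBd := (hB t ht).differentiableAt (by simp)
    have hcurve : HasDerivWithinAt (fun t => (t, z, y t)) (1, 0, u (t, z, y t)) (Icc 0 1) t :=
      (hasDerivWithinAt_id t _).prodMk ((hasDerivWithinAt_const t _ z).prodMk (hy t ht))
    have hPd := ((hPs t ht).differentiableAt (by simp)).hasFDerivAt
    have h0 : HasDerivWithinAt (fun t => P (t, z, y t))
        (fderiv ℝ P (t, z, y t) (1, 0, u (t, z, y t))) (Icc 0 1) t :=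
      HasFDerivAt.comp_hasDerivWithinAt (f := fun t => (t, z, y t)) t hPd hcurve
    have h1 := HasDerivWithinAt.clm_apply (c := fun t => P (t, z, y t)) h0 (hw t ht)
    refine h1.congr_deriv ?_
    have hud := ((hus t ht).differentiableAt (by simp)).hasFDerivAt
    have h2 : HasFDerivAt (fun q => P q (u q)) (0 : ℝ × ℝ × E →L[ℝ] ℝ) (t, z, y t) :=
      (hasFDerivAt_const (0 : ℝ) _).congr_of_eventuallyEq (hu t ht)
    have h3 := congrArg (fun T : ℝ × ℝ × E →L[ℝ] ℝ => T (0, 0, w t)) ((hPd.clm_apply hud).unique h2)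
    have h4 := fderiv_pathForm (p := (t, z, y t)) hAd hBd (1, 0, u (t, z, y t)) (w t)
    have h5 := fderiv_pathForm (p := (t, z, y t)) hAd hBd (0, 0, w t) (u (t, z, y t))
    have h6 : B (y t) (w t) + pathTwoForm A B (t, z, y t) (u (t, z, y t)) (w t) =
        G (t, z, y t) * P (t, z, y t) (w t) :=
      eq_mul_of_forall_ker (a := P (t, z, y t))
        (B (y t) + pathTwoForm A B (t, z, y t) (u (t, z, y t)))
        (fun v hv => by rw [add_apply, hu' t ht v hv, add_neg_cancel])
        ((hc t ht).apply_inverse (pathTwoForm_self _ _ _)) (w t)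
    rw [← h6]
    have h3' : P (t, z, y t) (fderiv ℝ u (t, z, y t) (0, 0, w t)) +
        fderiv ℝ P (t, z, y t) (0, 0, w t) (u (t, z, y t)) = 0 := by
      simpa using h3
    have h7 : pathTwoForm A B (t, z, y t) (u (t, z, y t)) (w t) =
        fderiv ℝ A (y t) (u (t, z, y t)) (w t) - fderiv ℝ A (y t) (w t) (u (t, z, y t)) +
        t * (fderiv ℝ B (y t) (u (t, z, y t)) (w t) -
          fderiv ℝ B (y t) (w t) (u (t, z, y t))) := by
      simp only [pathTwoForm, add_apply, smul_apply, dOne_apply, smul_eq_mul]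
    rw [h7]
    simp only at h4 h5
    rw [h5] at h3'
    rw [h4]
    linarith)
  simpa [hP, pathForm] using key

/-- Gray stability relative to a set: two contact forms which agree along `A`, together with their
exterior derivatives on the contact hyperplanes, have diffeomorphic kernels near `A`. -/
theorem exists_gray_map [T2Space X] {α₀ α₁ : OneForm E X} {O A : Set X} (hO : IsOpen O)
    (hAO : A ⊆ O) (h₀ : ∀ x ∈ O, SmoothFormAt I α₀ x) (h₁ : ∀ x ∈ O, SmoothFormAt I α₁ x)
    (hA : ∀ a ∈ A, α₁ a = α₀ a) (hc : ∀ a ∈ A, IsContactPair (α₀ a) (dForm I α₀ a))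
    (hd : ∀ a ∈ A, ∀ u v, α₀ a u = 0 → α₀ a v = 0 → dForm I α₁ a u v = dForm I α₀ a u v) :
    ∃ Φ : X → X, ∀ a ∈ A, Φ a = a ∧ ∃ W : Set X, IsOpen W ∧ a ∈ W ∧ ∀ x ∈ W, Φ x ∈ O ∧
      ContMDiffAt I I ∞ Φ x ∧ ∀ w, α₁ (Φ x) (md I I Φ x w) = 0 ↔ α₀ x w = 0 := by
  set η : OneForm E X := α₁ - α₀ with hη
  have hηs : ∀ x ∈ O, SmoothFormAt I η x := fun x hx => (h₁ x hx).sub (h₀ x hx)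
  have hpath : pathForm α₀ η 1 = α₁ := by
    funext x
    refine ContinuousLinearMap.ext fun v => ?_
    change α₀ x v + 1 * (α₁ x v - α₀ x v) = α₁ x v
    ring
  have hηA : ∀ a ∈ A, η a = 0 := fun a ha => by
    change α₁ a - α₀ a = 0
    rw [hA a ha, sub_self]
  have hpA : ∀ a ∈ A, ∀ t, pathForm α₀ η t a = α₀ a := fun a ha t => by
    refine ContinuousLinearMap.ext fun v => ?_
    change α₀ a v + t * η a v = α₀ a v
    rw [hηA a ha]; simp
  have hd1 : ∀ x ∈ O, dForm I α₁ x = dForm I α₀ x + (1 : ℝ) • dForm I η x := fun x hx => by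
    rw [← dForm_pathForm (h₀ x hx) (hηs x hx), hpath]
  have hD : ∀ a ∈ A, ∀ t z : ℝ, (t, z, a) ∈ contactDomain I α₀ η O := fun a ha t z => by
    refine ⟨hAO ha, ?_⟩
    change IsContactPair (pathForm α₀ η t a) (dForm I (pathForm α₀ η t) a)
    rw [hpA a ha t, dForm_pathForm (h₀ a (hAO ha)) (hηs a (hAO ha))]
    refine (hc a ha).congr fun u v hu hv => ?_
    have h1 := hd a ha u v hu hv
    rw [hd1 a (hAO ha)] at h1
    simp only [add_apply, smul_apply, smul_eq_mul, one_mul, add_eq_left] at h1 ⊢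
    rw [h1, mul_zero]
  obtain ⟨Φ, hΦ⟩ := exists_flow (isOpen_contactDomain hO h₀ hηs) (smoothFieldOn_grayField hO h₀ hηs)
  refine ⟨fun x => Φ 1 (0, x), fun a ha => ?_⟩
  -- On A the two forms coincide, so the Gray field vanishes there at all times and A is stationary.
  -- The extra parameter of the flow plays no role and is set to 0.
  obtain ⟨hfix, y, W, hWo, hWa, -, hW⟩ := hΦ 0 a (fun t ht => ⟨hD a ha t 0, by
    have hDa := (hD a ha t 0).2
    refine (hDa.eq_contactSolve (dForm_self _ _) (by simp) fun v hv => ?_).symm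
    change dForm I _ a 0 v = -(η a v)
    rw [hηA a ha]; simp⟩)
  refine ⟨hfix 1 (right_mem_Icc.2 zero_le_one), ?_⟩
  set φ := extChartAt I a with hφ
  refine ⟨φ.source ∩ φ ⁻¹' ((fun e => ((0 : ℝ), e)) ⁻¹' W),
    (continuousOn_extChartAt a).isOpen_inter_preimage (isOpen_extChartAt_source a)
      (hWo.preimage (by fun_prop)), ⟨mem_extChartAt_source a, hWa⟩, ?_⟩
  rintro x ⟨hxs, hxW⟩
  set e := φ x with he
  have hxW' : ((0 : ℝ), e) ∈ W := hxW
  have hex : φ.symm e = x := φ.left_inv hxs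
  obtain ⟨het, hy0, hy⟩ := hW _ hxW'
  have h1m : (1 : ℝ) ∈ Icc (0 : ℝ) 1 := right_mem_Icc.2 zero_le_one
  have hΦx : Φ 1 (0, x) = φ.symm (y 1 (0, e)) := by
    have := (hy 1 h1m).2.2.2.1
    simp only at this
    rwa [hex] at this
  -- the map in the chart
  set Y : E → E := fun e' => y 1 (0, e') with hY
  have hYs : ContDiffAt ℝ ∞ Y e :=
    ContDiffAt.comp (f := fun e' : E => ((0 : ℝ), e')) e (hy 1 h1m).2.2.1
      (contDiffAt_const.prodMk contDiffAt_id)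
  have hYd : ∀ v, fderiv ℝ Y e v = fderiv ℝ (y 1) (0, e) (0, v) := fun v => by
    have h2 : HasFDerivAt (fun e' : E => ((0 : ℝ), e')) (ContinuousLinearMap.inr ℝ ℝ E) e :=
      (hasFDerivAt_const _ _).prodMk (hasFDerivAt_id e)
    have h3 := (((hy 1 h1m).2.2.1.differentiableAt (by simp)).hasFDerivAt.comp e h2)
    have h4 : HasFDerivAt Y _ e := h3
    rw [h4.fderiv]
    simp
  have hev : (fun x' => Φ 1 (0, x')) =ᶠ[𝓝 x] φ.symm ∘ Y ∘ φ := by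
    have hmem : φ.source ∩ φ ⁻¹' ((fun e => ((0 : ℝ), e)) ⁻¹' W) ∈ 𝓝 x :=
      ((continuousOn_extChartAt a).isOpen_inter_preimage (isOpen_extChartAt_source a)
        (hWo.preimage (by fun_prop))).mem_nhds ⟨hxs, hxW⟩
    filter_upwards [hmem] with x' hx'
    have h := ((hW _ hx'.2).2.2 1 h1m).2.2.2.1
    simp only at h
    rw [φ.left_inv hx'.1] at h
    exact h
  have hφs : ContMDiffAt I 𝓘(ℝ, E) ∞ φ x :=
    contMDiffAt_extChartAt' (by rwa [← extChartAt_source I])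
  have hYt : Y e ∈ φ.target := (hy 1 h1m).1
  have hsY : ContMDiffAt 𝓘(ℝ, E) I ∞ φ.symm (Y e) := contMDiffAt_extChartAt_symm' hYt
  have hcomp : ContMDiffAt I I ∞ (φ.symm ∘ Y ∘ φ) x :=
    ContMDiffAt.comp x (g := φ.symm) (f := Y ∘ φ) hsY
      (ContMDiffAt.comp x (g := Y) (f := φ) hYs.contMDiffAt hφs)
  refine ⟨?_, hcomp.congr_of_eventuallyEq hev, fun w => ?_⟩
  · change Φ 1 (0, x) ∈ O
    rw [hΦx]
    exact (hy 1 h1m).2.1.1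
  -- derivative in the chart
  set w' : E := md I 𝓘(ℝ, E) φ x w with hw'
  have hmd : md I I (fun x' => Φ 1 (0, x')) x w = md 𝓘(ℝ, E) I φ.symm (Y e) (fderiv ℝ Y e w') := by
    rw [md_congr hev]
    change md I I (fun x' => φ.symm ((Y ∘ φ) x')) x w = _
    rw [md_comp (I' := 𝓘(ℝ, E)) (f := φ.symm) (g := Y ∘ φ)
      (hsY.mdifferentiableAt (by simp))
      ((ContMDiffAt.comp x (g := Y) (f := φ) hYs.contMDiffAt hφs).mdifferentiableAt (by simp))]
    change md 𝓘(ℝ, E) I φ.symm (Y e) (md I 𝓘(ℝ, E) (fun x' => Y (φ x')) x w) = _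
    rw [md_comp (I' := 𝓘(ℝ, E)) (f := Y) (g := φ) (hYs.contMDiffAt.mdifferentiableAt (by simp))
        (hφs.mdifferentiableAt (by simp)), md_eq_fderiv]
    rfl
  have hwback : md 𝓘(ℝ, E) I φ.symm e w' = w := by
    have := md_extChartAt_symm_comp (I := I) (x₀ := a) het
    have h := congrArg (fun T : E →L[ℝ] E => T w) this
    simp only at h
    rw [hex] at h
    exact h
  set A' := pullForm 𝓘(ℝ, E) I α₀ φ.symm with hA'
  set B' := pullForm 𝓘(ℝ, E) I η φ.symm with hB'
  have hzero : y 0 (0, e) = e := hy0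
  have main := gray_kernel_iff (A := A') (B := B') (u := chartField I (grayField I α₀ η) a) (z := 0)
    (y := fun t => y t (0, e)) (w := fun t => fderiv ℝ (y t) (0, e) (0, w'))
    (fun t ht => SmoothFormAt.contDiffAt_plot (f := φ.symm) (h₀ _ (hy t ht).2.1.1) (contMDiffAt_extChartAt_symm' (hy t ht).1))
    (fun t ht => SmoothFormAt.contDiffAt_plot (f := φ.symm) (hηs _ (hy t ht).2.1.1) (contMDiffAt_extChartAt_symm' (hy t ht).1))
    (fun t ht => (contactDomain_chart_iff h₀ hηs (hy t ht).1 (hy t ht).2.1.1 t 0).1 (hy t ht).2.1)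
    (fun t ht => smoothFieldOn_grayField hO h₀ hηs a t 0 _ (hy t ht).1 (hy t ht).2.1)
    (fun t ht => by
      have hcont : ContinuousAt (fun q : ℝ × ℝ × E => (q.1, q.2.1, φ.symm q.2.2))
          (t, 0, y t (0, e)) := by
        refine continuousAt_fst.prodMk ((by fun_prop : ContinuousAt _ _).prodMk ?_)
        exact ContinuousAt.comp (f := fun p : ℝ × ℝ × E => p.2.2)
          ((continuousOn_extChartAt_symm a).continuousAt
            ((isOpen_extChartAt_target a).mem_nhds (hy t ht).1)) (by fun_prop)
      have hc2 : ContinuousAt (fun p : ℝ × ℝ × E => p.2.2) (t, 0, y t (0, e)) := by fun_prop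
      filter_upwards [hcont.eventually
        ((isOpen_contactDomain hO h₀ hηs).mem_nhds (hy t ht).2.1),
        hc2.eventually ((isOpen_extChartAt_target (I := I) a).mem_nhds (hy t ht).1)] with q h1 h2
      rw [show q = (q.1, q.2.1, q.2.2) from rfl, chartField_grayField h₀ hηs h2 h1]
      exact ((contactDomain_chart_iff h₀ hηs h2 h1.1 q.1 q.2.1).1 h1).contactSolve_apply
        (pathTwoForm_self _ _ _) _ _)
    (fun t ht v hv => by
      rw [chartField_grayField h₀ hηs (hy t ht).1 (hy t ht).2.1]
      exact ((contactDomain_chart_iff h₀ hηs (hy t ht).1 (hy t ht).2.1.1 t 0).1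
        (hy t ht).2.1).contactSolve_ker (pathTwoForm_self _ _ _) _ _ hv)
    (fun t ht => (hy t ht).2.2.2.2.1) (fun t ht => (hy t ht).2.2.2.2.2 (0, w'))
  have hd0 : fderiv ℝ (y 0) (0, e) (0, w') = w' := by
    have hev0 : y 0 =ᶠ[𝓝 (0, e)] fun q => q.2 := by
      filter_upwards [hWo.mem_nhds hxW'] with q hq
      exact (hW q hq).2.1
    rw [hev0.fderiv_eq, fderiv_snd]
    rfl
  have e0 : A' (y 0 (0, e)) (fderiv ℝ (y 0) (0, e) (0, w')) = α₀ x w := by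
    rw [hd0, hzero]
    change α₀ (φ.symm e) (md 𝓘(ℝ, E) I φ.symm e w') = _
    rw [hwback, hex]
  have e1 : A' (y 1 (0, e)) (fderiv ℝ (y 1) (0, e) (0, w')) +
      B' (y 1 (0, e)) (fderiv ℝ (y 1) (0, e) (0, w')) =
      α₁ (Φ 1 (0, x)) (md I I (fun x' => Φ 1 (0, x')) x w) := by
    rw [hmd, hYd, hΦx, ← hpath]
    exact (congrArg _ (one_mul _)).symm
  rw [e0, e1] at main
  exact main.symm

end GrayStability

end OvertwistedBox

end

noncomputable section
namespace OvertwistedBox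

set_option linter.unusedSectionVars false

open Set Topology Filter

/-! ### Flowing out along a vector field. -/

section FlowOut

variable {E : Type} {H X : Type*} [NormedAddCommGroup E] [NormedSpace ℝ E] [FiniteDimensional ℝ E]
  [TopologicalSpace H] {I : ModelWithCorners ℝ E H} [TopologicalSpace X] [ChartedSpace H X]
  [I.Boundaryless] [IsManifold I ∞ X]

/-- The differential of a function, as a one-form. -/
def dFun (I : ModelWithCorners ℝ E H) (f : X → ℝ) : OneForm E X := fun x => md I 𝓘(ℝ, ℝ) f x

lemma pullForm_dFun {E' H' X' : Type*} [NormedAddCommGroup E'] [NormedSpace ℝ E']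
    [TopologicalSpace H'] {I' : ModelWithCorners ℝ E' H'} [TopologicalSpace X'] [ChartedSpace H' X']
    {f : X → ℝ} {g : X' → X} {x : X'} (hf : MDifferentiableAt I 𝓘(ℝ, ℝ) f (g x))
    (hg : MDifferentiableAt I' I g x) :
    pullForm I' I (dFun I f) g x = md I' 𝓘(ℝ, ℝ) (fun y => f (g y)) x :=
  (md_comp hf hg).symm

lemma smoothFormAt_dFun {f : X → ℝ} {x : X} (hf : ContMDiffAt I 𝓘(ℝ, ℝ) ∞ f x) :
    SmoothFormAt I (dFun I f) x := by
  have hs := extChartAt_to_inv (I := I) x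
  have h1 : ContMDiffAt 𝓘(ℝ, E) I ∞ (extChartAt I x).symm (extChartAt I x x) :=
    contMDiffAt_extChartAt_symm' (mem_extChartAt_target x)
  have hf' : ContMDiffAt I 𝓘(ℝ, ℝ) ∞ f ((extChartAt I x).symm (extChartAt I x x)) := by rwa [hs]
  have h2 : ContDiffAt ℝ ∞ (fun y => f ((extChartAt I x).symm y)) (extChartAt I x x) :=
    (hf'.comp _ h1).contDiffAt
  refine ContDiffAt.congr_of_eventuallyEq (h2.fderiv_right (m := ∞) (by simp)) ?_
  filter_upwards [h1.continuousAt.eventually (eventually_mdifferentiableAt hf'),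
    eventually_mdifferentiableAt h1] with y hy1 hy2
  rw [pullForm_dFun hy1 hy2, md_eq_fderiv]

lemma md_extChartAt_symm_self (x : X) :
    md 𝓘(ℝ, E) I (extChartAt I x).symm (extChartAt I x x) = ContinuousLinearMap.id ℝ E := by
  have := md_extChartAt_comp_symm (I := I) (mem_extChartAt_target x)
  rwa [extChartAt_to_inv, md_extChartAt_self, ContinuousLinearMap.id_comp] at this

/-- Smoothness of a vector field in charts. -/
def SmoothVectorOn (I : ModelWithCorners ℝ E H) (T : X → E) (O : Set X) : Prop :=
  ∀ (a : X) (e : E), e ∈ (extChartAt I a).target → (extChartAt I a).symm e ∈ O →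
    ContDiffAt ℝ ∞ (fun e => md I 𝓘(ℝ, E) (extChartAt I a) ((extChartAt I a).symm e)
      (T ((extChartAt I a).symm e))) e

lemma smoothVectorOn_contactField {α η : OneForm E X} {h : X → ℝ} {O : Set X} (hO : IsOpen O)
    (hα : ∀ x ∈ O, SmoothFormAt I α x) (hη : ∀ x ∈ O, SmoothFormAt I η x)
    (hh : ∀ x ∈ O, ContMDiffAt I 𝓘(ℝ, ℝ) ∞ h x)
    (hc : ∀ x ∈ O, IsContactPair (α x) (dForm I α x)) :
    SmoothVectorOn I (contactField I α η h) O := by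
  intro a e he hD
  have hs := contMDiffAt_extChartAt_symm' (I := I) he
  have hA := (hα _ hD).contDiffAt_plot hs
  have hB := (hη _ hD).contDiffAt_plot hs
  have hH : ContDiffAt ℝ ∞ (fun e => h ((extChartAt I a).symm e)) e :=
    ((hh _ hD).comp e hs).contDiffAt
  have hcp := (isContactPair_chart_iff he (hα _ hD)).2 (hc _ hD)
  refine ContDiffAt.congr_of_eventuallyEq (contDiffAt_contactSolve hA (contDiffAt_dOne hA) hB hH
    hcp (dOne_self _ _)) ?_
  filter_upwards [hs.continuousAt.eventually (hO.mem_nhds hD),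
    (isOpen_extChartAt_target (I := I) a).mem_nhds he] with q h1 h2
  exact md_contactField h2 (hα _ h1) η h (hc _ h1)

/-- The map `(z, x) ↦ φ_z(x)`, where `φ` is the flow of a vector field. -/
theorem exists_flowOut [T2Space X] {T : X → E} {O : Set X} (hO : IsOpen O)
    (hT : SmoothVectorOn I T O) :
    ∃ F : ℝ × X → X, ∀ a ∈ O, F (0, a) = a ∧
      (∀ w : ℝ × E, md (𝓘(ℝ, ℝ).prod I) I F (0, a) w = w.2 + w.1 • T a) ∧
      ∃ W : Set (ℝ × X), IsOpen W ∧ (0, a) ∈ W ∧ ∀ q ∈ W, F q ∈ O ∧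
        ContMDiffAt (𝓘(ℝ, ℝ).prod I) I ∞ F q := by
  have : IsManifold I 1 X := .of_le (n := ∞) (by simp)
  -- The time-one flow of z T is the time-z flow of T. With z as parameter, every point of O is
  -- stationary at z = 0, which is the situation covered by `exists_flow`.
  set v : ℝ → ℝ → X → E := fun _ z x => z • T x with hv
  set D : Set (ℝ × ℝ × X) := {p | p.2.2 ∈ O} with hD
  have hDo : IsOpen D := hO.preimage (by fun_prop)
  have hchart : ∀ a q, chartField I v a q = q.2.1 • md I 𝓘(ℝ, E) (extChartAt I a)
      ((extChartAt I a).symm q.2.2) (T ((extChartAt I a).symm q.2.2)) := fun a q => by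
    simp [chartField, hv]
  have hvs : SmoothFieldOn I v D := by
    intro a t z e he hDm
    have h1 := hT a e he hDm
    rw [show chartField I v a = _ from funext (hchart a)]
    exact contDiffAt_smul' (contDiffAt_snd.fst)
      (ContDiffAt.comp (f := fun q : ℝ × ℝ × E => q.2.2) (t, z, e) h1 (contDiffAt_snd.snd))
  obtain ⟨Φ, hΦ⟩ := exists_flow hDo hvs
  have h1m : (1 : ℝ) ∈ Icc (0 : ℝ) 1 := right_mem_Icc.2 zero_le_one
  refine ⟨Φ 1, fun a ha => ?_⟩
  obtain ⟨hfix, y, W, hWo, hWa, hyfix, hW⟩ := hΦ 0 a (fun t ht => ⟨ha, by simp [hv]⟩)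
  set φ := extChartAt I a with hφ
  refine ⟨hfix 1 h1m, ?_⟩
  set S : Set (ℝ × X) := {q | q.2 ∈ φ.source} ∩ (fun q => (q.1, φ q.2)) ⁻¹' W with hS
  have hso : IsOpen {q : ℝ × X | q.2 ∈ φ.source} :=
    (isOpen_extChartAt_source a).preimage continuous_snd
  have hcφ : ContinuousOn (fun q : ℝ × X => (q.1, φ q.2)) {q : ℝ × X | q.2 ∈ φ.source} :=
    continuousOn_fst.prodMk ((continuousOn_extChartAt a).comp continuousOn_snd fun q hq => hq)
  have hSo : IsOpen S := hcφ.isOpen_inter_preimage hso hWo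
  have hSa : ((0 : ℝ), a) ∈ S := ⟨mem_extChartAt_source a, hWa⟩
  have heq : ∀ q ∈ S, Φ 1 q = φ.symm (y 1 (q.1, φ q.2)) := fun q hq => by
    have h := ((hW _ hq.2).2.2 1 h1m).2.2.2.1
    simp only at h
    rw [φ.left_inv hq.1] at h
    exact h
  set κ : ℝ × X → ℝ × E := fun q => (q.1, φ q.2) with hκ
  have hκs : ∀ q ∈ S, ContMDiffAt (𝓘(ℝ, ℝ).prod I) 𝓘(ℝ, ℝ × E) ∞ κ q := fun q hq =>
    contMDiffAt_fst.prodMk_space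
      (ContMDiffAt.comp (f := fun q : ℝ × X => q.2) (g := φ) q
        (contMDiffAt_extChartAt' (by rw [← extChartAt_source I]; exact hq.1)) contMDiffAt_snd)
  have hys : ∀ q ∈ S, ContMDiffAt 𝓘(ℝ, ℝ × E) 𝓘(ℝ, E) ∞ (y 1) (κ q) := fun q hq =>
    (((hW _ hq.2).2.2 1 h1m).2.2.1).contMDiffAt
  have hφy : ∀ q ∈ S, ContMDiffAt 𝓘(ℝ, E) I ∞ φ.symm (y 1 (κ q)) := fun q hq =>
    contMDiffAt_extChartAt_symm' ((hW _ hq.2).2.2 1 h1m).1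
  have hcomp1 : ∀ q ∈ S, ContMDiffAt (𝓘(ℝ, ℝ).prod I) 𝓘(ℝ, E) ∞ (fun q => y 1 (κ q)) q :=
    fun q hq => ContMDiffAt.comp (f := κ) (g := y 1) q (hys q hq) (hκs q hq)
  have hev : ∀ q ∈ S, Φ 1 =ᶠ[𝓝 q] fun q => φ.symm (y 1 (κ q)) := fun q hq => by
    filter_upwards [hSo.mem_nhds hq] with q' hq' using heq q' hq'
  refine ⟨fun w => ?_, S, hSo, hSa, fun q hq => ⟨?_, ?_⟩⟩
  · have hκid : md (𝓘(ℝ, ℝ).prod I) 𝓘(ℝ, ℝ × E) κ (0, a) = ContinuousLinearMap.id ℝ (ℝ × E) :=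
      md_extChartAt_self (I := 𝓘(ℝ, ℝ).prod I) ((0 : ℝ), a)
    rw [md_congr (hev _ hSa), md_comp (I' := 𝓘(ℝ, E)) (f := φ.symm) (g := fun q => y 1 (κ q))
      ((hφy _ hSa).mdifferentiableAt (by simp)) ((hcomp1 _ hSa).mdifferentiableAt (by simp)),
      md_comp (I' := 𝓘(ℝ, ℝ × E)) (f := y 1) (g := κ) ((hys _ hSa).mdifferentiableAt (by simp))
        ((hκs _ hSa).mdifferentiableAt (by simp)), hκid]
    have hκa : κ (0, a) = (0, φ a) := rfl
    have hya : y 1 (κ (0, a)) = φ a := hyfix 1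
    rw [hya, md_extChartAt_symm_self, md_eq_fderiv, hκa]
    change fderiv ℝ (y 1) (0, φ a) w = w.2 + w.1 • T a
    -- At a stationary point with z = 0 the linearized equation has the constant right-hand side w.1
    -- • T a, since the derivative of T enters multiplied by z = 0.
    have hd : ∀ t ∈ Icc (0 : ℝ) 1, HasDerivWithinAt (fun s => fderiv ℝ (y s) (0, φ a) w)
        (w.1 • T a) (Icc 0 1) t := by
      intro t ht
      have h := (((hW _ hWa).2.2 t ht).2.2.2.2.2 w)
      simp only at h
      rw [hyfix] at h
      refine h.congr_deriv ?_
      have htar : φ a ∈ φ.target := φ.map_source (mem_extChartAt_source a)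
      have hsm := ((hT a (φ a) htar (by rw [extChartAt_to_inv]; exact ha)).differentiableAt
        (by simp)).hasFDerivAt
      have h3 : HasFDerivAt (fun q : ℝ × ℝ × E => q.2.2)
          ((ContinuousLinearMap.snd ℝ ℝ E).comp (ContinuousLinearMap.snd ℝ ℝ (ℝ × E)))
          (t, 0, φ a) :=
        ((ContinuousLinearMap.snd ℝ ℝ E).comp (ContinuousLinearMap.snd ℝ ℝ (ℝ × E))).hasFDerivAt
      have h4 : HasFDerivAt (fun q : ℝ × ℝ × E => q.2.1)
          ((ContinuousLinearMap.fst ℝ ℝ E).comp (ContinuousLinearMap.snd ℝ ℝ (ℝ × E)))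
          (t, 0, φ a) :=
        ((ContinuousLinearMap.fst ℝ ℝ E).comp (ContinuousLinearMap.snd ℝ ℝ (ℝ × E))).hasFDerivAt
      have h5 := HasFDerivAt.fun_smul (𝕜' := ℝ) h4 (HasFDerivAt.comp (f := fun q : ℝ × ℝ × E => q.2.2) (t, 0, φ a) hsm h3)
      rw [show chartField I v a = _ from funext (hchart a)]
      refine (congrArg (fun L : ℝ × ℝ × E →L[ℝ] E => L _) (HasFDerivAt.fderiv h5)).trans ?_
      have hid : md I 𝓘(ℝ, E) (extChartAt I a) ((extChartAt I a).symm (φ a))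
          (T ((extChartAt I a).symm (φ a))) = T a := by
        rw [extChartAt_to_inv, md_extChartAt_self]; rfl
      refine Eq.trans ?_ (congrArg (fun x => w.1 • x) hid)
      refine Eq.trans (add_apply _ _ _) ?_
      refine Eq.trans (congrArg₂ (· + ·) (zero_smul ℝ _) rfl) (zero_add _)
    have hconst : ∀ t ∈ Icc (0 : ℝ) 1, fderiv ℝ (y t) (0, φ a) w - t • w.1 • T a =
        fderiv ℝ (y 0) (0, φ a) w - (0 : ℝ) • w.1 • T a := by
      have hd2 : ∀ t ∈ Icc (0 : ℝ) 1,
          HasDerivWithinAt (fun s => fderiv ℝ (y s) (0, φ a) w - s • w.1 • T a) 0 (Icc 0 1) t := by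
        intro t ht
        have := (hd t ht).fun_sub ((hasDerivWithinAt_id t (Icc 0 1)).smul_const (w.1 • T a))
        simpa using this
      exact constant_of_has_deriv_right_zero (fun t ht => (hd2 t ht).continuousWithinAt)
        fun t ht => (hd2 t (Ico_subset_Icc_self ht)).mono_of_mem_nhdsWithin
          (Icc_mem_nhdsGE_of_mem ht)
    have h0 : fderiv ℝ (y 0) (0, φ a) w = w.2 := by
      have hev0 : y 0 =ᶠ[𝓝 (0, φ a)] fun q => q.2 := by
        filter_upwards [hWo.mem_nhds hWa] with q hq
        exact (hW q hq).2.1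
      rw [hev0.fderiv_eq, fderiv_snd]
      rfl
    have := hconst 1 h1m
    rw [h0, one_smul, zero_smul, sub_zero, sub_eq_iff_eq_add] at this
    exact this
  · rw [heq q hq]
    exact ((hW _ hq.2).2.2 1 h1m).2.1
  · exact (ContMDiffAt.comp (f := fun q => y 1 (κ q)) (g := φ.symm) q (hφy q hq)
      (hcomp1 q hq)).congr_of_eventuallyEq (hev q hq)

end FlowOut

/-! ### Contact germs along a hypersurface. -/

section Germ

variable {E ES EN : Type} {H HS HN X S N : Type*}
  [NormedAddCommGroup E] [NormedSpace ℝ E] [FiniteDimensional ℝ E]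
  [TopologicalSpace H] {I : ModelWithCorners ℝ E H} [TopologicalSpace X] [ChartedSpace H X]
  [I.Boundaryless] [IsManifold I ∞ X]
  [NormedAddCommGroup ES] [NormedSpace ℝ ES] [FiniteDimensional ℝ ES]
  [TopologicalSpace HS] {IS : ModelWithCorners ℝ ES HS} [TopologicalSpace S] [ChartedSpace HS S]
  [IS.Boundaryless] [IsManifold IS ∞ S]
  [NormedAddCommGroup EN] [NormedSpace ℝ EN] [FiniteDimensional ℝ EN]
  [TopologicalSpace HN] {IN : ModelWithCorners ℝ EN HN} [TopologicalSpace N] [ChartedSpace HN N]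
  [IN.Boundaryless] [IsManifold IN ∞ N]

/-- A hypersurface in a contact manifold whose induced form is modelled on the hypersurface `ζ = 0`
of a contact form `α₀` has a neighbourhood modelled on `α₀`. -/
theorem exists_contact_germ [T2Space X] [T2Space N] {ι : S → X} {π : N → S} {ζ : N → ℝ}
    {α : OneForm E X} {O : Set X} {h : X → ℝ} {α₀ : OneForm EN N} {A : Set N}
    (hO : IsOpen O) (hα : ∀ x ∈ O, SmoothFormAt I α x)
    (hc : ∀ x ∈ O, IsContactPair (α x) (dForm I α x))
    (hh : ∀ x ∈ O, ContMDiffAt I 𝓘(ℝ, ℝ) ∞ h x)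
    (hπ : ContMDiff IN IS ∞ π) (hζ : ContMDiff IN 𝓘(ℝ, ℝ) ∞ ζ)
    (hα₀ : ∀ x, SmoothFormAt IN α₀ x) (hc₀ : ∀ a ∈ A, IsContactPair (α₀ a) (dForm IN α₀ a))
    {WS : Set S} (hWS : IsOpen WS) (hι : ∀ x ∈ WS, ContMDiffAt IS I ∞ ι x)
    (hAW : ∀ a ∈ A, π a ∈ WS) (hAO : ∀ a ∈ A, ι (π a) ∈ O) (hAζ : ∀ a ∈ A, ζ a = 0)
    (h1 : ∀ a ∈ A, ∀ v, α₀ a v = α (ι (π a)) (md IS I ι (π a) (md IN IS π a v)) +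
      h (ι (π a)) * dFun IN ζ a v)
    (h2 : ∀ a ∈ A, ∀ u v, dForm IN α₀ a u v =
      dForm I α (ι (π a)) (md IS I ι (π a) (md IN IS π a u)) (md IS I ι (π a) (md IN IS π a v)) +
      (dFun I h (ι (π a)) (md IS I ι (π a) (md IN IS π a u)) * dFun IN ζ a v -
       dFun I h (ι (π a)) (md IS I ι (π a) (md IN IS π a v)) * dFun IN ζ a u)) :
    ∃ (G : N → X) (W : Set N), IsOpen W ∧ A ⊆ W ∧ (∀ a ∈ A, G a = ι (π a)) ∧
      ∀ x ∈ W, G x ∈ O ∧ ContMDiffAt IN I ∞ G x ∧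
        ∀ v, α (G x) (md IN I G x v) = 0 ↔ α₀ x v = 0 := by
  -- The contact vector field with Hamiltonian `h`: α T = h, and dα (T, ·) = -dh on ker α. The first
  -- equation produces the term h dζ of the model form, the second one the term dh ∧ dζ of its
  -- exterior derivative.
  set T : X → E := contactField I α (fun x => -dFun I h x) h with hT
  have hTs : SmoothVectorOn I T O :=
    smoothVectorOn_contactField hO hα (fun x hx => by
      exact ContDiffAt.neg (smoothFormAt_dFun (hh x hx))) hh hc
  obtain ⟨F, hF⟩ := exists_flowOut hO hTs
  set κ : N → ℝ × X := fun x => (ζ x, ι (π x)) with hκ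
  set Ψ : N → X := fun x => F (κ x) with hΨ
  -- the domain
  have hκs : ∀ x, π x ∈ WS → ContMDiffAt IN (𝓘(ℝ, ℝ).prod I) ∞ κ x := fun x hx =>
    hζ.contMDiffAt.prodMk (ContMDiffAt.comp x (f := π) (g := ι) (hι _ hx) hπ.contMDiffAt)
  have hloc : ∀ a ∈ A, ∃ V : Set N, IsOpen V ∧ a ∈ V ∧ ∀ x ∈ V, Ψ x ∈ O ∧
      ContMDiffAt IN I ∞ Ψ x := by
    intro a ha
    obtain ⟨W, hWo, hWa, hW⟩ := (hF _ (hAO a ha)).2.2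
    have hκc : ContinuousOn κ (π ⁻¹' WS) := fun x hx => (hκs x hx).continuousAt.continuousWithinAt
    refine ⟨π ⁻¹' WS ∩ κ ⁻¹' W, hκc.isOpen_inter_preimage (hWS.preimage hπ.continuous) hWo,
      ⟨hAW a ha, ?_⟩, fun x hx => ⟨(hW _ hx.2).1, ?_⟩⟩
    · change (ζ a, ι (π a)) ∈ W
      rw [hAζ a ha]; exact hWa
    · exact ContMDiffAt.comp x (f := κ) (g := F) (hW _ hx.2).2 (hκs x hx.1)
  choose! V hVo hVa hV using hloc
  set O' : Set N := ⋃ a ∈ A, V a with hO'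
  have hO'o : IsOpen O' := isOpen_biUnion hVo
  have hAO' : A ⊆ O' := fun a ha => mem_biUnion ha (hVa a ha)
  have hΨ' : ∀ x ∈ O', Ψ x ∈ O ∧ ContMDiffAt IN I ∞ Ψ x := fun x hx => by
    obtain ⟨a, ha, hxa⟩ := mem_iUnion₂.1 hx
    exact hV a ha x hxa
  have hΨA : ∀ a ∈ A, Ψ a = ι (π a) := fun a ha => by
    change F (ζ a, ι (π a)) = _
    rw [hAζ a ha]; exact (hF _ (hAO a ha)).1
  have hdΨ : ∀ a ∈ A, ∀ v, md IN I Ψ a v = md IS I ι (π a) (md IN IS π a v) +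
      dFun IN ζ a v • T (ι (π a)) := by
    intro a ha v
    have hιπ := ContMDiffAt.comp a (f := π) (g := ι) (hι _ (hAW a ha)) hπ.contMDiffAt
    have hκ0 : κ a = (0, ι (π a)) := by rw [hκ]; simp only [hAζ a ha]
    have hFs : ContMDiffAt (𝓘(ℝ, ℝ).prod I) I ∞ F (κ a) := by
      obtain ⟨W, hWo, hWa, hW⟩ := (hF _ (hAO a ha)).2.2
      rw [hκ0]; exact (hW _ hWa).2
    have hdκ : md IN (𝓘(ℝ, ℝ).prod I) κ a v =
        (dFun IN ζ a v, md IS I ι (π a) (md IN IS π a v)) := by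
      have e1 := mfderiv_prodMk (hζ.contMDiffAt.mdifferentiableAt (by simp) (x := a))
        (hιπ.mdifferentiableAt (by simp))
      have e2 : md IN I (fun x => ι (π x)) a = (md IS I ι (π a)).comp (md IN IS π a) :=
        md_comp ((hι _ (hAW a ha)).mdifferentiableAt (by simp))
          (hπ.contMDiffAt.mdifferentiableAt (by simp))
      have e3 : md IN (𝓘(ℝ, ℝ).prod I) κ a v =
        (dFun IN ζ a v, md IN I (fun x => ι (π x)) a v) := congrArg (fun L : EN →L[ℝ] ℝ × E => L v) e1
      rw [e3, e2]; rfl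
    have e4 : md IN I Ψ a v = md (𝓘(ℝ, ℝ).prod I) I F (κ a) (md IN (𝓘(ℝ, ℝ).prod I) κ a v) := by
      rw [hΨ, md_comp (I' := 𝓘(ℝ, ℝ).prod I) (hFs.mdifferentiableAt (by simp))
        ((hκs a (hAW a ha)).mdifferentiableAt (by simp))]
      rfl
    rw [e4, hdκ, hκ0, (hF _ (hAO a ha)).2.1]
  obtain ⟨Φ, hΦ⟩ := exists_gray_map (I := IN) (α₀ := α₀) (α₁ := pullForm IN I α Ψ) hO'o hAO'
    (fun x _ => hα₀ x) (fun x hx => (hα _ (hΨ' x hx).1).pullForm (hΨ' x hx).2)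
    (fun a ha => by
      ext v
      rw [pullForm_apply, hdΨ a ha, hΨA a ha, h1 a ha, map_add, map_smul, smul_eq_mul,
        hT, contactField, (hc _ (hAO a ha)).contactSolve_apply (dForm_self _ _), mul_comm])
    hc₀
    (fun a ha u v hu hv => by
      rw [dForm_pullForm (hα _ (hΨ' a (hAO' ha)).1) (hΨ' a (hAO' ha)).2, hdΨ a ha, hdΨ a ha,
        hΨA a ha, h2 a ha]
      have hp := hc _ (hAO a ha)
      set b := dForm I α (ι (π a)) with hb
      set u' := md IS I ι (π a) (md IN IS π a u) with hu'
      set v' := md IS I ι (π a) (md IN IS π a v) with hv'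
      set t := T (ι (π a)) with ht
      set p := dFun I h (ι (π a)) with hpp
      -- dα (T, ·) + dh vanishes on ker α and so is a multiple of α. For u in the kernel of the
      -- model form, α takes the value -h dζ(u) on the image of u in the hypersurface, so the terms
      -- containing the multiple are symmetric in u and v and cancel.
      have hk := eq_mul_of_forall_ker (a := α (ι (π a))) (b t + p) (fun y hy => by
        have := hp.contactSolve_ker (dForm_self _ _) (-dFun I h (ι (π a))) (h (ι (π a))) hy
        change b t y + p y = 0
        have h' : b t y = (-dFun I h (ι (π a))) y := this
        rw [h']
        change -(p y) + p y = 0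
        ring) (hp.apply_inverse (dForm_self _ _))
      set κ' := (b t + p) ((contactOp (α (ι (π a))) (dForm I α (ι (π a)))).inverse (α (ι (π a))))
      have hku : b t u' + p u' = κ' * α (ι (π a)) u' := hk u'
      have hkv : b t v' + p v' = κ' * α (ι (π a)) v' := hk v'
      have hu0 := h1 a ha u
      have hv0 := h1 a ha v
      rw [hu] at hu0
      rw [hv] at hv0
      have hsw : b u' t = -b t u' := dForm_swap _ _ _ _
      have hself : b t t = 0 := dForm_self _ _ _
      simp only [map_add, map_smul, add_apply, smul_apply, smul_eq_mul, hsw, hself]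
      have hu1 : α (ι (π a)) u' = - (h (ι (π a)) * dFun IN ζ a u) := by linarith
      have hv1 : α (ι (π a)) v' = - (h (ι (π a)) * dFun IN ζ a v) := by linarith
      rw [hu1] at hku
      rw [hv1] at hkv
      linear_combination (dFun IN ζ a u) * hkv - (dFun IN ζ a v) * hku)
  choose! hΦA W hWo hWa hW using hΦ
  refine ⟨fun x => Ψ (Φ x), ⋃ a ∈ A, W a, isOpen_biUnion hWo,
    fun a ha => mem_biUnion ha (hWa a ha), fun a ha => ?_, fun x hx => ?_⟩
  · change Ψ (Φ a) = _
    rw [hΦA a ha, hΨA a ha]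
  · obtain ⟨a, ha, hxa⟩ := mem_iUnion₂.1 hx
    obtain ⟨hm, hs, hk⟩ := hW a ha x hxa
    have hΨx := (hΨ' _ hm).2
    refine ⟨(hΨ' _ hm).1, ContMDiffAt.comp x (f := Φ) (g := Ψ) hΨx hs, fun v => ?_⟩
    rw [← hk v, pullForm_apply, md_comp (I' := IN) (hΨx.mdifferentiableAt (by simp))
      (hs.mdifferentiableAt (by simp))]
    rfl

end Germ

end OvertwistedBox

end

noncomputable section
namespace OvertwistedBox

set_option linter.unusedSectionVars false

open Set Topology Filter

/-! ### The entire functions cos √τ and sin √τ / √τ. -/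

section Radial

/-- The entire function with `cosSqrt (r ^ 2) = cos r`. -/
def cosSqrt (τ : ℝ) : ℝ :=
  (FormalMultilinearSeries.ofScalars ℝ fun n : ℕ => (-1 : ℝ) ^ n / (2 * n).factorial).sum τ

/-- The entire function with `sincSqrt (r ^ 2) = sinc r`. -/
def sincSqrt (τ : ℝ) : ℝ := -2 * deriv cosSqrt τ

/-- Quotients of consecutive coefficients tend to zero, so the series converges everywhere. In the
variable τ = r² the model forms have smooth coefficients across the axis r = 0. -/
lemma contDiff_cosSqrt : ContDiff ℝ ∞ cosSqrt := by
  set c : ℕ → ℝ := fun n => (-1 : ℝ) ^ n / (2 * n).factorial with hc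
  have hrad : (FormalMultilinearSeries.ofScalars ℝ c).radius = ⊤ := by
    refine FormalMultilinearSeries.ofScalars_radius_eq_top_of_tendsto ℝ c ?_ ?_
    · exact Eventually.of_forall fun n => div_ne_zero (pow_ne_zero _ (by norm_num))
        (by exact_mod_cast (Nat.factorial_ne_zero _))
    · have h1 : ∀ n : ℕ, ‖c n.succ‖ / ‖c n‖ = 1 / ((2 * n + 2) * (2 * n + 1)) := by
        intro n
        have h2 : (2 * n.succ).factorial = (2 * n + 2) * ((2 * n + 1) * (2 * n).factorial) := by
          rw [show 2 * n.succ = 2 * n + 1 + 1 by omega, Nat.factorial_succ, Nat.factorial_succ]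
        have h3 : ((2 * n).factorial : ℝ) ≠ 0 := by exact_mod_cast Nat.factorial_ne_zero _
        simp only [hc, norm_div, norm_pow, norm_neg, norm_one, one_pow, h2]
        push_cast
        rw [Real.norm_of_nonneg (by positivity), Real.norm_of_nonneg (by positivity)]
        field_simp
      simp_rw [h1]
      refine squeeze_zero (fun n => by positivity) (g := fun n : ℕ => 1 / ((n : ℝ) + 1)) (fun n => ?_)
        tendsto_one_div_add_atTop_nhds_zero_nat
      apply one_div_le_one_div_of_le (by positivity)
      nlinarith [(Nat.cast_nonneg n : (0 : ℝ) ≤ n)]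
  have h := (FormalMultilinearSeries.ofScalars ℝ c).hasFPowerSeriesOnBall (by rw [hrad]; simp)
  rw [hrad] at h
  rw [contDiff_iff_contDiffAt]
  exact fun x => (h.analyticAt_of_mem (by simp)).contDiffAt

lemma cosSqrt_sq (r : ℝ) : cosSqrt (r ^ 2) = Real.cos r := by
  have h : cosSqrt (r ^ 2) = ∑' n : ℕ, ((-1 : ℝ) ^ n / (2 * n).factorial) • (r ^ 2) ^ n :=
    FormalMultilinearSeries.ofScalars_sum_eq _ _
  rw [h, ← (Real.hasSum_cos r).tsum_eq]
  refine tsum_congr fun n => ?_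
  rw [smul_eq_mul, ← pow_mul]
  ring

lemma contDiff_sincSqrt : ContDiff ℝ ∞ sincSqrt := by
  have h : ContDiff ℝ ∞ (deriv cosSqrt) :=
    ((contDiff_succ_iff_deriv (n := ∞)).1 (by simpa using contDiff_cosSqrt)).2.2
  exact contDiff_const.mul h

lemma hasDerivAt_cosSqrt (τ : ℝ) : HasDerivAt cosSqrt (-sincSqrt τ / 2) τ := by
  have h := (contDiff_cosSqrt.differentiable (by simp) τ).hasDerivAt
  have h' : -sincSqrt τ / 2 = deriv cosSqrt τ := by unfold sincSqrt; ring
  rw [h']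
  exact h

/-- Both sides are minus the derivative of r ↦ cosSqrt (r²) = cos r. -/
lemma mul_sincSqrt_sq (r : ℝ) : r * sincSqrt (r ^ 2) = Real.sin r := by
  have h1 : HasDerivAt (fun r => cosSqrt (r ^ 2)) (-sincSqrt (r ^ 2) / 2 * (2 * r)) r := by
    have := HasDerivAt.comp (h₂ := cosSqrt) (h := fun r : ℝ => r ^ 2) r
      (hasDerivAt_cosSqrt (r ^ 2)) (hasDerivAt_pow 2 r)
    exact this.congr_deriv (by simp)
  have h2 : HasDerivAt (fun r => cosSqrt (r ^ 2)) (-Real.sin r) r := by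
    simp_rw [cosSqrt_sq]
    exact Real.hasDerivAt_cos r
  have := h1.unique h2
  linarith

lemma sincSqrt_sq (r : ℝ) : sincSqrt (r ^ 2) = Real.sinc r := by
  have h1 : Continuous fun r : ℝ => sincSqrt (r ^ 2) :=
    contDiff_sincSqrt.continuous.comp (continuous_pow 2)
  have h : (fun r : ℝ => sincSqrt (r ^ 2)) = Real.sinc := by
    refine Continuous.ext_on (dense_compl_singleton (0 : ℝ)) h1 Real.continuous_sinc fun x hx => ?_
    have hx0 : x ≠ 0 := hx
    rw [Real.sinc_of_ne_zero hx0, ← mul_sincSqrt_sq x]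
    field_simp
  exact congrFun h r

/-- Obtained by differentiating r sincSqrt (r²) = sin r. The relation is kept in multiplied form
because solving for k would divide by τ. -/
lemma exists_hasDerivAt_sincSqrt {τ : ℝ} (hτ : 0 ≤ τ) :
    ∃ k, HasDerivAt sincSqrt k τ ∧ 2 * τ * k = cosSqrt τ - sincSqrt τ := by
  have h := (contDiff_sincSqrt.differentiable (by simp) τ).hasDerivAt
  refine ⟨_, h, ?_⟩
  obtain ⟨r, rfl⟩ : ∃ r : ℝ, r ^ 2 = τ := ⟨√τ, Real.sq_sqrt hτ⟩
  have h1 : HasDerivAt (fun r => r * sincSqrt (r ^ 2))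
      (1 * sincSqrt (r ^ 2) + r * (deriv sincSqrt (r ^ 2) * (2 * r))) r := by
    have := HasDerivAt.comp (h₂ := sincSqrt) (h := fun r : ℝ => r ^ 2) r h (hasDerivAt_pow 2 r)
    exact ((hasDerivAt_id r).mul this).congr_deriv (by simp)
  have h2 : HasDerivAt (fun r => r * sincSqrt (r ^ 2)) (Real.cos r) r := by
    simp_rw [mul_sincSqrt_sq]
    exact Real.hasDerivAt_sin r
  have := h1.unique h2
  rw [cosSqrt_sq]
  linarith

lemma cosSqrt_sq_add {τ : ℝ} (hτ : 0 ≤ τ) : cosSqrt τ ^ 2 + τ * sincSqrt τ ^ 2 = 1 := by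
  obtain ⟨r, rfl⟩ : ∃ r : ℝ, r ^ 2 = τ := ⟨√τ, Real.sq_sqrt hτ⟩
  rw [cosSqrt_sq, ← mul_pow, mul_sincSqrt_sq, Real.cos_sq_add_sin_sq]

/-- For r ≠ 0 one has |cos r| ≤ 1 and |sin r / r| < 1. After multiplication by r the quantity is r +
cos r sin r; it governs the contact condition for α_OT, the monotonicity of r tan r and the
solvability of the squeezing equation. -/
lemma one_add_cosSqrt_mul_sincSqrt_pos {τ : ℝ} (hτ : 0 ≤ τ) : 0 < 1 + cosSqrt τ * sincSqrt τ := by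
  obtain ⟨r, rfl⟩ : ∃ r : ℝ, r ^ 2 = τ := ⟨√τ, Real.sq_sqrt hτ⟩
  rw [cosSqrt_sq, sincSqrt_sq]
  by_cases hr : r = 0
  · simp [hr]
  · have h1 : |Real.sinc r| < 1 := by
      rw [Real.sinc_of_ne_zero hr, abs_div, div_lt_one (abs_pos.2 hr)]
      exact Real.abs_sin_lt_abs hr
    have h2 : |Real.cos r * Real.sinc r| < 1 := by
      rw [abs_mul]
      calc |Real.cos r| * |Real.sinc r| ≤ 1 * |Real.sinc r| := by
            gcongr; exact Real.abs_cos_le_one r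
        _ < 1 := by rwa [one_mul]
    linarith [(abs_lt.1 h2).1]

end Radial

/-! ### The form r sin r dϑ and the function cos r on the plane. -/

section PlaneForms

/-- The square of the polar radius. -/
def radSq (x : Plane) : ℝ := x 0 ^ 2 + x 1 ^ 2

lemma norm_sq_eq_radSq (x : Plane) : ‖x‖ ^ 2 = radSq x := by
  rw [EuclideanSpace.norm_sq_eq]
  simp [radSq, Fin.sum_univ_two]

lemma radSq_nonneg (x : Plane) : 0 ≤ radSq x := by unfold radSq; positivity

lemma cos_norm (x : Plane) : Real.cos ‖x‖ = cosSqrt (radSq x) := by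
  rw [← norm_sq_eq_radSq, cosSqrt_sq]

lemma sinc_norm (x : Plane) : Real.sinc ‖x‖ = sincSqrt (radSq x) := by
  rw [← norm_sq_eq_radSq, sincSqrt_sq]

lemma rSinForm_apply (x v : Plane) :
    rSinForm x v = sincSqrt (radSq x) * (x 0 * v 1 - x 1 * v 0) := by
  simp [rSinForm, sinc_norm]

lemma contDiff_coord (i : Fin 2) : ContDiff ℝ ∞ fun x : Plane => x i :=
  (EuclideanSpace.proj (𝕜 := ℝ) i).contDiff

lemma contDiff_radSq : ContDiff ℝ ∞ radSq :=
  ((contDiff_coord 0).pow 2).add ((contDiff_coord 1).pow 2)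

lemma hasFDerivAt_coord (i : Fin 2) (x : Plane) :
    HasFDerivAt (fun x : Plane => x i) (EuclideanSpace.proj (𝕜 := ℝ) i) x :=
  (EuclideanSpace.proj (𝕜 := ℝ) i).hasFDerivAt

lemma hasFDerivAt_radSq (x : Plane) : HasFDerivAt radSq
    ((2 * x 0) • EuclideanSpace.proj (𝕜 := ℝ) (0 : Fin 2)
      + (2 * x 1) • EuclideanSpace.proj (𝕜 := ℝ) (1 : Fin 2)) x := by
  have : HasFDerivAt radSq _ x :=
    ((hasFDerivAt_coord 0 x).pow 2).add ((hasFDerivAt_coord 1 x).pow 2)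
  simpa using this

/-- The function `cos r` on the plane. -/
def cosRad (x : Plane) : ℝ := cosSqrt (radSq x)

lemma contDiff_cosRad : ContDiff ℝ ∞ cosRad := contDiff_cosSqrt.comp contDiff_radSq

lemma fderiv_cosRad (x v : Plane) :
    fderiv ℝ cosRad x v = -sincSqrt (radSq x) * (x 0 * v 0 + x 1 * v 1) := by
  have h : HasFDerivAt cosRad _ x :=
    (hasDerivAt_cosSqrt (radSq x)).comp_hasFDerivAt x (hasFDerivAt_radSq x)
  rw [h.fderiv]
  simp
  ring

lemma contDiff_rSinForm : ContDiff ℝ ∞ rSinForm := by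
  have h : rSinForm = fun x : Plane => sincSqrt (radSq x) •
      (x 0 • EuclideanSpace.proj (𝕜 := ℝ) (1 : Fin 2)
        - x 1 • EuclideanSpace.proj (𝕜 := ℝ) (0 : Fin 2)) := by
    funext x; rw [rSinForm, sinc_norm]
  rw [h]
  exact (contDiff_sincSqrt.comp contDiff_radSq).smul
    (((contDiff_coord 0).smul contDiff_const).sub ((contDiff_coord 1).smul contDiff_const))

lemma fderiv_rSinForm (x : Plane) : ∃ k, 2 * radSq x * k =
    cosSqrt (radSq x) - sincSqrt (radSq x) ∧ ∀ u v, fderiv ℝ rSinForm x u v =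
      2 * k * (x 0 * u 0 + x 1 * u 1) * (x 0 * v 1 - x 1 * v 0) +
        sincSqrt (radSq x) * (u 0 * v 1 - u 1 * v 0) := by
  obtain ⟨k, hk, hk'⟩ := exists_hasDerivAt_sincSqrt (radSq_nonneg x)
  refine ⟨k, hk', fun u v => ?_⟩
  have h1 := hk.comp_hasFDerivAt x (hasFDerivAt_radSq x)
  have h2 := h1.mul (((hasFDerivAt_coord 0 x).mul_const (v 1)).sub
    ((hasFDerivAt_coord 1 x).mul_const (v 0)))
  have h3 : HasFDerivAt (fun y => rSinForm y v) _ x :=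
    h2.congr_of_eventuallyEq (Eventually.of_forall fun y => rSinForm_apply y v)
  have h4 : HasFDerivAt (fun y => rSinForm y v) _ x :=
    ((contDiff_rSinForm.differentiable (by simp) x).hasFDerivAt).clm_apply (hasFDerivAt_const v x)
  have h5 := congrArg (fun T : Plane →L[ℝ] ℝ => T u) (h4.unique h3)
  simp at h5
  rw [h5]
  ring

/-- In polar coordinates d(r sin r dϑ) = (sin r + r cos r) dr ∧ dϑ, which is sin r / r + cos r times
the area form. -/
lemma dOne_rSinForm (x u v : Plane) : dOne rSinForm x u v =
    (cosSqrt (radSq x) + sincSqrt (radSq x)) * (u 0 * v 1 - u 1 * v 0) := by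
  obtain ⟨k, hk, h⟩ := fderiv_rSinForm x
  rw [dOne_apply, h, h]
  have : 2 * (x 0 ^ 2 + x 1 ^ 2) * k = cosSqrt (radSq x) - sincSqrt (radSq x) := hk
  linear_combination (u 0 * v 1 - u 1 * v 0) * this

end PlaneForms

/-! ### Canonical coordinates on T*L and the model forms. -/

section CanonicalCoordinates

variable {n : ℕ} {L : Type*} [TopologicalSpace L] [ChartedSpace (EuclideanSpace ℝ (Fin n)) L]
  [IsManifold (𝓡 n) ∞ L]

/-- The model space of `T*L`. -/
abbrev CotModel (n : ℕ) := EuclideanSpace ℝ (Fin n) × (EuclideanSpace ℝ (Fin n) →L[ℝ] ℝ)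

/-- A covector, as a functional on the model space of `L`. -/
def covec (ν : Cotangent n L) : EuclideanSpace ℝ (Fin n) →L[ℝ] ℝ := ν.snd

/-- The covector with base point `q` and value `p`. -/
def mkCovec (q : L) (p : EuclideanSpace ℝ (Fin n) →L[ℝ] ℝ) : Cotangent n L := ⟨q, p⟩

lemma contMDiff_proj : ContMDiff (cotangentModel n) (𝓡 n) ∞ fun ν : Cotangent n L => ν.proj :=
  Bundle.contMDiff_proj _

/-- The canonical one-form. -/
def lambdaOne : OneForm (CotModel n) (Cotangent n L) := fun ν =>
  -(covec ν).comp (md (cotangentModel n) (𝓡 n) (fun η : Cotangent n L => η.proj) ν)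

lemma mem_cotangent_source {ν η : Cotangent n L} :
    η ∈ (extChartAt (cotangentModel n) ν).source ↔ η.proj ∈ (extChartAt (𝓡 n) ν.proj).source := by
  rw [FiberBundle.extChartAt]
  simp
  exact fun h => h

lemma mem_cotangent_target {ν : Cotangent n L} {e : CotModel n} :
    e ∈ (extChartAt (cotangentModel n) ν).target ↔ e.1 ∈ (extChartAt (𝓡 n) ν.proj).target := by
  rw [FiberBundle.extChartAt]
  simp
  exact fun h => (chartAt (EuclideanSpace ℝ (Fin n)) ν.proj).map_target h

/-- The trivialization of the bundle of functionals precomposes a covector with the inverse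
trivialization of TL, which is the differential of the inverse chart of L. Hence the preferred
charts of T*L are canonical coordinates (q, p). -/
lemma extChartAt_cotangent_apply {ν η : Cotangent n L}
    (h : η.proj ∈ (extChartAt (𝓡 n) ν.proj).source) :
    extChartAt (cotangentModel n) ν η = (extChartAt (𝓡 n) ν.proj η.proj,
      (covec η).comp (md 𝓘(ℝ, EuclideanSpace ℝ (Fin n)) (𝓡 n) (extChartAt (𝓡 n) ν.proj).symm
        (extChartAt (𝓡 n) ν.proj η.proj))) := by
  have : IsManifold (𝓡 n) 1 L := .of_le (n := ∞) (by simp)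
  have hs : η.proj ∈ (chartAt (EuclideanSpace ℝ (Fin n)) ν.proj).source := by
    rwa [← extChartAt_source (𝓡 n)]
  have h3 := TangentBundle.symmL_trivializationAt (I := 𝓡 n) hs
  rw [(𝓡 n).range_eq_univ, mfderivWithin_univ] at h3
  rw [FiberBundle.extChartAt]
  simp only [PartialEquiv.coe_trans, Function.comp_apply]
  have h4 := hom_trivializationAt_apply (RingHom.id ℝ) (F₁ := EuclideanSpace ℝ (Fin n))
    (E₁ := fun q : L => TangentSpace (𝓡 n) q) (F₂ := ℝ) (E₂ := Bundle.Trivial L ℝ) ν.proj η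
  refine (congrArg ((extChartAt (𝓡 n) ν.proj).prod (PartialEquiv.refl _)) h4).trans ?_
  refine Prod.ext rfl ?_
  change ContinuousLinearMap.inCoordinates _ _ _ _ _ _ _ _ _ = _
  ext v
  have h5 := congrArg (fun T => covec η (T v)) h3
  refine Eq.trans ?_ h5
  simp [ContinuousLinearMap.inCoordinates]
  rfl

lemma cotangent_symm_proj_mem {ν : Cotangent n L} {e : CotModel n}
    (he : e ∈ (extChartAt (cotangentModel n) ν).target) :
    ((extChartAt (cotangentModel n) ν).symm e).proj ∈ (extChartAt (𝓡 n) ν.proj).source :=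
  mem_cotangent_source.1 ((extChartAt (cotangentModel n) ν).map_target he)

lemma extChartAt_cotangent_symm_proj {ν : Cotangent n L} {e : CotModel n}
    (he : e ∈ (extChartAt (cotangentModel n) ν).target) :
    ((extChartAt (cotangentModel n) ν).symm e).proj = (extChartAt (𝓡 n) ν.proj).symm e.1 := by
  have h1 := (extChartAt (cotangentModel n) ν).right_inv he
  rw [extChartAt_cotangent_apply (cotangent_symm_proj_mem he)] at h1
  rw [← h1]
  simp only
  rw [(extChartAt (𝓡 n) ν.proj).left_inv (cotangent_symm_proj_mem he), h1]

lemma covec_extChartAt_cotangent_symm {ν : Cotangent n L} {e : CotModel n}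
    (he : e ∈ (extChartAt (cotangentModel n) ν).target) (v : EuclideanSpace ℝ (Fin n)) :
    covec ((extChartAt (cotangentModel n) ν).symm e)
      (md 𝓘(ℝ, EuclideanSpace ℝ (Fin n)) (𝓡 n) (extChartAt (𝓡 n) ν.proj).symm e.1 v) = e.2 v := by
  have h1 := (extChartAt (cotangentModel n) ν).right_inv he
  rw [extChartAt_cotangent_apply (cotangent_symm_proj_mem he)] at h1
  have h2 := congrArg Prod.snd h1
  have h3 := congrArg Prod.fst h1
  simp only at h2 h3
  rw [h3] at h2
  exact congrArg (fun T : EuclideanSpace ℝ (Fin n) →L[ℝ] ℝ => T v) h2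

/-- In canonical coordinates, the canonical one-form is `-p dq`. -/
lemma pullForm_lambdaOne {ν : Cotangent n L} {e : CotModel n}
    (he : e ∈ (extChartAt (cotangentModel n) ν).target) (v : CotModel n) :
    pullForm 𝓘(ℝ, CotModel n) (cotangentModel n) lambdaOne (extChartAt (cotangentModel n) ν).symm e
      v = -e.2 v.1 := by
  set φ := extChartAt (cotangentModel n) ν with hφ
  set ψ := extChartAt (𝓡 n) ν.proj with hψ
  have h1 : ContMDiffAt 𝓘(ℝ, CotModel n) (cotangentModel n) ∞ φ.symm e :=
    contMDiffAt_extChartAt_symm' he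
  have h2 : (fun y => (φ.symm y).proj) =ᶠ[𝓝 e] fun y => ψ.symm y.1 := by
    filter_upwards [(isOpen_extChartAt_target (I := cotangentModel n) ν).mem_nhds he] with y hy
    exact extChartAt_cotangent_symm_proj hy
  have he1 : e.1 ∈ ψ.target := mem_cotangent_target.1 he
  have h3 : md 𝓘(ℝ, CotModel n) (𝓡 n) (fun y => (φ.symm y).proj) e =
      (md (cotangentModel n) (𝓡 n) (fun η : Cotangent n L => η.proj) (φ.symm e)).comp
        (md 𝓘(ℝ, CotModel n) (cotangentModel n) φ.symm e) :=
    md_comp (I' := cotangentModel n) (f := fun η : Cotangent n L => η.proj)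
      (contMDiff_proj.contMDiffAt.mdifferentiableAt (by simp)) (h1.mdifferentiableAt (by simp))
  have h4 : md 𝓘(ℝ, CotModel n) (𝓡 n) (fun y : CotModel n => ψ.symm y.1) e =
      (md 𝓘(ℝ, EuclideanSpace ℝ (Fin n)) (𝓡 n) ψ.symm e.1).comp
        (md 𝓘(ℝ, CotModel n) 𝓘(ℝ, EuclideanSpace ℝ (Fin n)) Prod.fst e) :=
    md_comp (I' := 𝓘(ℝ, EuclideanSpace ℝ (Fin n))) (f := ψ.symm)
      ((contMDiffAt_extChartAt_symm' he1).mdifferentiableAt (by simp))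
      (contDiffAt_fst.contMDiffAt.mdifferentiableAt (n := ∞) (by simp))
  rw [md_congr h2, h4, md_eq_fderiv, fderiv_fst] at h3
  have h5 := congrArg (fun T => T v) h3
  have h6 : md 𝓘(ℝ, EuclideanSpace ℝ (Fin n)) (𝓡 n) ψ.symm e.1 v.1 =
    md (cotangentModel n) (𝓡 n) (fun η : Cotangent n L => η.proj) (φ.symm e)
      (md 𝓘(ℝ, CotModel n) (cotangentModel n) φ.symm e v) := h5
  rw [pullForm_apply, lambdaOne]
  change -(covec (φ.symm e) _) = _
  rw [← covec_extChartAt_cotangent_symm he v.1, h6]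
  rfl

/-- The one-form `r sin r dϑ + λ_can`. -/
def betaOne : OneForm (Plane × CotModel n) (Plane × Cotangent n L) := fun x =>
  (rSinForm x.1).comp (ContinuousLinearMap.fst ℝ Plane (CotModel n)) +
    (lambdaOne x.2).comp (ContinuousLinearMap.snd ℝ Plane (CotModel n))

/-- The one-form `α_OT + λ_can`. -/
def boxOne : OneForm ((Plane × ℝ) × CotModel n) ((Plane × ℝ) × Cotangent n L) := fun x =>
  (alphaOT x.1).comp (ContinuousLinearMap.fst ℝ (Plane × ℝ) (CotModel n)) +
    (lambdaOne x.2).comp (ContinuousLinearMap.snd ℝ (Plane × ℝ) (CotModel n))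

lemma betaForm_eq (x : Plane × Cotangent n L) (v : TangentSpace (discModel n) x) :
    betaForm x v = betaOne x v := by
  rw [betaForm, mfderiv_fst, mfderiv_snd]
  rfl

lemma boxForm_eq (x : (Plane × ℝ) × Cotangent n L) (v : TangentSpace (boxModel n) x) :
    boxForm x v = boxOne x v := by
  rw [boxForm, mfderiv_fst, mfderiv_snd]
  rfl

/-- The expression of `betaOne` in canonical coordinates. -/
def betaCoord (e : Plane × CotModel n) : Plane × CotModel n →L[ℝ] ℝ :=
  (rSinForm e.1).comp (ContinuousLinearMap.fst ℝ Plane (CotModel n)) -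
    e.2.2.comp ((ContinuousLinearMap.fst ℝ (EuclideanSpace ℝ (Fin n)) _).comp
      (ContinuousLinearMap.snd ℝ Plane (CotModel n)))

/-- The expression of `boxOne` in canonical coordinates. -/
def boxCoord (e : (Plane × ℝ) × CotModel n) : (Plane × ℝ) × CotModel n →L[ℝ] ℝ :=
  (alphaOT e.1).comp (ContinuousLinearMap.fst ℝ (Plane × ℝ) (CotModel n)) -
    e.2.2.comp ((ContinuousLinearMap.fst ℝ (EuclideanSpace ℝ (Fin n)) _).comp
      (ContinuousLinearMap.snd ℝ (Plane × ℝ) (CotModel n)))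

section ProductChart

variable {V : Type} [NormedAddCommGroup V] [NormedSpace ℝ V]

lemma mem_target_prod {x : V × Cotangent n L} {e : V × CotModel n} :
    e ∈ (extChartAt (𝓘(ℝ, V).prod (cotangentModel n)) x).target ↔
      e.2 ∈ (extChartAt (cotangentModel n) x.2).target := by
  rw [extChartAt_prod, PartialEquiv.prod_target, mem_prod]
  refine ⟨fun h => h.2, fun h => ⟨?_, h⟩⟩
  rw [extChartAt_model_space_eq_id]
  exact mem_univ _

lemma extChartAt_prod_symm_apply (x : V × Cotangent n L) (e : V × CotModel n) :
    (extChartAt (𝓘(ℝ, V).prod (cotangentModel n)) x).symm e =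
      (e.1, (extChartAt (cotangentModel n) x.2).symm e.2) := by
  rw [extChartAt_prod]
  rfl

lemma extChartAt_prod_apply (x y : V × Cotangent n L) :
    extChartAt (𝓘(ℝ, V).prod (cotangentModel n)) x y =
      (y.1, extChartAt (cotangentModel n) x.2 y.2) := by
  rw [extChartAt_prod]
  rfl

lemma md_extChartAt_prod_symm {x : V × Cotangent n L} {e : V × CotModel n}
    (he : e.2 ∈ (extChartAt (cotangentModel n) x.2).target) (v : V × CotModel n) :
    md 𝓘(ℝ, V × CotModel n) (𝓘(ℝ, V).prod (cotangentModel n))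
      (extChartAt (𝓘(ℝ, V).prod (cotangentModel n)) x).symm e v =
    (v.1, md 𝓘(ℝ, CotModel n) (cotangentModel n) (extChartAt (cotangentModel n) x.2).symm e.2 v.2) := by
  have h0 : ⇑(extChartAt (𝓘(ℝ, V).prod (cotangentModel n)) x).symm = fun e : V × CotModel n =>
      (e.1, (extChartAt (cotangentModel n) x.2).symm e.2) := funext (extChartAt_prod_symm_apply x)
  rw [h0]
  have hs : ContMDiffAt 𝓘(ℝ, CotModel n) (cotangentModel n) ∞
    (extChartAt (cotangentModel n) x.2).symm e.2 := contMDiffAt_extChartAt_symm' he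
  have hsnd : ContMDiffAt 𝓘(ℝ, V × CotModel n) 𝓘(ℝ, CotModel n) ∞ Prod.snd e :=
    contDiffAt_snd.contMDiffAt
  have hfst : ContMDiffAt 𝓘(ℝ, V × CotModel n) 𝓘(ℝ, V) ∞ Prod.fst e :=
    contDiffAt_fst.contMDiffAt
  have h1 : md 𝓘(ℝ, V × CotModel n) (cotangentModel n)
      (fun e : V × CotModel n => (extChartAt (cotangentModel n) x.2).symm e.2) e =
      (md 𝓘(ℝ, CotModel n) (cotangentModel n) (extChartAt (cotangentModel n) x.2).symm e.2).comp
        (md 𝓘(ℝ, V × CotModel n) 𝓘(ℝ, CotModel n) Prod.snd e) :=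
    md_comp (I' := 𝓘(ℝ, CotModel n)) (hs.mdifferentiableAt (by simp))
      (hsnd.mdifferentiableAt (by simp))
  have h2 := mfderiv_prodMk (hfst.mdifferentiableAt (by simp))
    ((ContMDiffAt.comp (f := Prod.snd) e hs hsnd).mdifferentiableAt (by simp))
  have h3 := congrArg (fun T : V × CotModel n →L[ℝ] V × CotModel n => T v) h2
  refine Eq.trans h3 ?_
  refine Prod.ext ?_ ?_
  · change md 𝓘(ℝ, V × CotModel n) 𝓘(ℝ, V) Prod.fst e v = v.1
    rw [md_eq_fderiv, fderiv_fst]; rfl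
  · change md 𝓘(ℝ, V × CotModel n) (cotangentModel n)
      (fun e : V × CotModel n => (extChartAt (cotangentModel n) x.2).symm e.2) e v = _
    rw [h1, md_eq_fderiv, fderiv_snd]; rfl

end ProductChart

lemma pullForm_betaOne {x : Plane × Cotangent n L} {e : Plane × CotModel n}
    (he : e ∈ (extChartAt (discModel n) x).target) :
    pullForm 𝓘(ℝ, Plane × CotModel n) (discModel n) betaOne (extChartAt (discModel n) x).symm e =
      betaCoord e := by
  have he' := mem_target_prod.1 he
  refine ContinuousLinearMap.ext fun v => ?_
  rw [pullForm_apply, md_extChartAt_prod_symm he', extChartAt_prod_symm_apply, betaOne, betaCoord]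
  have h := pullForm_lambdaOne he' v.2
  change rSinForm e.1 v.1 + _ = rSinForm e.1 v.1 - _
  rw [sub_eq_add_neg]
  exact congrArg _ h

lemma pullForm_boxOne {x : (Plane × ℝ) × Cotangent n L} {e : (Plane × ℝ) × CotModel n}
    (he : e ∈ (extChartAt (boxModel n) x).target) :
    pullForm 𝓘(ℝ, (Plane × ℝ) × CotModel n) (boxModel n) boxOne (extChartAt (boxModel n) x).symm e =
      boxCoord e := by
  have he' := mem_target_prod.1 he
  refine ContinuousLinearMap.ext fun v => ?_
  rw [pullForm_apply, md_extChartAt_prod_symm he', extChartAt_prod_symm_apply, boxOne, boxCoord]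
  have h := pullForm_lambdaOne he' v.2
  change alphaOT e.1 v.1 + _ = alphaOT e.1 v.1 - _
  rw [sub_eq_add_neg]
  exact congrArg _ h

lemma betaOne_eq_betaCoord (x : Plane × Cotangent n L) :
    betaOne x = betaCoord (extChartAt (discModel n) x x) := by
  rw [← pullForm_betaOne (mem_extChartAt_target (I := discModel n) x), pullForm,
    md_extChartAt_symm_self, extChartAt_to_inv, ContinuousLinearMap.comp_id]

lemma boxOne_eq_boxCoord (x : (Plane × ℝ) × Cotangent n L) :
    boxOne x = boxCoord (extChartAt (boxModel n) x x) := by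
  rw [← pullForm_boxOne (mem_extChartAt_target (I := boxModel n) x), pullForm,
    md_extChartAt_symm_self, extChartAt_to_inv, ContinuousLinearMap.comp_id]

lemma betaCoord_apply (e v : Plane × CotModel n) : betaCoord e v =
    sincSqrt (radSq e.1) * (e.1 0 * v.1 1 - e.1 1 * v.1 0) - e.2.2 v.2.1 := by
  rw [← rSinForm_apply]; rfl

lemma boxCoord_apply (e v : (Plane × ℝ) × CotModel n) : boxCoord e v =
    cosSqrt (radSq e.1.1) * v.1.2 +
      sincSqrt (radSq e.1.1) * (e.1.1 0 * v.1.1 1 - e.1.1 1 * v.1.1 0) - e.2.2 v.2.1 := by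
  rw [← rSinForm_apply, ← cos_norm]; rfl

lemma contDiff_alphaOT : ContDiff ℝ ∞ alphaOT := by
  have h : alphaOT = fun x : Plane × ℝ => cosRad x.1 • ContinuousLinearMap.snd ℝ Plane ℝ
      + (rSinForm x.1).comp (ContinuousLinearMap.fst ℝ Plane ℝ) := by
    funext x; rw [alphaOT, cos_norm]; rfl
  rw [h]
  exact ((contDiff_cosRad.comp contDiff_fst).smul contDiff_const).add
    ((contDiff_rSinForm.comp contDiff_fst).clm_comp contDiff_const)

lemma contDiff_betaCoord : ContDiff ℝ ∞ (betaCoord (n := n)) :=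
  ((contDiff_rSinForm.comp contDiff_fst).clm_comp contDiff_const).sub
    (contDiff_snd.snd.clm_comp contDiff_const)

lemma contDiff_boxCoord : ContDiff ℝ ∞ (boxCoord (n := n)) :=
  ((contDiff_alphaOT.comp contDiff_fst).clm_comp contDiff_const).sub
    (contDiff_snd.snd.clm_comp contDiff_const)

lemma fderiv_apply_eq {F : Type*} [NormedAddCommGroup F] [NormedSpace ℝ F] {a : F → F →L[ℝ] ℝ}
    {e v : F} {T : F →L[ℝ] ℝ} (ha : DifferentiableAt ℝ a e)
    (h : HasFDerivAt (fun y => a y v) T e) (u : F) : fderiv ℝ a e u v = T u := by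
  have h4 : HasFDerivAt (fun y => a y v) _ e := ha.hasFDerivAt.clm_apply (hasFDerivAt_const v e)
  have h5 := congrArg (fun T : F →L[ℝ] ℝ => T u) (h4.unique h)
  simpa using h5

lemma fderiv_betaCoord (e u v : Plane × CotModel n) : fderiv ℝ betaCoord e u v =
    fderiv ℝ rSinForm e.1 u.1 v.1 - u.2.2 v.2.1 := by
  have h1 := ((contDiff_rSinForm.differentiable (by simp) e.1).hasFDerivAt).comp e
    (hasFDerivAt_fst (𝕜 := ℝ) (p := e))
  have h2 : HasFDerivAt (fun y : Plane × CotModel n => y.2.2)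
      ((ContinuousLinearMap.snd ℝ (EuclideanSpace ℝ (Fin n)) _).comp
        (ContinuousLinearMap.snd ℝ Plane (CotModel n))) e := (hasFDerivAt_snd (𝕜 := ℝ) (p := e)).snd
  have h3 := (h1.clm_apply (hasFDerivAt_const v.1 e)).sub (h2.clm_apply (hasFDerivAt_const v.2.1 e))
  rw [fderiv_apply_eq (contDiff_betaCoord.differentiable (by simp) e) h3]
  simp

lemma fderiv_boxCoord (e u v : (Plane × ℝ) × CotModel n) : fderiv ℝ boxCoord e u v =
    fderiv ℝ cosRad e.1.1 u.1.1 * v.1.2 + fderiv ℝ rSinForm e.1.1 u.1.1 v.1.1 - u.2.2 v.2.1 := by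
  have h0 : HasFDerivAt (fun y : (Plane × ℝ) × CotModel n => y.1.1)
      ((ContinuousLinearMap.fst ℝ Plane ℝ).comp
        (ContinuousLinearMap.fst ℝ (Plane × ℝ) (CotModel n))) e :=
    (hasFDerivAt_fst (𝕜 := ℝ) (p := e)).fst
  have h1 := HasFDerivAt.comp (f := fun y : (Plane × ℝ) × CotModel n => y.1.1) e
    ((contDiff_rSinForm.differentiable (by simp) e.1.1).hasFDerivAt) h0
  have h1' := HasFDerivAt.comp (f := fun y : (Plane × ℝ) × CotModel n => y.1.1) e
    ((contDiff_cosRad.differentiable (by simp) e.1.1).hasFDerivAt) h0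
  have h2 : HasFDerivAt (fun y : (Plane × ℝ) × CotModel n => y.2.2)
      ((ContinuousLinearMap.snd ℝ (EuclideanSpace ℝ (Fin n)) _).comp
        (ContinuousLinearMap.snd ℝ (Plane × ℝ) (CotModel n))) e :=
    (hasFDerivAt_snd (𝕜 := ℝ) (p := e)).snd
  have h3 := ((h1'.mul_const v.1.2).add (h1.clm_apply (hasFDerivAt_const v.1.1 e))).sub
    (h2.clm_apply (hasFDerivAt_const v.2.1 e))
  have h4 : HasFDerivAt (fun y => boxCoord y v) _ e := h3.congr_of_eventuallyEq
    (Eventually.of_forall fun y => (boxCoord_apply y v).trans (by rw [← rSinForm_apply]; rfl))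
  rw [fderiv_apply_eq (contDiff_boxCoord.differentiable (by simp) e) h4]
  simp
  ring

lemma dOne_betaCoord (e u v : Plane × CotModel n) : dOne betaCoord e u v =
    (cosSqrt (radSq e.1) + sincSqrt (radSq e.1)) * (u.1 0 * v.1 1 - u.1 1 * v.1 0) -
      (u.2.2 v.2.1 - v.2.2 u.2.1) := by
  rw [← dOne_rSinForm, dOne_apply, dOne_apply, fderiv_betaCoord, fderiv_betaCoord]
  ring

lemma dOne_boxCoord (e u v : (Plane × ℝ) × CotModel n) : dOne boxCoord e u v =
    (fderiv ℝ cosRad e.1.1 u.1.1 * v.1.2 - fderiv ℝ cosRad e.1.1 v.1.1 * u.1.2) +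
    (cosSqrt (radSq e.1.1) + sincSqrt (radSq e.1.1)) * (u.1.1 0 * v.1.1 1 - u.1.1 1 * v.1.1 0) -
      (u.2.2 v.2.1 - v.2.2 u.2.1) := by
  rw [← dOne_rSinForm, dOne_apply, dOne_apply, fderiv_boxCoord, fderiv_boxCoord]
  ring

lemma pullForm_betaOne_eventuallyEq (x : Plane × Cotangent n L) :
    pullForm 𝓘(ℝ, Plane × CotModel n) (discModel n) betaOne (extChartAt (discModel n) x).symm
      =ᶠ[𝓝 (extChartAt (discModel n) x x)] betaCoord := by
  filter_upwards [extChartAt_target_mem_nhds (I := discModel n) x] with y hy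
  exact pullForm_betaOne hy

lemma pullForm_boxOne_eventuallyEq (x : (Plane × ℝ) × Cotangent n L) :
    pullForm 𝓘(ℝ, (Plane × ℝ) × CotModel n) (boxModel n) boxOne (extChartAt (boxModel n) x).symm
      =ᶠ[𝓝 (extChartAt (boxModel n) x x)] boxCoord := by
  filter_upwards [extChartAt_target_mem_nhds (I := boxModel n) x] with y hy
  exact pullForm_boxOne hy

lemma smoothFormAt_betaOne (x : Plane × Cotangent n L) : SmoothFormAt (discModel n) betaOne x :=
  contDiff_betaCoord.contDiffAt.congr_of_eventuallyEq (pullForm_betaOne_eventuallyEq x)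

lemma smoothFormAt_boxOne (x : (Plane × ℝ) × Cotangent n L) : SmoothFormAt (boxModel n) boxOne x :=
  contDiff_boxCoord.contDiffAt.congr_of_eventuallyEq (pullForm_boxOne_eventuallyEq x)

lemma dForm_betaOne (x : Plane × Cotangent n L) :
    dForm (discModel n) betaOne x = dOne betaCoord (extChartAt (discModel n) x x) :=
  dOne_congr (pullForm_betaOne_eventuallyEq x)

lemma dForm_boxOne (x : (Plane × ℝ) × Cotangent n L) :
    dForm (boxModel n) boxOne x = dOne boxCoord (extChartAt (boxModel n) x x) :=
  dOne_congr (pullForm_boxOne_eventuallyEq x)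

/-- R = cos r ∂_z + (sin r / r) ∂_ϑ has value 1. If u in the kernel pairs to zero with the kernel,
then dα (u, ·) = κ α. Testing on ∂_p gives dq(u) = 0, testing on ∂_q gives dp(u) = κ p. The rest
splits into two 2 × 2 systems, one for w and the angular part l, one for κ and the radial part m,
both of determinant C² + τK² + CK = 1 + CK > 0. -/
lemma isContactPair_boxCoord (e : (Plane × ℝ) × CotModel n) :
    IsContactPair (boxCoord e) (dOne boxCoord e) := by
  obtain ⟨⟨x, z⟩, q, p⟩ := e
  set C := cosSqrt (radSq x) with hC
  set K := sincSqrt (radSq x) with hK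
  have hCK : C ^ 2 + (x 0 ^ 2 + x 1 ^ 2) * K ^ 2 = 1 := cosSqrt_sq_add (radSq_nonneg x)
  have hpos : 0 < 1 + C * K := one_add_cosSqrt_mul_sincSqrt_pos (radSq_nonneg x)
  set R : (Plane × ℝ) × CotModel n := ((!₂[-K * x 1, K * x 0], C), 0) with hR
  have hR1 : boxCoord ((x, z), (q, p)) R = 1 := by
    rw [boxCoord_apply]
    simp [hR, ← hC, ← hK]
    linarith
  refine ⟨fun h => by rw [h] at hR1; simp at hR1, fun u hu hu0 => ?_⟩
  by_contra! hcon
  obtain ⟨κ, hκ⟩ : ∃ κ, ∀ v, dOne boxCoord ((x, z), (q, p)) u v =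
      κ * boxCoord ((x, z), (q, p)) v := ⟨_, eq_mul_of_forall_ker _ hcon hR1⟩
  simp only [dOne_boxCoord, boxCoord_apply, fderiv_cosRad, ← hC, ← hK] at hκ
  rw [boxCoord_apply] at hu
  simp only [← hC, ← hK] at hu
  apply hu0
  obtain ⟨⟨y, w⟩, a, b⟩ := u
  simp only at hκ hu
  have ha : a = 0 := by
    by_contra ha
    obtain ⟨f, hf⟩ := SeparatingDual.exists_ne_zero (R := ℝ) ha
    have := hκ ((0, 0), (0, f))
    simp at this
    exact hf this
  subst ha
  have hb : b = κ • p := by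
    ext v
    have := hκ ((0, 0), (v, 0))
    simp at this
    simpa using this
  have hz := hκ ((0, 1), (0, 0))
  have h0 := hκ ((!₂[1, 0], 0), (0, 0))
  have h1 := hκ ((!₂[0, 1], 0), (0, 0))
  simp at hz h0 h1 hu
  set m := x 0 * y 0 + x 1 * y 1 with hm
  set l := x 0 * y 1 - x 1 * y 0 with hl
  set τ := x 0 ^ 2 + x 1 ^ 2 with hτ
  have e1 : K * τ * w - (C + K) * l = 0 := by
    rw [hτ, hl]; linear_combination x 0 * h0 + x 1 * h1
  have e2 : (C + K) * m = κ * K * τ := by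
    rw [hτ, hm]; linear_combination -x 1 * h0 + x 0 * h1
  have hw : w = 0 := by
    have : (1 + C * K) * w = 0 := by
      linear_combination K * e1 + (C + K) * hu - w * hCK
    exact (mul_eq_zero.1 this).resolve_left hpos.ne'
  have hl0 : l = 0 := by
    have : (1 + C * K) * l = 0 := by
      linear_combination K * τ * hu - C * e1 - l * hCK
    exact (mul_eq_zero.1 this).resolve_left hpos.ne'
  have hm0 : m = 0 := by
    have : (1 + C * K) * m = 0 := by
      linear_combination C * e2 - K * τ * hz - m * hCK
    exact (mul_eq_zero.1 this).resolve_left hpos.ne'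
  rw [hm0] at e2 hz
  have hκ0 : κ = 0 := by linear_combination -κ * hCK - C * hz - K * e2
  subst hw
  rw [hκ0, zero_smul] at hb
  rw [hκ0] at h0 h1
  -- Off the axis, y is recovered from its radial and angular parts m and l. On the axis these carry
  -- no information, and the equations `h0`, `h1` are used directly, with C + K ≠ 0.
  have hy : y 0 = 0 ∧ y 1 = 0 := by
    by_cases hτ0 : τ = 0
    · have hs : C + K ≠ 0 := by
        intro hs
        have : C ^ 2 = 1 := by rw [hτ0] at hCK; linarith
        have hK' : K = -C := by linarith
        rw [hK'] at hpos
        nlinarith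
      simp at h0 h1
      exact ⟨h1.resolve_left hs, h0.resolve_left hs⟩
    · have k0 : τ * y 0 = 0 := by
        rw [hτ]; linear_combination x 0 * (hm.symm.trans hm0) - x 1 * (hl.symm.trans hl0)
      have k1 : τ * y 1 = 0 := by
        rw [hτ]; linear_combination x 1 * (hm.symm.trans hm0) + x 0 * (hl.symm.trans hl0)
      exact ⟨(mul_eq_zero.1 k0).resolve_left hτ0, (mul_eq_zero.1 k1).resolve_left hτ0⟩
  have hy0 : y = 0 := by
    ext i; fin_cases i
    · exact hy.1
    · exact hy.2
  rw [hy0, hb]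
  rfl

lemma isContactPair_boxOne (x : (Plane × ℝ) × Cotangent n L) :
    IsContactPair (boxOne x) (dForm (boxModel n) boxOne x) := by
  rw [boxOne_eq_boxCoord, dForm_boxOne]
  exact isContactPair_boxCoord _

end CanonicalCoordinates

end OvertwistedBox

end

noncomputable section
namespace OvertwistedBox

set_option linter.unusedSectionVars false

open Set Topology Filter

/-! ### Dual norms of inner products. -/

section DualNorm

variable {V V' : Type*} [NormedAddCommGroup V] [NormedSpace ℝ V] [FiniteDimensional ℝ V]
  [NormedAddCommGroup V'] [NormedSpace ℝ V']

/-- Symmetric positive definite bilinear forms. -/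
structure IsInner (B : V →L[ℝ] V →L[ℝ] ℝ) : Prop where
  symm : ∀ u v, B u v = B v u
  pos : ∀ v, v ≠ 0 → 0 < B v v

/-- The dual norm of a covector. -/
def dualNorm (B : V' →L[ℝ] V' →L[ℝ] ℝ) (p : V' →L[ℝ] ℝ) : ℝ := sSup {a | ∃ v, B v v ≤ 1 ∧ a = p v}

variable {B : V →L[ℝ] V →L[ℝ] ℝ}

lemma IsInner.nonneg (hB : IsInner B) (v : V) : 0 ≤ B v v := by
  by_cases h : v = 0
  · simp [h]
  · exact (hB.pos v h).le

lemma IsInner.isInvertible (hB : IsInner B) : B.IsInvertible := by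
  refine isInvertible_of_injective ?_
  rw [injective_iff_map_eq_zero]
  intro v hv
  by_contra h
  have := hB.pos v h
  rw [hv] at this
  simp at this

lemma IsInner.cauchySchwarz (hB : IsInner B) (u v : V) : B u v ^ 2 ≤ B u u * B v v := by
  by_cases h : v = 0
  · simp [h]
  · have h1 := hB.nonneg (B v v • u - B u v • v)
    have h2 := hB.pos v h
    simp only [map_sub, map_smul, sub_apply, smul_apply, smul_eq_mul,
      hB.symm v u] at h1
    have h3 : 0 ≤ B v v * (B u u * B v v - B u v ^ 2) := by nlinarith
    nlinarith [(mul_nonneg_iff_of_pos_left h2).1 h3]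

/-- With w the Riesz representative of p, Cauchy–Schwarz gives the upper bound √(B w w), attained at
the normalised w. The closed formula is what exhibits the dual norm as continuous in B and p
together. -/
lemma IsInner.dualNorm_isLUB (hB : IsInner B) (p : V →L[ℝ] ℝ) :
    IsLUB {a | ∃ v, B v v ≤ 1 ∧ a = p v} (√(p (B.inverse p))) := by
  set w := B.inverse p with hw
  have hBw : ∀ v, B w v = p v := fun v => by rw [hw, hB.isInvertible.self_apply_inverse]
  have hpw : p w = B w w := (hBw w).symm
  have h0 := hB.nonneg w
  constructor
  · rintro a ⟨v, hv, rfl⟩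
    apply Real.le_sqrt_of_sq_le
    rw [hpw, ← hBw v]
    nlinarith [hB.cauchySchwarz w v]
  · intro b hb
    rcases h0.eq_or_lt with h | h
    · rw [hpw, ← h, Real.sqrt_zero]
      exact hb ⟨0, by simp, by simp⟩
    · refine hb ⟨(√(p w))⁻¹ • w, ?_, ?_⟩
      · have hs : √(p w) ≠ 0 := (Real.sqrt_pos.2 (by rw [hpw]; exact h)).ne'
        have hs2 : √(p w) * √(p w) = B w w := by rw [Real.mul_self_sqrt (by rw [hpw]; exact h0), hpw]
        simp only [map_smul, smul_apply, smul_eq_mul]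
        rw [← hs2]
        field_simp
        exact le_refl _
      · have hs : √(p w) ≠ 0 := (Real.sqrt_pos.2 (by rw [hpw]; exact h)).ne'
        rw [map_smul, smul_eq_mul]
        field_simp
        rw [Real.sq_sqrt (by rw [hpw]; exact h0)]

lemma IsInner.dualNorm_eq (hB : IsInner B) (p : V →L[ℝ] ℝ) : dualNorm B p = √(p (B.inverse p)) :=
  (hB.dualNorm_isLUB p).csSup_eq ⟨0, 0, by simp, by simp⟩

lemma IsInner.apply_le_dualNorm (hB : IsInner B) (p : V →L[ℝ] ℝ) {v : V} (hv : B v v ≤ 1) :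
    p v ≤ dualNorm B p := by
  rw [hB.dualNorm_eq]
  exact (hB.dualNorm_isLUB p).1 ⟨v, hv, rfl⟩

lemma dualNorm_le {p : V →L[ℝ] ℝ} {b : ℝ} (h : ∀ v, B v v ≤ 1 → p v ≤ b) : dualNorm B p ≤ b :=
  csSup_le ⟨0, 0, by simp, by simp⟩ (by rintro a ⟨v, hv, rfl⟩; exact h v hv)

lemma IsInner.dualNorm_nonneg (hB : IsInner B) (p : V →L[ℝ] ℝ) : 0 ≤ dualNorm B p := by
  rw [hB.dualNorm_eq]; exact Real.sqrt_nonneg _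

lemma IsInner.dualNorm_add_le (hB : IsInner B) (p p' : V →L[ℝ] ℝ) :
    dualNorm B (p + p') ≤ dualNorm B p + dualNorm B p' :=
  dualNorm_le fun _ hv => add_le_add (hB.apply_le_dualNorm p hv) (hB.apply_le_dualNorm p' hv)

lemma IsInner.dualNorm_smul_le (hB : IsInner B) (c : ℝ) (p : V →L[ℝ] ℝ) :
    dualNorm B (c • p) ≤ |c| * dualNorm B p := by
  refine dualNorm_le fun v hv => ?_
  rw [smul_apply, smul_eq_mul]
  rcases abs_cases c with ⟨h, _⟩ | ⟨h, _⟩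
  · rw [h]
    gcongr
    exact hB.apply_le_dualNorm p hv
  · rw [h, show c * p v = -c * p (-v) by simp]
    have : p (-v) ≤ dualNorm B p := hB.apply_le_dualNorm p (by simpa using hv)
    nlinarith

lemma IsInner.comp (hB : IsInner B) {D : V →L[ℝ] V} (hD : Function.Bijective D)
    {B' : V →L[ℝ] V →L[ℝ] ℝ} (hB' : ∀ u v, B' u v = B (D u) (D v)) : IsInner B' :=
  ⟨fun u v => by rw [hB', hB', hB.symm], fun v hv => by
    rw [hB']; exact hB.pos _ fun h => hv (hD.1 (by rw [h, map_zero]))⟩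

lemma dualNorm_comp {D : V →L[ℝ] V} (hD : Function.Surjective D)
    {B' : V →L[ℝ] V →L[ℝ] ℝ} (hB' : ∀ u v, B' u v = B (D u) (D v)) (p : V →L[ℝ] ℝ) :
    dualNorm B' (p.comp D) = dualNorm B p := by
  unfold dualNorm
  congr 1
  ext a
  constructor
  · rintro ⟨v, hv, rfl⟩
    exact ⟨D v, by rwa [← hB'], rfl⟩
  · rintro ⟨v, hv, rfl⟩
    obtain ⟨w, rfl⟩ := hD v
    exact ⟨w, by rwa [hB'], rfl⟩

end DualNorm

/-! ### Continuity of the covector norm on T*L. -/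

section CovectorNorm

variable {n : ℕ} {L : Type*} [TopologicalSpace L] [ChartedSpace (EuclideanSpace ℝ (Fin n)) L]
  [IsManifold (𝓡 n) ∞ L]
  (g : Bundle.ContMDiffRiemannianMetric (𝓡 n) ∞ (EuclideanSpace ℝ (Fin n))
      (fun q : L => TangentSpace (𝓡 n) q))

/-- The metric at a point, as a bilinear form on the model space. -/
def metricAt (q : L) : EuclideanSpace ℝ (Fin n) →L[ℝ] EuclideanSpace ℝ (Fin n) →L[ℝ] ℝ := g.inner q

lemma isInner_metricAt (q : L) : IsInner (metricAt g q) :=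
  ⟨fun u v => g.symm q u v, fun v hv => g.pos q v hv⟩

lemma covectorNorm_eq (ν : Cotangent n L) :
    covectorNorm g ν = dualNorm (metricAt g ν.proj) (covec ν) := rfl

/-- The metric in the coordinates of the chart at `q₀`. -/
def metricCoord (q₀ : L) (e : EuclideanSpace ℝ (Fin n)) :
    EuclideanSpace ℝ (Fin n) →L[ℝ] EuclideanSpace ℝ (Fin n) →L[ℝ] ℝ :=
  (metricAt g ((extChartAt (𝓡 n) q₀).symm e)).bilinearComp
    (md 𝓘(ℝ, EuclideanSpace ℝ (Fin n)) (𝓡 n) (extChartAt (𝓡 n) q₀).symm e)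
    (md 𝓘(ℝ, EuclideanSpace ℝ (Fin n)) (𝓡 n) (extChartAt (𝓡 n) q₀).symm e)

lemma isInner_metricCoord {q₀ : L} {e : EuclideanSpace ℝ (Fin n)}
    (he : e ∈ (extChartAt (𝓡 n) q₀).target) : IsInner (metricCoord g q₀ e) :=
  (isInner_metricAt g _).comp (bijective_md_extChartAt_symm he) fun _ _ => rfl

/-- The metric is continuous in the trivialization of TL at q₀. Over the chart domain the inverse of
that trivialization is the differential of the inverse chart, so the two coordinate expressions
agree. -/
lemma continuousAt_metricCoord (q₀ : L) :
    ContinuousAt (metricCoord g q₀) (extChartAt (𝓡 n) q₀ q₀) := by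
  have : IsManifold (𝓡 n) 1 L := .of_le (n := ∞) (by simp)
  set T : L → EuclideanSpace ℝ (Fin n) →L[ℝ] EuclideanSpace ℝ (Fin n) →L[ℝ] ℝ := fun x =>
    ContinuousLinearMap.inCoordinates (EuclideanSpace ℝ (Fin n)) (fun b : L => TangentSpace (𝓡 n) b)
      (EuclideanSpace ℝ (Fin n) →L[ℝ] ℝ) (fun b : L => TangentSpace (𝓡 n) b →L[ℝ] ℝ) q₀ x q₀ x
      (g.inner x) with hT
  have h1 : ContinuousAt T q₀ := by
    have W := g.contMDiff.continuous.continuousAt (x := q₀)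
    simp only [continuousAt_hom_bundle] at W
    exact W.2
  have h2 : ContinuousAt (fun e => T ((extChartAt (𝓡 n) q₀).symm e)) (extChartAt (𝓡 n) q₀ q₀) :=
    ContinuousAt.comp (f := (extChartAt (𝓡 n) q₀).symm) (g := T) (by rwa [extChartAt_to_inv])
      (continuousAt_extChartAt_symm q₀)
  refine h2.congr ?_
  filter_upwards [extChartAt_target_mem_nhds (I := 𝓡 n) q₀] with e he
  set x := (extChartAt (𝓡 n) q₀).symm e with hx
  have hxs : x ∈ (chartAt (EuclideanSpace ℝ (Fin n)) q₀).source := by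
    rw [← extChartAt_source (𝓡 n)]; exact (extChartAt (𝓡 n) q₀).map_target he
  have h3 := TangentBundle.symmL_trivializationAt (I := 𝓡 n) hxs
  rw [(𝓡 n).range_eq_univ, mfderivWithin_univ, (extChartAt (𝓡 n) q₀).right_inv he] at h3
  refine ContinuousLinearMap.ext fun u => ContinuousLinearMap.ext fun v => ?_
  have hb : x ∈ (trivializationAt (EuclideanSpace ℝ (Fin n)) (TangentSpace (𝓡 n)) q₀).baseSet := by
    simpa using hxs
  have h4 : T x u v = g.inner x
      ((trivializationAt (EuclideanSpace ℝ (Fin n)) (TangentSpace (𝓡 n)) q₀).symm x u)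
      ((trivializationAt (EuclideanSpace ℝ (Fin n)) (TangentSpace (𝓡 n)) q₀).symm x v) := by
    rw [hT]
    simp only
    rw [inCoordinates_apply_eq₂ hb hb (Set.mem_univ _)]
    simp
  have h5 : ∀ w, (trivializationAt (EuclideanSpace ℝ (Fin n)) (TangentSpace (𝓡 n)) q₀).symm x w =
      md 𝓘(ℝ, EuclideanSpace ℝ (Fin n)) (𝓡 n) (extChartAt (𝓡 n) q₀).symm e w := fun w => by
    have := congrArg (fun A => A w) h3
    rw [Bundle.Trivialization.symmL_apply _ hb] at this
    exact this
  rw [h4, h5, h5]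
  rfl

lemma covectorNorm_symm {ν₀ : Cotangent n L} {e : CotModel n}
    (he : e ∈ (extChartAt (cotangentModel n) ν₀).target) :
    covectorNorm g ((extChartAt (cotangentModel n) ν₀).symm e) =
      √(e.2 ((metricCoord g ν₀.proj e.1).inverse e.2)) := by
  have he1 := mem_cotangent_target.1 he
  rw [← (isInner_metricCoord g he1).dualNorm_eq, covectorNorm_eq, extChartAt_cotangent_symm_proj he]
  have h1 : e.2 = (covec ((extChartAt (cotangentModel n) ν₀).symm e)).comp
      (md 𝓘(ℝ, EuclideanSpace ℝ (Fin n)) (𝓡 n) (extChartAt (𝓡 n) ν₀.proj).symm e.1) :=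
    ContinuousLinearMap.ext fun v => (covec_extChartAt_cotangent_symm he v).symm
  rw [h1]
  exact (dualNorm_comp (bijective_md_extChartAt_symm he1).2 (fun _ _ => rfl) _).symm

lemma continuous_covectorNorm : Continuous (covectorNorm g) := by
  rw [continuous_iff_continuousAt]
  intro ν₀
  set φ := extChartAt (cotangentModel n) ν₀ with hφ
  have hG : ContinuousAt (fun e : CotModel n => metricCoord g ν₀.proj e.1) (φ ν₀) := by
    refine ContinuousAt.comp (f := Prod.fst) (g := metricCoord g ν₀.proj) ?_ continuousAt_fst
    rw [hφ, extChartAt_cotangent_apply (mem_extChartAt_source _)]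
    exact continuousAt_metricCoord g ν₀.proj
  have hinv : (metricCoord g ν₀.proj (φ ν₀).1).IsInvertible :=
    (isInner_metricCoord g (mem_cotangent_target.1 (mem_extChartAt_target ν₀))).isInvertible
  have hI : ContinuousAt (fun e : CotModel n => (metricCoord g ν₀.proj e.1).inverse) (φ ν₀) := by
    obtain ⟨T, hT⟩ := hinv
    have h := (contDiffAt_map_inverse (𝕜 := ℝ) (n := 0) T).continuousAt
    rw [hT] at h
    exact ContinuousAt.comp (f := fun e : CotModel n => metricCoord g ν₀.proj e.1)
      (g := ContinuousLinearMap.inverse) h hG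
  have h1 : ContinuousAt (fun e : CotModel n =>
      √(e.2 ((metricCoord g ν₀.proj e.1).inverse e.2))) (φ ν₀) :=
    Real.continuous_sqrt.continuousAt.comp
      (continuousAt_snd.clm_apply (hI.clm_apply continuousAt_snd))
  refine (ContinuousAt.comp (f := φ) h1 (continuousAt_extChartAt ν₀)).congr ?_
  filter_upwards [extChartAt_source_mem_nhds (I := cotangentModel n) ν₀] with ν hν
  change √((φ ν).2 ((metricCoord g ν₀.proj (φ ν).1).inverse (φ ν).2)) = _
  rw [← covectorNorm_symm g (φ.map_source hν), φ.left_inv hν]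

lemma isOpen_diskBundle (c : ℝ) : IsOpen (diskBundle g c) :=
  isOpen_lt (continuous_covectorNorm g) continuous_const

end CovectorNorm

/-! ### Separation and countability of T*L. -/

section CotangentTopology

variable {n : ℕ} {L : Type*} [TopologicalSpace L] [ChartedSpace (EuclideanSpace ℝ (Fin n)) L]
  [IsManifold (𝓡 n) ∞ L]

/-- Covectors over the same point lie in a common chart; covectors over different points are
separated in the base. -/
instance instT2SpaceCotangent [T2Space L] : T2Space (Cotangent n L) := by
  refine ⟨fun ν η hne => ?_⟩
  by_cases h : ν.proj = η.proj
  · set φ := extChartAt (cotangentModel n) ν with hφ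
    have hν : ν ∈ φ.source := mem_extChartAt_source ν
    have hη : η ∈ φ.source := mem_cotangent_source.2 (by rw [← h]; exact mem_extChartAt_source _)
    obtain ⟨U, V, hU, hV, hνU, hηV, hd⟩ := t2_separation (fun h => hne (φ.injOn hν hη h))
    refine ⟨φ.source ∩ φ ⁻¹' U, φ.source ∩ φ ⁻¹' V,
      (continuousOn_extChartAt ν).isOpen_inter_preimage (isOpen_extChartAt_source ν) hU,
      (continuousOn_extChartAt ν).isOpen_inter_preimage (isOpen_extChartAt_source ν) hV,
      ⟨hν, hνU⟩, ⟨hη, hηV⟩, ?_⟩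
    rw [Set.disjoint_left] at hd ⊢
    exact fun x hx hx' => hd hx.2 hx'.2
  · obtain ⟨U, V, hU, hV, hνU, hηV, hd⟩ := t2_separation h
    have hc : Continuous fun ν : Cotangent n L => ν.proj := contMDiff_proj.continuous
    refine ⟨_, _, hU.preimage hc, hV.preimage hc, hνU, hηV, ?_⟩
    exact hd.preimage _

/-- Chart domains of T*L are preimages of chart domains of L, so countably many of them suffice. -/
instance instSecondCountableCotangent [SecondCountableTopology L] :
    SecondCountableTopology (Cotangent n L) := by
  obtain ⟨s, hs, hcov⟩ := countable_cover_nhds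
    (fun q : L => (isOpen_extChartAt_source (I := 𝓡 n) q).mem_nhds (mem_extChartAt_source q))
  have : ProperSpace (EuclideanSpace ℝ (Fin n) →L[ℝ] ℝ) :=
    FiniteDimensional.proper_real _
  have h1 : SecondCountableTopology (EuclideanSpace ℝ (Fin n) →L[ℝ] ℝ) :=
    secondCountable_of_proper
  have h2 : SecondCountableTopology (EuclideanSpace ℝ (Fin n)) := secondCountable_of_proper
  have : SecondCountableTopology
      (ModelProd (EuclideanSpace ℝ (Fin n)) (EuclideanSpace ℝ (Fin n) →L[ℝ] ℝ)) :=
    @TopologicalSpace.instSecondCountableTopologyProd _ _ _ _ h2 h1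
  refine ChartedSpace.secondCountable_of_countable_cover
    (ModelProd (EuclideanSpace ℝ (Fin n)) (EuclideanSpace ℝ (Fin n) →L[ℝ] ℝ))
    (s := (fun q => mkCovec q 0) '' s) ?_ (hs.image _)
  rw [eq_univ_iff_forall]
  intro ν
  have h := hcov.symm.subset (mem_univ ν.proj)
  obtain ⟨q, hq, hνq⟩ := mem_iUnion₂.1 h
  refine mem_iUnion₂.2 ⟨mkCovec q 0, mem_image_of_mem _ hq, ?_⟩
  rw [← extChartAt_source (cotangentModel n)]
  exact mem_cotangent_source.2 hνq

end CotangentTopology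

end OvertwistedBox

end

noncomputable section
namespace OvertwistedBox

set_option linter.unusedSectionVars false

open Set Topology Filter

/-! ### Passing from the interior of the disc to its boundary. -/

section Density

/-- Two functions which agree on a set agree at the points of its closure where both are
continuous. -/
lemma eq_of_mem_closure {X Y : Type*} [TopologicalSpace X] [TopologicalSpace Y] [T2Space Y]
    {f g : X → Y} {x : X} {Q U : Set X} (hf : ContinuousAt f x) (hg : ContinuousAt g x)
    (hU : U ∈ 𝓝 x) (hx : x ∈ closure Q) (h : ∀ y ∈ U, y ∈ Q → f y = g y) : f x = g x := by
  have : (𝓝[Q] x).NeBot := mem_closure_iff_nhdsWithin_neBot.1 hx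
  refine tendsto_nhds_unique (l := 𝓝[Q] x) (hf.mono_left nhdsWithin_le_nhds) ?_
  refine (hg.mono_left nhdsWithin_le_nhds : Tendsto g (𝓝[Q] x) _).congr' ?_
  filter_upwards [mem_nhdsWithin_of_mem_nhds hU, self_mem_nhdsWithin] with y h1 h2
  exact (h y h1 h2).symm

/-- The embedding is controlled only over the closed disc, whereas derivatives at boundary points
see a full neighbourhood. On the open set Q the derivatives agree, and continuity of derivatives
extends this to the closure. -/
lemma fderiv_eq_of_mem_closure {E F : Type*} [NormedAddCommGroup E] [NormedSpace ℝ E]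
    [NormedAddCommGroup F] [NormedSpace ℝ F] {f g : E → F} {x : E} {Q U : Set E}
    (hf : ContDiffAt ℝ ∞ f x) (hg : ContDiffAt ℝ ∞ g x) (hU : U ∈ 𝓝 x) (hQ : IsOpen Q)
    (hx : x ∈ closure Q) (h : ∀ y ∈ U, y ∈ Q → f y = g y) : fderiv ℝ f x = fderiv ℝ g x := by
  refine eq_of_mem_closure (hf.fderiv_right (m := ∞) (by simp)).continuousAt
    (hg.fderiv_right (m := ∞) (by simp)).continuousAt (interior_mem_nhds.2 hU) hx fun y hyU hyQ => ?_
  refine Filter.EventuallyEq.fderiv_eq ?_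
  filter_upwards [isOpen_interior.mem_nhds hyU, hQ.mem_nhds hyQ] with z h1 h2
  exact h z (interior_subset h1) h2

/-- An open dense subset of the disc of radius `π` on which `r sin r dϑ` does not vanish. -/
def innerSet : Set Plane := {x | ‖x‖ < Real.pi ∧ x 0 ≠ 0}

lemma isOpen_innerSet : IsOpen innerSet :=
  (isOpen_lt continuous_norm continuous_const).inter
    (isOpen_ne_fun (contDiff_coord 0).continuous continuous_const)

lemma closedBall_subset_closure_innerSet :
    Metric.closedBall (0 : Plane) Real.pi ⊆ closure innerSet := by
  have hd : Dense {x : Plane | x 0 ≠ 0} := by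
    have hs : Function.Surjective (EuclideanSpace.proj (𝕜 := ℝ) (0 : Fin 2)) := fun r =>
      ⟨!₂[r, 0], by simp⟩
    exact (dense_compl_singleton (0 : ℝ)).preimage
      ((EuclideanSpace.proj (𝕜 := ℝ) (0 : Fin 2)).isOpenMap hs)
  rw [← closure_ball _ Real.pi_ne_zero]
  refine closure_minimal ?_ isClosed_closure
  refine (hd.open_subset_closure_inter Metric.isOpen_ball).trans (closure_mono ?_)
  rintro x ⟨hx, hx0⟩
  exact ⟨by simpa using hx, hx0⟩

lemma fst_mem_closure {Y : Type*} [TopologicalSpace Y] {e : Plane × Y} (he : ‖e.1‖ ≤ Real.pi) :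
    e ∈ closure (Prod.fst ⁻¹' innerSet : Set (Plane × Y)) := by
  rw [← isOpenMap_fst.preimage_closure_eq_closure_preimage continuous_fst]
  exact closedBall_subset_closure_innerSet (by simpa using he)

lemma sincSqrt_radSq_pos {x : Plane} (hx : ‖x‖ < Real.pi) : 0 < sincSqrt (radSq x) := by
  rw [← sinc_norm]
  by_cases h : ‖x‖ = 0
  · rw [h]; simp
  · rw [Real.sinc_of_ne_zero h]
    have hp : 0 < ‖x‖ := lt_of_le_of_ne (norm_nonneg x) (Ne.symm h)
    exact div_pos (Real.sin_pos_of_pos_of_lt_pi hp hx) hp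

end Density

/-! ### Smooth division of one-forms by β. -/

section Division

variable {n : ℕ}

lemma exists_eq_smul_of_ker {V : Type*} [NormedAddCommGroup V] [NormedSpace ℝ V]
    {a b : V →L[ℝ] ℝ} (h : ∀ v, b v = 0 ↔ a v = 0) : ∃ c : ℝ, c ≠ 0 ∧ b = c • a := by
  by_cases ha : a = 0
  · refine ⟨1, one_ne_zero, ?_⟩
    ext v
    have := (h v).2 (by simp [ha])
    simp [this, ha]
  · obtain ⟨w, hw⟩ : ∃ w, a w ≠ 0 := by
      by_contra! h'
      exact ha (ContinuousLinearMap.ext h')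
    have hR : a ((a w)⁻¹ • w) = 1 := by rw [map_smul, smul_eq_mul, inv_mul_cancel₀ hw]
    refine ⟨b ((a w)⁻¹ • w), fun h0 => ?_, ?_⟩
    · rw [h, hR] at h0
      exact one_ne_zero h0
    · ext v
      exact eq_mul_of_forall_ker b (fun v hv => (h v).2 hv) hR v

/-- On the dense open part, b is some multiple of β, and testing on `v` identifies the multiple as F
/ s. Both sides are continuous, so the identity persists on the closed disc. -/
lemma eq_smul_betaCoord_of_quotient {b : Plane × CotModel n → Plane × CotModel n →L[ℝ] ℝ}
    {W : Set (Plane × CotModel n)} (hW : IsOpen W)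
    (hb : ∀ e ∈ W, ContDiffAt ℝ ∞ b e)
    (hker : ∀ e ∈ W, ‖e.1‖ ≤ Real.pi → ∀ v, b e v = 0 ↔ betaCoord e v = 0)
    {w F s : Plane × CotModel n → ℝ} {v : Plane × CotModel n → Plane × CotModel n}
    (hF : ∀ e ∈ W, ContDiffAt ℝ ∞ F e) (hs : ∀ e ∈ W, ContDiffAt ℝ ∞ s e)
    (hs0 : ∀ e ∈ W, s e ≠ 0) (hBF : ∀ e ∈ W, b e (v e) = w e * F e)
    (hβ : ∀ e ∈ W, betaCoord e (v e) = w e * s e)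
    (hw : ∀ e ∈ W, e.1 ∈ innerSet → w e ≠ 0) :
    ∀ e ∈ W, ‖e.1‖ ≤ Real.pi → b e = (F e / s e) • betaCoord e := by
  intro e he hpi
  refine eq_of_mem_closure (hb e he).continuousAt
    (contDiffAt_smul' ((hF e he).div (hs e he) (hs0 e he)) contDiff_betaCoord.contDiffAt).continuousAt
    (hW.mem_nhds he) (fst_mem_closure hpi) fun y hy hyQ => ?_
  obtain ⟨c, -, hc⟩ := exists_eq_smul_of_ker (hker y hy hyQ.1.le)
  have h1 := hBF y hy
  rw [hc, smul_apply, smul_eq_mul, hβ y hy] at h1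
  have h2 : F y = c * s y := by
    apply mul_left_cancel₀ (hw y hy hyQ)
    linarith
  rw [hc, Pi.div_apply, h2, mul_div_cancel_right₀ _ (hs0 y hy)]

/-- A form with the kernel of `β` is a smooth multiple of `β`. -/
lemma exists_smooth_factor {b : Plane × CotModel n → Plane × CotModel n →L[ℝ] ℝ}
    {U : Set (Plane × CotModel n)} (hU : IsOpen U) {e₀ : Plane × CotModel n} (he₀ : e₀ ∈ U)
    (hpi : ‖e₀.1‖ ≤ Real.pi) (hb : ∀ e ∈ U, ContDiffAt ℝ ∞ b e)
    (hker : ∀ e ∈ U, ‖e.1‖ ≤ Real.pi → ∀ v, b e v = 0 ↔ betaCoord e v = 0) :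
    ∃ (f : Plane × CotModel n → ℝ) (W : Set (Plane × CotModel n)), IsOpen W ∧ e₀ ∈ W ∧ W ⊆ U ∧
      (∀ e ∈ W, ContDiffAt ℝ ∞ f e) ∧ ∀ e ∈ W, ‖e.1‖ ≤ Real.pi → b e = f e • betaCoord e := by
  have hcoord : ∀ i, ContDiff ℝ ∞ fun e : Plane × CotModel n => e.1 i := fun i =>
    (contDiff_coord i).comp contDiff_fst
  have hrad : ContDiff ℝ ∞ fun e : Plane × CotModel n => radSq e.1 := contDiff_radSq.comp contDiff_fst
  -- Where β ≠ 0, the factor is the quotient of the values on one fixed vector. In the closed disc β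
  -- vanishes only for p = 0 together with r = 0 or r = π, and these two cases call for genuine
  -- division.
  by_cases hβ : betaCoord e₀ = 0
  swap
  · obtain ⟨v, hv⟩ : ∃ v, betaCoord e₀ v ≠ 0 := by
      by_contra! h'
      exact hβ (ContinuousLinearMap.ext h')
    have hs : ContDiff ℝ ∞ fun e => betaCoord e v := contDiff_betaCoord.clm_apply contDiff_const
    have hO : IsOpen {e : Plane × CotModel n | betaCoord e v ≠ 0} :=
      isOpen_ne_fun hs.continuous continuous_const
    have hbv : ∀ e ∈ U, ContDiffAt ℝ ∞ (fun e => b e v) e := fun e he =>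
      (hb e he).clm_apply contDiffAt_const
    refine ⟨fun e => b e v / betaCoord e v, U ∩ {e | betaCoord e v ≠ 0}, hU.inter hO, ⟨he₀, hv⟩,
      inter_subset_left, fun e he => (hbv e he.1).div hs.contDiffAt he.2, fun e he hp => ?_⟩
    obtain ⟨c, -, hc⟩ := exists_eq_smul_of_ker (hker e he.1 hp)
    have he2 : betaCoord e v ≠ 0 := he.2
    change b e = (b e v / betaCoord e v) • betaCoord e
    rw [hc, smul_apply, smul_eq_mul, mul_div_cancel_right₀ _ he2]
  · by_cases hx : e₀.1 = 0
    · -- the centre of the disc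
      set ρ : Plane × CotModel n → Plane × CotModel n := fun e => (e.1 1 • !₂[0, 1], e.2) with hρ
      have hρs : ContDiff ℝ ∞ ρ := ((hcoord 1).smul contDiff_const).prodMk contDiff_snd
      set D : Set (Plane × CotModel n) := U ∩ (ρ ⁻¹' U ∩ {e | ‖e.1‖ < Real.pi}) with hD
      have hDo : IsOpen D := hU.inter ((hU.preimage hρs.continuous).inter
        (isOpen_lt (by fun_prop) continuous_const))
      have hρ0 : ρ e₀ = e₀ := by
        rw [hρ]; ext i <;> simp [hx]
      have hwD : ∀ e, ‖(ρ e).1‖ ≤ ‖e.1‖ := fun e => by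
        rw [← sq_le_sq₀ (norm_nonneg _) (norm_nonneg _), norm_sq_eq_radSq, norm_sq_eq_radSq]
        simp [hρ, radSq]
        positivity
      -- β(∂₁) = x₀ sin r / r vanishes on the line x₀ = 0, hence b(∂₁) vanishes there too and is
      -- divisible by x₀. Here ρ is the projection to that line.
      obtain ⟨F, W, hW, heW, hWD, hF⟩ := exists_smooth_quotient (a := e₀) (D := D)
        (B := fun e => b e (!₂[0, 1], 0)) (w := fun e => e.1 0) (ρ := ρ)
        (e := fun _ => (!₂[1, 0], 0)) hDo
        ⟨he₀, by rw [mem_preimage, hρ0]; exact he₀, by rw [mem_ofPred_eq, hx]; simp [Real.pi_pos]⟩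
        (fun e he => (hb e he.1).clm_apply contDiffAt_const) (fun e _ => (hcoord 0).contDiffAt)
        (fun e _ => hρs.contDiffAt) (fun e _ => contDiffAt_const)
        (fun e _ => by
          refine Prod.ext ?_ (by simp [hρ])
          ext i; fin_cases i <;> simp [hρ])
        (fun e he => by
          rw [hker _ he.2.1 ((hwD e).trans (le_of_lt he.2.2)), betaCoord_apply]
          simp [hρ])
        (by simp [hx])
      have hs : ContDiff ℝ ∞ fun e : Plane × CotModel n => sincSqrt (radSq e.1) :=
        contDiff_sincSqrt.comp hrad
      refine ⟨fun e => F e / sincSqrt (radSq e.1), W, hW, heW, fun e he => (hWD he).1,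
        fun e he => (hF e he).1.div hs.contDiffAt (sincSqrt_radSq_pos (hWD he).2.2).ne', ?_⟩
      refine eq_smul_betaCoord_of_quotient (v := fun _ => (!₂[0, 1], 0)) (w := fun e => e.1 0) hW
        (fun e he => hb e (hWD he).1) (fun e he => hker e (hWD he).1) (fun e he => (hF e he).1)
        (fun e he => hs.contDiffAt) (fun e he => (sincSqrt_radSq_pos (hWD he).2.2).ne')
        (fun e he => (hF e he).2) (fun e he => ?_) fun e _ h => h.2
      rw [betaCoord_apply]
      simp
      ring
    · -- the boundary of the disc
      have hr0 : 0 < ‖e₀.1‖ := norm_pos_iff.2 hx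
      have hrpi : ‖e₀.1‖ = Real.pi := by
        by_contra hne
        have hlt : ‖e₀.1‖ < Real.pi := lt_of_le_of_ne hpi hne
        have h1 := congrArg (fun T : Plane × CotModel n →L[ℝ] ℝ => T (!₂[-e₀.1 1, e₀.1 0], 0)) hβ
        simp only [betaCoord_apply] at h1
        have h2 := sincSqrt_radSq_pos hlt
        have h3 : 0 < radSq e₀.1 := by rw [← norm_sq_eq_radSq]; positivity
        have h4 : sincSqrt (radSq e₀.1) * radSq e₀.1 = 0 := by
          have h5 : sincSqrt (radSq e₀.1) * (e₀.1 0 * e₀.1 0 - e₀.1 1 * -e₀.1 1) -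
            e₀.2.2 (0 : CotModel n).1 = 0 := h1
          rw [Prod.fst_zero, map_zero] at h5
          rw [radSq] at h5 ⊢
          linear_combination h5
        exact (mul_pos h2 h3).ne' h4
      set r : Plane × CotModel n → ℝ := fun e => ‖e.1‖ with hr
      have hrc : Continuous r := continuous_norm.comp continuous_fst
      have hrs : ∀ e : Plane × CotModel n, 0 < r e → ContDiffAt ℝ ∞ r e := fun e he =>
        contDiffAt_fst.norm ℝ (norm_pos_iff.1 he)
      set ρ : Plane × CotModel n → Plane × CotModel n := fun e => ((Real.pi / r e) • e.1, e.2)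
        with hρ
      have hρs : ∀ e : Plane × CotModel n, 0 < r e → ContDiffAt ℝ ∞ ρ e := fun e he =>
        ((contDiffAt_const.div (hrs e he) he.ne').smul contDiffAt_fst).prodMk contDiffAt_snd
      set D₁ : Set (Plane × CotModel n) := {e | 0 < r e} with hD₁
      have hD₁o : IsOpen D₁ := isOpen_lt continuous_const hrc
      set D : Set (Plane × CotModel n) := U ∩ (D₁ ∩ ρ ⁻¹' U) with hD
      have hDo : IsOpen D := hU.inter (ContinuousOn.isOpen_inter_preimage
        (fun e he => (hρs e he).continuousAt.continuousWithinAt) hD₁o hU)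
      have hρ0 : ρ e₀ = e₀ := by
        rw [hρ]; simp only [hr, hrpi, div_self Real.pi_ne_zero, one_smul]
      have hρn : ∀ e, 0 < r e → ‖(ρ e).1‖ = Real.pi := fun e he => by
        rw [hρ]
        simp only [norm_smul, norm_div, Real.norm_of_nonneg Real.pi_pos.le]
        rw [Real.norm_of_nonneg he.le]
        change Real.pi / r e * r e = Real.pi
        field_simp
      have hvs : ContDiff ℝ ∞ fun e : Plane × CotModel n =>
          (((-e.1 1) • !₂[1, 0] + e.1 0 • !₂[0, 1] : Plane), (0 : CotModel n)) :=
        (((hcoord 1).neg.smul contDiff_const).add ((hcoord 0).smul contDiff_const)).prodMk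
          contDiff_const
      set v : Plane × CotModel n → Plane × CotModel n := fun e =>
        ((-e.1 1) • !₂[1, 0] + e.1 0 • !₂[0, 1], 0) with hv
      have hβv : ∀ e : Plane × CotModel n, betaCoord e (v e) = r e * Real.sin (r e) := fun e => by
        rw [betaCoord_apply, ← mul_sincSqrt_sq, hr]
        simp only
        rw [norm_sq_eq_radSq, ← mul_assoc, ← pow_two, norm_sq_eq_radSq]
        simp [hv, radSq]
        ring
      -- On the rotation field `v`, β takes the value r sin r, which vanishes on the circle r = π.
      -- So b(v) vanishes there and is divisible by r - π; here ρ is the radial projection to the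
      -- circle.
      obtain ⟨F, W, hW, heW, hWD, hF⟩ := exists_smooth_quotient (a := e₀) (D := D)
        (B := fun e => b e (v e)) (w := fun e => r e - Real.pi) (ρ := ρ)
        (e := fun e => ((r e)⁻¹ • e.1, 0)) hDo
        ⟨he₀, hr0, by rw [mem_preimage, hρ0]; exact he₀⟩
        (fun e he => (hb e he.1).clm_apply hvs.contDiffAt)
        (fun e he => (hrs e he.2.1).sub contDiffAt_const)
        (fun e he => hρs e he.2.1)
        (fun e he => ((((hrs e he.2.1).inv he.2.1.ne')).smul contDiffAt_fst).prodMk contDiffAt_const)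
        (fun e he => by
          have hre : r e ≠ 0 := he.2.1.ne'
          refine Prod.ext ?_ (by simp [hρ])
          simp only [hρ, Prod.fst_add, Prod.smul_fst, smul_smul, ← add_smul]
          rw [show Real.pi / r e + (r e - Real.pi) * (r e)⁻¹ = 1 by field_simp; ring, one_smul])
        (fun e he => by
          rw [hker _ he.2.2 (hρn e he.2.1).le, hβv]
          rw [show r (ρ e) = Real.pi from hρn e he.2.1, Real.sin_pi, mul_zero])
        (by simp [hr, hrpi])
      -- From sin r = -sin (r - π) one gets r sin r = (r - π) s, where s = -π on the circle.
      set s : Plane × CotModel n → ℝ := fun e => -(r e * sincSqrt ((r e - Real.pi) ^ 2)) with hs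
      have hss : ∀ e, 0 < r e → ContDiffAt ℝ ∞ s e := fun e he =>
        ((hrs e he).mul (contDiff_sincSqrt.contDiffAt.comp e
          (((hrs e he).sub contDiffAt_const).pow 2))).neg
      have hsc : ContinuousAt s e₀ := (hss e₀ hr0).continuousAt
      have hs0 : s e₀ ≠ 0 := by
        simp only [hs, hr, hrpi]
        rw [sub_self, sincSqrt_sq]
        simp [Real.pi_ne_zero]
      obtain ⟨W', hW'sub, hW'o, heW'⟩ := mem_nhds_iff.1 (hsc.eventually_ne hs0)
      have hWD' : ∀ e ∈ W ∩ W', e ∈ D := fun e he => hWD he.1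
      refine ⟨fun e => F e / s e, W ∩ W', hW.inter hW'o, ⟨heW, heW'⟩, fun e he => (hWD' e he).1,
        fun e he => (hF e he.1).1.div (hss e (hWD' e he).2.1) (hW'sub he.2), ?_⟩
      refine eq_smul_betaCoord_of_quotient (v := v) (w := fun e => r e - Real.pi) (hW.inter hW'o)
        (fun e he => hb e (hWD' e he).1) (fun e he => hker e (hWD' e he).1)
        (fun e he => (hF e he.1).1) (fun e he => hss e (hWD' e he).2.1) (fun e he => hW'sub he.2)
        (fun e he => (hF e he.1).2) (fun e he => ?_) fun e _ h => (sub_neg.2 h.1).ne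
      rw [hβv]
      simp only [hs]
      have h1 := mul_sincSqrt_sq (r e - Real.pi)
      rw [Real.sin_sub_pi] at h1
      linear_combination r e * h1

end Division

end OvertwistedBox

end

noncomputable section
namespace OvertwistedBox

set_option linter.unusedSectionVars false

open Set Topology Filter

/-! ### Rescaling of contact forms. -/

section FormAlgebra

variable {E : Type} {H X : Type*} [NormedAddCommGroup E] [NormedSpace ℝ E] [FiniteDimensional ℝ E]
  [TopologicalSpace H] {I : ModelWithCorners ℝ E H} [TopologicalSpace X] [ChartedSpace H X]
  [I.Boundaryless] [IsManifold I ∞ X]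

lemma pullForm_extChartAt_model (a : E → E →L[ℝ] ℝ) (y : E) :
    pullForm 𝓘(ℝ, E) 𝓘(ℝ, E) a (extChartAt 𝓘(ℝ, E) y).symm = a := by
  funext e
  rw [extChartAt_model_space_eq_id, pullForm, md_eq_fderiv]
  change (a e).comp (fderiv ℝ (fun x => x) e) = a e
  rw [fderiv_fun_id, ContinuousLinearMap.comp_id]

lemma smoothFormAt_model {a : E → E →L[ℝ] ℝ} {y : E} :
    SmoothFormAt 𝓘(ℝ, E) a y ↔ ContDiffAt ℝ ∞ a y := by
  rw [SmoothFormAt, pullForm_extChartAt_model, extChartAt_model_space_eq_id]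
  rfl

lemma dForm_model (a : E → E →L[ℝ] ℝ) (y : E) : dForm 𝓘(ℝ, E) a y = dOne a y := by
  rw [dForm, pullForm_extChartAt_model, extChartAt_model_space_eq_id]
  rfl

lemma contDiffAt_comp_extChartAt_symm {f : X → ℝ} {x : X} (hf : ContMDiffAt I 𝓘(ℝ, ℝ) ∞ f x) :
    ContDiffAt ℝ ∞ (fun e => f ((extChartAt I x).symm e)) (extChartAt I x x) := by
  have hf' : ContMDiffAt I 𝓘(ℝ, ℝ) ∞ f ((extChartAt I x).symm (extChartAt I x x)) := by
    rwa [extChartAt_to_inv]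
  exact (hf'.comp _ (contMDiffAt_extChartAt_symm' (mem_extChartAt_target x))).contDiffAt

lemma SmoothFormAt.smul {α : OneForm E X} {f : X → ℝ} {x : X} (hα : SmoothFormAt I α x)
    (hf : ContMDiffAt I 𝓘(ℝ, ℝ) ∞ f x) : SmoothFormAt I (fun y => f y • α y) x :=
  ContDiffAt.congr_of_eventuallyEq (contDiffAt_smul' (contDiffAt_comp_extChartAt_symm hf) hα)
    (Eventually.of_forall fun _ => rfl)

/-- d(fα) = df ∧ α + f dα, and the first term vanishes on ker α. -/
lemma dForm_smul {α : OneForm E X} {f : X → ℝ} {x : X} (hα : SmoothFormAt I α x)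
    (hf : ContMDiffAt I 𝓘(ℝ, ℝ) ∞ f x) {u v : E} (hu : α x u = 0) (hv : α x v = 0) :
    dForm I (fun y => f y • α y) x u v = f x * dForm I α x u v := by
  set φ := extChartAt I x with hφ
  have h1 := ((contDiffAt_comp_extChartAt_symm hf).differentiableAt (by simp)).hasFDerivAt
  have h2 := (ContDiffAt.differentiableAt hα (by simp)).hasFDerivAt
  have h3 : HasFDerivAt (pullForm 𝓘(ℝ, E) I (fun y => f y • α y) φ.symm) _ (φ x) :=
    HasFDerivAt.fun_smul (𝕜' := ℝ) h1 h2
  have hx : φ.symm (φ x) = x := extChartAt_to_inv x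
  have hα0 : ∀ w, pullForm 𝓘(ℝ, E) I α φ.symm (φ x) w = α x w := fun w => by
    rw [pullForm_apply, md_extChartAt_symm_self, hx]; rfl
  rw [dForm, dForm, dOne_apply, dOne_apply, h3.fderiv]
  simp only [add_apply, smul_apply, ContinuousLinearMap.smulRight_apply, smul_eq_mul]
  rw [← hφ, hα0, hα0, hu, hv, hx]
  ring

lemma isContactPair_smul {α : OneForm E X} {f : X → ℝ} {x : X} (hα : SmoothFormAt I α x)
    (hf : ContMDiffAt I 𝓘(ℝ, ℝ) ∞ f x) (h0 : f x ≠ 0)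
    (hc : IsContactPair (α x) (dForm I α x)) :
    IsContactPair (f x • α x) (dForm I (fun y => f y • α y) x) := by
  refine ⟨smul_ne_zero h0 hc.1, fun u hu hu0 => ?_⟩
  have hu' : α x u = 0 := by simpa [h0] using hu
  obtain ⟨v, hv, hv'⟩ := hc.2 u hu' hu0
  refine ⟨v, by simp [hv], ?_⟩
  rw [dForm_smul hα hf hu' hv]
  exact mul_ne_zero h0 hv'

end FormAlgebra

/-! ### Local contact forms of a contact structure. -/

section LocalContactForm

variable {m : ℕ} {M : Type*} [TopologicalSpace M] [ChartedSpace (EuclideanSpace ℝ (Fin m)) M]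
  [IsManifold (𝓡 m) ∞ M]

/-- `α` is, on `O`, a contact form with kernel `ξ`. -/
def IsContactFormOn (ξ : ∀ x : M, Submodule ℝ (TangentSpace (𝓡 m) x))
    (α : OneForm (EuclideanSpace ℝ (Fin m)) M) (O : Set M) : Prop :=
  ∀ y ∈ O, SmoothFormAt (𝓡 m) α y ∧ IsContactPair (α y) (dForm (𝓡 m) α y) ∧
    ∀ v : EuclideanSpace ℝ (Fin m), v ∈ ξ y ↔ α y v = 0

lemma exists_local_contact_form {ξ : ∀ x : M, Submodule ℝ (TangentSpace (𝓡 m) x)}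
    (hξ : IsContactStructure ξ) (y₀ : M) :
    ∃ (V : Set M) (A : OneForm (EuclideanSpace ℝ (Fin m)) M), IsOpen V ∧ y₀ ∈ V ∧
      IsContactFormOn ξ A V := by
  obtain ⟨V, a, hVo, hyV, hVt, has, ha⟩ := hξ y₀
  set φ := extChartAt (𝓡 m) y₀ with hφ
  refine ⟨φ.source ∩ φ ⁻¹' V, pullForm (𝓡 m) 𝓘(ℝ, EuclideanSpace ℝ (Fin m)) a φ,
    (continuousOn_extChartAt y₀).isOpen_inter_preimage (isOpen_extChartAt_source y₀) hVo,
    ⟨mem_extChartAt_source y₀, hyV⟩, ?_⟩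
  rintro y ⟨hys, hyV'⟩
  have hyV : φ y ∈ V := hyV'
  have hyt : φ y ∈ φ.target := φ.map_source hys
  have hyy : φ.symm (φ y) = y := φ.left_inv hys
  have hs : SmoothFormAt 𝓘(ℝ, EuclideanSpace ℝ (Fin m)) a (φ y) :=
    smoothFormAt_model.2 (has.contDiffAt (hVo.mem_nhds hyV))
  have hφs : ContMDiffAt (𝓡 m) 𝓘(ℝ, EuclideanSpace ℝ (Fin m)) ∞ φ y :=
    contMDiffAt_extChartAt' (by rwa [← extChartAt_source (𝓡 m)])
  have hbij : Function.Bijective (md (𝓡 m) 𝓘(ℝ, EuclideanSpace ℝ (Fin m)) φ y) := by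
    have := bijective_md_extChartAt (I := 𝓡 m) (a := y₀) hyt
    rwa [← hφ, hyy] at this
  obtain ⟨hk, hne, hnd⟩ := ha (φ y) hyV
  refine ⟨hs.pullForm hφs, ?_, fun v => ?_⟩
  · have hc : IsContactPair (a (φ y)) (dOne a (φ y)) :=
      ⟨hne, fun u hu hu0 => by
        obtain ⟨v, hv, hv'⟩ := hnd u hu hu0
        exact ⟨v, hv, by rwa [dOne_apply]⟩⟩
    refine hc.comp hbij fun u v => ?_
    rw [dForm_pullForm hs hφs, dForm_model]
  · have h1 := hk (md (𝓡 m) 𝓘(ℝ, EuclideanSpace ℝ (Fin m)) φ y v)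
    have h2 := congrArg (fun T : EuclideanSpace ℝ (Fin m) →L[ℝ] EuclideanSpace ℝ (Fin m) => T v)
      (md_extChartAt_symm_comp (I := 𝓡 m) (x₀ := y₀) hyt)
    simp only [← hφ, hyy] at h2
    have h3 : mfderiv 𝓘(ℝ, EuclideanSpace ℝ (Fin m)) (𝓡 m) φ.symm (φ y)
      (md (𝓡 m) 𝓘(ℝ, EuclideanSpace ℝ (Fin m)) φ y v) = v := h2
    rw [h3] at h1
    rw [pullForm_apply, ← h1]
    constructor
    · intro h; exact hyy.symm ▸ h
    · intro h; exact hyy ▸ h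

end LocalContactForm

/-! ### Local left inverses of immersions. -/

section Retraction

variable {E ES : Type} {H HS X S : Type*}
  [NormedAddCommGroup E] [NormedSpace ℝ E] [FiniteDimensional ℝ E]
  [TopologicalSpace H] {I : ModelWithCorners ℝ E H} [TopologicalSpace X] [ChartedSpace H X]
  [I.Boundaryless] [IsManifold I ∞ X]
  [NormedAddCommGroup ES] [NormedSpace ℝ ES] [FiniteDimensional ℝ ES]
  [TopologicalSpace HS] {IS : ModelWithCorners ℝ ES HS} [TopologicalSpace S] [ChartedSpace HS S]
  [IS.Boundaryless] [IsManifold IS ∞ S]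

lemma exists_continuous_leftInverse {D : ES →L[ℝ] E} (hD : Function.Injective D) :
    ∃ Q : E →L[ℝ] ES, Q.comp D = ContinuousLinearMap.id ℝ ES := by
  obtain ⟨q, hq⟩ := LinearMap.exists_leftInverse_of_injective (D : ES →ₗ[ℝ] E)
    (LinearMap.ker_eq_bot.2 hD)
  refine ⟨LinearMap.toContinuousLinearMap q, ?_⟩
  ext v
  exact congrArg (fun T : ES →ₗ[ℝ] ES => T v) hq

/-- A smooth map from a normed space to itself with invertible differential has a smooth local
inverse. -/
lemma exists_smooth_local_inverse {P : ES → ES} {U : Set ES} (hU : IsOpen U) {e₀ : ES}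
    (he₀ : e₀ ∈ U) (hP : ∀ e ∈ U, ContDiffAt ℝ ∞ P e)
    (hd : HasFDerivAt P (ContinuousLinearMap.id ℝ ES) e₀) :
    ∃ (k : ES → ES) (T W : Set ES), IsOpen T ∧ IsOpen W ∧ e₀ ∈ W ∧ W ⊆ U ∧
      (∀ y ∈ T, ContDiffAt ℝ ∞ k y) ∧ ∀ e ∈ W, P e ∈ T ∧ k (P e) = e := by
  have : CompleteSpace ES := FiniteDimensional.complete ℝ ES
  have hd' : HasFDerivAt P ((ContinuousLinearEquiv.refl ℝ ES : ES ≃L[ℝ] ES) : ES →L[ℝ] ES) e₀ := hd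
  set F := (hP e₀ he₀).toOpenPartialHomeomorph P hd' (by simp) with hF
  have hFc : ⇑F = P := rfl
  have hsrc : e₀ ∈ F.source := (hP e₀ he₀).mem_toOpenPartialHomeomorph_source hd' (by simp)
  set U' : Set ES := U ∩ {e | fderiv ℝ P e ∈ range
    (ContinuousLinearEquiv.toContinuousLinearMap : (ES ≃L[ℝ] ES) → ES →L[ℝ] ES)} with hU'
  have hU'o : IsOpen U' := by
    refine ContinuousOn.isOpen_inter_preimage (f := fderiv ℝ P) (fun e he =>
      ((hP e he).fderiv_right (m := ∞) (by simp)).continuousAt.continuousWithinAt) hU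
      ContinuousLinearEquiv.isOpen
  have he₀' : e₀ ∈ U' := ⟨he₀, ContinuousLinearEquiv.refl ℝ ES, hd'.fderiv.symm⟩
  refine ⟨F.symm, F.target ∩ F.symm ⁻¹' U', F.source ∩ U',
    F.symm.continuousOn.isOpen_inter_preimage F.open_target hU'o, F.open_source.inter hU'o,
    ⟨hsrc, he₀'⟩, fun e he => he.2.1, ?_, ?_⟩
  · rintro y ⟨hyt, hyU, T, hT⟩
    refine F.contDiffAt_symm (f₀' := T) hyt ?_ (hP _ hyU)
    rw [hT]
    exact ((hP _ hyU).differentiableAt (by simp)).hasFDerivAt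
  · rintro e ⟨hes, heU⟩
    have h1 : F.symm (P e) = e := F.left_inv hes
    refine ⟨⟨F.map_source hes, ?_⟩, h1⟩
    change F.symm (P e) ∈ U'
    rwa [h1]

/-- A smooth immersion has a smooth local left inverse. -/
lemma exists_local_retraction {f : S → X} {W : Set S} (hW : IsOpen W) {x₀ : S} (hx₀ : x₀ ∈ W)
    (hf : ∀ x ∈ W, ContMDiffAt IS I ∞ f x) (hd : Function.Injective (md IS I f x₀)) :
    ∃ (ℓ : X → ES) (V : Set X) (W' : Set S), IsOpen V ∧ IsOpen W' ∧ x₀ ∈ W' ∧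
      (∀ y ∈ V, ContMDiffAt I 𝓘(ℝ, ES) ∞ ℓ y) ∧
      ∀ x ∈ W', f x ∈ V ∧ ℓ (f x) = extChartAt IS x₀ x := by
  set φ := extChartAt IS x₀ with hφ
  set ψ := extChartAt I (f x₀) with hψ
  -- Followed by a linear left inverse of its differential, the map has identity differential at the
  -- base point and can be inverted locally.
  obtain ⟨Q, hQ⟩ := exists_continuous_leftInverse hd
  set W₁ : Set S := W ∩ f ⁻¹' ψ.source with hW₁
  have hW₁o : IsOpen W₁ := ContinuousOn.isOpen_inter_preimage
    (fun x hx => (hf x hx).continuousAt.continuousWithinAt) hW (isOpen_extChartAt_source _)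
  set U : Set ES := φ.target ∩ φ.symm ⁻¹' W₁ with hU
  have hUo : IsOpen U := (continuousOn_extChartAt_symm x₀).isOpen_inter_preimage
    (isOpen_extChartAt_target x₀) hW₁o
  have hx : φ.symm (φ x₀) = x₀ := extChartAt_to_inv x₀
  have he₀ : φ x₀ ∈ U := ⟨mem_extChartAt_target x₀, by
    rw [mem_preimage, hx]; exact ⟨hx₀, mem_extChartAt_source _⟩⟩
  have hG : ∀ e ∈ U, ContMDiffAt 𝓘(ℝ, ES) I ∞ (fun e => f (φ.symm e)) e := fun e he =>
    ContMDiffAt.comp e (f := φ.symm) (g := f) (hf _ he.2.1) (contMDiffAt_extChartAt_symm' he.1)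
  have hP : ∀ e ∈ U, ContDiffAt ℝ ∞ (fun e => ψ (f (φ.symm e))) e := fun e he =>
    contDiffAt_extChartAt_comp (hG e he) he.2.2
  have hd1 : fderiv ℝ (fun e => ψ (f (φ.symm e))) (φ x₀) = md IS I f x₀ := by
    have h1 : MDifferentiableAt I 𝓘(ℝ, E) ψ (f (φ.symm (φ x₀))) := by
      rw [hx]
      exact (contMDiffAt_extChartAt (n := ∞)).mdifferentiableAt (by simp)
    have h2 : MDifferentiableAt IS I f (φ.symm (φ x₀)) := by
      rw [hx]; exact (hf x₀ hx₀).mdifferentiableAt (by simp)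
    have h3 : MDifferentiableAt 𝓘(ℝ, ES) IS φ.symm (φ x₀) :=
      (contMDiffAt_extChartAt_symm' (mem_extChartAt_target x₀)).mdifferentiableAt (by simp)
    rw [← md_eq_fderiv, md_comp (f := ψ) (g := fun e => f (φ.symm e)) h1 ((hG _ he₀).mdifferentiableAt (by simp)),
      md_comp (f := f) (g := φ.symm) h2 h3, md_extChartAt_symm_self, hx, md_extChartAt_self]
    rfl
  obtain ⟨k, T, W₂, hTo, hW₂o, he₂, hW₂U, hk, hkP⟩ := exists_smooth_local_inverse hUo he₀
    (P := fun e => Q (ψ (f (φ.symm e))))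
    (fun e he => Q.contDiff.contDiffAt.comp e (hP e he)) (by
      have h := ((hP _ he₀).differentiableAt (by simp)).hasFDerivAt
      rw [hd1] at h
      have h' := Q.hasFDerivAt.comp (φ x₀) h
      rw [hQ] at h'
      exact h')
  have hQψ : ContinuousOn (fun y => Q (ψ y)) ψ.source :=
    Q.continuous.comp_continuousOn (continuousOn_extChartAt _)
  refine ⟨fun y => k (Q (ψ y)), ψ.source ∩ (fun y => Q (ψ y)) ⁻¹' T, φ.source ∩ φ ⁻¹' W₂,
    hQψ.isOpen_inter_preimage (isOpen_extChartAt_source _) hTo,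
    (continuousOn_extChartAt x₀).isOpen_inter_preimage (isOpen_extChartAt_source _) hW₂o,
    ⟨mem_extChartAt_source _, he₂⟩, ?_, ?_⟩
  · rintro y ⟨hys, hyT⟩
    have h1 : ContMDiffAt I 𝓘(ℝ, E) ∞ ψ y :=
      contMDiffAt_extChartAt' (by rwa [← extChartAt_source I])
    have h2 : ContDiffAt ℝ ∞ (fun e => k (Q e)) (ψ y) :=
      ContDiffAt.comp (ψ y) (hk _ hyT) Q.contDiff.contDiffAt
    exact ContMDiffAt.comp y (f := ψ) (g := fun e => k (Q e)) h2.contMDiffAt h1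
  · rintro x ⟨hxs, hxW⟩
    have hxU := hW₂U hxW
    have h := hkP (φ x) hxW
    have hxx : φ.symm (φ x) = x := φ.left_inv hxs
    simp only [hxx] at h
    have hU2 : φ.symm (φ x) ∈ W₁ := hxU.2
    rw [hxx] at hU2
    exact ⟨⟨hU2.2, h.1⟩, h.2⟩

end Retraction

end OvertwistedBox

end

noncomputable section
namespace OvertwistedBox

set_option linter.unusedSectionVars false

open Set Topology Filter

/-! ### Normalised contact forms near a point of the hypersurface. -/

section LocalData

variable {n : ℕ} {L : Type*} [TopologicalSpace L] [ChartedSpace (EuclideanSpace ℝ (Fin n)) L]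
  [IsManifold (𝓡 n) ∞ L]
  {g : Bundle.ContMDiffRiemannianMetric (𝓡 n) ∞ (EuclideanSpace ℝ (Fin n))
      (fun q : L => TangentSpace (𝓡 n) q)}
  {M : Type*} [TopologicalSpace M] [ChartedSpace (EuclideanSpace ℝ (Fin (2 * n + 3))) M]
  [IsManifold (𝓡 (2 * n + 3)) ∞ M]
  {ξ : ∀ x : M, Submodule ℝ (TangentSpace (𝓡 (2 * n + 3)) x)} {c₀ : ℝ}
  {ι : Plane × Cotangent n L → M}

lemma finrank_discModel : Module.finrank ℝ (Plane × CotModel n) = 2 * n + 2 := by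
  have h1 : Module.finrank ℝ (EuclideanSpace ℝ (Fin n) →L[ℝ] ℝ) = n := by
    rw [← (LinearMap.toContinuousLinearMap :
      (EuclideanSpace ℝ (Fin n) →ₗ[ℝ] ℝ) ≃ₗ[ℝ] EuclideanSpace ℝ (Fin n) →L[ℝ] ℝ).finrank_eq]
    exact (Subspace.dual_finrank_eq (K := ℝ) (V := EuclideanSpace ℝ (Fin n))).trans
      finrank_euclideanSpace_fin
  rw [Module.finrank_prod, Module.finrank_prod, h1, finrank_euclideanSpace_fin,
    finrank_euclideanSpace_fin]
  ring

/-- An injective map into the kernel of a covector, of complementary dimension one, is onto. -/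
lemma exists_preimage_of_ker {V V' : Type*} [NormedAddCommGroup V] [NormedSpace ℝ V]
    [FiniteDimensional ℝ V] [NormedAddCommGroup V'] [NormedSpace ℝ V'] [FiniteDimensional ℝ V']
    (hdim : Module.finrank ℝ V = Module.finrank ℝ V' + 1) {D : V' →L[ℝ] V}
    (hD : Function.Injective D) {a : V →L[ℝ] ℝ} (ha : a ≠ 0) (haD : ∀ u, a (D u) = 0) {v : V}
    (hv : a v = 0) : ∃ u, D u = v := by
  have h1 : LinearMap.range (D : V' →ₗ[ℝ] V) ≤ LinearMap.ker (a : V →ₗ[ℝ] ℝ) := by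
    rintro _ ⟨u, rfl⟩
    exact haD u
  have hsurj : Function.Surjective (a : V →ₗ[ℝ] ℝ) :=
    LinearMap.surjective (fun h => ha (ContinuousLinearMap.ext fun v =>
      congrArg (fun T : V →ₗ[ℝ] ℝ => T v) h))
  have h2 := LinearMap.finrank_range_add_finrank_ker (a : V →ₗ[ℝ] ℝ)
  rw [LinearMap.range_eq_top.2 hsurj, finrank_top, Module.finrank_self] at h2
  have h3 := LinearMap.finrank_range_of_inj (f := (D : V' →ₗ[ℝ] V)) hD
  have h4 := Submodule.eq_of_le_of_finrank_eq h1 (by omega)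
  have : v ∈ LinearMap.range (D : V' →ₗ[ℝ] V) := by rw [h4]; exact hv
  exact this

lemma extChartAt_disc_fst (x y : Plane × Cotangent n L) :
    (extChartAt (discModel n) x y).1 = y.1 := by
  rw [show extChartAt (discModel n) x y = _ from extChartAt_prod_apply x y]

lemma fderiv_smul_eq_zero {P V : Type*} [NormedAddCommGroup P] [NormedSpace ℝ P]
    [NormedAddCommGroup V] [NormedSpace ℝ V] {f : P → ℝ} {b : P → V} {p : P}
    (hf : DifferentiableAt ℝ f p) (hb : DifferentiableAt ℝ b p) (hf0 : f p = 0) (hb0 : b p = 0) :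
    fderiv ℝ (fun q => f q • b q) p = 0 := by
  rw [fderiv_fun_smul hf hb, hf0, hb0]
  simp

/-- The pullback of a contact form under the embedding, in canonical coordinates. -/
lemma pullback_factor_ne_zero {A : OneForm (EuclideanSpace ℝ (Fin (2 * n + 3))) M}
    {j : Plane × CotModel n → M} {e₀ : Plane × CotModel n} {W : Set (Plane × CotModel n)}
    (hW : IsOpen W) (he₀ : e₀ ∈ W) (hpi : ‖e₀.1‖ ≤ Real.pi)
    (hj : ContMDiffAt 𝓘(ℝ, Plane × CotModel n) (𝓡 (2 * n + 3)) ∞ j e₀)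
    (hinj : Function.Injective (md 𝓘(ℝ, Plane × CotModel n) (𝓡 (2 * n + 3)) j e₀))
    (hA : SmoothFormAt (𝓡 (2 * n + 3)) A (j e₀))
    (hc : IsContactPair (A (j e₀)) (dForm (𝓡 (2 * n + 3)) A (j e₀)))
    (hker : ∀ v, pullForm 𝓘(ℝ, Plane × CotModel n) (𝓡 (2 * n + 3)) A j e₀ v = 0 ↔
      betaCoord e₀ v = 0)
    {f : Plane × CotModel n → ℝ} (hf : ContDiffAt ℝ ∞ f e₀)
    (hfac : ∀ e ∈ W, ‖e.1‖ ≤ Real.pi →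
      pullForm 𝓘(ℝ, Plane × CotModel n) (𝓡 (2 * n + 3)) A j e = f e • betaCoord e) :
    f e₀ ≠ 0 := by
  -- If f vanished at e₀, so would the pullback of A, and β as well because the kernels agree. Then
  -- fβ, and with it the pullback of A, has zero derivative at e₀, so dA = 0 on the image of the
  -- differential of `j`. By dimension this image is all of ker A, against the contact condition.
  intro hf0
  have hb0 : ∀ v, pullForm 𝓘(ℝ, Plane × CotModel n) (𝓡 (2 * n + 3)) A j e₀ v = 0 := fun v => by
    rw [hfac e₀ he₀ hpi, hf0, zero_smul]; rfl
  have hβ0 : betaCoord e₀ = 0 := ContinuousLinearMap.ext fun v => (hker v).1 (hb0 v)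
  set b := pullForm 𝓘(ℝ, Plane × CotModel n) (𝓡 (2 * n + 3)) A j with hb
  have hbs : ContDiffAt ℝ ∞ b e₀ := hA.contDiffAt_plot hj
  have h1 : fderiv ℝ b e₀ = fderiv ℝ (fun e => f e • betaCoord e) e₀ :=
    fderiv_eq_of_mem_closure hbs (contDiffAt_smul' hf contDiff_betaCoord.contDiffAt)
      (hW.mem_nhds he₀) (isOpen_innerSet.preimage continuous_fst) (fst_mem_closure hpi)
      fun e he heQ => hfac e he (le_of_lt heQ.1)
  rw [fderiv_smul_eq_zero (hf.differentiableAt (by simp))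
    (contDiff_betaCoord.differentiable (by simp) e₀) hf0 hβ0] at h1
  set D := md 𝓘(ℝ, Plane × CotModel n) (𝓡 (2 * n + 3)) j e₀ with hD
  have h3 : ∀ u v, dForm (𝓡 (2 * n + 3)) A (j e₀) (D u) (D v) = 0 := fun u v => by
    rw [← dOne_plot hA hj, dOne_apply, ← hb, h1]
    simp
  set u : Plane × CotModel n := (!₂[1, 0], 0) with hu
  have hu0 : u ≠ 0 := fun h => by
    have := congrArg (fun w : Plane × CotModel n => w.1 0) h
    simp [hu] at this
  obtain ⟨v', hv', hne⟩ := hc.2 (D u) (hb0 u) (fun h => hu0 (hinj (by rw [h, map_zero])))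
  obtain ⟨v, rfl⟩ := exists_preimage_of_ker (by rw [finrank_discModel, finrank_euclideanSpace_fin])
    hinj hc.1 hb0 hv'
  exact hne (h3 u v)

/-- A local left inverse `ℓ` of ι carries the factor f and the function cos r from the hypersurface
to M; dividing A by f ∘ ℓ normalises it. That ι is a homeomorphism onto its image enters through
`V₃`: it keeps distant parts of ι(Σ), on which `ℓ` does not invert ι, out of V. -/
lemma exists_local_data (hξ : IsContactStructure ξ)
    (hι : IsSmoothEmbeddingOn (discModel n) (𝓡 (2 * n + 3)) ι (modelHypersurface g c₀))
    (hk : InducesKernelOn (discModel n) (𝓡 (2 * n + 3)) ι (modelHypersurface g c₀) ξ betaForm)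
    {x₀ : Plane × Cotangent n L} (hx₀ : x₀ ∈ modelHypersurface g c₀) :
    ∃ (V : Set M) (α : OneForm (EuclideanSpace ℝ (Fin (2 * n + 3))) M) (h : M → ℝ),
      IsOpen V ∧ ι x₀ ∈ V ∧ IsContactFormOn ξ α V ∧
      (∀ y ∈ V, ContMDiffAt (𝓡 (2 * n + 3)) 𝓘(ℝ, ℝ) ∞ h y) ∧
      ∀ a ∈ modelHypersurface g c₀, ι a ∈ V →
        (∀ v, α (ι a) (md (discModel n) (𝓡 (2 * n + 3)) ι a v) = betaOne a v) ∧
        h (ι a) = cosRad a.1 := by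
  obtain ⟨W, hWo, hSW, hιW⟩ := hι.smooth
  have hιs : ∀ x ∈ W, ContMDiffAt (discModel n) (𝓡 (2 * n + 3)) ∞ ι x := fun x hx =>
    hιW.contMDiffAt (hWo.mem_nhds hx)
  obtain ⟨V₁, A, hV₁o, hyV₁, hA⟩ := exists_local_contact_form hξ (ι x₀)
  obtain ⟨ℓ, V₂, W₂, hV₂o, hW₂o, hxW₂, hℓs, hℓ⟩ :=
    exists_local_retraction hWo (hSW hx₀) hιs (hι.immersive x₀ hx₀)
  set φ := extChartAt (discModel n) x₀ with hφ
  set N₁ : Set (Plane × Cotangent n L) := (W ∩ ι ⁻¹' V₁) ∩ Prod.snd ⁻¹' diskBundle g c₀ with hN₁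
  have hN₁o : IsOpen N₁ := (hιW.continuousOn.isOpen_inter_preimage hWo hV₁o).inter
    ((isOpen_diskBundle g c₀).preimage continuous_snd)
  have hxN₁ : x₀ ∈ N₁ := ⟨⟨hSW hx₀, hyV₁⟩, hx₀.2⟩
  set U : Set (Plane × CotModel n) := φ.target ∩ φ.symm ⁻¹' N₁ with hU
  have hUo : IsOpen U := (continuousOn_extChartAt_symm x₀).isOpen_inter_preimage
    (isOpen_extChartAt_target x₀) hN₁o
  have hxx : φ.symm (φ x₀) = x₀ := extChartAt_to_inv x₀
  have he₀ : φ x₀ ∈ U := ⟨mem_extChartAt_target x₀, by rw [mem_preimage, hxx]; exact hxN₁⟩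
  set j : Plane × CotModel n → M := fun e => ι (φ.symm e) with hj
  set b := pullForm 𝓘(ℝ, Plane × CotModel n) (𝓡 (2 * n + 3)) A j with hb
  have hsymm : ∀ e ∈ U, ContMDiffAt 𝓘(ℝ, Plane × CotModel n) (discModel n) ∞ φ.symm e :=
    fun e he => contMDiffAt_extChartAt_symm' he.1
  have hjs : ∀ e ∈ U, ContMDiffAt 𝓘(ℝ, Plane × CotModel n) (𝓡 (2 * n + 3)) ∞ j e := fun e he =>
    ContMDiffAt.comp e (f := φ.symm) (g := ι) (hιs _ he.2.1.1) (hsymm e he)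
  have hmdj : ∀ e ∈ U, ∀ v, md 𝓘(ℝ, Plane × CotModel n) (𝓡 (2 * n + 3)) j e v =
      md (discModel n) (𝓡 (2 * n + 3)) ι (φ.symm e)
        (md 𝓘(ℝ, Plane × CotModel n) (discModel n) φ.symm e v) := fun e he v => by
    rw [hj, md_comp (I' := discModel n) (f := ι) (g := φ.symm)
      ((hιs _ he.2.1.1).mdifferentiableAt (by simp)) ((hsymm e he).mdifferentiableAt (by simp))]
    rfl
  have hbs : ∀ e ∈ U, ContDiffAt ℝ ∞ b e := fun e he =>
    SmoothFormAt.contDiffAt_plot (f := j) (hA _ he.2.1.2).1 (hjs e he)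
  have hfst : ∀ e ∈ φ.target, (φ.symm e).1 = e.1 := fun e he => by
    rw [← extChartAt_disc_fst x₀ (φ.symm e), ← hφ, φ.right_inv he]
  have hβ : ∀ e ∈ U, ∀ v, betaOne (φ.symm e)
      (md 𝓘(ℝ, Plane × CotModel n) (discModel n) φ.symm e v) = betaCoord e v := fun e he v => by
    rw [← pullForm_betaOne he.1]; rfl
  have hker : ∀ e ∈ U, ‖e.1‖ ≤ Real.pi → ∀ v, b e v = 0 ↔ betaCoord e v = 0 := by
    intro e he hpi v
    have hmem : φ.symm e ∈ modelHypersurface g c₀ :=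
      ⟨by rw [mem_closedBall_zero_iff, hfst e he.1]; exact hpi, he.2.2⟩
    rw [← hβ e he]
    refine Iff.trans ?_ ((hk _ hmem
      (md 𝓘(ℝ, Plane × CotModel n) (discModel n) φ.symm e v)).trans
      (Iff.of_eq (congrArg (· = 0) (betaForm_eq _ _))))
    rw [hb, pullForm_apply, hmdj e he]
    exact ((hA _ he.2.1.2).2.2 _).symm
  have hpi₀ : ‖(φ x₀).1‖ ≤ Real.pi := by
    rw [extChartAt_disc_fst]; simpa using hx₀.1
  obtain ⟨f, W₃, hW₃o, he₃, hW₃U, hfs, hfac⟩ := exists_smooth_factor hUo he₀ hpi₀ hbs hker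
  have hf0 : f (φ x₀) ≠ 0 := by
    have hjx : j (φ x₀) = ι x₀ := by rw [hj]; simp only [hxx]
    refine pullback_factor_ne_zero hW₃o he₃ hpi₀ (hjs _ he₀) ?_ ?_ ?_
      (hker _ he₀ hpi₀) (hfs _ he₃) hfac
    · intro u v huv
      rw [hmdj _ he₀, hmdj _ he₀, md_extChartAt_symm_self, hxx] at huv
      exact hι.immersive x₀ hx₀ huv
    · exact (hA _ he₀.2.1.2).1
    · exact (hA _ he₀.2.1.2).2.1
  -- a neighbourhood whose points of the hypersurface are close to `x₀`
  set N₂ : Set (Plane × Cotangent n L) := W₂ ∩ (φ.source ∩ φ ⁻¹' W₃) with hN₂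
  have hN₂o : IsOpen N₂ := hW₂o.inter ((continuousOn_extChartAt x₀).isOpen_inter_preimage
    (isOpen_extChartAt_source x₀) hW₃o)
  obtain ⟨V₃, hV₃o, hV₃⟩ : ∃ V₃ : Set M, IsOpen V₃ ∧
      ((modelHypersurface g c₀).domRestrict ι) ⁻¹' V₃ = Subtype.val ⁻¹' N₂ := by
    have := hι.embedding.isInducing.isOpen_iff.1 (hN₂o.preimage
      (continuous_subtype_val (p := fun x => x ∈ modelHypersurface g c₀)))
    exact this
  have hV₃' : ∀ a ∈ modelHypersurface g c₀, ι a ∈ V₃ ↔ a ∈ N₂ := fun a ha =>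
    Set.ext_iff.1 hV₃ ⟨a, ha⟩
  set W₄ : Set (Plane × CotModel n) := W₃ ∩ f ⁻¹' {0}ᶜ with hW₄
  have hW₄o : IsOpen W₄ := ContinuousOn.isOpen_inter_preimage
    (fun e he => (hfs e he).continuousAt.continuousWithinAt) hW₃o isOpen_compl_singleton
  set V₅ : Set M := V₂ ∩ ℓ ⁻¹' W₄ with hV₅
  have hV₅o : IsOpen V₅ := ContinuousOn.isOpen_inter_preimage
    (fun y hy => (hℓs y hy).continuousAt.continuousWithinAt) hV₂o hW₄o
  have hx₀2 := hℓ x₀ hxW₂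
  have hFs : ∀ y ∈ V₅, ContMDiffAt (𝓡 (2 * n + 3)) 𝓘(ℝ, ℝ) ∞ (fun y => (f (ℓ y))⁻¹) y := by
    intro y hy
    exact ContMDiffAt.comp y (f := ℓ) (g := fun e => (f e)⁻¹)
      ((hfs _ hy.2.1).inv hy.2.2).contMDiffAt (hℓs y hy.1)
  refine ⟨V₁ ∩ (V₃ ∩ V₅), fun y => (f (ℓ y))⁻¹ • A y, fun y => cosRad (ℓ y).1,
    hV₁o.inter (hV₃o.inter hV₅o), ⟨hyV₁, (hV₃' x₀ hx₀).2 ⟨hxW₂, mem_extChartAt_source _, he₃⟩,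
      hx₀2.1, ?_⟩, ?_, ?_, ?_⟩
  · rw [mem_preimage, hx₀2.2]; exact ⟨he₃, hf0⟩
  · rintro y ⟨hy1, hy3, hy5⟩
    have hne : (f (ℓ y))⁻¹ ≠ 0 := inv_ne_zero hy5.2.2
    obtain ⟨hAs, hAc, hAk⟩ := hA y hy1
    refine ⟨hAs.smul (hFs y hy5), isContactPair_smul hAs (hFs y hy5) hne hAc, fun v => ?_⟩
    rw [hAk v, smul_apply, smul_eq_mul, mul_eq_zero]
    exact ⟨Or.inr, fun h => h.resolve_left hne⟩
  · rintro y ⟨hy1, hy3, hy5⟩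
    exact ContMDiffAt.comp y (f := ℓ) (g := fun e : Plane × CotModel n => cosRad e.1)
      ((contDiff_cosRad.comp contDiff_fst).contDiffAt).contMDiffAt (hℓs y hy5.1)
  · rintro a ha ⟨ha1, ha3, ha5⟩
    obtain ⟨haW₂, has, haW₃⟩ := (hV₃' a ha).1 ha3
    have hla : ℓ (ι a) = φ a := (hℓ a haW₂).2
    have haa : φ.symm (φ a) = a := φ.left_inv has
    have haU : φ a ∈ U := hW₃U haW₃
    have hfa : f (φ a) ≠ 0 := by rw [← hla]; exact ha5.2.2
    have hpa : ‖(φ a).1‖ ≤ Real.pi := by rw [extChartAt_disc_fst]; simpa using ha.1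
    refine ⟨fun v => ?_, ?_⟩
    · set v' := md (discModel n) 𝓘(ℝ, Plane × CotModel n) φ a v with hv'
      have hvv : md 𝓘(ℝ, Plane × CotModel n) (discModel n) φ.symm (φ a) v' = v := by
        have := congrArg (fun T : Plane × CotModel n →L[ℝ] Plane × CotModel n => T v)
          (md_extChartAt_symm_comp (I := discModel n) (x₀ := x₀) haU.1)
        simp only [← hφ, haa] at this
        exact this
      have h1 := congrArg (fun T : Plane × CotModel n →L[ℝ] ℝ => T v') (hfac _ haW₃ hpa)
      simp only [hb] at h1
      rw [pullForm_apply, hmdj _ haU, hvv, smul_apply, smul_eq_mul, ← hβ _ haU, hvv, hj] at h1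
      simp only [haa] at h1
      change (f (ℓ (ι a)))⁻¹ * A (ι a) _ = _
      rw [h1, hla]
      field_simp
    · change cosRad (ℓ (ι a)).1 = _
      rw [hla, extChartAt_disc_fst]

end LocalData

end OvertwistedBox

end

noncomputable section
namespace OvertwistedBox

set_option linter.unusedSectionVars false

open Set Topology Filter

/-! ### Partitions of unity on open subsets. -/

section Patching

variable {m : ℕ} {M : Type*} [TopologicalSpace M] [ChartedSpace (EuclideanSpace ℝ (Fin m)) M]
  [IsManifold (𝓡 m) ∞ M]

/-- A smooth partition of unity on the union of a family of open sets. -/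
lemma exists_partition_iUnion [T2Space M] [SecondCountableTopology M] {κ : Type*} {V : κ → Set M}
    (hV : ∀ i, IsOpen (V i)) :
    ∃ ρ : κ → M → ℝ, (∀ i, ∀ y ∈ ⋃ i, V i, ContMDiffAt (𝓡 m) 𝓘(ℝ, ℝ) ∞ (ρ i) y) ∧
      ∀ y ∈ ⋃ i, V i, ∃ F : Finset κ, ∀ᶠ z in 𝓝 y, (∀ i ∈ F, z ∈ V i) ∧ (∀ i, i ∉ F → ρ i z = 0) ∧
        ∑ i ∈ F, ρ i z = 1 := by
  classical
  set O : TopologicalSpace.Opens M := ⟨⋃ i, V i, isOpen_iUnion hV⟩ with hO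
  have : LocallyCompactSpace M := ChartedSpace.locallyCompactSpace (EuclideanSpace ℝ (Fin m)) M
  have : LocallyCompactSpace O := O.isOpen.locallyCompactSpace
  have : SigmaCompactSpace O := inferInstance
  obtain ⟨f, hf⟩ := SmoothPartitionOfUnity.exists_isSubordinate (𝓡 m) (M := O) isClosed_univ
    (fun i => Subtype.val ⁻¹' V i) (fun i => (hV i).preimage continuous_subtype_val)
    (fun x _ => by simpa using mem_iUnion.1 x.2)
  have hval : ∀ (i : κ) (x : O), Subtype.val.extend (f i) 0 (x : M) = f i x := fun i x =>
    Subtype.val_injective.extend_apply _ _ x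
  -- Functions on the open submanifold are extended by zero. The value off the union is immaterial,
  -- since smoothness is claimed only inside it.
  refine ⟨fun i => Subtype.val.extend (f i) 0, fun i y hy => ?_, fun y hy => ?_⟩
  · have h1 : ContMDiffAt (𝓡 m) 𝓘(ℝ, ℝ) ∞ (f i) (⟨y, hy⟩ : O) := (f i).contMDiff.contMDiffAt
    rw [← contMDiffAt_subtype_iff (x := (⟨y, hy⟩ : O))]
    exact h1.congr_of_eventuallyEq (Eventually.of_forall fun x => hval i x)
  · obtain ⟨F, N, hN, hNV, hF⟩ := f.toPartitionOfUnity.exists_finset_nhds_support_subset hf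
      (fun i => (hV i).preimage continuous_subtype_val) ⟨y, hy⟩
    refine ⟨F, ?_⟩
    have hmap : Subtype.val '' N ∈ 𝓝 y := by
      have := O.isOpen.isOpenEmbedding_subtypeVal.isOpenMap.image_mem_nhds hN
      exact this
    filter_upwards [hmap]
    rintro _ ⟨z, hz, rfl⟩
    have h0 : ∀ i, i ∉ F → f i z = 0 := fun i hi => by
      by_contra h
      exact hi (hF z hz h)
    refine ⟨fun i hi => by simpa using mem_iInter₂.1 (hNV hz) i hi, fun i hi => ?_, ?_⟩
    · rw [hval, h0 i hi]
    · simp only [hval]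
      exact (finsum_eq_sum_of_support_subset (fun i => f i z) (s := F) (hF z hz)).symm.trans
        (f.sum_eq_one (mem_univ z))

end Patching

/-! ### Locality of one-forms and dependence of the contact condition on the kernel. -/

section Forms

variable {E : Type} {H X : Type*} [NormedAddCommGroup E] [NormedSpace ℝ E] [FiniteDimensional ℝ E]
  [TopologicalSpace H] {I : ModelWithCorners ℝ E H} [TopologicalSpace X] [ChartedSpace H X]
  [I.Boundaryless] [IsManifold I ∞ X] {α A : OneForm E X} {y : X}

lemma eventually_pullForm_symm {p : X → Prop} (h : ∀ᶠ z in 𝓝 y, p z) :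
    ∀ᶠ e in 𝓝 (extChartAt I y y), p ((extChartAt I y).symm e) := by
  have hc := (continuousAt_extChartAt_symm (I := I) y)
  rw [ContinuousAt, extChartAt_to_inv] at hc
  exact hc.eventually h

lemma pullForm_eventuallyEq (h : α =ᶠ[𝓝 y] A) :
    pullForm 𝓘(ℝ, E) I α (extChartAt I y).symm
      =ᶠ[𝓝 (extChartAt I y y)]
    pullForm 𝓘(ℝ, E) I A (extChartAt I y).symm := by
  filter_upwards [eventually_pullForm_symm h] with e he
  rw [pullForm, pullForm, he]

lemma SmoothFormAt.congr (hA : SmoothFormAt I A y) (h : α =ᶠ[𝓝 y] A) :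
    SmoothFormAt I α y :=
  ContDiffAt.congr_of_eventuallyEq hA (pullForm_eventuallyEq h)

lemma dForm_congr (h : α =ᶠ[𝓝 y] A) : dForm I α y = dForm I A y :=
  dOne_congr (pullForm_eventuallyEq h)

lemma smoothFormAt_sum {κ : Type*} {F : Finset κ} {a : κ → OneForm E X}
    (h : ∀ i ∈ F, SmoothFormAt I (a i) y) :
    SmoothFormAt I (fun z => ∑ i ∈ F, a i z) y := by
  have h1 : ContDiffAt ℝ ∞ (fun e => ∑ i ∈ F, pullForm 𝓘(ℝ, E) I (a i)
      (extChartAt I y).symm e) (extChartAt I y y) := ContDiffAt.sum fun i hi => h i hi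
  refine h1.congr_of_eventuallyEq (Eventually.of_forall fun e => ContinuousLinearMap.ext fun v => ?_)
  simp [pullForm]

lemma pullForm_symm_self : pullForm 𝓘(ℝ, E) I α
    (extChartAt I y).symm (extChartAt I y y) = α y := by
  refine ContinuousLinearMap.ext fun v => ?_
  rw [pullForm_apply, md_extChartAt_symm_self, extChartAt_to_inv]
  rfl

lemma SmoothFormAt.eventually_ne (h : SmoothFormAt I α y) (h0 : α y ≠ 0) :
    ∀ᶠ z in 𝓝 y, α z ≠ 0 := by
  have h1 := (ContDiffAt.continuousAt h).eventually_ne (by rwa [pullForm_symm_self])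
  have h2 := (continuousAt_extChartAt (I := I) y).eventually h1
  filter_upwards [h2, extChartAt_source_mem_nhds (I := I) y] with z hz hzs h0
  refine hz (ContinuousLinearMap.ext fun v => ?_)
  rw [pullForm_apply, (extChartAt I y).left_inv hzs, h0]
  rfl

/-- A smooth form with the kernel of a contact form is a contact form. -/
lemma isContactPair_of_ker (hα : SmoothFormAt I α y) (hA : SmoothFormAt I A y)
    (hker : ∀ᶠ z in 𝓝 y, ∀ v, α z v = 0 ↔ A z v = 0)
    (hc : IsContactPair (A y) (dForm I A y)) :
    IsContactPair (α y) (dForm I α y) := by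
  obtain ⟨v, hv⟩ : ∃ v, A y v ≠ 0 := by
    by_contra! h'
    exact hc.1 (ContinuousLinearMap.ext h')
  set φ := extChartAt I y with hφ
  set a := pullForm 𝓘(ℝ, E) I α φ.symm with ha
  set b := pullForm 𝓘(ℝ, E) I A φ.symm with hb
  have hb0 : b (φ y) v ≠ 0 := by rwa [hb, pullForm_symm_self]
  have has : ContDiffAt ℝ ∞ (fun e => a e v) (φ y) := ContDiffAt.clm_apply hα contDiffAt_const
  have hbs : ContDiffAt ℝ ∞ (fun e => b e v) (φ y) := ContDiffAt.clm_apply hA contDiffAt_const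
  have hfs : ContMDiffAt I 𝓘(ℝ, ℝ) ∞ (fun z => a (φ z) v / b (φ z) v) y :=
    ContMDiffAt.comp y (f := φ) (g := fun e => a e v / b e v)
      (has.div hbs hb0).contMDiffAt contMDiffAt_extChartAt
  have hev : α =ᶠ[𝓝 y] fun z => (a (φ z) v / b (φ z) v) • A z := by
    have h2 := (continuousAt_extChartAt (I := I) y).eventually
      (hbs.continuousAt.eventually_ne hb0)
    filter_upwards [hker, h2, extChartAt_source_mem_nhds (I := I) y] with z hz hz2 hzs
    obtain ⟨c, -, hc⟩ := exists_eq_smul_of_ker hz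
    have h3 : a (φ z) v = c * b (φ z) v := by
      simp only [ha, hb]
      rw [pullForm_apply, pullForm_apply, φ.left_inv hzs, hc]
      rfl
    rw [h3, mul_div_cancel_right₀ _ hz2, hc]
  have hy0 : a (φ y) v / b (φ y) v ≠ 0 := by
    refine div_ne_zero ?_ hb0
    rw [ha, pullForm_symm_self]
    exact fun h => hv ((hker.self_of_nhds v).1 h)
  rw [dForm_congr hev, hev.eq_of_nhds]
  exact isContactPair_smul hA hfs hy0 hc

end Forms

end OvertwistedBox

end

noncomputable section
namespace OvertwistedBox

set_option linter.unusedSectionVars false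

open Set Topology Filter

/-! ### The contact form along the whole hypersurface. -/

section GlobalData

variable {n : ℕ} {L : Type*} [TopologicalSpace L] [ChartedSpace (EuclideanSpace ℝ (Fin n)) L]
  [IsManifold (𝓡 n) ∞ L]
  {g : Bundle.ContMDiffRiemannianMetric (𝓡 n) ∞ (EuclideanSpace ℝ (Fin n))
      (fun q : L => TangentSpace (𝓡 n) q)}
  {M : Type*} [TopologicalSpace M] [ChartedSpace (EuclideanSpace ℝ (Fin (2 * n + 3))) M]
  [IsManifold (𝓡 (2 * n + 3)) ∞ M]
  {ξ : ∀ x : M, Submodule ℝ (TangentSpace (𝓡 (2 * n + 3)) x)} {c₀ : ℝ}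
  {ι : Plane × Cotangent n L → M}

lemma betaOne_ne_zero {a : Plane × Cotangent n L} (ha : a.1 ∈ innerSet) :
    betaOne a ≠ 0 := by
  rw [betaOne_eq_betaCoord]
  intro h
  have h1 := congrArg (fun T : Plane × CotModel n →L[ℝ] ℝ => T (!₂[0, 1], 0)) h
  simp only [betaCoord_apply, extChartAt_disc_fst] at h1
  have h2 := (sincSqrt_radSq_pos ha.1).ne'
  have h3 := ha.2
  simp [h2, h3] at h1

/-- Two contact forms inducing `β` agree along the hypersurface. -/
lemma contactForm_unique
    (hι : IsSmoothEmbeddingOn (discModel n) (𝓡 (2 * n + 3)) ι (modelHypersurface g c₀))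
    {V V' : Set M} (hV : IsOpen V) (hV' : IsOpen V')
    {α α' : OneForm (EuclideanSpace ℝ (Fin (2 * n + 3))) M}
    (hα : IsContactFormOn ξ α V) (hα' : IsContactFormOn ξ α' V')
    (h : ∀ a ∈ modelHypersurface g c₀, ι a ∈ V →
      ∀ v, α (ι a) (md (discModel n) (𝓡 (2 * n + 3)) ι a v) = betaOne a v)
    (h' : ∀ a ∈ modelHypersurface g c₀, ι a ∈ V' →
      ∀ v, α' (ι a) (md (discModel n) (𝓡 (2 * n + 3)) ι a v) = betaOne a v)
    {a : Plane × Cotangent n L} (ha : a ∈ modelHypersurface g c₀) (haV : ι a ∈ V)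
    (haV' : ι a ∈ V') : α (ι a) = α' (ι a) := by
  obtain ⟨W, hWo, hSW, hιW⟩ := hι.smooth
  have hιc : ContinuousAt ι a := (hιW.contMDiffAt (hWo.mem_nhds (hSW ha))).continuousAt
  set ψ := extChartAt (𝓡 (2 * n + 3)) (ι a) with hψ
  have hc : ∀ {A : OneForm (EuclideanSpace ℝ (Fin (2 * n + 3))) M},
      SmoothFormAt (𝓡 (2 * n + 3)) A (ι a) → ContinuousAt (fun b =>
        pullForm 𝓘(ℝ, EuclideanSpace ℝ (Fin (2 * n + 3))) (𝓡 (2 * n + 3)) A ψ.symm (ψ (ι b))) a :=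
    fun {A} hA => ContinuousAt.comp (f := fun b => ψ (ι b)) (ContDiffAt.continuousAt hA)
      (ContinuousAt.comp (f := ι) (continuousAt_extChartAt (I := 𝓡 (2 * n + 3)) (ι a)) hιc)
  have hnhds : {b | b.2 ∈ diskBundle g c₀ ∧ ι b ∈ V ∩ V' ∩ ψ.source} ∈ 𝓝 a := by
    refine Filter.inter_mem (((isOpen_diskBundle g c₀).preimage continuous_snd).mem_nhds ha.2)
      (hιc.preimage_mem_nhds (((hV.inter hV').inter (isOpen_extChartAt_source (ι a))).mem_nhds
        ⟨⟨haV, haV'⟩, mem_extChartAt_source _⟩))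
  have h3 := eq_of_mem_closure (hc (hα _ haV).1) (hc (hα' _ haV').1) hnhds
    (fst_mem_closure (by simpa using ha.1)) (fun b hb hbQ => by
      have hbS : b ∈ modelHypersurface g c₀ :=
        ⟨by simpa using le_of_lt (show ‖b.1‖ < Real.pi from hbQ.1), hb.1⟩
      have hker : ∀ v, α' (ι b) v = 0 ↔ α (ι b) v = 0 := fun v =>
        ((hα' _ hb.2.1.2).2.2 v).symm.trans ((hα _ hb.2.1.1).2.2 v)
      obtain ⟨t, -, ht⟩ := exists_eq_smul_of_ker hker
      obtain ⟨v, hv⟩ : ∃ v, betaOne b v ≠ 0 := by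
        by_contra! h0
        exact betaOne_ne_zero hbQ (ContinuousLinearMap.ext h0)
      have h4 := h' b hbS hb.2.1.2 v
      rw [ht, smul_apply, h b hbS hb.2.1.1 v, smul_eq_mul] at h4
      have ht1 : t = 1 := by
        apply mul_right_cancel₀ hv
        rw [h4, one_mul]
      have h5 : α (ι b) = α' (ι b) := by rw [ht, ht1, one_smul]
      simp only [pullForm, hψ, (extChartAt (𝓡 (2 * n + 3)) (ι a)).left_inv hb.2.2, h5])
  simpa only [hψ, pullForm_symm_self] using h3

variable [T2Space M] [SecondCountableTopology M]

/-- Along ι(Σ) all normalised local forms coincide by `contactForm_unique`, so their weighted sum is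
that common form and needs no coorientation of ξ. Elsewhere the local forms are merely proportional
and the sum may vanish, so O is cut down to where it does not; there it has kernel ξ and is contact
by `isContactPair_of_ker`. -/
lemma exists_global_data (hξ : IsContactStructure ξ)
    (hι : IsSmoothEmbeddingOn (discModel n) (𝓡 (2 * n + 3)) ι (modelHypersurface g c₀))
    (hk : InducesKernelOn (discModel n) (𝓡 (2 * n + 3)) ι (modelHypersurface g c₀) ξ betaForm)
    {U : Set M} (hU : IsOpen U) (hιU : ι '' modelHypersurface g c₀ ⊆ U) :
    ∃ (O : Set M) (α : OneForm (EuclideanSpace ℝ (Fin (2 * n + 3))) M) (h : M → ℝ),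
      IsOpen O ∧ O ⊆ U ∧ IsContactFormOn ξ α O ∧
      (∀ y ∈ O, ContMDiffAt (𝓡 (2 * n + 3)) 𝓘(ℝ, ℝ) ∞ h y) ∧
      ∀ a ∈ modelHypersurface g c₀, ι a ∈ O ∧
        (∀ v, α (ι a) (md (discModel n) (𝓡 (2 * n + 3)) ι a v) = betaOne a v) ∧
        h (ι a) = cosRad a.1 := by
  classical
  have hloc := fun a : modelHypersurface g c₀ => exists_local_data hξ hι hk a.2
  choose V A H hVo hmem hA hH hAH using hloc
  obtain ⟨ρ, hρs, hρ⟩ := exists_partition_iUnion (m := 2 * n + 3) hVo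
  set P : Set M := ⋃ i, V i with hP
  have hPo : IsOpen P := isOpen_iUnion hVo
  set α : OneForm (EuclideanSpace ℝ (Fin (2 * n + 3))) M := fun y => ∑ᶠ i, ρ i y • A i y with hα
  set h : M → ℝ := fun y => ∑ᶠ i, ρ i y * H i y with hh
  have hαF : ∀ {y : M} {F : Finset (modelHypersurface g c₀)}, (∀ i, i ∉ F → ρ i y = 0) →
      α y = ∑ i ∈ F, ρ i y • A i y := fun {y F} hy =>
    finsum_eq_sum_of_support_subset _ fun i hi => by
      by_contra hiF
      exact hi (by simp [hy i hiF])
  have hhF : ∀ {y : M} {F : Finset (modelHypersurface g c₀)}, (∀ i, i ∉ F → ρ i y = 0) →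
      h y = ∑ i ∈ F, ρ i y * H i y := fun {y F} hy =>
    finsum_eq_sum_of_support_subset _ fun i hi => by
      by_contra hiF
      exact hi (by simp [hy i hiF])
  have hαs : ∀ y ∈ P, SmoothFormAt (𝓡 (2 * n + 3)) α y := by
    intro y hy
    obtain ⟨F, hF⟩ := hρ y hy
    refine SmoothFormAt.congr (A := fun z => ∑ i ∈ F, ρ i z • A i z) (smoothFormAt_sum fun i hi =>
      SmoothFormAt.smul (hA i y (hF.self_of_nhds.1 i hi)).1 (hρs i y hy)) ?_
    filter_upwards [hF] with z hz using hαF hz.2.1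
  have hhs : ∀ y ∈ P, ContMDiffAt (𝓡 (2 * n + 3)) 𝓘(ℝ, ℝ) ∞ h y := by
    intro y hy
    obtain ⟨F, hF⟩ := hρ y hy
    have h1 : ContMDiffAt (𝓡 (2 * n + 3)) 𝓘(ℝ, ℝ) ∞ (fun z => ∑ i ∈ F, ρ i z * H i z) y :=
      contMDiffAt_finsetSum fun i hi =>
        (hρs i y hy).mul (hH i y (hF.self_of_nhds.1 i hi))
    refine h1.congr_of_eventuallyEq ?_
    filter_upwards [hF] with z hz using hhF hz.2.1
  have hker : ∀ y ∈ P, α y ≠ 0 → ∀ v : EuclideanSpace ℝ (Fin (2 * n + 3)),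
      v ∈ ξ y ↔ α y v = 0 := by
    intro y hy hy0 v
    obtain ⟨j, hj⟩ := mem_iUnion.1 hy
    obtain ⟨F, hF⟩ := hρ y hy
    have h1 : ∃ t : ℝ, α y = t • A j y := by
      rw [hαF hF.self_of_nhds.2.1]
      have h2 : ∀ i ∈ F, ∃ t : ℝ, A i y = t • A j y := fun i hi => by
        obtain ⟨t, -, ht⟩ := exists_eq_smul_of_ker (a := A j y) (b := A i y) fun v =>
          ((hA i y (hF.self_of_nhds.1 i hi)).2.2 v).symm.trans ((hA j y hj).2.2 v)
        exact ⟨t, ht⟩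
      choose! t ht using h2
      refine ⟨∑ i ∈ F, ρ i y * t i, ?_⟩
      rw [Finset.sum_smul]
      refine Finset.sum_congr rfl fun i hi => ?_
      rw [ht i hi, smul_smul]
    obtain ⟨t, ht⟩ := h1
    have ht0 : t ≠ 0 := fun h => hy0 (by rw [ht, h, zero_smul])
    rw [(hA j y hj).2.2 v, ht, smul_apply, smul_eq_mul, mul_eq_zero]
    exact ⟨Or.inr, fun h => h.resolve_left ht0⟩
  have hS : ∀ a ∈ modelHypersurface g c₀, ∃ i, ι a ∈ V i ∧ α (ι a) = A i (ι a) ∧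
      h (ι a) = cosRad a.1 := by
    intro a ha
    have haP : ι a ∈ P := mem_iUnion.2 ⟨⟨a, ha⟩, hmem _⟩
    obtain ⟨F, hF⟩ := hρ _ haP
    obtain ⟨hF1, hF2, hF3⟩ := hF.self_of_nhds
    refine ⟨⟨a, ha⟩, hmem _, ?_, ?_⟩
    · rw [hαF hF2, ← one_smul ℝ (A ⟨a, ha⟩ (ι a)), ← hF3, Finset.sum_smul]
      refine Finset.sum_congr rfl fun i hi => ?_
      rw [contactForm_unique hι (hVo i) (hVo ⟨a, ha⟩) (hA i) (hA ⟨a, ha⟩)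
        (fun b hb hbV => (hAH i b hb hbV).1) (fun b hb hbV => (hAH _ b hb hbV).1) ha (hF1 i hi)
        (hmem ⟨a, ha⟩)]
    · rw [hhF hF2, ← one_mul (cosRad a.1), ← hF3, Finset.sum_mul]
      refine Finset.sum_congr rfl fun i hi => ?_
      rw [(hAH i a ha (hF1 i hi)).2]
  set O : Set M := U ∩ {y | y ∈ P ∧ α y ≠ 0} with hO
  have hOo : IsOpen O := by
    refine hU.inter (isOpen_iff_mem_nhds.2 fun y hy => ?_)
    exact Filter.inter_mem (hPo.mem_nhds hy.1) ((hαs y hy.1).eventually_ne hy.2)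
  refine ⟨O, α, h, hOo, inter_subset_left, ?_, fun y hy => hhs y hy.2.1, fun a ha => ?_⟩
  · intro y hy
    refine ⟨hαs y hy.2.1, ?_, hker y hy.2.1 hy.2.2⟩
    obtain ⟨j, hj⟩ := mem_iUnion.1 hy.2.1
    refine isContactPair_of_ker (hαs y hy.2.1) (hA j y hj).1 ?_ (hA j y hj).2.1
    filter_upwards [hOo.mem_nhds hy, (hVo j).mem_nhds hj] with z hz hzj v
    exact (hker z hz.2.1 hz.2.2 v).symm.trans ((hA j z hzj).2.2 v)
  · obtain ⟨i, hi, hαi, hhi⟩ := hS a ha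
    refine ⟨⟨hιU ⟨a, ha, rfl⟩, mem_iUnion.2 ⟨i, hi⟩, ?_⟩, fun v => ?_, hhi⟩
    · rw [hαi]; exact (hA i _ hi).2.1.1
    · rw [hαi]; exact (hAH i a ha hi).1 v

end GlobalData

end OvertwistedBox

end

noncomputable section
namespace OvertwistedBox

set_option linter.unusedSectionVars false

open Set Topology Filter

/-! ### Maps that preserve contact kernels are immersions. -/

section Immersion

variable {E E' : Type} {H X H' X' : Type*}
  [NormedAddCommGroup E] [NormedSpace ℝ E] [FiniteDimensional ℝ E]
  [TopologicalSpace H] {I : ModelWithCorners ℝ E H} [TopologicalSpace X] [ChartedSpace H X]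
  [I.Boundaryless] [IsManifold I ∞ X]
  [NormedAddCommGroup E'] [NormedSpace ℝ E'] [FiniteDimensional ℝ E']
  [TopologicalSpace H'] {I' : ModelWithCorners ℝ E' H'} [TopologicalSpace X'] [ChartedSpace H' X']
  [I'.Boundaryless] [IsManifold I' ∞ X']

/-- A map which pulls back a form to one with the kernel of a contact form is an immersion. -/
lemma injective_md_of_ker {α : OneForm E X} {α₀ : OneForm E' X'} {f : X' → X} {x : X'}
    (hα : SmoothFormAt I α (f x)) (hf : ContMDiffAt I' I ∞ f x) (hα₀ : SmoothFormAt I' α₀ x)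
    (hker : ∀ᶠ z in 𝓝 x, ∀ v, α (f z) (md I' I f z v) = 0 ↔ α₀ z v = 0)
    (hc : IsContactPair (α₀ x) (dForm I' α₀ x)) : Function.Injective (md I' I f x) := by
  have hc' : IsContactPair _ (dForm I' (pullForm I' I α f) x) :=
    isContactPair_of_ker (hα.pullForm hf) hα₀ (hker.mono fun z hz v => hz v) hc
  refine (injective_iff_map_eq_zero _).2 fun u hu => ?_
  by_contra hu0
  obtain ⟨v, -, hv⟩ := hc'.2 u (by rw [pullForm_apply, hu, map_zero]) hu0
  rw [dForm_pullForm hα hf, hu, map_zero] at hv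
  exact hv rfl

end Immersion

/-! ### The germ of the embedding along the zero slice. -/

section Germ

variable {n : ℕ} {L : Type*} [TopologicalSpace L] [ChartedSpace (EuclideanSpace ℝ (Fin n)) L]
  [IsManifold (𝓡 n) ∞ L]
  {g : Bundle.ContMDiffRiemannianMetric (𝓡 n) ∞ (EuclideanSpace ℝ (Fin n))
      (fun q : L => TangentSpace (𝓡 n) q)}
  {M : Type*} [TopologicalSpace M] [ChartedSpace (EuclideanSpace ℝ (Fin (2 * n + 3))) M]
  [IsManifold (𝓡 (2 * n + 3)) ∞ M]
  {ξ : ∀ x : M, Submodule ℝ (TangentSpace (𝓡 (2 * n + 3)) x)} {c₀ : ℝ}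
  {ι : Plane × Cotangent n L → M}

/-- The projection of `ℝ³ × T*L` to `ℝ² × T*L` along the height. -/
def discProj (x : (Plane × ℝ) × Cotangent n L) : Plane × Cotangent n L := (x.1.1, x.2)

lemma contMDiff_fst_fst : ContMDiff (boxModel n) 𝓘(ℝ, Plane) ∞
    fun x : (Plane × ℝ) × Cotangent n L => x.1.1 :=
  ContMDiff.comp (g := (Prod.fst : Plane × ℝ → Plane)) (f := Prod.fst)
    contDiff_fst.contMDiff contMDiff_fst

lemma contMDiff_discProj : ContMDiff (boxModel n) (discModel n) ∞ (discProj (n := n) (L := L)) :=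
  contMDiff_fst_fst.prodMk contMDiff_snd

lemma contMDiff_height : ContMDiff (boxModel n) 𝓘(ℝ, ℝ) ∞
    fun x : (Plane × ℝ) × Cotangent n L => x.1.2 :=
  ContMDiff.comp (g := (Prod.snd : Plane × ℝ → ℝ)) (f := Prod.fst)
    contDiff_snd.contMDiff contMDiff_fst

lemma md_fst_fst (x : (Plane × ℝ) × Cotangent n L) (v : (Plane × ℝ) × CotModel n) :
    md (boxModel n) 𝓘(ℝ, Plane) (fun x : (Plane × ℝ) × Cotangent n L => x.1.1) x v = v.1.1 := by
  rw [md_comp (I' := 𝓘(ℝ, Plane × ℝ)) (f := (Prod.fst : Plane × ℝ → Plane)) (g := Prod.fst)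
    (contDiff_fst.contMDiff.mdifferentiableAt (by simp : (∞ : WithTop ℕ∞) ≠ 0))
    (contMDiff_fst.mdifferentiableAt (by simp : (∞ : WithTop ℕ∞) ≠ 0)), md_eq_fderiv, fderiv_fst]
  change (mfderiv (boxModel n) 𝓘(ℝ, Plane × ℝ) Prod.fst x v).1 = _
  rw [mfderiv_fst]
  rfl

lemma dFun_height (x : (Plane × ℝ) × Cotangent n L) (v : (Plane × ℝ) × CotModel n) :
    dFun (boxModel n) (fun x : (Plane × ℝ) × Cotangent n L => x.1.2) x v = v.1.2 := by
  rw [dFun, md_comp (I' := 𝓘(ℝ, Plane × ℝ)) (f := (Prod.snd : Plane × ℝ → ℝ)) (g := Prod.fst)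
    (contDiff_snd.contMDiff.mdifferentiableAt (by simp : (∞ : WithTop ℕ∞) ≠ 0))
    (contMDiff_fst.mdifferentiableAt (by simp : (∞ : WithTop ℕ∞) ≠ 0)), md_eq_fderiv, fderiv_snd]
  change (mfderiv (boxModel n) 𝓘(ℝ, Plane × ℝ) Prod.fst x v).2 = _
  rw [mfderiv_fst]
  rfl

lemma md_discProj (x : (Plane × ℝ) × Cotangent n L) (v : (Plane × ℝ) × CotModel n) :
    md (boxModel n) (discModel n) discProj x v = (v.1.1, v.2) := by
  have h1 : md (boxModel n) (discModel n) discProj x =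
      (md (boxModel n) 𝓘(ℝ, Plane) (fun x : (Plane × ℝ) × Cotangent n L => x.1.1) x).prod
        (md (boxModel n) (cotangentModel n) Prod.snd x) :=
    mfderiv_prodMk (contMDiff_fst_fst.mdifferentiableAt (by simp))
      (contMDiff_snd.mdifferentiableAt (by simp : (∞ : WithTop ℕ∞) ≠ 0))
  rw [h1]
  refine Prod.ext (md_fst_fst x v) ?_
  change mfderiv (boxModel n) (cotangentModel n) Prod.snd x v = _
  rw [mfderiv_snd]
  rfl

/-- The model form is β + cos r dz, the shape h dζ over a hypersurface form which
`exists_contact_germ` requires. -/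
lemma boxOne_apply_eq (x : (Plane × ℝ) × Cotangent n L) (v : (Plane × ℝ) × CotModel n) :
    boxOne x v = betaOne (discProj x) (v.1.1, v.2) + cosRad x.1.1 * v.1.2 := by
  rw [boxOne_eq_boxCoord, betaOne_eq_betaCoord, boxCoord_apply, betaCoord_apply,
    show extChartAt (boxModel n) x x = _ from extChartAt_prod_apply x x,
    show extChartAt (discModel n) (discProj x) (discProj x) = _ from extChartAt_prod_apply _ _]
  simp only [discProj, cosRad]
  ring

lemma dForm_boxOne_apply_eq (x : (Plane × ℝ) × Cotangent n L) (u v : (Plane × ℝ) × CotModel n) :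
    dForm (boxModel n) boxOne x u v =
      dForm (discModel n) betaOne (discProj x) (u.1.1, u.2) (v.1.1, v.2) +
      (fderiv ℝ cosRad x.1.1 u.1.1 * v.1.2 - fderiv ℝ cosRad x.1.1 v.1.1 * u.1.2) := by
  rw [dForm_boxOne, dForm_betaOne, dOne_boxCoord, dOne_betaCoord,
    show extChartAt (boxModel n) x x = _ from extChartAt_prod_apply x x,
    show extChartAt (discModel n) (discProj x) (discProj x) = _ from extChartAt_prod_apply _ _]
  simp only [discProj]
  ring

section Plot

variable {W : Set (Plane × Cotangent n L)} {a : Plane × Cotangent n L}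

lemma plot_nhds (hW : IsOpen W) (haW : a ∈ W) (ha : a ∈ modelHypersurface g c₀) :
    {e | (extChartAt (discModel n) a).symm e ∈ W ∩ Prod.snd ⁻¹' diskBundle g c₀} ∩
      (extChartAt (discModel n) a).target ∈ 𝓝 (extChartAt (discModel n) a a) := by
  have hc := continuousAt_extChartAt_symm (I := discModel n) a
  rw [ContinuousAt, extChartAt_to_inv] at hc
  exact Filter.inter_mem (hc ((hW.inter ((isOpen_diskBundle g c₀).preimage
    continuous_snd)).mem_nhds ⟨haW, ha.2⟩)) (extChartAt_target_mem_nhds a)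

lemma plot_mem {e : Plane × CotModel n} (he : (extChartAt (discModel n) a).symm e ∈
      W ∩ Prod.snd ⁻¹' diskBundle g c₀) (het : e ∈ (extChartAt (discModel n) a).target)
    (hpi : ‖e.1‖ ≤ Real.pi) :
    (extChartAt (discModel n) a).symm e ∈ modelHypersurface g c₀ := by
  refine ⟨?_, he.2⟩
  have : ((extChartAt (discModel n) a).symm e).1 = e.1 := by
    rw [← extChartAt_disc_fst a, (extChartAt (discModel n) a).right_inv het]
  rw [mem_closedBall_zero_iff, this]
  exact hpi

/-- ι*α = β is known over the closed disc only. This set is contained in the closure of an open part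
of it, so first derivatives, and with them the exterior derivatives, still agree at its points. -/
lemma dForm_eq_of_pullback {α : OneForm (EuclideanSpace ℝ (Fin (2 * n + 3))) M}
    (hW : IsOpen W) (hιs : ∀ x ∈ W, ContMDiffAt (discModel n) (𝓡 (2 * n + 3)) ∞ ι x)
    (hSW : modelHypersurface g c₀ ⊆ W) (ha : a ∈ modelHypersurface g c₀)
    (hα : SmoothFormAt (𝓡 (2 * n + 3)) α (ι a))
    (h : ∀ b ∈ modelHypersurface g c₀, ∀ v,
      α (ι b) (md (discModel n) (𝓡 (2 * n + 3)) ι b v) = betaOne b v)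
    (u v : Plane × CotModel n) :
    dForm (𝓡 (2 * n + 3)) α (ι a) (md (discModel n) (𝓡 (2 * n + 3)) ι a u)
      (md (discModel n) (𝓡 (2 * n + 3)) ι a v) = dForm (discModel n) betaOne a u v := by
  have hs := SmoothFormAt.pullForm hα (hιs a (hSW ha))
  rw [← dForm_pullForm hα (hιs a (hSW ha)), dForm, dForm, dOne_apply, dOne_apply]
  suffices H : fderiv ℝ (pullForm 𝓘(ℝ, Plane × CotModel n) (discModel n)
      (pullForm (discModel n) (𝓡 (2 * n + 3)) α ι) (extChartAt (discModel n) a).symm)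
        (extChartAt (discModel n) a a) =
      fderiv ℝ (pullForm 𝓘(ℝ, Plane × CotModel n) (discModel n) betaOne
        (extChartAt (discModel n) a).symm) (extChartAt (discModel n) a a) by rw [H]
  refine fderiv_eq_of_mem_closure hs (smoothFormAt_betaOne a) (plot_nhds hW (hSW ha) ha)
    (isOpen_innerSet.preimage continuous_fst)
    (fst_mem_closure (by rw [extChartAt_disc_fst]; simpa using ha.1)) fun e he heQ => ?_
  refine ContinuousLinearMap.ext fun w => ?_
  rw [pullForm_apply, pullForm_apply, pullForm_apply]
  exact h _ (plot_mem he.1 he.2 (le_of_lt heQ.1)) _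

/-- Same density argument, for functions in place of forms. -/
lemma dFun_eq_of_restrict {h : M → ℝ}
    (hW : IsOpen W) (hιs : ∀ x ∈ W, ContMDiffAt (discModel n) (𝓡 (2 * n + 3)) ∞ ι x)
    (hSW : modelHypersurface g c₀ ⊆ W) (ha : a ∈ modelHypersurface g c₀)
    (hh : ContMDiffAt (𝓡 (2 * n + 3)) 𝓘(ℝ, ℝ) ∞ h (ι a))
    (hr : ∀ b ∈ modelHypersurface g c₀, h (ι b) = cosRad b.1) (u : Plane × CotModel n) :
    dFun (𝓡 (2 * n + 3)) h (ι a) (md (discModel n) (𝓡 (2 * n + 3)) ι a u) =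
      fderiv ℝ cosRad a.1 u.1 := by
  set φ := extChartAt (discModel n) a with hφ
  have hxx : φ.symm (φ a) = a := extChartAt_to_inv a
  have hιa := hιs a (hSW ha)
  have hcomp : ContMDiffAt (discModel n) 𝓘(ℝ, ℝ) ∞ (fun b => h (ι b)) a :=
    ContMDiffAt.comp a (f := ι) (g := h) hh hιa
  have h1 : ContDiffAt ℝ ∞ (fun e => h (ι (φ.symm e))) (φ a) :=
    contDiffAt_comp_extChartAt_symm hcomp
  have h2 : ContDiff ℝ ∞ (fun e : Plane × CotModel n => cosRad e.1) :=
    contDiff_cosRad.comp contDiff_fst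
  have h3 := fderiv_eq_of_mem_closure h1 h2.contDiffAt (plot_nhds hW (hSW ha) ha)
    (isOpen_innerSet.preimage continuous_fst)
    (fst_mem_closure (by rw [hφ, extChartAt_disc_fst]; simpa using ha.1)) fun e he heQ => by
      rw [hr _ (plot_mem he.1 he.2 (le_of_lt heQ.1))]
      congr 1
  have h4 : fderiv ℝ (fun e => h (ι (φ.symm e))) (φ a) =
      (md (𝓡 (2 * n + 3)) 𝓘(ℝ, ℝ) h (ι a)).comp (md (discModel n) (𝓡 (2 * n + 3)) ι a) := by
    have hd : MDifferentiableAt (discModel n) 𝓘(ℝ, ℝ) (fun b => h (ι b)) (φ.symm (φ a)) := by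
      rw [hxx]; exact hcomp.mdifferentiableAt (by simp)
    rw [← md_eq_fderiv, md_comp (I' := discModel n) (f := fun b => h (ι b)) (g := φ.symm) hd
      ((contMDiffAt_extChartAt_symm' (mem_extChartAt_target a)).mdifferentiableAt (by simp)),
      md_extChartAt_symm_self, hxx, md_comp (I' := 𝓡 (2 * n + 3)) (f := h) (g := ι)
        (hh.mdifferentiableAt (by simp)) (hιa.mdifferentiableAt (by simp)),
      ContinuousLinearMap.comp_id]
  have h5 : fderiv ℝ (fun e : Plane × CotModel n => cosRad e.1) (φ a) u =
      fderiv ℝ cosRad a.1 u.1 := by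
    have h6 : HasFDerivAt (fun e : Plane × CotModel n => cosRad e.1) _ (φ a) :=
      HasFDerivAt.comp (φ a) (f := Prod.fst) (g := cosRad)
        (contDiff_cosRad.differentiable (by simp) (φ a).1).hasFDerivAt hasFDerivAt_fst
    rw [h6.fderiv, hφ, extChartAt_disc_fst]
    rfl
  rw [← h5, ← h3, h4]
  rfl

end Plot

variable [T2Space L] [SecondCountableTopology L] [T2Space M] [SecondCountableTopology M]

/-- A neighbourhood of the model hypersurface is contactomorphic to a neighbourhood of the zero
height slice in the box. -/
theorem exists_box_germ (hξ : IsContactStructure ξ)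
    (hι : IsSmoothEmbeddingOn (discModel n) (𝓡 (2 * n + 3)) ι (modelHypersurface g c₀))
    (hk : InducesKernelOn (discModel n) (𝓡 (2 * n + 3)) ι (modelHypersurface g c₀) ξ betaForm)
    {U : Set M} (hU : IsOpen U) (hιU : ι '' modelHypersurface g c₀ ⊆ U) :
    ∃ (G : (Plane × ℝ) × Cotangent n L → M) (W : Set ((Plane × ℝ) × Cotangent n L)),
      IsOpen W ∧ (∀ x, discProj x ∈ modelHypersurface g c₀ → x.1.2 = 0 →
        x ∈ W ∧ G x = ι (discProj x)) ∧
      ∀ x ∈ W, G x ∈ U ∧ ContMDiffAt (boxModel n) (𝓡 (2 * n + 3)) ∞ G x ∧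
        (∀ v, md (boxModel n) (𝓡 (2 * n + 3)) G x v ∈ ξ (G x) ↔ boxOne x v = 0) ∧
        Function.Injective (md (boxModel n) (𝓡 (2 * n + 3)) G x) := by
  obtain ⟨O, α, h, hO, hOU, hα, hh, hS⟩ := exists_global_data hξ hι hk hU hιU
  obtain ⟨WS, hWS, hSW, hιW⟩ := hι.smooth
  have hιs : ∀ x ∈ WS, ContMDiffAt (discModel n) (𝓡 (2 * n + 3)) ∞ ι x := fun x hx =>
    hιW.contMDiffAt (hWS.mem_nhds hx)
  obtain ⟨G, W, hW, hAW, hGA, hG⟩ := exists_contact_germ (I := 𝓡 (2 * n + 3)) (IS := discModel n)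
    (IN := boxModel n) (ι := ι) (π := discProj) (ζ := fun x => x.1.2) (α := α) (h := h)
    (α₀ := boxOne) (A := {x | discProj x ∈ modelHypersurface g c₀ ∧ x.1.2 = 0}) (WS := WS)
    hO (fun y hy => (hα y hy).1) (fun y hy => (hα y hy).2.1) hh contMDiff_discProj contMDiff_height
    smoothFormAt_boxOne (fun a _ => isContactPair_boxOne a) hWS hιs (fun a ha => hSW ha.1)
    (fun a ha => (hS _ ha.1).1) (fun a ha => ha.2)
    (fun a ha v => by
      rw [md_discProj, (hS _ ha.1).2.1, (hS _ ha.1).2.2, boxOne_apply_eq, dFun_height]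
      rfl)
    (fun a ha u v => by
      rw [md_discProj, md_discProj, dForm_boxOne_apply_eq, dFun_height, dFun_height,
        dForm_eq_of_pullback hWS hιs hSW ha.1 (hα _ (hS _ ha.1).1).1 (fun b hb => (hS b hb).2.1),
        dFun_eq_of_restrict hWS hιs hSW ha.1 (hh _ (hS _ ha.1).1) (fun b hb => (hS b hb).2.2),
        dFun_eq_of_restrict hWS hιs hSW ha.1 (hh _ (hS _ ha.1).1) (fun b hb => (hS b hb).2.2)]
      rfl)
  refine ⟨G, W, hW, fun x h1 h2 => ⟨hAW ⟨h1, h2⟩, hGA x ⟨h1, h2⟩⟩, fun x hx => ?_⟩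
  obtain ⟨hGO, hGs, hGk⟩ := hG x hx
  refine ⟨hOU hGO, hGs, fun v => ((hα _ hGO).2.2 _).trans (hGk v), ?_⟩
  refine injective_md_of_ker (hα _ hGO).1 hGs (smoothFormAt_boxOne x) ?_ (isContactPair_boxOne x)
  filter_upwards [hW.mem_nhds hx] with z hz v
  exact (hG z hz).2.2 v

end Germ

end OvertwistedBox

end

noncomputable section
namespace OvertwistedBox

set_option linter.unusedSectionVars false

open Set Topology Filter

/-! ### The curve (cos r, r sin r) and the function r tan r. -/

section Tangent

lemma hasDerivAt_mul_tan {t : ℝ} (ht : Real.cos t ≠ 0) : HasDerivAt (fun t => t * Real.tan t)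
    ((t + Real.cos t * Real.sin t) / Real.cos t ^ 2) t := by
  have h : HasDerivAt (fun t => t * Real.tan t) _ t :=
    (hasDerivAt_id t).mul (Real.hasDerivAt_tan ht)
  convert h using 1
  rw [Real.tan_eq_sin_div_cos, id]
  field_simp
  ring

lemma add_cos_mul_sin_pos {t : ℝ} (ht : 0 < t) : 0 < t + Real.cos t * Real.sin t := by
  have h := one_add_cosSqrt_mul_sincSqrt_pos (sq_nonneg t)
  rw [cosSqrt_sq] at h
  have h2 := mul_sincSqrt_sq t
  have h3 := mul_pos ht h
  have : t * (1 + Real.cos t * sincSqrt (t ^ 2)) = t + Real.cos t * Real.sin t := by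
    rw [← h2]; ring
  rwa [this] at h3

/-- The derivative has the numerator t + cos t sin t, which is positive for t > 0. -/
lemma strictMonoOn_mul_tan {D : Set ℝ} (hD : Convex ℝ D) (h0 : ∀ t ∈ D, 0 ≤ t)
    (hcos : ∀ t ∈ D, Real.cos t ≠ 0) : StrictMonoOn (fun t => t * Real.tan t) D := by
  refine strictMonoOn_of_deriv_pos hD
    (fun t ht => (hasDerivAt_mul_tan (hcos t ht)).continuousAt.continuousWithinAt) fun t ht => ?_
  have htD := interior_subset ht
  rw [(hasDerivAt_mul_tan (hcos t htD)).deriv]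
  have htpos : 0 < t := by
    rcases (h0 t htD).lt_or_eq with h | h
    · exact h
    · exfalso
      have h1 := mem_interior_iff_mem_nhds.1 ht
      rw [← h] at h1
      obtain ⟨ε, hε, hb⟩ := Metric.mem_nhds_iff.1 h1
      have := h0 (-(ε / 2)) (hb (by simp [abs_of_pos hε]; linarith))
      linarith
  have := hcos t htD
  have := add_cos_mul_sin_pos htpos
  positivity

lemma cos_neg_of_branch {t : ℝ} (h1 : Real.pi / 2 < t) (h2 : t < 3 * Real.pi / 2) :
    Real.cos t < 0 := Real.cos_neg_of_pi_div_two_lt_of_lt h1 (by linarith)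

lemma strictMonoOn_mul_tan_Ico : StrictMonoOn (fun t => t * Real.tan t) (Ico 0 (Real.pi / 2)) :=
  strictMonoOn_mul_tan (convex_Ico _ _) (fun _ ht => ht.1) fun t ht =>
    (Real.cos_pos_of_mem_Ioo ⟨by linarith [ht.1, Real.pi_pos], ht.2⟩).ne'

lemma strictMonoOn_mul_tan_Ioo :
    StrictMonoOn (fun t => t * Real.tan t) (Ioo (Real.pi / 2) (3 * Real.pi / 2)) :=
  strictMonoOn_mul_tan (convex_Ioo _ _) (fun _ ht => by linarith [ht.1, Real.pi_pos]) fun t ht =>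
    (cos_neg_of_branch ht.1 ht.2).ne

lemma cos_cases {t : ℝ} (h0 : 0 ≤ t) (h1 : t < 3 * Real.pi / 2) :
    (t ∈ Ico 0 (Real.pi / 2) ∧ 0 < Real.cos t) ∨ (t = Real.pi / 2 ∧ Real.cos t = 0) ∨
      (t ∈ Ioo (Real.pi / 2) (3 * Real.pi / 2) ∧ Real.cos t < 0) := by
  rcases lt_trichotomy t (Real.pi / 2) with h | h | h
  · exact Or.inl ⟨⟨h0, h⟩, Real.cos_pos_of_mem_Ioo ⟨by linarith [Real.pi_pos], h⟩⟩
  · exact Or.inr (Or.inl ⟨h, by rw [h, Real.cos_pi_div_two]⟩)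
  · exact Or.inr (Or.inr ⟨⟨h, h1⟩, cos_neg_of_branch h h1⟩)

/-- The curve `t ↦ (cos t, t sin t)` meets each ray once. -/
lemma eq_of_ray {a b l l' : ℝ} {u v : ℝ} (ha0 : 0 ≤ a) (ha : a < 3 * Real.pi / 2) (hb0 : 0 ≤ b)
    (hb : b < 3 * Real.pi / 2) (hl : 0 < l) (hl' : 0 < l') (h1 : Real.cos a = l * u)
    (h2 : a * Real.sin a = l * v) (h3 : Real.cos b = l' * u) (h4 : b * Real.sin b = l' * v) :
    a = b := by
  have hcross : Real.cos a * (b * Real.sin b) = Real.cos b * (a * Real.sin a) := by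
    rw [h1, h2, h3, h4]; ring
  have hsign : 0 ≤ Real.cos a * Real.cos b := by
    rw [h1, h3, show l * u * (l' * u) = l * l' * u ^ 2 by ring]; positivity
  have hzero : Real.cos a = 0 ↔ Real.cos b = 0 := by
    rw [h1, h3, mul_eq_zero, mul_eq_zero]
    simp [hl.ne', hl'.ne']
  have htan : Real.cos a ≠ 0 → Real.cos b ≠ 0 → a * Real.tan a = b * Real.tan b := fun h h' => by
    rw [Real.tan_eq_sin_div_cos, Real.tan_eq_sin_div_cos]
    field_simp
    linarith
  rcases cos_cases ha0 ha with ⟨hA, hca⟩ | ⟨hA, hca⟩ | ⟨hA, hca⟩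
  · rcases cos_cases hb0 hb with ⟨hB, hcb⟩ | ⟨hB, hcb⟩ | ⟨hB, hcb⟩
    · exact strictMonoOn_mul_tan_Ico.injOn hA hB (htan hca.ne' hcb.ne')
    · exact absurd (hzero.2 hcb) hca.ne'
    · nlinarith
  · rcases cos_cases hb0 hb with ⟨hB, hcb⟩ | ⟨hB, hcb⟩ | ⟨hB, hcb⟩
    · exact absurd (hzero.1 hca) hcb.ne'
    · rw [hA, hB]
    · exact absurd (hzero.1 hca) hcb.ne
  · rcases cos_cases hb0 hb with ⟨hB, hcb⟩ | ⟨hB, hcb⟩ | ⟨hB, hcb⟩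
    · nlinarith
    · exact absurd (hzero.2 hcb) hca.ne
    · exact strictMonoOn_mul_tan_Ioo.injOn hA hB (htan hca.ne hcb.ne)

lemma continuousOn_mul_tan {D : Set ℝ} (hcos : ∀ t ∈ D, Real.cos t ≠ 0) :
    ContinuousOn (fun t => t * Real.tan t) D := fun t ht =>
  (hasDerivAt_mul_tan (hcos t ht)).continuousAt.continuousWithinAt

/-- Intermediate value theorem for R tan R = s r tan r on the branch of the tangent that contains r.
Since s ≤ 1, R moves from r towards the zero of the branch, which is 0 on the first and π on the
second; thus R can exceed r only for π/2 < r ≤ R ≤ π. At the pole r = π/2, R = r. -/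
lemma exists_radius {s r : ℝ} (hs : 0 < s) (hs1 : s ≤ 1) (hr : 0 < r) (hr3 : r < 3 * Real.pi / 2) :
    ∃ R, 0 < R ∧ R < 3 * Real.pi / 2 ∧ (R ≤ r ∨ Real.pi / 2 < r ∧ r ≤ R ∧ R ≤ Real.pi) ∧
      R * Real.sin R * Real.cos r = s * (r * Real.sin r) * Real.cos R ∧
      (r = Real.pi / 2 ∧ R = r ∨ 0 < Real.cos R * Real.cos r) := by
  have hpi := Real.pi_pos
  have key : ∀ R, Real.cos R ≠ 0 → Real.cos r ≠ 0 → R * Real.tan R = s * (r * Real.tan r) →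
      R * Real.sin R * Real.cos r = s * (r * Real.sin r) * Real.cos R := fun R h1 h2 h => by
    rw [Real.tan_eq_sin_div_cos, Real.tan_eq_sin_div_cos] at h
    field_simp at h
    linarith
  rcases cos_cases hr.le hr3 with ⟨hA, hc⟩ | ⟨hA, hc⟩ | ⟨hA, hc⟩
  · have hcos : ∀ t ∈ Icc 0 r, 0 < Real.cos t := fun t ht =>
      Real.cos_pos_of_mem_Ioo ⟨by linarith [ht.1], ht.2.trans_lt hA.2⟩
    have hP : 0 < r * Real.tan r :=
      mul_pos hr (Real.tan_pos_of_pos_of_lt_pi_div_two hr hA.2)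
    obtain ⟨R, hR, hRe⟩ := intermediate_value_Icc hr.le
      (continuousOn_mul_tan fun t ht => (hcos t ht).ne')
      (show s * (r * Real.tan r) ∈ Icc ((0 : ℝ) * Real.tan 0) (r * Real.tan r) by
        constructor
        · rw [zero_mul]; positivity
        · nlinarith)
    have hR0 : 0 < R := by
      rcases hR.1.lt_or_eq with h | h
      · exact h
      · rw [← h] at hRe
        simp only [zero_mul] at hRe
        have := mul_pos hs hP
        linarith
    exact ⟨R, hR0, hR.2.trans_lt hr3, Or.inl hR.2, key R (hcos R hR).ne' hc.ne' hRe,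
      Or.inr (mul_pos (hcos R hR) hc)⟩
  · refine ⟨r, hr, hr3, Or.inl le_rfl, ?_, Or.inl ⟨hA, rfl⟩⟩
    rw [hc, mul_zero, mul_zero]
  · rcases le_total Real.pi r with h | h
    · have hcos : ∀ t ∈ Icc Real.pi r, Real.cos t < 0 := fun t ht =>
        cos_neg_of_branch (by linarith [ht.1]) (ht.2.trans_lt hr3)
      have hP : 0 ≤ r * Real.tan r := by
        have := strictMonoOn_mul_tan_Ioo.monotoneOn (a := Real.pi) ⟨by linarith, by linarith⟩ hA h
        simpa using this
      obtain ⟨R, hR, hRe⟩ := intermediate_value_Icc h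
        (continuousOn_mul_tan fun t ht => (hcos t ht).ne)
        (show s * (r * Real.tan r) ∈ Icc (Real.pi * Real.tan Real.pi) (r * Real.tan r) by
          constructor
          · rw [Real.tan_pi, mul_zero]; positivity
          · nlinarith)
      exact ⟨R, by linarith [hR.1], hR.2.trans_lt hr3, Or.inl hR.2, key R (hcos R hR).ne hc.ne hRe,
        Or.inr (mul_pos_of_neg_of_neg (hcos R hR) hc)⟩
    · have hcos : ∀ t ∈ Icc r Real.pi, Real.cos t < 0 := fun t ht =>
        cos_neg_of_branch (by linarith [ht.1, hA.1]) (by linarith [ht.2])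
      have hP : r * Real.tan r ≤ 0 := by
        have := strictMonoOn_mul_tan_Ioo.monotoneOn (b := Real.pi) hA ⟨by linarith, by linarith⟩ h
        simpa using this
      obtain ⟨R, hR, hRe⟩ := intermediate_value_Icc h
        (continuousOn_mul_tan fun t ht => (hcos t ht).ne)
        (show s * (r * Real.tan r) ∈ Icc (r * Real.tan r) (Real.pi * Real.tan Real.pi) by
          constructor
          · nlinarith
          · rw [Real.tan_pi, mul_zero]; nlinarith)
      exact ⟨R, by linarith [hR.1], by linarith [hR.2], Or.inr ⟨hA.1, hR.1, hR.2⟩,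
        key R (hcos R hR).ne hc.ne hRe, Or.inr (mul_pos_of_neg_of_neg (hcos R hR) hc)⟩

/-- The true maximum is about 1.82, near t = π/2 + 0.46. The bound 1.83 leaves just enough room:
1.83 / (π/2) < 1.166. A Taylor estimate of cos u covers u ≤ 1, and monotonicity of cos the rest. -/
lemma mul_sin_le {t : ℝ} (h1 : Real.pi / 2 ≤ t) (h2 : t ≤ Real.pi) : t * Real.sin t ≤ 183 / 100 := by
  have hp1 := Real.pi_gt_d4
  have hp2 := Real.pi_lt_d4
  obtain ⟨u, rfl⟩ : ∃ u, t = Real.pi / 2 + u := ⟨t - Real.pi / 2, by ring⟩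
  have hu0 : 0 ≤ u := by linarith
  rw [add_comm (Real.pi / 2) u, Real.sin_add_pi_div_two]
  by_cases hu : u ≤ 1
  · have hc := (abs_le.1 (Real.cos_bound (x := u) (by rwa [abs_of_nonneg hu0]))).2
    rw [abs_of_nonneg hu0] at hc
    have hc' : Real.cos u ≤ 1 - u ^ 2 / 2 + u ^ 4 * (5 / 96) := by linarith
    have hpos : 0 ≤ u + Real.pi / 2 := by linarith
    have h3 : 0 ≤ 1 - u ^ 2 / 2 + u ^ 4 * (5 / 96) := by nlinarith [sq_nonneg (u ^ 2)]
    calc (u + Real.pi / 2) * Real.cos u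
        ≤ (u + Real.pi / 2) * (1 - u ^ 2 / 2 + u ^ 4 * (5 / 96)) := by gcongr
      _ ≤ (u + 1.5708) * (1 - u ^ 2 / 2 + u ^ 4 * (5 / 96)) := by gcongr; linarith
      _ ≤ 183 / 100 := by
        -- 0.46 approximates the position of the maximum, so squares of u - 0.46 are the natural
        -- certificates.
        nlinarith [sq_nonneg (u - 0.46), mul_nonneg hu0 (sq_nonneg (u - 0.46)),
          mul_nonneg hu0 (sub_nonneg.2 hu), mul_nonneg (mul_nonneg hu0 hu0) (sub_nonneg.2 hu),
          mul_nonneg (mul_nonneg (mul_nonneg hu0 hu0) hu0) (sub_nonneg.2 hu),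
          sq_nonneg (u * (u - 0.46)), mul_nonneg hu0 (sq_nonneg (u * (u - 0.46)))]
  · have hcos : Real.cos u ≤ Real.cos 1 :=
      Real.cos_le_cos_of_nonneg_of_le_pi zero_le_one (by linarith) (by linarith)
    have hc := (abs_le.1 (Real.cos_bound (x := 1) (by simp))).2
    norm_num at hc
    have : Real.cos u ≤ 0.5521 := by norm_num; linarith
    have hcos0 : 0 ≤ Real.cos u := Real.cos_nonneg_of_mem_Icc ⟨by linarith, by linarith⟩
    nlinarith

/-- The second derivative 2 cos t - t sin t has both terms nonpositive on [π/2, π]. -/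
lemma concaveOn_mul_sin : ConcaveOn ℝ (Icc (Real.pi / 2) Real.pi) fun t => t * Real.sin t := by
  have hd : ∀ t : ℝ, HasDerivAt (fun t => t * Real.sin t) (Real.sin t + t * Real.cos t) t := fun t => by
    have h : HasDerivAt (fun t => t * Real.sin t) _ t := (hasDerivAt_id t).mul (Real.hasDerivAt_sin t)
    simpa using h
  have hd1 : deriv (fun t => t * Real.sin t) = fun t => Real.sin t + t * Real.cos t :=
    funext fun t => (hd t).deriv
  have hd2 : ∀ t : ℝ, HasDerivAt (fun t => Real.sin t + t * Real.cos t)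
      (2 * Real.cos t - t * Real.sin t) t := fun t => by
    have h : HasDerivAt (fun t => Real.sin t + t * Real.cos t) _ t :=
      (Real.hasDerivAt_sin t).add ((hasDerivAt_id t).mul (Real.hasDerivAt_cos t))
    convert h using 1
    simp
    ring
  refine concaveOn_of_deriv2_nonpos' (convex_Icc _ _)
    (fun t _ => (hd t).differentiableAt.differentiableWithinAt) ?_ fun t ht => ?_
  · rw [hd1]
    exact fun t _ => (hd2 t).differentiableAt.differentiableWithinAt
  · rw [Function.iterate_succ, Function.iterate_one, Function.comp_apply, hd1, (hd2 t).deriv]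
    have h1 := Real.cos_nonpos_of_pi_div_two_le_of_le ht.1 (by linarith [ht.2, Real.pi_pos])
    have h2 := Real.sin_nonneg_of_nonneg_of_le_pi (by linarith [ht.1, Real.pi_pos]) ht.2
    have h3 : 0 ≤ t := by linarith [ht.1, Real.pi_pos]
    nlinarith

/-- The squeezing factor is bounded by a constant less than `7 / 6`. -/
lemma factor_le {s r R f : ℝ} (hs : 0 < s) (hs1 : s ≤ 1) (hr : 0 < r) (hR : 0 < R)
    (hcase : R ≤ r ∨ Real.pi / 2 < r ∧ r ≤ R ∧ R ≤ Real.pi)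
    (h1 : f * Real.cos r = s * Real.cos R) (h2 : f * (r * Real.sin r) = R * Real.sin R) :
    f ≤ 1166 / 1000 := by
  by_cases hle : R ≤ r
  · have h3 : f * Real.sin r = R / r * Real.sin R := by
      field_simp; linarith
    -- If R ≤ r, then f² = s² cos² R + (R/r)² sin² R is at most 1.
    have h4 : f ^ 2 = (s * Real.cos R) ^ 2 + (R / r * Real.sin R) ^ 2 := by
      rw [← h1, ← h3]
      linear_combination -f ^ 2 * Real.sin_sq_add_cos_sq r
    have h5 : (R / r) ≤ 1 := by rw [div_le_one hr]; exact hle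
    have h6 : 0 ≤ R / r := by positivity
    have h7 : f ^ 2 ≤ 1 := by
      rw [h4, mul_pow, mul_pow, ← Real.cos_sq_add_sin_sq R]
      have : s ^ 2 ≤ 1 := by nlinarith
      have : (R / r) ^ 2 ≤ 1 := by nlinarith
      nlinarith [sq_nonneg (Real.cos R), sq_nonneg (Real.sin R)]
    nlinarith
  · obtain ⟨h3, h4, h5⟩ := hcase.resolve_left hle
    have hlt : r < R := not_le.1 hle
    have hsin : 0 < Real.sin r := Real.sin_pos_of_pos_of_lt_pi hr (by linarith)
    have hmul : 0 < r * Real.sin r := mul_pos hr hsin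
    -- On [π/2, R] a concave function is at least the smaller of its end values, so r sin r ≥ min
    -- (π/2, R sin R). In the first case f ≤ 1.83 / (π/2), in the second f ≤ 1.
    have hmin := concaveOn_mul_sin.min_le_of_mem_Icc (x := Real.pi / 2) (y := R) (z := r)
      ⟨le_rfl, by linarith [Real.pi_pos]⟩ ⟨by linarith, h5⟩ ⟨h3.le, h4⟩
    simp only [Real.sin_pi_div_two, mul_one] at hmin
    rcases min_le_iff.1 hmin with h | h
    · have h6 := mul_sin_le (t := R) (by linarith) h5
      have := Real.pi_gt_d4
      by_contra! hf
      nlinarith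
    · by_contra! hf
      nlinarith

end Tangent

end OvertwistedBox

end

noncomputable section
namespace OvertwistedBox

set_option linter.unusedSectionVars false

open Set Topology Filter

/-! ### The squeezing equation and its smooth solution. -/

section Squeeze

/-- The equation for the squared ratio `κ` of the radii `R` and `r = √τ` with
`R tan R = s r tan r`. -/
def squeezeEq (s τ κ : ℝ) : ℝ :=
  κ * sincSqrt (κ * τ) * cosSqrt τ - s * cosSqrt (κ * τ) * sincSqrt τ

/-- The conformal factor of the squeezing map. -/
def squeezeFactor (s τ κ : ℝ) : ℝ :=
  s * cosSqrt (κ * τ) * cosSqrt τ + κ * τ * sincSqrt (κ * τ) * sincSqrt τ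

/-- `κ` is the squared ratio of radii, on the correct branch of the tangent. -/
structure IsSqueeze (s τ κ : ℝ) : Prop where
  pos : 0 < κ
  lt : κ * τ < (3 * Real.pi / 2) ^ 2
  eq : squeezeEq s τ κ = 0
  factor_pos : 0 < squeezeFactor s τ κ

variable {s τ κ : ℝ}

/-- With r² = τ and R² = κτ, put a = (s cos R, κ r sinc R) and b = (cos r, sin r). Then
`squeezeFactor` is the inner product of a and b, and r times `squeezeEq` is their cross product. As
b is a unit vector and the cross product vanishes, a is `squeezeFactor` times b. This is its first
component, and `factor_sinc` is the second one with r cancelled. -/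
lemma IsSqueeze.factor_cos (h : IsSqueeze s τ κ) (hτ : 0 ≤ τ) :
    squeezeFactor s τ κ * cosSqrt τ = s * cosSqrt (κ * τ) := by
  have h1 := cosSqrt_sq_add hτ
  have h2 := h.eq
  unfold squeezeEq at h2
  unfold squeezeFactor
  linear_combination s * cosSqrt (κ * τ) * h1 + τ * sincSqrt τ * h2

lemma IsSqueeze.factor_sinc (h : IsSqueeze s τ κ) (hτ : 0 ≤ τ) :
    squeezeFactor s τ κ * sincSqrt τ = κ * sincSqrt (κ * τ) := by
  have h1 := cosSqrt_sq_add hτ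
  have h2 := h.eq
  unfold squeezeEq at h2
  unfold squeezeFactor
  linear_combination κ * sincSqrt (κ * τ) * h1 - cosSqrt τ * h2

lemma cosSqrt_eq (hτ : 0 ≤ τ) : cosSqrt τ = Real.cos √τ := by
  rw [← cosSqrt_sq, Real.sq_sqrt hτ]

lemma mul_sincSqrt_eq (hτ : 0 ≤ τ) : τ * sincSqrt τ = √τ * Real.sin √τ := by
  rw [← mul_sincSqrt_sq, Real.sq_sqrt hτ, ← mul_assoc, Real.mul_self_sqrt hτ]

lemma sqrt_lt_of_lt (h : τ < (3 * Real.pi / 2) ^ 2) : √τ < 3 * Real.pi / 2 :=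
  (Real.sqrt_lt' (by have := Real.pi_pos; positivity)).2 h

/-- The radii satisfy `f (cos r, r sin r) = (s cos R, R sin R)`. -/
lemma IsSqueeze.polar (h : IsSqueeze s τ κ) (hτ : 0 ≤ τ) :
    squeezeFactor s τ κ * Real.cos √τ = s * Real.cos √(κ * τ) ∧
    squeezeFactor s τ κ * (√τ * Real.sin √τ) = √(κ * τ) * Real.sin √(κ * τ) := by
  have hκτ : 0 ≤ κ * τ := mul_nonneg h.pos.le hτ
  rw [← cosSqrt_eq hτ, ← cosSqrt_eq hκτ, ← mul_sincSqrt_eq hτ, ← mul_sincSqrt_eq hκτ]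
  refine ⟨h.factor_cos hτ, ?_⟩
  linear_combination τ * h.factor_sinc hτ

lemma IsSqueeze.eq_of_zero (h : IsSqueeze s 0 κ) : κ = s := by
  have h2 := h.eq
  have h0 : cosSqrt 0 = 1 := by simpa using cosSqrt_sq 0
  have h1 : sincSqrt 0 = 1 := by simpa using sincSqrt_sq 0
  rw [squeezeEq, mul_zero, h0, h1] at h2
  linarith

/-- Both radii R lie on the same ray of the curve (cos R, R sin R), because the factors are
positive; `eq_of_ray` applies. At τ = 0 the equation itself reads κ = s. -/
lemma IsSqueeze.unique {κ' : ℝ} (hs : 0 < s) (hτ : 0 ≤ τ) (h : IsSqueeze s τ κ)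
    (h' : IsSqueeze s τ κ') : κ = κ' := by
  rcases hτ.eq_or_lt with rfl | hτ0
  · rw [h.eq_of_zero, h'.eq_of_zero]
  · obtain ⟨h1, h2⟩ := h.polar hτ
    obtain ⟨h3, h4⟩ := h'.polar hτ
    have hsq : √(κ * τ) = √(κ' * τ) := by
      refine eq_of_ray (l := squeezeFactor s τ κ) (l' := squeezeFactor s τ κ')
        (u := Real.cos √τ / s) (v := √τ * Real.sin √τ) (Real.sqrt_nonneg _) (sqrt_lt_of_lt h.lt)
        (Real.sqrt_nonneg _) (sqrt_lt_of_lt h'.lt) h.factor_pos h'.factor_pos ?_ h2.symm ?_ h4.symm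
      · field_simp; linarith
      · field_simp; linarith
    rw [Real.sqrt_inj (mul_nonneg h.pos.le hτ) (mul_nonneg h'.pos.le hτ)] at hsq
    exact mul_right_cancel₀ hτ0.ne' hsq

lemma IsSqueeze.injective {τ' κ' : ℝ} (hτ : 0 ≤ τ) (hτ' : 0 ≤ τ')
    (hτ3 : τ < (3 * Real.pi / 2) ^ 2) (hτ3' : τ' < (3 * Real.pi / 2) ^ 2)
    (h : IsSqueeze s τ κ) (h' : IsSqueeze s τ' κ') (he : κ * τ = κ' * τ') : τ = τ' := by
  obtain ⟨h1, h2⟩ := h.polar hτ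
  obtain ⟨h3, h4⟩ := h'.polar hτ'
  rw [← he] at h3 h4
  have hf := h.factor_pos
  have hf' := h'.factor_pos
  have hsq : √τ = √τ' := by
    refine eq_of_ray (l := (squeezeFactor s τ κ)⁻¹) (l' := (squeezeFactor s τ' κ')⁻¹)
      (u := s * Real.cos √(κ * τ)) (v := √(κ * τ) * Real.sin √(κ * τ)) (Real.sqrt_nonneg _)
      (sqrt_lt_of_lt hτ3) (Real.sqrt_nonneg _) (sqrt_lt_of_lt hτ3') (by positivity) (by positivity)
      ?_ ?_ ?_ ?_
    · rw [← h1]; field_simp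
    · rw [← h2]; field_simp
    · rw [← h3]; field_simp
    · rw [← h4]; field_simp
  rwa [Real.sqrt_inj hτ hτ'] at hsq

/-- κ = (R/r)² with R from `exists_radius`; the factor is positive because cos R and cos r have the
same sign, except at r = R = π/2, where it is computed directly. At τ = 0 the value is κ = s. -/
lemma exists_isSqueeze (hs : 0 < s) (hs1 : s ≤ 1) (hτ : 0 ≤ τ) (hτ3 : τ < (3 * Real.pi / 2) ^ 2) :
    ∃ κ, IsSqueeze s τ κ ∧ squeezeFactor s τ κ ≤ 1166 / 1000 ∧
      (√(κ * τ) ≤ √τ ∨ √(κ * τ) ≤ Real.pi) := by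
  rcases hτ.eq_or_lt with rfl | hτ0
  · have h0 : cosSqrt 0 = 1 := by simpa using cosSqrt_sq 0
    have hf : squeezeFactor s 0 s = s := by simp [squeezeFactor, h0]
    refine ⟨s, ⟨hs, by rw [mul_zero]; exact hτ3, by simp [squeezeEq]; ring, by rwa [hf]⟩, ?_, ?_⟩
    · rw [hf]; linarith
    · simp
  set r := √τ with hr
  have hr0 : 0 < r := Real.sqrt_pos.2 hτ0
  have hrτ : r ^ 2 = τ := Real.sq_sqrt hτ
  obtain ⟨R, hR0, hR3, hcase, heq, hbr⟩ := exists_radius hs hs1 hr0 (sqrt_lt_of_lt hτ3)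
  have hκτ : (R / r) ^ 2 * τ = R ^ 2 := by rw [← hrτ]; field_simp
  have hsinR := mul_sincSqrt_sq R
  have hsinr := mul_sincSqrt_sq r
  have hK : ∀ {y : ℝ}, 0 < y → sincSqrt (y ^ 2) = Real.sin y / y := fun {y} hy => by
    rw [← mul_sincSqrt_sq y]; field_simp
  have hsq : squeezeEq s τ ((R / r) ^ 2) = 0 := by
    rw [squeezeEq, hκτ, ← hrτ, cosSqrt_sq, cosSqrt_sq, hK hR0, hK hr0]
    field_simp
    linarith
  have hfeq : squeezeFactor s τ ((R / r) ^ 2) =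
      s * Real.cos R * Real.cos r + R * Real.sin R * (Real.sin r / r) := by
    rw [squeezeFactor, hκτ, ← hrτ, cosSqrt_sq, cosSqrt_sq, hK hR0, hK hr0]
    field_simp
  have hsc := Real.sin_sq_add_cos_sq r
  have hfc : squeezeFactor s τ ((R / r) ^ 2) * Real.cos r = s * Real.cos R := by
    rw [hfeq]
    field_simp
    linear_combination s * Real.cos R * r * hsc + Real.sin r * heq
  have hf0 : 0 < squeezeFactor s τ ((R / r) ^ 2) := by
    rcases hbr with ⟨h1, h2⟩ | hpos
    · rw [hfeq, h2, h1, Real.sin_pi_div_two, Real.cos_pi_div_two]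
      have := Real.pi_pos
      field_simp
      norm_num
    · by_contra! hneg
      have h1 : squeezeFactor s τ ((R / r) ^ 2) * Real.cos r ^ 2 = s * (Real.cos R * Real.cos r) := by
        linear_combination Real.cos r * hfc
      have h2 : 0 < s * (Real.cos R * Real.cos r) := mul_pos hs hpos
      nlinarith [sq_nonneg (Real.cos r)]
  have hS : IsSqueeze s τ ((R / r) ^ 2) := ⟨by positivity, by rw [hκτ]; gcongr, hsq, hf0⟩
  have hpol := hS.polar hτ
  rw [hκτ, Real.sqrt_sq hR0.le] at hpol
  refine ⟨(R / r) ^ 2, hS, factor_le hs hs1 hr0 hR0 hcase hpol.1 hpol.2, ?_⟩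
  rw [hκτ, Real.sqrt_sq hR0.le]
  rcases hcase with h | h
  · exact Or.inl h
  · exact Or.inr h.2.2

/-- For small `s` the disc of radius `π + δ` is squeezed into any disc of radius more than `π`. -/
lemma exists_squeeze_radius {δ ρ : ℝ} (hδ : 0 < δ) (hδ2 : δ < Real.pi / 2) (hρ : 0 < ρ) :
    ∃ ε > 0, ∀ s τ κ, 0 < s → s < ε → s ≤ 1 → 0 ≤ τ → τ < (Real.pi + δ) ^ 2 → IsSqueeze s τ κ →
      √(κ * τ) < Real.pi + ρ := by
  have hpi := Real.pi_pos
  -- Keeps π + ρ' on the branch (π/2, 3π/2) of the tangent.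
  set ρ' := min ρ δ with hρ'
  have hρ'0 : 0 < ρ' := lt_min hρ hδ
  have hρ'2 : ρ' < Real.pi / 2 := (min_le_right _ _).trans_lt hδ2
  set P : ℝ → ℝ := fun t => t * Real.tan t with hP
  have hmono := strictMonoOn_mul_tan_Ioo
  have hmemδ : Real.pi + δ ∈ Ioo (Real.pi / 2) (3 * Real.pi / 2) := ⟨by linarith, by linarith⟩
  have hmemρ : Real.pi + ρ' ∈ Ioo (Real.pi / 2) (3 * Real.pi / 2) := ⟨by linarith, by linarith⟩
  have hmempi : Real.pi ∈ Ioo (Real.pi / 2) (3 * Real.pi / 2) := ⟨by linarith, by linarith⟩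
  have hPpi : P Real.pi = 0 := by simp [hP]
  have hPδ : 0 < P (Real.pi + δ) := by
    rw [← hPpi]; exact hmono hmempi hmemδ (by linarith)
  have hPρ : 0 < P (Real.pi + ρ') := by
    rw [← hPpi]; exact hmono hmempi hmemρ (by linarith)
  -- P R = s P r and P is increasing, so below this ratio P R < P (π + ρ') whenever r < π + δ.
  refine ⟨P (Real.pi + ρ') / P (Real.pi + δ), div_pos hPρ hPδ, ?_⟩
  intro s τ κ hs hsε hs1 hτ hτδ h
  have hτ3 : τ < (3 * Real.pi / 2) ^ 2 := hτδ.trans (by gcongr; linarith)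
  obtain ⟨κ', h', -, hcase⟩ := exists_isSqueeze hs hs1 hτ hτ3
  obtain rfl := h.unique hs hτ h'
  have hpol := h.polar hτ
  have hr3 : √τ < Real.pi + δ := (Real.sqrt_lt' (by linarith)).2 hτδ
  have hR3 := sqrt_lt_of_lt h.lt
  set r := √τ
  set R := √(κ * τ)
  rw [lt_div_iff₀ hPδ] at hsε
  by_cases hRpi : R ≤ Real.pi
  · linarith
  have hRpi' : Real.pi < R := not_le.1 hRpi
  have hRr : R ≤ r := hcase.resolve_right hRpi
  have hmemR : R ∈ Ioo (Real.pi / 2) (3 * Real.pi / 2) := ⟨by linarith, hR3⟩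
  have hmemr : r ∈ Ioo (Real.pi / 2) (3 * Real.pi / 2) := ⟨by linarith, by linarith⟩
  have hcR := cos_neg_of_branch hmemR.1 hmemR.2
  have hcr := cos_neg_of_branch hmemr.1 hmemr.2
  have hf := h.factor_pos
  have hPR : P R = s * P r := by
    simp only [hP]
    rw [Real.tan_eq_sin_div_cos, Real.tan_eq_sin_div_cos]
    have := hcR.ne
    have := hcr.ne
    field_simp
    apply mul_left_cancel₀ hf.ne'
    linear_combination (R * Real.sin R) * hpol.1 - s * Real.cos R * hpol.2
  have hPr : P r < P (Real.pi + δ) := hmono hmemr hmemδ hr3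
  have hlt : P R < P (Real.pi + ρ') := by
    rw [hPR]
    exact (mul_lt_mul_of_pos_left hPr hs).trans hsε
  have := (hmono.lt_iff_lt hmemR hmemρ).1 hlt
  exact this.trans_le (by linarith [min_le_left ρ δ])

/-- The value is written so that its sign is visible: for s > 0 it is positive by
`one_add_cosSqrt_mul_sincSqrt_pos`, hence d ≠ 0 and the implicit function theorem applies. -/
lemma hasDerivAt_squeezeEq (h : IsSqueeze s τ κ) (hτ : 0 ≤ τ) :
    ∃ d, HasDerivAt (squeezeEq s τ) d κ ∧
      squeezeFactor s τ κ * d = s / 2 * (1 + cosSqrt (κ * τ) * sincSqrt (κ * τ)) := by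
  have hκτ : 0 ≤ κ * τ := mul_nonneg h.pos.le hτ
  obtain ⟨k, hk, hk'⟩ := exists_hasDerivAt_sincSqrt hκτ
  have hm : HasDerivAt (fun κ => κ * τ) τ κ := by simpa using (hasDerivAt_id κ).mul_const τ
  have h1 : HasDerivAt (fun κ => sincSqrt (κ * τ)) (k * τ) κ :=
    HasDerivAt.comp (h₂ := sincSqrt) (h := fun κ => κ * τ) κ hk hm
  have h2 : HasDerivAt (fun κ => cosSqrt (κ * τ)) (-sincSqrt (κ * τ) / 2 * τ) κ :=
    HasDerivAt.comp (h₂ := cosSqrt) (h := fun κ => κ * τ) κ (hasDerivAt_cosSqrt _) hm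
  have h3 : HasDerivAt (squeezeEq s τ)
      ((1 * sincSqrt (κ * τ) + κ * (k * τ)) * cosSqrt τ -
        (s * (-sincSqrt (κ * τ) / 2 * τ)) * sincSqrt τ) κ :=
    ((HasDerivAt.mul (hasDerivAt_id κ) h1).mul_const (cosSqrt τ)).sub
      ((h2.const_mul s).mul_const (sincSqrt τ))
  refine ⟨_, h3, ?_⟩
  have e1 := h.factor_cos hτ
  have e2 := h.factor_sinc hτ
  have e3 := cosSqrt_sq_add hκτ
  linear_combination (sincSqrt (κ * τ) + κ * (k * τ)) * e1 +
    s * (sincSqrt (κ * τ) / 2 * τ) * e2 + s * cosSqrt (κ * τ) / 2 * hk' + s / 2 * e3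

/-- The squared ratio of radii depends smoothly on the parameter and the point. -/
lemma contDiffAt_squeeze {κ : ℝ × Plane → ℝ} {D : Set (ℝ × Plane)} (hD : IsOpen D)
    (hs : ∀ p ∈ D, 0 < p.1) (hκ : ∀ p ∈ D, IsSqueeze p.1 (radSq p.2) (κ p)) {p : ℝ × Plane}
    (hp : p ∈ D) : ContDiffAt ℝ ∞ κ p := by
  set F : (ℝ × Plane) × ℝ → ℝ := fun u => squeezeEq u.1.1 (radSq u.1.2) u.2 with hF
  set Q : (ℝ × Plane) × ℝ → ℝ := fun u => squeezeFactor u.1.1 (radSq u.1.2) u.2 with hQ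
  have hrad : ContDiff ℝ ∞ fun u : (ℝ × Plane) × ℝ => radSq u.1.2 :=
    contDiff_radSq.comp (contDiff_snd.comp contDiff_fst)
  have hs1 : ContDiff ℝ ∞ fun u : (ℝ × Plane) × ℝ => u.1.1 := contDiff_fst.comp contDiff_fst
  have hm : ContDiff ℝ ∞ fun u : (ℝ × Plane) × ℝ => u.2 * radSq u.1.2 := contDiff_snd.mul hrad
  have hFs : ContDiff ℝ ∞ F :=
    ((contDiff_snd.mul (contDiff_sincSqrt.comp hm)).mul (contDiff_cosSqrt.comp hrad)).sub
      ((hs1.mul (contDiff_cosSqrt.comp hm)).mul (contDiff_sincSqrt.comp hrad))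
  have hQs : ContDiff ℝ ∞ Q :=
    ((hs1.mul (contDiff_cosSqrt.comp hm)).mul (contDiff_cosSqrt.comp hrad)).add
      ((hm.mul (contDiff_sincSqrt.comp hm)).mul (contDiff_sincSqrt.comp hrad))
  set u : (ℝ × Plane) × ℝ := (p, κ p) with hu
  have hup := hκ p hp
  obtain ⟨d, hd, hd'⟩ := hasDerivAt_squeezeEq hup (radSq_nonneg _)
  have hd0 : d ≠ 0 := by
    rintro rfl
    rw [mul_zero] at hd'
    have h1 := one_add_cosSqrt_mul_sincSqrt_pos (mul_nonneg hup.pos.le (radSq_nonneg p.2))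
    have h2 := mul_pos (half_pos (hs p hp)) h1
    linarith
  have hpar : (fderiv ℝ F u ∘L .inr ℝ (ℝ × Plane) ℝ) 1 = d := by
    have h1 : HasFDerivAt F (fderiv ℝ F u) (p, κ p) :=
      (hFs.differentiable (by simp) u).hasFDerivAt
    have h2 : HasFDerivAt (fun k : ℝ => ((p, k) : (ℝ × Plane) × ℝ))
      (.inr ℝ (ℝ × Plane) ℝ) (κ p) := hasFDerivAt_prodMk_right p (κ p)
    have h3 : HasFDerivAt (fun k => F (p, k)) _ (κ p) :=
      HasFDerivAt.comp (g := F) (f := fun k : ℝ => (p, k)) (κ p) h1 h2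
    exact h3.hasDerivAt.unique hd
  have hinv : (fderiv ℝ F u ∘L .inr ℝ (ℝ × Plane) ℝ).IsInvertible := by
    refine ⟨ContinuousLinearEquiv.unitsEquivAut ℝ (Units.mk0 d hd0),
      ContinuousLinearMap.ext fun t => ?_⟩
    have h1 : (fderiv ℝ F u ∘L .inr ℝ (ℝ × Plane) ℝ) t = t * d := by
      rw [← hpar, ← smul_eq_mul, ← map_smul, smul_eq_mul, mul_one]
    rw [h1]
    simp
  have hcd : ContDiffAt ℝ ∞ F u := hFs.contDiffAt
  set ψ := hcd.implicitFunction (by simp) hinv with hψ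
  have hψs : ContDiffAt ℝ ∞ ψ p := hcd.contDiffAt_implicitFunction (by simp) hinv
  have hψp : ψ p = κ p := hcd.implicitFunction_apply_self (by simp) hinv
  have hψF : ∀ᶠ x in 𝓝 p, F (x, ψ x) = F u := hcd.eventually_apply_implicitFunction (by simp) hinv
  refine hψs.congr_of_eventuallyEq ?_
  have hc : ContinuousAt (fun x => ((x, ψ x) : (ℝ × Plane) × ℝ)) p :=
    continuousAt_id.prodMk hψs.continuousAt
  -- The inequalities in `IsSqueeze` are open, so the implicit solution stays on the right branch
  -- near p and agrees with κ by uniqueness.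
  have hop : IsOpen {v : (ℝ × Plane) × ℝ | 0 < v.2 ∧ v.2 * radSq v.1.2 < (3 * Real.pi / 2) ^ 2 ∧
      0 < Q v} :=
    (isOpen_lt continuous_const continuous_snd).inter
      ((isOpen_lt hm.continuous continuous_const).inter (isOpen_lt continuous_const hQs.continuous))
  have hev := hc.preimage_mem_nhds (hop.mem_nhds (by
    rw [hψp]; exact ⟨hup.pos, hup.lt, hup.factor_pos⟩))
  filter_upwards [hψF, hev, hD.mem_nhds hp] with x hx1 hx2 hxD
  have hFu : F u = 0 := hup.eq
  exact (hκ x hxD).unique (hs x hxD) (radSq_nonneg _) ⟨hx2.1, hx2.2.1, hx1.trans hFu, hx2.2.2⟩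

end Squeeze

end OvertwistedBox

end

noncomputable section
namespace OvertwistedBox

set_option linter.unusedSectionVars false

open Set Topology Filter

/-! ### Smoothness tested in a chart of the target. -/

section Charts

variable {E : Type} {H X : Type*} [NormedAddCommGroup E] [NormedSpace ℝ E]
  [TopologicalSpace H] {I : ModelWithCorners ℝ E H} [TopologicalSpace X] [ChartedSpace H X]
  [I.Boundaryless] [IsManifold I ∞ X]
  {E' H' X' : Type*} [NormedAddCommGroup E'] [NormedSpace ℝ E'] [TopologicalSpace H']
  {I' : ModelWithCorners ℝ E' H'} [TopologicalSpace X'] [ChartedSpace H' X']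

lemma contMDiffAt_of_extChartAt_comp {f : X' → X} {x : X'} {y : X}
    (hs : ∀ᶠ z in 𝓝 x, f z ∈ (extChartAt I y).source)
    (h : ContMDiffAt I' 𝓘(ℝ, E) ∞ (fun z => extChartAt I y (f z)) x) : ContMDiffAt I' I ∞ f x := by
  have ht : extChartAt I y (f x) ∈ (extChartAt I y).target :=
    (extChartAt I y).map_source hs.self_of_nhds
  have h1 : ContMDiffAt I' I ∞ (fun z => (extChartAt I y).symm (extChartAt I y (f z))) x :=
    ContMDiffAt.comp x (f := fun z => extChartAt I y (f z)) (g := (extChartAt I y).symm)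
      (contMDiffAt_extChartAt_symm' ht) h
  refine h1.congr_of_eventuallyEq ?_
  filter_upwards [hs] with z hz
  exact ((extChartAt I y).left_inv hz).symm

end Charts

/-! ### Positive functions on L with small values and small differentials. -/

section Small

variable {n : ℕ} {L : Type*} [TopologicalSpace L] [ChartedSpace (EuclideanSpace ℝ (Fin n)) L]
  [IsManifold (𝓡 n) ∞ L]

/-- The differential of a function, as a section of the cotangent bundle. -/
def dSection (s : L → ℝ) (q : L) : Cotangent n L := mkCovec q (md (𝓡 n) 𝓘(ℝ, ℝ) s q)

lemma md_comp_extChartAt_symm {s : L → ℝ} (hs : ContMDiff (𝓡 n) 𝓘(ℝ, ℝ) ∞ s) {q₀ q : L}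
    (hq : q ∈ (extChartAt (𝓡 n) q₀).source) :
    (md (𝓡 n) 𝓘(ℝ, ℝ) s q).comp (md 𝓘(ℝ, EuclideanSpace ℝ (Fin n)) (𝓡 n)
      (extChartAt (𝓡 n) q₀).symm (extChartAt (𝓡 n) q₀ q)) =
    fderiv ℝ (fun e => s ((extChartAt (𝓡 n) q₀).symm e)) (extChartAt (𝓡 n) q₀ q) := by
  rw [← md_eq_fderiv, md_comp (I' := 𝓡 n) (f := s) (g := (extChartAt (𝓡 n) q₀).symm)
    (hs.mdifferentiableAt (by simp)) ((contMDiffAt_extChartAt_symm'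
      ((extChartAt (𝓡 n) q₀).map_source hq)).mdifferentiableAt (by simp)),
    (extChartAt (𝓡 n) q₀).left_inv hq]

lemma contDiffAt_comp_symm {s : L → ℝ} (hs : ContMDiff (𝓡 n) 𝓘(ℝ, ℝ) ∞ s) {q₀ : L}
    {e : EuclideanSpace ℝ (Fin n)} (he : e ∈ (extChartAt (𝓡 n) q₀).target) :
    ContDiffAt ℝ ∞ (fun e => s ((extChartAt (𝓡 n) q₀).symm e)) e :=
  (ContMDiffAt.comp e (f := (extChartAt (𝓡 n) q₀).symm) (g := s) hs.contMDiffAt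
    (contMDiffAt_extChartAt_symm' he)).contDiffAt

lemma contMDiff_dSection {s : L → ℝ} (hs : ContMDiff (𝓡 n) 𝓘(ℝ, ℝ) ∞ s) :
    ContMDiff (𝓡 n) (cotangentModel n) ∞ (dSection (n := n) s) := by
  intro q₀
  have hev : ∀ᶠ q in 𝓝 q₀, q ∈ (extChartAt (𝓡 n) q₀).source := extChartAt_source_mem_nhds q₀
  refine contMDiffAt_of_extChartAt_comp (y := dSection (n := n) s q₀)
    (hev.mono fun q hq => mem_cotangent_source.2 hq) ?_
  have h1 : ContMDiffAt (𝓡 n) 𝓘(ℝ, CotModel n) ∞ (fun q => ((extChartAt (𝓡 n) q₀ q,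
      fderiv ℝ (fun e => s ((extChartAt (𝓡 n) q₀).symm e)) (extChartAt (𝓡 n) q₀ q)) : CotModel n))
      q₀ := by
    have h2 := contDiffAt_comp_symm hs (mem_extChartAt_target (I := 𝓡 n) q₀)
    have h3 : ContDiffAt ℝ ∞ (fun e => ((e, fderiv ℝ (fun e =>
      s ((extChartAt (𝓡 n) q₀).symm e)) e) : CotModel n)) (extChartAt (𝓡 n) q₀ q₀) :=
      contDiffAt_id.prodMk (h2.fderiv_right (m := ∞) (by simp))
    exact ContMDiffAt.comp q₀ (f := extChartAt (𝓡 n) q₀) h3.contMDiffAt contMDiffAt_extChartAt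
  refine h1.congr_of_eventuallyEq ?_
  filter_upwards [hev] with q hq
  rw [extChartAt_cotangent_apply (ν := dSection (n := n) s q₀) (η := dSection s q) hq,
    ← md_comp_extChartAt_symm hs hq]
  rfl

variable (g : Bundle.ContMDiffRiemannianMetric (𝓡 n) ∞ (EuclideanSpace ℝ (Fin n))
      (fun q : L => TangentSpace (𝓡 n) q))

lemma dualNorm_md_eq (s : L → ℝ) (q : L) :
    dualNorm (metricAt g q) (md (𝓡 n) 𝓘(ℝ, ℝ) s q) = covectorNorm g (dSection s q) :=
  (covectorNorm_eq g (dSection s q)).symm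

lemma exists_bound_dualNorm [T2Space L] {s : L → ℝ} (hs : ContMDiff (𝓡 n) 𝓘(ℝ, ℝ) ∞ s)
    {K : Set L} (hK : IsCompact K) (hsK : tsupport s ⊆ K) :
    ∃ C, 0 ≤ C ∧ ∀ q, dualNorm (metricAt g q) (md (𝓡 n) 𝓘(ℝ, ℝ) s q) ≤ C := by
  have hc : Continuous fun q => covectorNorm g (dSection s q) :=
    (continuous_covectorNorm g).comp (contMDiff_dSection hs).continuous
  obtain ⟨C, hC⟩ := (hK.image hc).bddAbove
  refine ⟨max C 0, le_max_right _ _, fun q => ?_⟩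
  by_cases hq : q ∈ K
  · rw [dualNorm_md_eq]
    exact (hC ⟨q, hq, rfl⟩).trans (le_max_left _ _)
  · have h0 : md (𝓡 n) 𝓘(ℝ, ℝ) s q = 0 := by
      have h1 : s =ᶠ[𝓝 q] fun _ => (0 : ℝ) := by
        exact notMem_tsupport_iff_eventuallyEq.1 fun h => hq (hsK h)
      rw [md_congr h1]
      exact mfderiv_const
    rw [h0]
    exact dualNorm_le fun v _ => le_max_right _ _

lemma dualNorm_md_sum_le {κ : Type*} (F : Finset κ) {f : κ → L → ℝ} {ε C : κ → ℝ} {q : L}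
    (hf : ∀ i, ContMDiff (𝓡 n) 𝓘(ℝ, ℝ) ∞ (f i)) (hε : ∀ i, 0 ≤ ε i)
    (hC : ∀ i, dualNorm (metricAt g q) (md (𝓡 n) 𝓘(ℝ, ℝ) (f i) q) ≤ C i) :
    dualNorm (metricAt g q) (md (𝓡 n) 𝓘(ℝ, ℝ) (fun q => ∑ i ∈ F, f i q * ε i) q) ≤
      ∑ i ∈ F, ε i * C i := by
  classical
  have hsm : ∀ i, ContMDiff (𝓡 n) 𝓘(ℝ, ℝ) ∞ (fun q => f i q * ε i) := fun i =>
    (hf i).mul contMDiff_const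
  have hsum : ∀ F : Finset κ, ContMDiff (𝓡 n) 𝓘(ℝ, ℝ) ∞ (fun q => ∑ i ∈ F, f i q * ε i) :=
    fun F => contMDiff_finsetSum fun i _ => hsm i
  induction F using Finset.induction_on with
  | empty =>
    simp only [Finset.sum_empty]
    refine dualNorm_le fun v _ => ?_
    have h0 : md (𝓡 n) 𝓘(ℝ, ℝ) (fun _ : L => (0 : ℝ)) q = 0 := mfderiv_const
    rw [h0]
    exact le_rfl
  | insert i F hi ih =>
    have h1 : (fun q => ∑ j ∈ insert i F, f j q * ε j) =
        fun q => f i q * ε i + ∑ j ∈ F, f j q * ε j := funext fun q => Finset.sum_insert hi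
    have h2 : md (𝓡 n) 𝓘(ℝ, ℝ) (fun q => f i q * ε i + ∑ j ∈ F, f j q * ε j) q =
        ε i • md (𝓡 n) 𝓘(ℝ, ℝ) (f i) q +
          md (𝓡 n) 𝓘(ℝ, ℝ) (fun q => ∑ j ∈ F, f j q * ε j) q := by
      have h3 := ((hf i).mdifferentiableAt (x := q) (by simp)).hasMFDerivAt
      have h4 := ((hsum F).mdifferentiableAt (x := q) (by simp)).hasMFDerivAt
      have h5 := (h3.const_smul (ε i)).add h4
      have h6 : (fun q => f i q * ε i + ∑ j ∈ F, f j q * ε j) =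
          (ε i • f i + fun q => ∑ j ∈ F, f j q * ε j) := by
        funext q
        simp [mul_comm]
      rw [h6]
      exact h5.mfderiv
    rw [h1, h2, Finset.sum_insert hi]
    refine ((isInner_metricAt g q).dualNorm_add_le _ _).trans (add_le_add ?_ ih)
    refine ((isInner_metricAt g q).dualNorm_smul_le _ _).trans ?_
    rw [abs_of_nonneg (hε i)]
    exact mul_le_mul_of_nonneg_left (hC i) (hε i)

/-- A positive smooth function which is small, and whose differential is small. -/
lemma exists_small_function [T2Space L] [SecondCountableTopology L] {V : L → Set L} {e : L → ℝ}
    (hV : ∀ q, IsOpen (V q)) (hVq : ∀ q, q ∈ V q) (he : ∀ q, 0 < e q) {η : ℝ} (hη : 0 < η) :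
    ∃ s : L → ℝ, ContMDiff (𝓡 n) 𝓘(ℝ, ℝ) ∞ s ∧ ∀ q, 0 < s q ∧ (∃ q', q ∈ V q' ∧ s q ≤ e q') ∧
      dualNorm (metricAt g q) (md (𝓡 n) 𝓘(ℝ, ℝ) s q) ≤ η := by
  classical
  have : LocallyCompactSpace L := ChartedSpace.locallyCompactSpace (EuclideanSpace ℝ (Fin n)) L
  have hK : ∀ q : L, ∃ K, IsCompact K ∧ q ∈ interior K := fun q => exists_compact_mem_nhds q |>.imp
    fun K hK => ⟨hK.1, mem_interior_iff_mem_nhds.2 hK.2⟩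
  choose K hK hqK using hK
  obtain ⟨T, hT, hTU⟩ := TopologicalSpace.countable_cover_nhds (f := fun q => V q ∩ interior (K q))
    fun q => ((hV q).inter isOpen_interior).mem_nhds ⟨hVq q, hqK q⟩
  obtain ⟨f, hf⟩ := SmoothPartitionOfUnity.exists_isSubordinate (𝓡 n) (M := L) isClosed_univ
    (fun i : T => V i ∩ interior (K i)) (fun i => (hV i).inter isOpen_interior)
    (fun x _ => by
      have : x ∈ ⋃ q ∈ T, V q ∩ interior (K q) := hTU ▸ mem_univ x
      simpa using this)
  have hfs : ∀ i, ContMDiff (𝓡 n) 𝓘(ℝ, ℝ) ∞ (f i) := fun i => (f i).contMDiff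
  have hC : ∀ i, ∃ C, 0 ≤ C ∧ ∀ q, dualNorm (metricAt g q) (md (𝓡 n) 𝓘(ℝ, ℝ) (f i) q) ≤ C :=
    fun i => exists_bound_dualNorm g (hfs i) (hK i)
      ((hf i).trans (inter_subset_right.trans interior_subset))
  choose C hC0 hC using hC
  -- Countability of the cover provides positive weights whose finite sums are at most η. The
  -- coefficient ε i is then taken small enough to absorb the bound C i for the differential of f i.
  obtain ⟨w, hw0, hw⟩ := hT.exists_pos_forall_sum_le hη
  set ε : T → ℝ := fun i => min (e i) (w i / (1 + C i)) with hε
  have hε0 : ∀ i, 0 < ε i := fun i => lt_min (he i) (div_pos (hw0 i) (by linarith [hC0 i]))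
  have hεC : ∀ i, ε i * C i ≤ w i := fun i => by
    have h1 : ε i ≤ w i / (1 + C i) := min_le_right _ _
    rw [le_div_iff₀ (by linarith [hC0 i])] at h1
    nlinarith [hε0 i]
  set s : L → ℝ := fun q => ∑ᶠ i, f i q • ε i with hs
  have hss : ContMDiff (𝓡 n) 𝓘(ℝ, ℝ) ∞ s :=
    f.contMDiff_finsum_smul fun i _ _ => contMDiffAt_const
  refine ⟨s, hss, fun q => ?_⟩
  obtain ⟨F, N, hN, hNV, hF⟩ := f.toPartitionOfUnity.exists_finset_nhds_support_subset hf
    (fun i => (hV i).inter isOpen_interior) q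
  have hsF : ∀ z ∈ N, s z = ∑ i ∈ F, f i z * ε i := fun z hz =>
    finsum_eq_sum_of_support_subset _ fun i hi => hF z hz fun h0 => hi (by
      change f i z • ε i = 0
      have : f i z = 0 := h0
      rw [this, zero_smul])
  have h1F : ∑ i ∈ F, f i q = 1 :=
    (finsum_eq_sum_of_support_subset (fun i => f i q) (s := F) (hF q (mem_of_mem_nhds hN))).symm.trans
      (f.sum_eq_one (mem_univ q))
  have hnn : ∀ i, 0 ≤ f i q := fun i => f.nonneg i q
  have hFne : F.Nonempty := by
    by_contra h
    rw [Finset.not_nonempty_iff_eq_empty] at h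
    rw [h, Finset.sum_empty] at h1F
    exact zero_ne_one h1F
  have hsq := hsF q (mem_of_mem_nhds hN)
  refine ⟨?_, ?_, ?_⟩
  · obtain ⟨i, hi, hi0⟩ : ∃ i ∈ F, f i q ≠ 0 := by
      by_contra! h
      rw [Finset.sum_eq_zero h] at h1F
      exact zero_ne_one h1F
    rw [hsq]
    exact Finset.sum_pos' (fun j _ => mul_nonneg (hnn j) (hε0 j).le)
      ⟨i, hi, mul_pos (lt_of_le_of_ne (hnn i) (Ne.symm hi0)) (hε0 i)⟩
  -- s q is a convex combination of the ε i with q in V i, so it is at most the largest of them.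
  · obtain ⟨i, hi, hmax⟩ := F.exists_max_image ε hFne
    refine ⟨i, ?_, ?_⟩
    · have := mem_iInter₂.1 (hNV (mem_of_mem_nhds hN)) i hi
      exact this.1
    · calc s q = ∑ j ∈ F, f j q * ε j := hsq
        _ ≤ ∑ j ∈ F, f j q * ε i :=
          Finset.sum_le_sum fun j hj => mul_le_mul_of_nonneg_left (hmax j hj) (hnn j)
        _ = ε i := by rw [← Finset.sum_mul, h1F, one_mul]
        _ ≤ e i := min_le_left _ _
  · rw [md_congr (g := fun q => ∑ i ∈ F, f i q * ε i) (by filter_upwards [hN] with z hz using hsF z hz)]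
    refine (dualNorm_md_sum_le g F hfs (fun i => (hε0 i).le) (fun i => hC i q)).trans ?_
    refine (Finset.sum_le_sum fun i _ => hεC i).trans ?_
    have := hw (F.map ⟨Subtype.val, Subtype.val_injective⟩) (by
      intro x hx
      simp only [Finset.coe_map, Function.Embedding.coeFn_mk, mem_image] at hx
      obtain ⟨i, -, rfl⟩ := hx
      exact i.2)
    rwa [Finset.sum_map] at this

end Small

end OvertwistedBox

end

noncomputable section
namespace OvertwistedBox

set_option linter.unusedSectionVars false

open Set Topology Filter

/-! ### The squeezing map on the box. -/

section SqueezeMap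

variable {n : ℕ}

/-- The squeezing map in canonical coordinates. -/
def squeezeCoord (κ : ℝ × Plane → ℝ) (σ : EuclideanSpace ℝ (Fin n) → ℝ)
    (e : (Plane × ℝ) × CotModel n) : (Plane × ℝ) × CotModel n :=
  ((√(κ (σ e.2.1, e.1.1)) • e.1.1, σ e.2.1 * e.1.2),
    (e.2.1, squeezeFactor (σ e.2.1) (radSq e.1.1) (κ (σ e.2.1, e.1.1)) • e.2.2 +
      (e.1.2 * cosSqrt (κ (σ e.2.1, e.1.1) * radSq e.1.1)) • fderiv ℝ σ e.2.1))

lemma radSq_smul (m : ℝ) (x : Plane) : radSq (m • x) = m ^ 2 * radSq x := by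
  simp only [radSq, PiLp.smul_apply, smul_eq_mul]
  ring

variable {κ : ℝ × Plane → ℝ} {σ : EuclideanSpace ℝ (Fin n) → ℝ} {e : (Plane × ℝ) × CotModel n}

lemma contDiffAt_squeezeCoord_pieces (hσ : ContDiffAt ℝ ∞ σ e.2.1)
    (hκ : ContDiffAt ℝ ∞ κ (σ e.2.1, e.1.1)) (hκ0 : 0 < κ (σ e.2.1, e.1.1)) :
    ContDiffAt ℝ ∞ (fun e : (Plane × ℝ) × CotModel n => σ e.2.1) e ∧
    ContDiffAt ℝ ∞ (fun e : (Plane × ℝ) × CotModel n => √(κ (σ e.2.1, e.1.1))) e ∧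
    ContDiffAt ℝ ∞ (fun e : (Plane × ℝ) × CotModel n =>
      squeezeFactor (σ e.2.1) (radSq e.1.1) (κ (σ e.2.1, e.1.1)) • e.2.2 +
      (e.1.2 * cosSqrt (κ (σ e.2.1, e.1.1) * radSq e.1.1)) • fderiv ℝ σ e.2.1) e := by
  have hq : ContDiff ℝ ∞ fun e : (Plane × ℝ) × CotModel n => e.2.1 := contDiff_fst.comp contDiff_snd
  have hx : ContDiff ℝ ∞ fun e : (Plane × ℝ) × CotModel n => e.1.1 := contDiff_fst.comp contDiff_fst
  have hz : ContDiff ℝ ∞ fun e : (Plane × ℝ) × CotModel n => e.1.2 := contDiff_snd.comp contDiff_fst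
  have hp : ContDiff ℝ ∞ fun e : (Plane × ℝ) × CotModel n => e.2.2 := contDiff_snd.comp contDiff_snd
  have h1 : ContDiffAt ℝ ∞ (fun e : (Plane × ℝ) × CotModel n => σ e.2.1) e :=
    ContDiffAt.comp e (f := fun e : (Plane × ℝ) × CotModel n => e.2.1) (g := σ) hσ hq.contDiffAt
  have h2 : ContDiffAt ℝ ∞ (fun e : (Plane × ℝ) × CotModel n => κ (σ e.2.1, e.1.1)) e :=
    ContDiffAt.comp e (f := fun e : (Plane × ℝ) × CotModel n => (σ e.2.1, e.1.1)) (g := κ) hκ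
      (h1.prodMk hx.contDiffAt)
  have h3 : ContDiffAt ℝ ∞ (fun e : (Plane × ℝ) × CotModel n => fderiv ℝ σ e.2.1) e :=
    ContDiffAt.comp e (f := fun e : (Plane × ℝ) × CotModel n => e.2.1) (g := fderiv ℝ σ)
      (hσ.fderiv_right (m := ∞) (by simp)) hq.contDiffAt
  have hr : ContDiff ℝ ∞ fun e : (Plane × ℝ) × CotModel n => radSq e.1.1 := contDiff_radSq.comp hx
  have hm := h2.mul hr.contDiffAt
  have hC := ContDiffAt.comp e contDiff_cosSqrt.contDiffAt hm
  have hK := ContDiffAt.comp e contDiff_sincSqrt.contDiffAt hm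
  have hf : ContDiffAt ℝ ∞ (fun e : (Plane × ℝ) × CotModel n =>
      squeezeFactor (σ e.2.1) (radSq e.1.1) (κ (σ e.2.1, e.1.1))) e :=
    ((h1.mul hC).mul (contDiff_cosSqrt.comp hr).contDiffAt).add
      ((hm.mul hK).mul (contDiff_sincSqrt.comp hr).contDiffAt)
  refine ⟨h1, h2.sqrt hκ0.ne', ?_⟩
  exact (contDiffAt_smul' hf hp.contDiffAt).add
    (contDiffAt_smul' (hz.contDiffAt.mul hC) h3)

lemma contDiffAt_squeezeCoord (hσ : ContDiffAt ℝ ∞ σ e.2.1)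
    (hκ : ContDiffAt ℝ ∞ κ (σ e.2.1, e.1.1)) (hκ0 : 0 < κ (σ e.2.1, e.1.1)) :
    ContDiffAt ℝ ∞ (squeezeCoord κ σ) e := by
  obtain ⟨h1, h2, h3⟩ := contDiffAt_squeezeCoord_pieces hσ hκ hκ0
  exact ((contDiffAt_smul' h2 (contDiff_fst.comp contDiff_fst).contDiffAt).prodMk
    (h1.mul (contDiff_snd.comp contDiff_fst).contDiffAt)).prodMk
    ((contDiff_fst.comp contDiff_snd).contDiffAt.prodMk h3)

/-- cos R d(s z) contributes z cos R ds, which the correction term in the covector cancels. What is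
left is s cos R dz + R sin R dϑ - f p dq, and this is f (cos r dz + r sin r dϑ - p dq) by the choice
of R and f. -/
lemma boxCoord_squeezeCoord (hσ : ContDiffAt ℝ ∞ σ e.2.1)
    (hκ : ContDiffAt ℝ ∞ κ (σ e.2.1, e.1.1))
    (hS : IsSqueeze (σ e.2.1) (radSq e.1.1) (κ (σ e.2.1, e.1.1))) (v : (Plane × ℝ) × CotModel n) :
    boxCoord (squeezeCoord κ σ e) (fderiv ℝ (squeezeCoord κ σ) e v) =
      squeezeFactor (σ e.2.1) (radSq e.1.1) (κ (σ e.2.1, e.1.1)) * boxCoord e v := by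
  obtain ⟨h1, h2, h3⟩ := contDiffAt_squeezeCoord_pieces hσ hκ hS.pos
  have d2 := (h2.differentiableAt (by simp)).hasFDerivAt
  have d3 := (h3.differentiableAt (by simp)).hasFDerivAt
  have dσ : HasFDerivAt (fun e : (Plane × ℝ) × CotModel n => σ e.2.1) _ e :=
    HasFDerivAt.comp e (f := fun e : (Plane × ℝ) × CotModel n => e.2.1) (g := σ)
      (hσ.differentiableAt (by simp)).hasFDerivAt
      (hasFDerivAt_snd (𝕜 := ℝ) (p := e)).fst
  have dx : HasFDerivAt (fun e : (Plane × ℝ) × CotModel n => e.1.1) _ e :=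
    (hasFDerivAt_fst (𝕜 := ℝ) (p := e)).fst
  have dz : HasFDerivAt (fun e : (Plane × ℝ) × CotModel n => e.1.2) _ e :=
    (hasFDerivAt_fst (𝕜 := ℝ) (p := e)).snd
  have dq : HasFDerivAt (fun e : (Plane × ℝ) × CotModel n => e.2.1) _ e :=
    (hasFDerivAt_snd (𝕜 := ℝ) (p := e)).fst
  have hd : HasFDerivAt (squeezeCoord κ σ) _ e :=
    ((d2.smul dx).prodMk (dσ.mul dz)).prodMk (dq.prodMk d3)
  rw [hd.fderiv]
  set m := √(κ (σ e.2.1, e.1.1)) with hm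
  have hm2 : m ^ 2 = κ (σ e.2.1, e.1.1) := Real.sq_sqrt hS.pos.le
  have e1 := hS.factor_cos (radSq_nonneg _)
  have e2 := hS.factor_sinc (radSq_nonneg _)
  set f := squeezeFactor (σ e.2.1) (radSq e.1.1) (κ (σ e.2.1, e.1.1)) with hf
  set m' := fderiv ℝ (fun e : (Plane × ℝ) × CotModel n => √(κ (σ e.2.1, e.1.1))) e v with hm'
  -- The derivative m' of the scale factor only moves points radially, and r sin r dϑ kills radial
  -- vectors, so m' is never computed. Neither is the variation of the covector, which -p dq does
  -- not see.
  have hcoord : ∀ w : (Plane × ℝ) × CotModel n, w.1.1 = m • v.1.1 + m' • e.1.1 →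
      w.1.2 = σ e.2.1 * v.1.2 + e.1.2 * fderiv ℝ σ e.2.1 v.2.1 → w.2.1 = v.2.1 →
      boxCoord (squeezeCoord κ σ e) w = f * boxCoord e v := by
    intro w hw1 hw2 hw3
    rw [boxCoord_apply, boxCoord_apply, hw1, hw2, hw3]
    simp only [squeezeCoord]
    rw [← hm, radSq_smul, hm2, ← hf]
    simp only [PiLp.smul_apply, PiLp.add_apply, smul_eq_mul, add_apply, smul_apply]
    linear_combination -v.1.2 * e1 - (e.1.1 0 * v.1.1 1 - e.1.1 1 * v.1.1 0) * e2 +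
      sincSqrt (κ (σ e.2.1, e.1.1) * radSq e.1.1) *
        (e.1.1 0 * v.1.1 1 - e.1.1 1 * v.1.1 0) * hm2
  exact hcoord _ rfl rfl rfl

variable {L : Type*} [TopologicalSpace L] [ChartedSpace (EuclideanSpace ℝ (Fin n)) L]
  [IsManifold (𝓡 n) ∞ L]

/-- The squeezing map. -/
def squeezeMap (κ : ℝ × Plane → ℝ) (s : L → ℝ) (x : (Plane × ℝ) × Cotangent n L) :
    (Plane × ℝ) × Cotangent n L :=
  ((√(κ (s x.2.proj, x.1.1)) • x.1.1, s x.2.proj * x.1.2),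
    mkCovec x.2.proj
      (squeezeFactor (s x.2.proj) (radSq x.1.1) (κ (s x.2.proj, x.1.1)) • covec x.2 +
      (x.1.2 * cosSqrt (κ (s x.2.proj, x.1.1) * radSq x.1.1)) • md (𝓡 n) 𝓘(ℝ, ℝ) s x.2.proj))

lemma extChartAt_squeezeMap {s : L → ℝ} (hs : ContMDiff (𝓡 n) 𝓘(ℝ, ℝ) ∞ s)
    {x₀ x : (Plane × ℝ) × Cotangent n L} (hx : x.2.proj ∈ (extChartAt (𝓡 n) x₀.2.proj).source) :
    extChartAt (boxModel n) (squeezeMap κ s x₀) (squeezeMap κ s x) =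
      squeezeCoord κ (fun e => s ((extChartAt (𝓡 n) x₀.2.proj).symm e))
        (extChartAt (boxModel n) x₀ x) := by
  rw [show extChartAt (boxModel n) (squeezeMap κ s x₀) (squeezeMap κ s x) = _ from
      extChartAt_prod_apply _ _, show extChartAt (boxModel n) x₀ x = _ from
      extChartAt_prod_apply _ _, extChartAt_cotangent_apply (ν := (squeezeMap κ s x₀).2)
        (η := (squeezeMap κ s x).2) hx, extChartAt_cotangent_apply hx]
  have h1 := md_comp_extChartAt_symm hs hx
  have h2 : (extChartAt (𝓡 n) x₀.2.proj).symm (extChartAt (𝓡 n) x₀.2.proj x.2.proj) = x.2.proj :=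
    (extChartAt (𝓡 n) x₀.2.proj).left_inv hx
  simp only [squeezeCoord, h2]
  rw [← h1]
  rfl

variable {s : L → ℝ} {x : (Plane × ℝ) × Cotangent n L}

lemma eventually_proj_mem_source (x : (Plane × ℝ) × Cotangent n L) :
    ∀ᶠ y in 𝓝 x, y.2.proj ∈ (extChartAt (𝓡 n) x.2.proj).source := by
  have hc : Continuous fun y : (Plane × ℝ) × Cotangent n L => y.2.proj :=
    contMDiff_proj.continuous.comp continuous_snd
  exact hc.continuousAt.eventually (extChartAt_source_mem_nhds x.2.proj)

lemma extChartAt_box_self (x : (Plane × ℝ) × Cotangent n L) :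
    (extChartAt (boxModel n) x x).1 = x.1 ∧
      (extChartAt (boxModel n) x x).2.1 = extChartAt (𝓡 n) x.2.proj x.2.proj := by
  rw [show extChartAt (boxModel n) x x = _ from extChartAt_prod_apply _ _,
    extChartAt_cotangent_apply (mem_extChartAt_source _)]
  exact ⟨rfl, rfl⟩

lemma contMDiffAt_squeezeMap (hs : ContMDiff (𝓡 n) 𝓘(ℝ, ℝ) ∞ s)
    (hκ : ContDiffAt ℝ ∞ κ (s x.2.proj, x.1.1))
    (hS : IsSqueeze (s x.2.proj) (radSq x.1.1) (κ (s x.2.proj, x.1.1))) :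
    ContMDiffAt (boxModel n) (boxModel n) ∞ (squeezeMap κ s) x ∧
    ∀ v, boxOne (squeezeMap κ s x) (md (boxModel n) (boxModel n) (squeezeMap κ s) x v) =
      squeezeFactor (s x.2.proj) (radSq x.1.1) (κ (s x.2.proj, x.1.1)) * boxOne x v := by
  set σ : EuclideanSpace ℝ (Fin n) → ℝ := fun e => s ((extChartAt (𝓡 n) x.2.proj).symm e) with hσ
  set e := extChartAt (boxModel n) x x with he
  obtain ⟨he1, he2⟩ := extChartAt_box_self x
  rw [← he] at he1 he2
  have hσe : σ e.2.1 = s x.2.proj := by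
    rw [he2, hσ]
    simp only [extChartAt_to_inv]
  have hσs : ContDiffAt ℝ ∞ σ e.2.1 := by
    rw [he2]
    exact contDiffAt_comp_symm hs (mem_extChartAt_target _)
  have hκ' : ContDiffAt ℝ ∞ κ (σ e.2.1, e.1.1) := by rw [hσe, he1]; exact hκ
  have hS' : IsSqueeze (σ e.2.1) (radSq e.1.1) (κ (σ e.2.1, e.1.1)) := by
    rw [hσe, he1]; exact hS
  have hcd := contDiffAt_squeezeCoord hσs hκ' hS'.pos
  have hev : (fun y => extChartAt (boxModel n) (squeezeMap κ s x) (squeezeMap κ s y)) =ᶠ[𝓝 x]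
      fun y => squeezeCoord κ σ (extChartAt (boxModel n) x y) := by
    filter_upwards [eventually_proj_mem_source x] with y hy
    exact extChartAt_squeezeMap hs hy
  have hsm : ContMDiffAt (boxModel n) 𝓘(ℝ, (Plane × ℝ) × CotModel n) ∞
      (fun y => squeezeCoord κ σ (extChartAt (boxModel n) x y)) x :=
    ContMDiffAt.comp x (f := extChartAt (boxModel n) x) (g := squeezeCoord κ σ) hcd.contMDiffAt
      contMDiffAt_extChartAt
  have hsrc : ∀ᶠ y in 𝓝 x, squeezeMap κ s y ∈
      (extChartAt (boxModel n) (squeezeMap κ s x)).source := by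
    filter_upwards [eventually_proj_mem_source x] with y hy
    rw [show extChartAt (boxModel n) (squeezeMap κ s x) = _ from extChartAt_prod _,
      PartialEquiv.prod_source]
    refine ⟨?_, mem_cotangent_source.2 hy⟩
    rw [extChartAt_model_space_eq_id]
    exact mem_univ _
  have hMs : ContMDiffAt (boxModel n) (boxModel n) ∞ (squeezeMap κ s) x :=
    contMDiffAt_of_extChartAt_comp hsrc (hsm.congr_of_eventuallyEq hev)
  refine ⟨hMs, fun v => ?_⟩
  have h1 : md (boxModel n) (boxModel n) (squeezeMap κ s) x = fderiv ℝ (squeezeCoord κ σ) e := by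
    have h2 := md_congr (I' := boxModel n) (I := 𝓘(ℝ, (Plane × ℝ) × CotModel n)) hev
    rw [md_comp (I' := boxModel n) (f := extChartAt (boxModel n) (squeezeMap κ s x))
        (g := squeezeMap κ s)
        ((contMDiffAt_extChartAt (n := ∞)).mdifferentiableAt (by simp))
        (hMs.mdifferentiableAt (by simp)),
      md_comp (I' := 𝓘(ℝ, (Plane × ℝ) × CotModel n)) (f := squeezeCoord κ σ)
        (g := extChartAt (boxModel n) x) (hcd.contMDiffAt.mdifferentiableAt (by simp))
        ((contMDiffAt_extChartAt (n := ∞)).mdifferentiableAt (by simp)),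
      md_extChartAt_self, md_extChartAt_self, md_eq_fderiv] at h2
    exact h2
  have h3 : extChartAt (boxModel n) (squeezeMap κ s x) (squeezeMap κ s x) = squeezeCoord κ σ e :=
    hev.self_of_nhds
  rw [h1, boxOne_eq_boxCoord, boxOne_eq_boxCoord, h3, ← he, boxCoord_squeezeCoord hσs hκ' hS', hσe,
    he1]

end SqueezeMap

end OvertwistedBox

end

noncomputable section
namespace OvertwistedBox

set_option linter.unusedSectionVars false

open Set Topology Filter

/-! ### Neighbourhoods of the slice of locally uniform size. -/

section Tube

lemma continuousAt_opNorm {T V : Type*} [TopologicalSpace T] [NormedAddCommGroup V]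
    [NormedSpace ℝ V] {f : T → V →L[ℝ] V →L[ℝ] ℝ} {t : T} (hf : ContinuousAt f t) :
    ContinuousAt (fun x => ‖f x‖) t :=
  ContinuousAt.norm (E := V →L[ℝ] V →L[ℝ] ℝ) hf

/-- A vector divided by (‖B‖ + 1) times its norm has B-length at most one. The resulting bound in
the fixed norm of the model space makes closed disk bundles compact over small compact sets. -/
lemma IsInner.norm_le_dualNorm {V : Type*} [NormedAddCommGroup V] [NormedSpace ℝ V]
    [FiniteDimensional ℝ V] {B : V →L[ℝ] V →L[ℝ] ℝ} (hB : IsInner B) (p : V →L[ℝ] ℝ) :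
    ‖p‖ ≤ dualNorm B p * (‖B‖ + 1) := by
  have hB0 := norm_nonneg B
  have hd := hB.dualNorm_nonneg p
  have key : ∀ v, p v ≤ dualNorm B p * (‖B‖ + 1) * ‖v‖ := by
    intro v
    by_cases hv : v = 0
    · simp [hv]
    have hv0 : 0 < ‖v‖ := norm_pos_iff.2 hv
    have ht : 0 < (‖B‖ + 1) * ‖v‖ := by positivity
    have h1 := hB.apply_le_dualNorm p (v := ((‖B‖ + 1) * ‖v‖)⁻¹ • v) (by
      have h2 : B v v ≤ ‖B‖ * ‖v‖ * ‖v‖ := (le_abs_self _).trans (B.le_opNorm₂ v v)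
      simp only [map_smul, smul_apply, smul_eq_mul]
      rw [← mul_assoc, ← mul_inv, inv_mul_le_iff₀ (by positivity)]
      nlinarith [mul_pos hv0 hv0])
    rw [map_smul, smul_eq_mul, inv_mul_le_iff₀ ht] at h1
    linarith
  refine ContinuousLinearMap.opNorm_le_bound _ (by positivity) fun v => ?_
  rw [Real.norm_eq_abs, abs_le]
  refine ⟨?_, key v⟩
  have := key (-v)
  rw [map_neg, norm_neg] at this
  linarith

variable {n : ℕ} {L : Type*} [TopologicalSpace L] [ChartedSpace (EuclideanSpace ℝ (Fin n)) L]
  [IsManifold (𝓡 n) ∞ L]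
  (g : Bundle.ContMDiffRiemannianMetric (𝓡 n) ∞ (EuclideanSpace ℝ (Fin n))
      (fun q : L => TangentSpace (𝓡 n) q))

/-- Closed disk bundles are compact over small compact sets. -/
lemma exists_isCompact_diskBundle [T2Space L] (q₀ : L) (c : ℝ) :
    ∃ Q ∈ 𝓝 q₀, IsCompact {ν : Cotangent n L | ν.proj ∈ Q ∧ covectorNorm g ν ≤ c} := by
  have : LocallyCompactSpace L := ChartedSpace.locallyCompactSpace (EuclideanSpace ℝ (Fin n)) L
  set φ := extChartAt (𝓡 n) q₀ with hφ
  set ν₀ : Cotangent n L := mkCovec q₀ 0 with hν₀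
  set b := ‖metricCoord g q₀ (φ q₀)‖ + 1 with hb
  have h1 : ∀ᶠ q in 𝓝 q₀, ‖metricCoord g q₀ (φ q)‖ < b := by
    have hc : ContinuousAt (fun q => ‖metricCoord g q₀ (φ q)‖) q₀ :=
      continuousAt_opNorm
        (ContinuousAt.comp (f := φ) (continuousAt_metricCoord g q₀) (continuousAt_extChartAt q₀))
    exact hc.eventually_lt continuousAt_const (by simp [hb])
  obtain ⟨Q, hQ, hQs, hQc⟩ := local_compact_nhds
    (Filter.inter_mem (extChartAt_source_mem_nhds (I := 𝓡 n) q₀) h1)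
  refine ⟨Q, hQ, ?_⟩
  set T : Set (CotModel n) := (φ '' Q) ×ˢ Metric.closedBall 0 (|c| * (b + 1)) with hT
  have hTc : IsCompact T :=
    (hQc.image_of_continuousOn ((continuousOn_extChartAt q₀).mono fun q hq => (hQs hq).1)).prod
      (isCompact_closedBall _ _)
  have hTt : T ⊆ (extChartAt (cotangentModel n) ν₀).target := by
    rintro e ⟨⟨q, hq, hqe⟩, -⟩
    rw [mem_cotangent_target, ← hqe]
    exact φ.map_source (hQs hq).1
  refine IsCompact.of_isClosed_subset (hTc.image_of_continuousOn
    ((continuousOn_extChartAt_symm ν₀).mono hTt)) ?_ ?_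
  · exact (hQc.isClosed.preimage contMDiff_proj.continuous).inter
      (isClosed_le (continuous_covectorNorm g) continuous_const)
  · rintro ν ⟨hνQ, hνc⟩
    have hνs : ν.proj ∈ φ.source := (hQs hνQ).1
    have hs : ν ∈ (extChartAt (cotangentModel n) ν₀).source := mem_cotangent_source.2 hνs
    obtain ⟨e, he⟩ : ∃ e, e = extChartAt (cotangentModel n) ν₀ ν := ⟨_, rfl⟩
    have het : e ∈ (extChartAt (cotangentModel n) ν₀).target :=
      he ▸ (extChartAt (cotangentModel n) ν₀).map_source hs
    have hee : (extChartAt (cotangentModel n) ν₀).symm e = ν :=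
      he ▸ (extChartAt (cotangentModel n) ν₀).left_inv hs
    have he1 : e.1 = φ ν.proj := by
      rw [he, extChartAt_cotangent_apply (ν := ν₀) (η := ν) hνs]
      rfl
    refine ⟨e, ⟨⟨ν.proj, hνQ, he1.symm⟩, ?_⟩, hee⟩
    have hin : IsInner (metricCoord g q₀ e.1) := isInner_metricCoord g (by
      rw [he1]; exact φ.map_source hνs)
    have h2 : covectorNorm g ν = dualNorm (metricCoord g q₀ e.1) e.2 := by
      have := covectorNorm_symm g het
      rw [hee] at this
      exact this.trans (hin.dualNorm_eq e.2).symm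
    have h3 := hin.norm_le_dualNorm e.2
    rw [← h2] at h3
    have h4 : ‖metricCoord g q₀ e.1‖ < b := by rw [he1]; exact (hQs hνQ).2
    have h5 : 0 ≤ covectorNorm g ν := by rw [h2]; exact hin.dualNorm_nonneg _
    rw [mem_closedBall_zero_iff]
    refine h3.trans (mul_le_mul (hνc.trans (le_abs_self c)) (by linarith) (by positivity)
      (abs_nonneg c))

/-- A neighbourhood of the zero height slice contains a neighbourhood of uniform size over small
sets. -/
lemma exists_tube [T2Space L] {W : Set ((Plane × ℝ) × Cotangent n L)} (hW : IsOpen W) {c₀ c₁ : ℝ}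
    (hc : c₁ < c₀) (hSW : ∀ x, discProj x ∈ modelHypersurface g c₀ → x.1.2 = 0 → x ∈ W) (q₀ : L) :
    ∃ (V : Set L) (ρ : ℝ), IsOpen V ∧ q₀ ∈ V ∧ 0 < ρ ∧ ∀ x : (Plane × ℝ) × Cotangent n L,
      x.2.proj ∈ V → ‖x.1.1‖ < Real.pi + ρ → |x.1.2| < ρ → covectorNorm g x.2 ≤ c₁ → x ∈ W := by
  obtain ⟨Q, hQ, hQc⟩ := exists_isCompact_diskBundle g q₀ c₁
  set A : Set (Plane × ℝ) := Metric.closedBall 0 Real.pi ×ˢ {0} with hA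
  have hAc : IsCompact A := (isCompact_closedBall _ _).prod isCompact_singleton
  -- The part of the slice over Q with norm at most c₁ is a product of two compact sets; c₁ < c₀
  -- places it inside the slice, hence in W.
  obtain ⟨u, v, hu, hv, hAu, hBv, huv⟩ := generalized_tube_lemma hAc hQc hW (by
    rintro ⟨⟨x, z⟩, ν⟩ ⟨⟨hx, hz⟩, hν⟩
    exact hSW _ ⟨hx, lt_of_le_of_lt hν.2 hc⟩ hz)
  obtain ⟨ρ, hρ, hρu⟩ := hAc.exists_thickening_subset_open hu hAu
  refine ⟨interior Q, ρ, isOpen_interior, mem_interior_iff_mem_nhds.2 hQ, hρ, ?_⟩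
  rintro ⟨⟨x, z⟩, ν⟩ hq hx hz hν
  refine huv ⟨hρu ?_, hBv ⟨interior_subset hq, hν⟩⟩
  have hx' : x ∈ Metric.thickening ρ (Metric.closedBall (0 : Plane) Real.pi) := by
    rw [thickening_closedBall hρ Real.pi_pos.le]
    rw [mem_ball_zero_iff]
    simpa [add_comm] using hx
  obtain ⟨y, hy, hxy⟩ := Metric.mem_thickening_iff.1 hx'
  refine Metric.mem_thickening_iff.2 ⟨(y, 0), ⟨hy, rfl⟩, ?_⟩
  rw [Prod.dist_eq]
  exact max_lt hxy (by simpa [Real.dist_eq] using hz)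

end Tube

end OvertwistedBox

end

noncomputable section
namespace OvertwistedBox

set_option linter.unusedSectionVars false

open Set Topology Filter

/-! ### Squeezing the box into a neighbourhood of the slice. -/

section ExistsSqueeze

/-- The solution is chosen point by point; uniqueness makes the choice smooth through
`contDiffAt_squeeze`. -/
lemma exists_smooth_squeeze : ∃ κ : ℝ × Plane → ℝ, ∀ p : ℝ × Plane, 0 < p.1 → p.1 < 1 →
    ‖p.2‖ < 3 * Real.pi / 2 → IsSqueeze p.1 (radSq p.2) (κ p) ∧ ContDiffAt ℝ ∞ κ p ∧
      squeezeFactor p.1 (radSq p.2) (κ p) ≤ 1166 / 1000 := by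
  set D : Set (ℝ × Plane) := {p | 0 < p.1 ∧ p.1 < 1 ∧ ‖p.2‖ < 3 * Real.pi / 2} with hD
  have hDo : IsOpen D := (isOpen_lt continuous_const continuous_fst).inter
    ((isOpen_lt continuous_fst continuous_const).inter
      (isOpen_lt (continuous_norm.comp continuous_snd) continuous_const))
  have hex : ∀ p ∈ D, ∃ k, IsSqueeze p.1 (radSq p.2) k ∧
      squeezeFactor p.1 (radSq p.2) k ≤ 1166 / 1000 := fun p hp => by
    have h3 : radSq p.2 < (3 * Real.pi / 2) ^ 2 := by
      rw [← norm_sq_eq_radSq]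
      exact pow_lt_pow_left₀ hp.2.2 (norm_nonneg _) two_ne_zero
    obtain ⟨k, hk, hk', -⟩ := exists_isSqueeze hp.1 hp.2.1.le (radSq_nonneg p.2) h3
    exact ⟨k, hk, hk'⟩
  choose! κ hκ using hex
  exact ⟨κ, fun p h1 h2 h3 => ⟨(hκ p ⟨h1, h2, h3⟩).1,
    contDiffAt_squeeze hDo (fun p hp => hp.1) (fun p hp => (hκ p hp).1) ⟨h1, h2, h3⟩,
    (hκ p ⟨h1, h2, h3⟩).2⟩⟩

lemma abs_cosSqrt_le {τ : ℝ} (hτ : 0 ≤ τ) : |cosSqrt τ| ≤ 1 := by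
  rw [cosSqrt_eq hτ]
  exact Real.abs_cos_le_one _

variable {n : ℕ} {L : Type*} [TopologicalSpace L] [ChartedSpace (EuclideanSpace ℝ (Fin n)) L]
  [IsManifold (𝓡 n) ∞ L]

lemma cotangent_ext {ν ν' : Cotangent n L} (h : ν.proj = ν'.proj) (h' : covec ν = covec ν') :
    ν = ν' := by
  obtain ⟨q, p⟩ := ν
  obtain ⟨q', p'⟩ := ν'
  obtain rfl : q = q' := h
  exact congrArg (Bundle.TotalSpace.mk q) h'

lemma norm_sqrt_smul {k : ℝ} (hk : 0 ≤ k) (x : Plane) : ‖√k • x‖ = √(k * radSq x) := by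
  rw [norm_smul, Real.norm_of_nonneg (Real.sqrt_nonneg _), ← norm_sq_eq_radSq, Real.sqrt_mul hk,
    Real.sqrt_sq (norm_nonneg _)]

/-- The base point is unchanged, and z is recovered because s > 0. The radius R determines r, since
both points lie on one ray of the curve (cos r, r sin r), and thus κ and the point of the plane.
Finally p is recovered because f > 0. -/
lemma squeezeMap_injective {κ : ℝ × Plane → ℝ} {s : L → ℝ} {x y : (Plane × ℝ) × Cotangent n L}
    (hs : ∀ q, 0 < s q)
    (hx : IsSqueeze (s x.2.proj) (radSq x.1.1) (κ (s x.2.proj, x.1.1)))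
    (hy : IsSqueeze (s y.2.proj) (radSq y.1.1) (κ (s y.2.proj, y.1.1)))
    (hx3 : ‖x.1.1‖ < 3 * Real.pi / 2) (hy3 : ‖y.1.1‖ < 3 * Real.pi / 2)
    (h : squeezeMap κ s x = squeezeMap κ s y) : x = y := by
  have hrad : ∀ {z : Plane}, ‖z‖ < 3 * Real.pi / 2 → radSq z < (3 * Real.pi / 2) ^ 2 := fun hz => by
    rw [← norm_sq_eq_radSq]
    exact pow_lt_pow_left₀ hz (norm_nonneg _) two_ne_zero
  have hqq : (squeezeMap κ s x).2.proj = (squeezeMap κ s y).2.proj := by rw [h]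
  have hq : x.2.proj = y.2.proj := hqq
  have hz : s x.2.proj * x.1.2 = s y.2.proj * y.1.2 :=
    congrArg (fun w : (Plane × ℝ) × Cotangent n L => w.1.2) h
  have hX : √(κ (s x.2.proj, x.1.1)) • x.1.1 = √(κ (s y.2.proj, y.1.1)) • y.1.1 :=
    congrArg (fun w : (Plane × ℝ) × Cotangent n L => w.1.1) h
  have hp := congrArg (fun w : (Plane × ℝ) × Cotangent n L => covec w.2) h
  simp only [squeezeMap] at hp
  rw [← hq] at hz hX hy
  have hz' : x.1.2 = y.1.2 := mul_left_cancel₀ (hs _).ne' hz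
  have hκτ : κ (s x.2.proj, x.1.1) * radSq x.1.1 = κ (s x.2.proj, y.1.1) * radSq y.1.1 := by
    have := congrArg norm hX
    rw [norm_sqrt_smul hx.pos.le, norm_sqrt_smul hy.pos.le, Real.sqrt_inj
      (mul_nonneg hx.pos.le (radSq_nonneg _)) (mul_nonneg hy.pos.le (radSq_nonneg _))] at this
    exact this
  have hτ := hx.injective (radSq_nonneg _) (radSq_nonneg _) (hrad hx3) (hrad hy3) hy hκτ
  have hκ : κ (s x.2.proj, x.1.1) = κ (s x.2.proj, y.1.1) := by
    rw [← hτ] at hy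
    exact hx.unique (hs _) (radSq_nonneg _) hy
  have hx' : x.1.1 = y.1.1 := by
    rw [hκ] at hX
    exact smul_right_injective _ (Real.sqrt_pos.2 hy.pos).ne' hX
  have hν : covec x.2 = covec y.2 := by
    rw [← hq, ← hx', ← hz'] at hp
    exact smul_right_injective _ hx.factor_pos.ne' (add_right_cancel hp)
  exact Prod.ext (Prod.ext hx' hz') (cotangent_ext hq hν)

variable [T2Space L] [SecondCountableTopology L]
  (g : Bundle.ContMDiffRiemannianMetric (𝓡 n) ∞ (EuclideanSpace ℝ (Fin n))
      (fun q : L => TangentSpace (𝓡 n) q))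

/-- The box can be squeezed, preserving the contact structure, into any neighbourhood of the zero
height slice. -/
theorem exists_squeeze {W : Set ((Plane × ℝ) × Cotangent n L)} (hW : IsOpen W) {c₀ c δ h : ℝ}
    (hSW : ∀ x, discProj x ∈ modelHypersurface g c₀ → x.1.2 = 0 → x ∈ W)
    (hδ : 0 < δ) (hδ2 : δ < Real.pi / 2) (hcc : 1166 / 1000 * c < c₀) (hh : 0 < h) :
    ∃ S : (Plane × ℝ) × Cotangent n L → (Plane × ℝ) × Cotangent n L,
      InjOn S (boxDomain g δ h c) ∧ ∀ x ∈ boxDomain g δ h c, S x ∈ W ∧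
        ContMDiffAt (boxModel n) (boxModel n) ∞ S x ∧
        ∀ v, boxOne (S x) (md (boxModel n) (boxModel n) S x v) = 0 ↔ boxOne x v = 0 := by
  -- The midpoint leaves room on both sides: below it for the term h |ds| in the covectors, above it
  -- for the compactness argument in `exists_tube`.
  set c₁ := (1166 / 1000 * c + c₀) / 2 with hc₁
  have hc₁0 : c₁ < c₀ := by rw [hc₁]; linarith
  have htube := exists_tube g hW hc₁0 hSW
  choose V ρ hVo hVq hρ hV using htube
  have hrad := fun q => exists_squeeze_radius hδ hδ2 (hρ q)
  choose ε hε hεr using hrad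
  -- The bounds on s serve the radius (ε), the height (ρ/(2h)) and the condition s < 1; the bound on
  -- ds makes h |ds| at most c₁ - 1.166 c.
  obtain ⟨s, hs, hs'⟩ := exists_small_function g (V := V)
    (e := fun q => min (min (ε q / 2) (ρ q / (2 * h))) (1 / 2)) hVo hVq
    (fun q => lt_min (lt_min (half_pos (hε q)) (div_pos (hρ q) (by linarith))) (by norm_num))
    (η := (c₁ - 1166 / 1000 * c) / h) (div_pos (by rw [hc₁]; linarith) hh)
  obtain ⟨κ, hκ⟩ := exists_smooth_squeeze
  have hpi := Real.pi_pos
  have hs0 : ∀ q, 0 < s q := fun q => (hs' q).1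
  have hs1 : ∀ q, s q < 1 := fun q => by
    obtain ⟨q', -, hq'⟩ := (hs' q).2.1
    have := hq'.trans (min_le_right _ _)
    linarith
  have hx3 : ∀ x ∈ boxDomain g δ h c, ‖x.1.1‖ < 3 * Real.pi / 2 := fun x hx => by
    have := hx.1.1
    linarith
  have hκx := fun x (hx : x ∈ boxDomain g δ h c) =>
    hκ (s x.2.proj, x.1.1) (hs0 _) (hs1 _) (hx3 x hx)
  refine ⟨squeezeMap κ s, fun x hx y hy hxy => squeezeMap_injective hs0 (hκx x hx).1 (hκx y hy).1
    (hx3 x hx) (hx3 y hy) hxy, fun x hx => ?_⟩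
  obtain ⟨hSq, hκs, hfac⟩ := hκx x hx
  simp only at hSq hfac
  obtain ⟨hsm, hpull⟩ := contMDiffAt_squeezeMap (x := x) hs hκs hSq
  refine ⟨?_, hsm, fun v => ?_⟩
  · obtain ⟨q', hqV, hq'⟩ := (hs' x.2.proj).2.1
    have h1 : s x.2.proj ≤ ε q' / 2 := hq'.trans ((min_le_left _ _).trans (min_le_left _ _))
    have h2 : s x.2.proj ≤ ρ q' / (2 * h) := hq'.trans ((min_le_left _ _).trans (min_le_right _ _))
    refine hV q' _ hqV ?_ ?_ ?_
    · change ‖√(κ (s x.2.proj, x.1.1)) • x.1.1‖ < _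
      rw [norm_sqrt_smul hSq.pos.le]
      refine hεr q' _ _ _ (hs0 _) (by linarith [hε q']) (hs1 _).le (radSq_nonneg _) ?_ hSq
      rw [← norm_sq_eq_radSq]
      exact pow_lt_pow_left₀ hx.1.1 (norm_nonneg _) two_ne_zero
    · change |s x.2.proj * x.1.2| < _
      rw [abs_mul, abs_of_pos (hs0 _)]
      rw [le_div_iff₀ (by linarith)] at h2
      have h3 : |x.1.2| < h := hx.1.2
      have h4 := hs0 x.2.proj
      nlinarith [hρ q', abs_nonneg x.1.2]
    · rw [covectorNorm_eq]
      have hin := isInner_metricAt g x.2.proj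
      have hν : dualNorm (metricAt g x.2.proj) (covec x.2) < c := by
        rw [← covectorNorm_eq]; exact hx.2
      have hν0 := hin.dualNorm_nonneg (covec x.2)
      refine (hin.dualNorm_add_le _ _).trans ?_
      have h3 := hin.dualNorm_smul_le
        (squeezeFactor (s x.2.proj) (radSq x.1.1) (κ (s x.2.proj, x.1.1))) (covec x.2)
      have h4 := hin.dualNorm_smul_le
        (x.1.2 * cosSqrt (κ (s x.2.proj, x.1.1) * radSq x.1.1)) (md (𝓡 n) 𝓘(ℝ, ℝ) s x.2.proj)
      have h5 := (hs' x.2.proj).2.2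
      have h6 := hin.dualNorm_nonneg (md (𝓡 n) 𝓘(ℝ, ℝ) s x.2.proj)
      have h7 := abs_cosSqrt_le (mul_nonneg hSq.pos.le (radSq_nonneg x.1.1))
      have h8 : |x.1.2| < h := hx.1.2
      have h9 : |x.1.2 * cosSqrt (κ (s x.2.proj, x.1.1) * radSq x.1.1)| ≤ h := by
        rw [abs_mul]
        nlinarith [abs_nonneg x.1.2]
      rw [abs_of_pos hSq.factor_pos] at h3
      have h10 : h * ((c₁ - 1166 / 1000 * c) / h) = c₁ - 1166 / 1000 * c := by field_simp
      have h11 := mul_le_mul h9 h5 h6 hh.le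
      have h12 := mul_le_mul hfac hν.le hν0 (by norm_num)
      linarith
  · rw [hpull, mul_eq_zero]
    exact ⟨fun h => h.resolve_left hSq.factor_pos.ne', Or.inr⟩

end ExistsSqueeze

end OvertwistedBox

end

noncomputable section
namespace OvertwistedBox

set_option linter.unusedSectionVars false

open Set Topology Filter

/-! ### The inverse function theorem on manifolds. -/

section LocalDiffeo

variable {E E' : Type} {H X H' X' : Type*}
  [NormedAddCommGroup E] [NormedSpace ℝ E] [FiniteDimensional ℝ E]
  [TopologicalSpace H] {I : ModelWithCorners ℝ E H} [TopologicalSpace X] [ChartedSpace H X]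
  [I.Boundaryless] [IsManifold I ∞ X]
  [NormedAddCommGroup E'] [NormedSpace ℝ E'] [FiniteDimensional ℝ E']
  [TopologicalSpace H'] {I' : ModelWithCorners ℝ E' H'} [TopologicalSpace X'] [ChartedSpace H' X']
  [I'.Boundaryless] [IsManifold I' ∞ X']

/-- The inverse function theorem on manifolds. -/
lemma map_nhds_eq_and_injOn {f : X' → X} {x : X'} (hf : ContMDiffAt I' I ∞ f x)
    (hd : Function.Injective (md I' I f x)) (hdim : Module.finrank ℝ E' = Module.finrank ℝ E) :
    map f (𝓝 x) = 𝓝 (f x) ∧ ∃ U ∈ 𝓝 x, InjOn f U := by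
  have : CompleteSpace E' := FiniteDimensional.complete ℝ E'
  set φ := extChartAt I' x with hφ
  set ψ := extChartAt I (f x) with hψ
  have hx : φ.symm (φ x) = x := extChartAt_to_inv x
  have hf' : ContMDiffAt I' I ∞ f (φ.symm (φ x)) := by rwa [hx]
  have hs : ContMDiffAt 𝓘(ℝ, E') I' ∞ φ.symm (φ x) :=
    contMDiffAt_extChartAt_symm' (mem_extChartAt_target x)
  have hG : ContMDiffAt 𝓘(ℝ, E') I ∞ (fun e => f (φ.symm e)) (φ x) :=
    ContMDiffAt.comp (φ x) (f := φ.symm) (g := f) hf' hs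
  set F : E' → E := fun e => ψ (f (φ.symm e)) with hF
  have hFs : ContDiffAt ℝ ∞ F (φ x) :=
    contDiffAt_extChartAt_comp hG (by rw [hx]; exact mem_extChartAt_source _)
  have hFd : fderiv ℝ F (φ x) = md I' I f x := by
    have h1 : MDifferentiableAt I 𝓘(ℝ, E) ψ (f (φ.symm (φ x))) := by
      rw [hx]
      exact (contMDiffAt_extChartAt (n := ∞)).mdifferentiableAt (by simp)
    rw [← md_eq_fderiv, md_comp (f := ψ) (g := fun e => f (φ.symm e)) h1
        (hG.mdifferentiableAt (by simp)),
      md_comp (f := f) (g := φ.symm) (hf'.mdifferentiableAt (by simp))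
        (hs.mdifferentiableAt (by simp)), md_extChartAt_symm_self, hx, md_extChartAt_self]
    rfl
  set T : E' ≃L[ℝ] E := (LinearEquiv.ofInjectiveOfFinrankEq
    (md I' I f x : E' →ₗ[ℝ] E) hd hdim).toContinuousLinearEquiv with hT
  have hTd : (T : E' →L[ℝ] E) = fderiv ℝ F (φ x) := by
    rw [hFd]
    rfl
  have hst : HasStrictFDerivAt F (T : E' →L[ℝ] E) (φ x) := by
    rw [hTd]
    exact hFs.hasStrictFDerivAt (by simp)
  have hev : (fun z => ψ (f z)) =ᶠ[𝓝 x] fun z => F (φ z) := by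
    filter_upwards [extChartAt_source_mem_nhds (I := I') x] with z hz
    simp only [hF, hφ, (extChartAt I' x).left_inv hz]
  have hsrc : ∀ᶠ z in 𝓝 x, f z ∈ ψ.source :=
    hf.continuousAt.eventually (extChartAt_source_mem_nhds (f x))
  constructor
  · have h1 : map ψ (map f (𝓝 x)) = map ψ (𝓝 (f x)) := by
      have h2 : map ψ (𝓝 (f x)) = 𝓝 (ψ (f x)) := map_extChartAt_nhds_of_boundaryless (f x)
      have h3 : map φ (𝓝 x) = 𝓝 (φ x) := map_extChartAt_nhds_of_boundaryless x
      rw [map_map, h2, show map (ψ ∘ f) (𝓝 x) = map (fun z => F (φ z)) (𝓝 x) from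
        Filter.map_congr hev,
        show (fun z => F (φ z)) = F ∘ φ from rfl, ← map_map, h3, hst.map_nhds_eq_of_equiv]
      simp only [hF, hx]
    have h4 := congrArg (map ψ.symm) h1
    rw [map_map, map_map, map_map] at h4
    have h5 : map (ψ.symm ∘ ψ) (𝓝 (f x)) = 𝓝 (f x) := by
      have h7 : (ψ.symm ∘ ψ : X → X) =ᶠ[𝓝 (f x)] id := by
        filter_upwards [extChartAt_source_mem_nhds (I := I) (f x)] with y hy
        exact ψ.left_inv hy
      rw [Filter.map_congr h7, Filter.map_id]
    have h6 : map (ψ.symm ∘ ψ ∘ f) (𝓝 x) = map f (𝓝 x) := by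
      refine Filter.map_congr ?_
      filter_upwards [hsrc] with z hz
      exact ψ.left_inv hz
    rw [← h6, ← h5]
    exact h4
  · set P := hst.toOpenPartialHomeomorph F with hP
    have hPs : φ x ∈ P.source := hst.mem_toOpenPartialHomeomorph_source
    have hPn : φ ⁻¹' P.source ∈ 𝓝 x :=
      (continuousAt_extChartAt x).preimage_mem_nhds (P.open_source.mem_nhds hPs)
    refine ⟨_, Filter.inter_mem hPn (Filter.inter_mem (extChartAt_source_mem_nhds (I := I') x) hev),
      fun a ha b hb hab => ?_⟩
    have h1 : F (φ a) = F (φ b) := by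
      have h2 : ψ (f a) = F (φ a) := ha.2.2
      have h3 : ψ (f b) = F (φ b) := hb.2.2
      rw [← h2, ← h3, hab]
    exact φ.injOn ha.2.1 hb.2.1 (P.injOn ha.1 hb.1 h1)

end LocalDiffeo

/-! ### Injectivity near a set. -/

section Injectivity

/-- A map which is injective on a set, properly so, and locally injective at its points, is
injective near that set. -/
lemma exists_injOn_nhds {X Y : Type*} [TopologicalSpace X] [TopologicalSpace.MetrizableSpace X]
    [TopologicalSpace Y] [TopologicalSpace.MetrizableSpace Y] {f : X → Y} {A : Set X}
    (hc : ∀ a ∈ A, ContinuousAt f a) (hloc : ∀ a ∈ A, ∃ U ∈ 𝓝 a, InjOn f U)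
    (hemb : ∀ a ∈ A, ∀ U ∈ 𝓝 a, ∃ V ∈ 𝓝 (f a), ∀ b ∈ A, f b ∈ V → b ∈ U) :
    ∃ W, IsOpen W ∧ A ⊆ W ∧ InjOn f W := by
  let _ := TopologicalSpace.metrizableSpaceMetric X
  let _ := TopologicalSpace.metrizableSpaceMetric Y
  have h1 : ∀ a ∈ A, ∃ η > 0, InjOn f (Metric.ball a (2 * η)) := fun a ha => by
    obtain ⟨U, hU, hUi⟩ := hloc a ha
    obtain ⟨r, hr, hrU⟩ := Metric.mem_nhds_iff.1 hU
    exact ⟨r / 2, half_pos hr, hUi.mono (by rwa [mul_div_cancel₀ _ two_ne_zero])⟩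
  choose! η hη hηi using h1
  have h2 : ∀ a ∈ A, ∃ θ > 0, θ ≤ η a ∧ ∀ b ∈ A, dist (f b) (f a) < θ → dist b a < η a :=
    fun a ha => by
      obtain ⟨V, hV, hVA⟩ := hemb a ha _ (Metric.ball_mem_nhds a (hη a ha))
      obtain ⟨r, hr, hrV⟩ := Metric.mem_nhds_iff.1 hV
      exact ⟨min r (η a), lt_min hr (hη a ha), min_le_right _ _, fun b hb hd =>
        hVA b hb (hrV (hd.trans_le (min_le_left _ _)))⟩
  choose! θ hθ hθη hθA using h2
  set N : X → Set X := fun a => {x | dist x a < θ a ∧ dist (f x) (f a) < θ a / 2} with hN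
  have hNn : ∀ a ∈ A, N a ∈ 𝓝 a := fun a ha =>
    Filter.inter_mem (Metric.ball_mem_nhds a (hθ a ha))
      ((hc a ha).preimage_mem_nhds (Metric.ball_mem_nhds (f a) (half_pos (hθ a ha))))
  -- With θ b ≤ θ a, an equality f x = f y puts f b within θ a of f a, hence b within η a of a. Then
  -- x and y both lie in the ball around a on which f is injective.
  have key : ∀ a ∈ A, ∀ b ∈ A, θ b ≤ θ a → ∀ x ∈ N a, ∀ y ∈ N b, f x = f y → x = y := by
    intro a ha b hb hab x hx y hy hxy
    have hfab : dist (f b) (f a) < θ a := by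
      have h3 := dist_triangle_left (f b) (f a) (f y)
      have h4 : dist (f y) (f a) < θ a / 2 := by rw [← hxy]; exact hx.2
      have h5 : dist (f y) (f b) < θ b / 2 := hy.2
      linarith
    have hba := hθA a ha b hb hfab
    have hya : dist y a < 2 * η a := by
      have h3 := dist_triangle y b a
      have h4 : dist y b < θ b := hy.1
      have h5 := hθη a ha
      linarith
    have hxa : dist x a < 2 * η a := by
      have h4 : dist x a < θ a := hx.1
      have h5 := hθη a ha
      have h6 := hη a ha
      linarith
    exact hηi a ha hxa hya hxy
  refine ⟨⋃ a ∈ A, interior (N a), isOpen_biUnion fun a _ => isOpen_interior,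
    fun a ha => mem_biUnion ha (mem_interior_iff_mem_nhds.2 (hNn a ha)), ?_⟩
  intro x hx y hy hxy
  obtain ⟨a, ha, hxa⟩ := mem_iUnion₂.1 hx
  obtain ⟨b, hb, hyb⟩ := mem_iUnion₂.1 hy
  rcases le_total (θ b) (θ a) with h | h
  · exact key a ha b hb h x (interior_subset hxa) y (interior_subset hyb) hxy
  · exact (key b hb a ha h y (interior_subset hyb) x (interior_subset hxa) hxy.symm).symm

lemma isEmbedding_domRestrict {X Y : Type*} [TopologicalSpace X] [TopologicalSpace Y] {f : X → Y}
    {A : Set X} (hA : IsOpen A) (hf : ∀ x ∈ A, map f (𝓝 x) = 𝓝 (f x)) (hi : InjOn f A) :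
    IsEmbedding (A.domRestrict f) := by
  have hmap : ∀ a : A, map (A.domRestrict f) (𝓝 a) = 𝓝 (A.domRestrict f a) := fun a => by
    have h1 : map (Subtype.val : A → X) (𝓝 a) = 𝓝 (a : X) :=
      hA.isOpenEmbedding_subtypeVal.map_nhds_eq a
    rw [show A.domRestrict f = f ∘ Subtype.val from rfl, ← map_map, h1]
    exact hf a a.2
  exact (IsOpenEmbedding.of_continuous_injective_isOpenMap
    (continuous_iff_continuousAt.2 fun a => (hmap a).le) (injOn_iff_injective.1 hi)
    (isOpenMap_iff_nhds_le.2 fun a => (hmap a).ge)).isEmbedding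

end Injectivity

/-! ### Assembly. -/

section Main

variable {n : ℕ} {L : Type*} [TopologicalSpace L] [ChartedSpace (EuclideanSpace ℝ (Fin n)) L]
  [IsManifold (𝓡 n) ∞ L] [T2Space L] [SecondCountableTopology L]
  {g : Bundle.ContMDiffRiemannianMetric (𝓡 n) ∞ (EuclideanSpace ℝ (Fin n))
      (fun q : L => TangentSpace (𝓡 n) q)}
  {M : Type*} [TopologicalSpace M] [ChartedSpace (EuclideanSpace ℝ (Fin (2 * n + 3))) M]
  [IsManifold (𝓡 (2 * n + 3)) ∞ M] [T2Space M] [SecondCountableTopology M]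
  {ξ : ∀ x : M, Submodule ℝ (TangentSpace (𝓡 (2 * n + 3)) x)} {c₀ : ℝ}
  {ι : Plane × Cotangent n L → M}

lemma finrank_boxModel : Module.finrank ℝ ((Plane × ℝ) × CotModel n) =
    Module.finrank ℝ (EuclideanSpace ℝ (Fin (2 * n + 3))) := by
  have h := finrank_discModel (n := n)
  have h2 : Module.finrank ℝ Plane = 2 := finrank_euclideanSpace_fin
  have h3 : Module.finrank ℝ (EuclideanSpace ℝ (Fin (2 * n + 3))) = 2 * n + 3 :=
    finrank_euclideanSpace_fin
  rw [Module.finrank_prod, h2] at h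
  rw [Module.finrank_prod, Module.finrank_prod, Module.finrank_self, h2, h3]
  omega

lemma isOpen_boxDomain (δ h c : ℝ) : IsOpen (boxDomain g δ h c) := by
  refine IsOpen.prod ?_ (isOpen_diskBundle g c)
  exact (isOpen_lt (continuous_norm.comp continuous_fst) continuous_const).inter
    (isOpen_lt (continuous_abs.comp continuous_snd) continuous_const)

instance instMetrizableBox : TopologicalSpace.MetrizableSpace ((Plane × ℝ) × Cotangent n L) := by
  have : LocallyCompactSpace ((Plane × ℝ) × Cotangent n L) :=
    Manifold.locallyCompact_of_finiteDimensional (boxModel n)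
  exact Manifold.metrizableSpace (boxModel n) _

/-- The germ is a local diffeomorphism because dimensions agree, and on the slice it is ι. As ι is a
homeomorphism onto its image, slice points with nearby images are close to each other, which is the
hypothesis of `exists_injOn_nhds`; no compactness of the slice is required. -/
theorem exists_injective_box_germ (hξ : IsContactStructure ξ)
    (hι : IsSmoothEmbeddingOn (discModel n) (𝓡 (2 * n + 3)) ι (modelHypersurface g c₀))
    (hk : InducesKernelOn (discModel n) (𝓡 (2 * n + 3)) ι (modelHypersurface g c₀) ξ betaForm)
    {U : Set M} (hU : IsOpen U) (hιU : ι '' modelHypersurface g c₀ ⊆ U) :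
    ∃ (G : (Plane × ℝ) × Cotangent n L → M) (W : Set ((Plane × ℝ) × Cotangent n L)),
      IsOpen W ∧ (∀ x, discProj x ∈ modelHypersurface g c₀ → x.1.2 = 0 → x ∈ W) ∧ InjOn G W ∧
      ∀ x ∈ W, G x ∈ U ∧ ContMDiffAt (boxModel n) (𝓡 (2 * n + 3)) ∞ G x ∧
        (∀ v, md (boxModel n) (𝓡 (2 * n + 3)) G x v ∈ ξ (G x) ↔ boxOne x v = 0) ∧
        Function.Injective (md (boxModel n) (𝓡 (2 * n + 3)) G x) := by
  have : LocallyCompactSpace M := Manifold.locallyCompact_of_finiteDimensional (𝓡 (2 * n + 3))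
  have : TopologicalSpace.MetrizableSpace M := Manifold.metrizableSpace (𝓡 (2 * n + 3)) M
  obtain ⟨G, W, hW, hAW, hG⟩ := exists_box_germ hξ hι hk hU hιU
  obtain ⟨W', hW', hAW', hi⟩ := exists_injOn_nhds (f := G)
    (A := {x | discProj x ∈ modelHypersurface g c₀ ∧ x.1.2 = 0})
    (fun a ha => (hG a (hAW a ha.1 ha.2).1).2.1.continuousAt)
    (fun a ha => (map_nhds_eq_and_injOn (hG a (hAW a ha.1 ha.2).1).2.1
      (hG a (hAW a ha.1 ha.2).1).2.2.2 finrank_boxModel).2)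
    (fun a ha N hN => by
      set j : Plane × Cotangent n L → (Plane × ℝ) × Cotangent n L := fun p => ((p.1, 0), p.2)
        with hj
      have hjc : Continuous j := (continuous_fst.prodMk continuous_const).prodMk continuous_snd
      have hja : ∀ b : (Plane × ℝ) × Cotangent n L, b.1.2 = 0 → j (discProj b) = b := fun b hb =>
        Prod.ext (Prod.ext rfl hb.symm) rfl
      have h1 : j ⁻¹' N ∈ 𝓝 (discProj a) := hjc.continuousAt.preimage_mem_nhds (by
        rwa [hja a ha.2])
      have h2 : (Subtype.val : modelHypersurface g c₀ → _) ⁻¹' (j ⁻¹' N) ∈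
          𝓝 (⟨discProj a, ha.1⟩ : modelHypersurface g c₀) :=
        continuous_subtype_val.continuousAt.preimage_mem_nhds h1
      rw [hι.embedding.isInducing.nhds_eq_comap, mem_comap] at h2
      obtain ⟨V, hV, hVN⟩ := h2
      refine ⟨V, by rw [(hAW a ha.1 ha.2).2]; exact hV, fun b hb hbV => ?_⟩
      have h3 : (⟨discProj b, hb.1⟩ : modelHypersurface g c₀) ∈
          (modelHypersurface g c₀).domRestrict ι ⁻¹' V := by
        rw [(hAW b hb.1 hb.2).2] at hbV
        exact hbV
      have h4 : j (discProj b) ∈ N := hVN h3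
      rwa [hja b hb.2] at h4)
  exact ⟨G, W ∩ W', hW.inter hW', fun x h1 h2 => ⟨(hAW x h1 h2).1, hAW' ⟨h1, h2⟩⟩,
    hi.mono inter_subset_right, fun x hx => hG x hx.1⟩

/-- The composition of squeezing map and germ pulls ξ back to the model structure. It is an
immersion since contact kernels are preserved (`injective_md_of_ker`). By equality of dimensions it
is a local homeomorphism, and together with injectivity this makes it an embedding of the open box.
-/
theorem exists_box_embedding (hξ : IsContactStructure ξ)
    (hι : IsSmoothEmbeddingOn (discModel n) (𝓡 (2 * n + 3)) ι (modelHypersurface g c₀))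
    (hk : InducesKernelOn (discModel n) (𝓡 (2 * n + 3)) ι (modelHypersurface g c₀) ξ betaForm)
    {δ c h : ℝ} (hδ : 0 < δ) (hδ2 : δ < Real.pi / 2) (hcc : 1166 / 1000 * c < c₀) (hh : 0 < h)
    {U : Set M} (hU : IsOpen U) (hιU : ι '' modelHypersurface g c₀ ⊆ U) :
    ∃ Φ : (Plane × ℝ) × Cotangent n L → M,
      IsSmoothEmbeddingOn (boxModel n) (𝓡 (2 * n + 3)) Φ (boxDomain g δ h c) ∧
      InducesKernelOn (boxModel n) (𝓡 (2 * n + 3)) Φ (boxDomain g δ h c) ξ boxForm ∧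
      Φ '' boxDomain g δ h c ⊆ U := by
  obtain ⟨G, W, hW, hSW, hGi, hG⟩ := exists_injective_box_germ hξ hι hk hU hιU
  obtain ⟨S, hSi, hS⟩ := exists_squeeze g hW hSW hδ hδ2 hcc hh
  have hO : IsOpen (boxDomain g δ h c) := isOpen_boxDomain δ h c
  have hsm : ∀ x ∈ boxDomain g δ h c,
      ContMDiffAt (boxModel n) (𝓡 (2 * n + 3)) ∞ (fun y => G (S y)) x := fun x hx =>
    ContMDiffAt.comp x (g := G) (f := S) (hG _ (hS x hx).1).2.1 (hS x hx).2.1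
  have hmd : ∀ x ∈ boxDomain g δ h c, md (boxModel n) (𝓡 (2 * n + 3)) (fun y => G (S y)) x =
      (md (boxModel n) (𝓡 (2 * n + 3)) G (S x)).comp (md (boxModel n) (boxModel n) S x) :=
    fun x hx => md_comp (f := G) (g := S) ((hG _ (hS x hx).1).2.1.mdifferentiableAt (by simp))
      ((hS x hx).2.1.mdifferentiableAt (by simp))
  have hinj : ∀ x ∈ boxDomain g δ h c,
      Function.Injective (md (boxModel n) (𝓡 (2 * n + 3)) (fun y => G (S y)) x) := fun x hx => by
    have h1 : Function.Injective (md (boxModel n) (boxModel n) S x) := by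
      refine injective_md_of_ker (smoothFormAt_boxOne (S x)) (hS x hx).2.1 (smoothFormAt_boxOne x)
        ?_ (isContactPair_boxOne x)
      filter_upwards [hO.mem_nhds hx] with z hz v
      exact (hS z hz).2.2 v
    rw [hmd x hx]
    exact (hG _ (hS x hx).1).2.2.2.comp h1
  refine ⟨fun y => G (S y), ⟨⟨_, hO, subset_rfl, fun x hx => (hsm x hx).contMDiffWithinAt⟩, hinj,
    isEmbedding_domRestrict hO
      (fun x hx => (map_nhds_eq_and_injOn (hsm x hx) (hinj x hx) finrank_boxModel).1)
      (hGi.comp hSi fun x hx => (hS x hx).1)⟩, fun x hx v => ?_, ?_⟩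
  · have h1 : md (boxModel n) (𝓡 (2 * n + 3)) (fun y => G (S y)) x v =
        md (boxModel n) (𝓡 (2 * n + 3)) G (S x) (md (boxModel n) (boxModel n) S x v) := by
      rw [hmd x hx]
      rfl
    have h2 : md (boxModel n) (𝓡 (2 * n + 3)) (fun y => G (S y)) x v ∈ ξ (G (S x)) ↔
        boxOne x v = 0 := by
      rw [h1]
      exact ((hG _ (hS x hx).1).2.2.1 _).trans ((hS x hx).2.2 v)
    exact h2.trans (Iff.of_eq (congrArg (· = 0) (boxForm_eq x v).symm))
  · rintro _ ⟨x, hx, rfl⟩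
    exact (hG _ (hS x hx).1).1

end Main

end OvertwistedBox

end

theorem mainTheorem4 :
    ∃ μ₀ : ℝ, 0 < μ₀ ∧ μ₀ < 7 / 6 ∧
      ∀ (n : ℕ)
        (L : Type*) [TopologicalSpace L] [T2Space L] [SecondCountableTopology L]
        [ChartedSpace (EuclideanSpace ℝ (Fin n)) L] [IsManifold (𝓡 n) ∞ L]
        (g : Bundle.ContMDiffRiemannianMetric (𝓡 n) ∞ (EuclideanSpace ℝ (Fin n))
          (fun q : L => TangentSpace (𝓡 n) q))
        (M : Type*) [TopologicalSpace M] [T2Space M] [SecondCountableTopology M]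
        [ChartedSpace (EuclideanSpace ℝ (Fin (2 * n + 3))) M] [IsManifold (𝓡 (2 * n + 3)) ∞ M]
        (ξ : ∀ x : M, Submodule ℝ (TangentSpace (𝓡 (2 * n + 3)) x))
        (c₀ : ℝ) (ι : OvertwistedBox.Plane × OvertwistedBox.Cotangent n L → M),
        OvertwistedBox.IsContactStructure ξ →
        OvertwistedBox.IsSmoothEmbeddingOn (OvertwistedBox.discModel n) (𝓡 (2 * n + 3)) ι
          (OvertwistedBox.modelHypersurface g c₀) →
        OvertwistedBox.InducesKernelOn (OvertwistedBox.discModel n) (𝓡 (2 * n + 3)) ι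
          (OvertwistedBox.modelHypersurface g c₀) ξ OvertwistedBox.betaForm →
        ∀ δ : ℝ, 0 < δ → δ < Real.pi / 2 →
        ∀ c : ℝ, 0 < c → μ₀ * c < c₀ →
        ∀ h : ℝ, 0 < h →
        ∀ U : Set M, IsOpen U → ι '' OvertwistedBox.modelHypersurface g c₀ ⊆ U →
          ∃ Φ : (OvertwistedBox.Plane × ℝ) × OvertwistedBox.Cotangent n L → M,
            OvertwistedBox.IsSmoothEmbeddingOn (OvertwistedBox.boxModel n) (𝓡 (2 * n + 3)) Φ
              (OvertwistedBox.boxDomain g δ h c) ∧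
            OvertwistedBox.InducesKernelOn (OvertwistedBox.boxModel n) (𝓡 (2 * n + 3)) Φ
              (OvertwistedBox.boxDomain g δ h c) ξ OvertwistedBox.boxForm ∧
            Φ '' OvertwistedBox.boxDomain g δ h c ⊆ U := by
  -- The bound on the conformal factor from `factor_le`.
  refine ⟨1166 / 1000, by norm_num, by norm_num, ?_⟩
  intro n L _ _ _ _ _ g M _ _ _ _ _ ξ c₀ ι hξ hι hk δ hδ hδ2 c _ hcc h hh U hU hιU
  exact OvertwistedBox.exists_box_embedding hξ hι hk hδ hδ2 hcc hh hU hιU
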